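/- **Theorem (Completeness of mixed graded/linear models).** Let $(\mathcal R,1,*,0,+,\le)$ be a preordered semiring: a semiring ($+$ commutative, $*$ not necessarily commutative) with a preorder for which $+$ and $*$ are monotone. *Syntax.* Graded types are $X::=J\mid X\boxtimes Y\mid \mathsf{Lin}\,A$ and linear types are $A::=I\mid A\otimes B\mid A\multimap B\mid \mathsf{Grd}_r X$ with $r\in\mathcal R$. A graded context $\Delta$ is a list of pairs $r\odot X$, a linear context $\Gamma$ is a list of linear types, and $r*\Delta$ multiplies all grades of $\Delta$ by $r$ on the left; $\Delta\le\Delta'$ means the same types with pointwise smaller grades. Derivations of $\Delta\vdash_{GS}X$ and of $\Delta;\Gamma\vdash_{MS}A$ are built by the following rules. Graded system GS: $1\odot X\vdash X$; $\emptyset\vdash J$; from $\Delta_1\vdash X$ and $\Delta_2\vdash Y$ infer $\Delta_1,\Delta_2\vdash X\boxtimes Y$; from $\Delta;\emptyset\vdash_{MS}A$ infer $\Delta\vdash\mathsf{Lin}\,A$; (cut) from $\Delta_2\vdash X$ and $\Delta_1,r\odot X,\Delta_3\vdash Y$ infer $\Delta_1,r*\Delta_2,\Delta_3\vdash Y$;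 (approximation) from $\Delta\vdash X$ and $\Delta\le\Delta'$ infer $\Delta'\vdash X$; and the graded left rules, which, anywhere in the context, replace the block $\emptyset$ by $r\odot J$; $\;r\odot X,r\odot Y$ by $r\odot(X\boxtimes Y)$; $\;\emptyset$ by $0\odot X$ (weakening); $\;r_1\odot X,r_2\odot X$ by $(r_1+r_2)\odot X$ (contraction); $\;r\odot X,s\odot Y$ by $s\odot Y,r\odot X$ (exchange). Mixed system MS: $\emptyset;A\vdash A$; $\emptyset;\emptyset\vdash I$; from $\Delta_1;\Gamma_1\vdash A$ and $\Delta_2;\Gamma_2\vdash B$ infer $\Delta_1,\Delta_2;\Gamma_1,\Gamma_2\vdash A\otimes B$; from $\Delta;\Gamma,A\vdash B$ infer $\Delta;\Gamma\vdash A\multimap B$; from $\Delta_2;\Gamma_2\vdash A$ and $\Delta_1;\Gamma_1,B,\Gamma_3\vdash C$ infer $\Delta_1,\Delta_2;\Gamma_1,A\multimap B,\Gamma_2,\Gamma_3\vdash C$; from $\Delta\vdash_{GS}X$ infer $r*\Delta;\emptyset\vdash\mathsf{Grd}_rX$; from $\Delta,r\odot X;\Gamma\vdash B$ infer $\Delta;\mathsf{Grd}_rX,\Gamma\vdash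 B$; from $\Delta;A,\Gamma\vdash B$ infer $\Delta,1\odot\mathsf{Lin}\,A;\Gamma\vdash B$; (linear cut) from $\Delta_2;\Gamma_2\vdash A$ and $\Delta_1;\Gamma_1,A,\Gamma_3\vdash B$ infer $\Delta_1,\Delta_2;\Gamma_1,\Gamma_2,\Gamma_3\vdash B$; (graded cut) from $\Delta_2\vdash_{GS}X$ and $\Delta_1,r\odot X,\Delta_3;\Gamma\vdash B$ infer $\Delta_1,r*\Delta_2,\Delta_3;\Gamma\vdash B$; approximation and the graded left rules on $\Delta$; and, in $\Gamma$, left introduction of $I$ and of $\otimes$, and exchange. *Equational theory.* $\equiv$ is the least family of equivalence relations on derivations of GS and of MS (contexts being identified along the equations of semirings and lists) that is a congruence for all rules and contains: (i) all steps of cut reduction for the three cuts, i.e. associativity of cut and interchange of independent cuts, expansion of the identity at each of $J,\boxtimes,\mathsf{Lin},I,\otimes,\multimap,\mathsf{Grd}_r$, cut against an identity on either side, cut of a right rule against the matching left rule, commutation of cut with a left rule that ends its left premise (a graded left rule being multiplied by the grade of the cut formula), commutation of cut with any rule ending the right premise in which the cut formula is passive, and cut of a formula that is weakened, contracted or exchanged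 (yielding weakening, contraction or exchange of the whole context of the left premise); (ii) for contraction in both systems the two unit laws with weakening, associativity, and commutativity up to exchange; each exchange is an involution; (iii) approximation along $\Delta\le\Delta$ is trivial, successive approximations compose, and approximation commutes with every rule (including contraction, left introduction of $J$ and $\boxtimes$, and both premises and the grade of a cut). *Models.* A mixed graded/linear model over $\mathcal R$ consists of a symmetric monoidal category $(\mathcal C,J,\boxtimes)$, a symmetric monoidal closed category $(\mathcal M,I,\otimes,\multimap)$, a symmetric monoidal adjunction $\mathsf{Mny}\dashv\mathsf{Lin}:\mathcal M\to\mathcal C$, and a strict exponential action: a bifunctor $\odot:\mathcal R^{op}\times\mathcal C\to\mathcal C$ such that (a) $1\odot X=X$ and $(r*s)\odot X=r\odot(s\odot X)$, naturally; (b) each $r\odot-$ is a strict symmetric monoidal functor, naturally in $r$; (c) there are natural maps $\mathsf{weak}_X:0\odot X\to J$ and $\mathsf{contr}_{r,s,X}:(r+s)\odot X\to (r\odot X)\boxtimes(s\odot X)$, where $\mathsf{contr}$ is associative, commutative, and has $\mathsf{weak}$ as unit; (d) modulo the equalities in (a), (b): $\mathsf{weak}_{s\odot X}=\mathsf{weak}_X$,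 $\;s\odot\mathsf{weak}_X=\mathsf{weak}_X$, $\;r\odot\mathsf{contr}_{s_1,s_2,X}=\mathsf{contr}_{r*s_1,r*s_2,X}$, $\;\mathsf{contr}_{s_1,s_2,r\odot X}=\mathsf{contr}_{s_1*r,s_2*r,X}$. *Interpretation.* $\llbracket J\rrbracket=J$, $\llbracket X\boxtimes Y\rrbracket=\llbracket X\rrbracket\boxtimes\llbracket Y\rrbracket$, $\llbracket\mathsf{Lin}\,A\rrbracket=\mathsf{Lin}\llbracket A\rrbracket$, $\llbracket I\rrbracket=I$, $\llbracket A\otimes B\rrbracket=\llbracket A\rrbracket\otimes\llbracket B\rrbracket$, $\llbracket A\multimap B\rrbracket=\llbracket A\rrbracket\multimap\llbracket B\rrbracket$, $\llbracket\mathsf{Grd}_rX\rrbracket=\mathsf{Mny}(r\odot\llbracket X\rrbracket)$. A GS derivation of $r_1\odot X_1,\dots,r_n\odot X_n\vdash X$ is interpreted as a morphism $(r_1\odot\llbracket X_1\rrbracket)\boxtimes\cdots\boxtimes(r_n\odot\llbracket X_n\rrbracket)\to\llbracket X\rrbracket$ of $\mathcal C$, and an MS derivation of $r_1\odot X_1,\dots,r_n\odot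 X_n;A_1,\dots,A_m\vdash B$ as a morphism $\mathsf{Mny}(r_1\odot\llbracket X_1\rrbracket)\otimes\cdots\otimes\mathsf{Mny}(r_n\odot\llbracket X_n\rrbracket)\otimes\llbracket A_1\rrbracket\otimes\cdots\otimes\llbracket A_m\rrbracket\to\llbracket B\rrbracket$ of $\mathcal M$, by recursion on the derivation in the standard way, from the structure of the model. *Claim.* (1) If $\Pi_1,\Pi_2$ are GS derivations of the same sequent and $\llbracket\Pi_1\rrbracket=\llbracket\Pi_2\rrbracket$ in every mixed graded/linear model over $\mathcal R$, then $\Pi_1\equiv\Pi_2$. (2) If $\Pi_1,\Pi_2$ are MS derivations of the same sequent and $\llbracket\Pi_1\rrbracket=\llbracket\Pi_2\rrbracket$ in every mixed graded/linear model over $\mathcal R$, then $\Pi_1\equiv\Pi_2$. -/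

import Mathlib

open CategoryTheory MonoidalCategory Opposite

universe u

namespace MGL

/-! ## Types and contexts -/

mutual
/-- Graded types: `J`, `X ⊠ Y` and `Lin A`. -/
inductive GTy (R : Type u) : Type u
  | unit : GTy R
  | tensor : GTy R → GTy R → GTy R
  | lin : LTy R → GTy R
/-- Linear types: `I`, `A ⊗ B`, `A ⊸ B` and `Grd_r X`. -/
inductive LTy (R : Type u) : Type u
  | unit : LTy R
  | tensor : LTy R → LTy R → LTy R
  | imp : LTy R → LTy R → LTy R
  | grd : R → GTy R → LTy R
end

/-- A graded context `δ ⊙ Δ`: a list of graded types, each with its grade. -/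
abbrev GCtx (R : Type u) : Type u := List (R × GTy R)

/-- A linear context. -/
abbrev LCtx (R : Type u) : Type u := List (LTy R)

/-- Scaling of all grades of a graded context, `(r * δ) ⊙ Δ`. -/
def scale {R : Type u} [Semiring R] (r : R) (Δ : GCtx R) : GCtx R :=
  Δ.map fun p => (r * p.1, p.2)

/-- `δ ⊙ Δ` and `δ' ⊙ Δ'` have the same types in the same order, and `δ ≤ δ'` pointwise. -/
def CtxLe {R : Type u} [Preorder R] : GCtx R → GCtx R → Prop
  | [], [] => True
  | p :: Δ, q :: Δ' => p.1 ≤ q.1 ∧ p.2 = q.2 ∧ CtxLe Δ Δ'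
  | _, _ => False

/-! ## Derivations -/

/-- The one-premise rules that act on a block of adjacent hypotheses in a graded context and that
are common to both systems. A term of `GLeft P Q` is a rule which turns the block `P` of the premise
into the block `Q` of the conclusion: left introduction of `J` and of `⊠`, weakening, contraction
and exchange. -/
inductive GLeft {R : Type u} [Semiring R] : GCtx R → GCtx R → Type u
  | unit (r : R) : GLeft [] [(r, .unit)]
  | tensor (r : R) (X Y : GTy R) : GLeft [(r, X), (r, Y)] [(r, .tensor X Y)]
  | weak (r : R) (X : GTy R) (h : r = 0) : GLeft [] [(r, X)]
  | cont (r₁ r₂ r : R) (X : GTy R) (h : r = r₁ + r₂) : GLeft [(r₁, X), (r₂, X)] [(r, X)]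
  | ex (a b : R × GTy R) : GLeft [a, b] [b, a]

/-- The one-premise rules on a block of adjacent linear hypotheses: left introduction of `I` and
of `⊗`, and exchange. -/
inductive LLeft {R : Type u} : LCtx R → LCtx R → Type u
  | unit : LLeft [] [.unit]
  | tensor (A B : LTy R) : LLeft [A, B] [.tensor A B]
  | ex (A B : LTy R) : LLeft [A, B] [B, A]

mutual
/-- Derivations of the sequents `Δ ⊢ X` of the graded system. -/
inductive GS {R : Type u} [Semiring R] [Preorder R] : GCtx R → GTy R → Type u
  | id (X : GTy R) : GS [(1, X)] X
  | unitR : GS [] .unit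
  | tenR {Δ₁ Δ₂ : GCtx R} {X Y : GTy R} : GS Δ₁ X → GS Δ₂ Y → GS (Δ₁ ++ Δ₂) (.tensor X Y)
  | linR {Δ : GCtx R} {A : LTy R} : MS Δ [] A → GS Δ (.lin A)
  | left {P Q : GCtx R} (l : GLeft P Q) (Δ₁ Δ₂ : GCtx R) {X : GTy R} :
      GS (Δ₁ ++ P ++ Δ₂) X → GS (Δ₁ ++ Q ++ Δ₂) X
  | cut (r : R) (Δ₁ Δ₃ : GCtx R) {Δ₂ : GCtx R} {X Y : GTy R} :
      GS Δ₂ X → GS (Δ₁ ++ [(r, X)] ++ Δ₃) Y → GS (Δ₁ ++ scale r Δ₂ ++ Δ₃) Y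
  | sub {Δ Δ' : GCtx R} (h : CtxLe Δ Δ') {X : GTy R} : GS Δ X → GS Δ' X
/-- Derivations of the sequents `Δ; Γ ⊢ A` of the mixed system. -/
inductive MS {R : Type u} [Semiring R] [Preorder R] : GCtx R → LCtx R → LTy R → Type u
  | id (A : LTy R) : MS [] [A] A
  | unitR : MS [] [] .unit
  | tenR {Δ₁ Δ₂ : GCtx R} {Γ₁ Γ₂ : LCtx R} {A B : LTy R} :
      MS Δ₁ Γ₁ A → MS Δ₂ Γ₂ B → MS (Δ₁ ++ Δ₂) (Γ₁ ++ Γ₂) (.tensor A B)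
  | impR {Δ : GCtx R} {Γ : LCtx R} {A B : LTy R} : MS Δ (Γ ++ [A]) B → MS Δ Γ (.imp A B)
  | impL {Δ₁ Δ₂ : GCtx R} (Γ₁ Γ₃ : LCtx R) {Γ₂ : LCtx R} {A B C : LTy R} :
      MS Δ₂ Γ₂ A → MS Δ₁ (Γ₁ ++ [B] ++ Γ₃) C →
        MS (Δ₁ ++ Δ₂) (Γ₁ ++ (.imp A B :: Γ₂) ++ Γ₃) C
  | grdR (r : R) {Δ : GCtx R} {X : GTy R} : GS Δ X → MS (scale r Δ) [] (.grd r X)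
  | grdL {Δ : GCtx R} (r : R) (X : GTy R) {Γ : LCtx R} {B : LTy R} :
      MS (Δ ++ [(r, X)]) Γ B → MS Δ (.grd r X :: Γ) B
  | linL {Δ : GCtx R} {A : LTy R} {Γ : LCtx R} {B : LTy R} :
      MS Δ (A :: Γ) B → MS (Δ ++ [(1, .lin A)]) Γ B
  | left {P Q : GCtx R} (l : GLeft P Q) (Δ₁ Δ₂ : GCtx R) {Γ : LCtx R} {B : LTy R} :
      MS (Δ₁ ++ P ++ Δ₂) Γ B → MS (Δ₁ ++ Q ++ Δ₂) Γ B
  | lleft {P Q : LCtx R} (l : LLeft P Q) {Δ : GCtx R} (Γ₁ Γ₂ : LCtx R) {B : LTy R} :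
      MS Δ (Γ₁ ++ P ++ Γ₂) B → MS Δ (Γ₁ ++ Q ++ Γ₂) B
  | cut {Δ₁ Δ₂ : GCtx R} (Γ₁ Γ₃ : LCtx R) {Γ₂ : LCtx R} {A B : LTy R} :
      MS Δ₂ Γ₂ A → MS Δ₁ (Γ₁ ++ [A] ++ Γ₃) B → MS (Δ₁ ++ Δ₂) (Γ₁ ++ Γ₂ ++ Γ₃) B
  | gcut (r : R) (Δ₁ Δ₃ : GCtx R) {Δ₂ : GCtx R} {X : GTy R} {Γ : LCtx R} {B : LTy R} :
      GS Δ₂ X → MS (Δ₁ ++ [(r, X)] ++ Δ₃) Γ B → MS (Δ₁ ++ scale r Δ₂ ++ Δ₃) Γ B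
  | sub {Δ Δ' : GCtx R} (h : CtxLe Δ Δ') {Γ : LCtx R} {B : LTy R} : MS Δ Γ B → MS Δ' Γ B
end

/-- Transport of a derivation along an equality of contexts. -/
def GS.cast {R : Type u} [Semiring R] [Preorder R] {Δ Δ' : GCtx R} {X : GTy R}
    (π : GS Δ X) (h : Δ = Δ') : GS Δ' X := h ▸ π

/-- Transport of a derivation along equalities of contexts. -/
def MS.cast {R : Type u} [Semiring R] [Preorder R] {Δ Δ' : GCtx R} {Γ Γ' : LCtx R} {A : LTy R}
    (π : MS Δ Γ A) (h : Δ = Δ') (h' : Γ = Γ') : MS Δ' Γ' A := h ▸ h' ▸ π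

/-! ## Sequences of left rules -/

/-- Finite sequences of rules `L`, each applied somewhere inside the current list. A term of
`Path L P Q` leads from the block `P` of a premise to the block `Q` of a conclusion. -/
inductive Path {α : Type u} (L : List α → List α → Type u) : List α → List α → Type u
  | nil {P Q : List α} (h : P = Q) : Path L P Q
  | snoc {P N A B K : List α} (p : Path L P N) (D₁ D₂ : List α) (l : L A B)
      (hN : N = D₁ ++ A ++ D₂) (hK : K = D₁ ++ B ++ D₂) : Path L P K

namespace Path

variable {α : Type u} {L : List α → List α → Type u}

/-- One rule. -/
def single {A B : List α} (l : L A B) : Path L A B :=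
  .snoc (.nil rfl) [] [] l (by simp) (by simp)

/-- Concatenation. -/
def trans {P Q : List α} (p : Path L P Q) : ∀ {K : List α}, Path L Q K → Path L P K
  | _, .nil h => h ▸ p
  | _, .snoc q D₁ D₂ l hN hK => .snoc (trans p q) D₁ D₂ l hN hK

/-- The same sequence of rules with `D₁` on the left and `D₂` on the right. -/
def inside (D₁ D₂ : List α) {P : List α} : ∀ {Q M K : List α}, Path L P Q →
    M = D₁ ++ P ++ D₂ → K = D₁ ++ Q ++ D₂ → Path L M K
  | _, _, _, .nil h, hM, hK => .nil (by rw [hM, hK, h])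
  | _, _, _, .snoc q E₁ E₂ l hN hK', hM, hK =>
      .snoc (inside D₁ D₂ q hM rfl) (D₁ ++ E₁) (E₂ ++ D₂) l (by simp [hN]) (by simp [hK, hK'])

/-- Exchange of one hypothesis with a block. -/
def move (ex : ∀ a b, L [a, b] [b, a]) (a : α) : ∀ Q : List α, Path L (a :: Q) (Q ++ [a])
  | [] => .nil rfl
  | b :: Q => trans (K := b :: Q ++ [a]) (inside [] Q (single (ex a b)) rfl rfl)
      (inside [b] [] (move ex a Q) (by simp) (by simp))

/-- Exchange of two adjacent blocks. -/
def swap (ex : ∀ a b, L [a, b] [b, a]) : ∀ P Q : List α, Path L (P ++ Q) (Q ++ P)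
  | [], Q => .nil (by simp)
  | a :: P, Q => trans (Q := a :: (Q ++ P)) (inside [a] [] (swap ex P Q) (by simp) (by simp))
      (inside [] P (move ex a Q) (by simp) (by simp))

end Path

section Blocks

variable {R : Type u} [Semiring R]

/-- Exchange of two adjacent blocks of graded hypotheses. -/
def gswap (P Q : GCtx R) : Path GLeft (P ++ Q) (Q ++ P) := Path.swap GLeft.ex P Q

/-- Exchange of two adjacent blocks of linear hypotheses. -/
def lswap (P Q : LCtx R) : Path LLeft (P ++ Q) (Q ++ P) := Path.swap LLeft.ex P Q

/-- Weakening by a whole block of hypotheses, all of grade `0`. -/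
def weakBlock (r : R) (h : r = 0) : ∀ E : GCtx R, Path GLeft [] (scale r E)
  | [] => .nil rfl
  | (a, X) :: E =>
      .snoc (weakBlock r h E) [] (scale r E) (.weak (r * a) X (by simp [h])) (by simp)
        (by simp [scale])

/-- Contraction of two copies of a whole block of hypotheses. -/
def contBlock (r₁ r₂ r : R) (h : r = r₁ + r₂) :
    ∀ E : GCtx R, Path GLeft (scale r₁ E ++ scale r₂ E) (scale r E)
  | [] => .nil rfl
  | (a, X) :: E =>
      Path.trans (Q := [(r * a, X)] ++ (scale r₁ E ++ scale r₂ E))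
        (.snoc
          (Path.inside [(r₁ * a, X)] (scale r₂ E) (gswap (scale r₁ E) [(r₂ * a, X)])
            (by simp [scale]) rfl)
          [] (scale r₁ E ++ scale r₂ E)
          (.cont (r₁ * a) (r₂ * a) (r * a) X (by rw [h, add_mul])) (by simp) (by simp))
        (Path.inside [(r * a, X)] [] (contBlock r₁ r₂ r h E) (by simp) (by simp [scale]))

/-- A left rule with all its grades multiplied by `r` on the left. -/
def GLeft.scaled (r : R) : ∀ {P Q : GCtx R}, GLeft P Q → GLeft (scale r P) (scale r Q)
  | _, _, .unit s => .unit (r * s)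
  | _, _, .tensor s X Y => .tensor (r * s) X Y
  | _, _, .weak s X h => .weak (r * s) X (by simp [h])
  | _, _, .cont s₁ s₂ s X h => .cont (r * s₁) (r * s₂) (r * s) X (by rw [h, mul_add])
  | _, _, .ex a b => .ex (r * a.1, a.2) (r * b.1, b.2)

/-- Two instances of the same left rule, on the same types; the grades of the first are
below those of the second. -/
inductive GLeft.Le [Preorder R] : ∀ {P Q P' Q' : GCtx R}, GLeft P Q → GLeft P' Q' → Prop
  | unit {r s : R} (h : r ≤ s) : GLeft.Le (.unit r) (.unit s)
  | tensor {r s : R} (h : r ≤ s) (X Y : GTy R) : GLeft.Le (.tensor r X Y) (.tensor s X Y)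
  | weak (r s : R) (h : r = 0) (h' : s = 0) (X : GTy R) : GLeft.Le (.weak r X h) (.weak s X h')
  | cont {r₁ r₂ r s₁ s₂ s : R} (h₁ : r₁ ≤ s₁) (h₂ : r₂ ≤ s₂) (h : r = r₁ + r₂) (h' : s = s₁ + s₂)
      (X : GTy R) : GLeft.Le (.cont r₁ r₂ r X h) (.cont s₁ s₂ s X h')
  | ex {r r' s s' : R} (h : r ≤ r') (h' : s ≤ s') (X Y : GTy R) :
      GLeft.Le (.ex (r, X) (s, Y)) (.ex (r', X) (s', Y))

variable [Preorder R]

/-- Application of a sequence of left rules in the graded system. -/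
def GS.path (D₁ D₂ : GCtx R) {P : GCtx R} {X : GTy R} :
    ∀ {Q : GCtx R}, Path GLeft P Q → GS (D₁ ++ P ++ D₂) X → GS (D₁ ++ Q ++ D₂) X
  | _, .nil h, π => π.cast (by rw [h])
  | _, .snoc p E₁ E₂ l hN hK, π =>
      GS.cast (.left l (D₁ ++ E₁) (E₂ ++ D₂) ((GS.path D₁ D₂ p π).cast (by simp [hN])))
        (by simp [hK])

/-- Application of a sequence of graded left rules in the mixed system. -/
def MS.path (D₁ D₂ : GCtx R) {P : GCtx R} {Γ : LCtx R} {B : LTy R} :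
    ∀ {Q : GCtx R}, Path GLeft P Q → MS (D₁ ++ P ++ D₂) Γ B → MS (D₁ ++ Q ++ D₂) Γ B
  | _, .nil h, π => π.cast (by rw [h]) rfl
  | _, .snoc p E₁ E₂ l hN hK, π =>
      MS.cast (.left l (D₁ ++ E₁) (E₂ ++ D₂) ((MS.path D₁ D₂ p π).cast (by simp [hN]) rfl))
        (by simp [hK]) rfl

/-- Application of a sequence of linear left rules in the mixed system. -/
def MS.lpath (G₁ G₂ : LCtx R) {P : LCtx R} {Δ : GCtx R} {B : LTy R} :
    ∀ {Q : LCtx R}, Path LLeft P Q → MS Δ (G₁ ++ P ++ G₂) B → MS Δ (G₁ ++ Q ++ G₂) B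
  | _, .nil h, π => π.cast rfl (by rw [h])
  | _, .snoc p E₁ E₂ l hN hK, π =>
      MS.cast (.lleft l (G₁ ++ E₁) (E₂ ++ G₂) ((MS.lpath G₁ G₂ p π).cast rfl (by simp [hN])))
        rfl (by simp [hK])

end Blocks

/-! ## The equational theory -/

section Equations

variable {R : Type u} [Semiring R]

/-- The equations between sequences of structural rules on graded hypotheses. -/
inductive GStructEq : ∀ {P Q : GCtx R}, Path GLeft P Q → Path GLeft P Q → Prop
  | contr_unitL (r : R) (X : GTy R) :
      GStructEq
        (.snoc (N := [(0, X), (r, X)]) (.snoc (.nil rfl) [] [(r, X)] (.weak 0 X rfl) rfl rfl) [] []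
          (.cont 0 r r X (by simp)) rfl rfl)
        (.nil rfl)
  | contr_unitR (r : R) (X : GTy R) :
      GStructEq
        (.snoc (N := [(r, X), (0, X)]) (.snoc (.nil rfl) [(r, X)] [] (.weak 0 X rfl) rfl rfl) [] []
          (.cont r 0 r X (by simp)) rfl rfl)
        (.nil rfl)
  | contr_assoc (r₁ r₂ r₃ : R) (X : GTy R) :
      GStructEq
        (.snoc (P := [(r₁, X), (r₂, X), (r₃, X)]) (N := [(r₁ + r₂, X), (r₃, X)])
          (.snoc (.nil rfl) [] [(r₃, X)] (.cont r₁ r₂ (r₁ + r₂) X rfl) rfl rfl) [] []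
          (.cont (r₁ + r₂) r₃ (r₁ + r₂ + r₃) X rfl) rfl rfl)
        (.snoc (N := [(r₁, X), (r₂ + r₃, X)])
          (.snoc (.nil rfl) [(r₁, X)] [] (.cont r₂ r₃ (r₂ + r₃) X rfl) rfl rfl) [] []
          (.cont r₁ (r₂ + r₃) (r₁ + r₂ + r₃) X (by rw [add_assoc])) rfl rfl)
  | contr_sym (r s : R) (X : GTy R) :
      GStructEq
        (.snoc (P := [(r, X), (s, X)]) (.nil rfl) [] [] (.cont r s (r + s) X rfl) rfl rfl)
        (.snoc (N := [(s, X), (r, X)])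
          (.snoc (.nil rfl) [] [] (.ex (r, X) (s, X)) rfl rfl) [] []
          (.cont s r (r + s) X (by rw [add_comm])) rfl rfl)
  | ex_ex (a b : R × GTy R) :
      GStructEq
        (.snoc (N := [b, a]) (.snoc (.nil rfl) [] [] (.ex a b) rfl rfl) [] [] (.ex b a) rfl rfl)
        (.nil rfl)

variable [Preorder R]

mutual
/-- The equational theory `≡` on derivations of the graded system: the congruence generated by
the steps of cut reduction and by the equations for the structural rules. The two sides of an
equation have contexts that are equal, but possibly only by the laws of the semiring and
of concatenation; hence the two context indices. -/
inductive EqG : ∀ {Δ Δ' : GCtx R} {X : GTy R}, GS Δ X → GS Δ' X → Prop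
  -- equivalence and congruence
  | refl {Δ : GCtx R} {X : GTy R} (π : GS Δ X) : EqG π π
  | symm {Δ Δ' : GCtx R} {X : GTy R} {π : GS Δ X} {ρ : GS Δ' X} : EqG π ρ → EqG ρ π
  | trans {Δ Δ' Δ'' : GCtx R} {X : GTy R} {π : GS Δ X} {ρ : GS Δ' X} {σ : GS Δ'' X} :
      EqG π ρ → EqG ρ σ → EqG π σ
  | congr_tenR {Δ₁ Δ₂ : GCtx R} {X Y : GTy R} {a a' : GS Δ₁ X} {b b' : GS Δ₂ Y} :
      EqG a a' → EqG b b' → EqG (.tenR a b) (.tenR a' b')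
  | congr_linR {Δ : GCtx R} {A : LTy R} {a a' : MS Δ [] A} :
      EqM a a' → EqG (.linR a) (.linR a')
  | congr_left {P Q : GCtx R} (l : GLeft P Q) (Δ₁ Δ₂ : GCtx R) {X : GTy R}
      {a a' : GS (Δ₁ ++ P ++ Δ₂) X} : EqG a a' → EqG (.left l Δ₁ Δ₂ a) (.left l Δ₁ Δ₂ a')
  | congr_cut (r : R) (Δ₁ Δ₃ : GCtx R) {Δ₂ : GCtx R} {X Y : GTy R} {a a' : GS Δ₂ X}
      {c c' : GS (Δ₁ ++ [(r, X)] ++ Δ₃) Y} :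
      EqG a a' → EqG c c' → EqG (.cut r Δ₁ Δ₃ a c) (.cut r Δ₁ Δ₃ a' c')
  | congr_sub {Δ Δ' : GCtx R} (h : CtxLe Δ Δ') {X : GTy R} {a a' : GS Δ X} :
      EqG a a' → EqG (.sub h a) (.sub h a')
  -- cut against cut
  | cut_assoc (r s : R) (Δ₁ Δ₃ D₁ D₃ : GCtx R) {E : GCtx R} {X Y Z : GTy R} (a : GS E X)
      (b : GS (D₁ ++ [(s, X)] ++ D₃) Y) (c : GS (Δ₁ ++ [(r, Y)] ++ Δ₃) Z) :
      EqG (.cut r Δ₁ Δ₃ (.cut s D₁ D₃ a b) c)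
        (.cut (r * s) (Δ₁ ++ scale r D₁) (scale r D₃ ++ Δ₃) a
          ((GS.cut r Δ₁ Δ₃ b c).cast (by simp [scale])))
  | cut_cut (r s : R) (Δ₁ Δ₂ Δ₃ : GCtx R) {E F : GCtx R} {X Y Z : GTy R} (a : GS E X)
      (b : GS F Y) (c : GS (Δ₁ ++ [(r, X)] ++ Δ₂ ++ [(s, Y)] ++ Δ₃) Z) :
      EqG
        (.cut r Δ₁ (Δ₂ ++ scale s F ++ Δ₃) a
          ((GS.cut s (Δ₁ ++ [(r, X)] ++ Δ₂) Δ₃ b c).cast (by simp)))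
        (.cut s (Δ₁ ++ scale r E ++ Δ₂) Δ₃ b
          ((GS.cut r Δ₁ (Δ₂ ++ [(s, Y)] ++ Δ₃) a (c.cast (by simp))).cast (by simp)))
  -- expansion of identities
  | eta_tensor (X Y : GTy R) :
      EqG (.id (.tensor X Y)) (.left (.tensor 1 X Y) [] [] ((GS.tenR (.id X) (.id Y)).cast rfl))
  | eta_unit : EqG (.id .unit) (.left (.unit 1) [] [] .unitR)
  | eta_lin (A : LTy R) : EqG (.id (.lin A)) (.linR (.linL (Δ := []) (.id A)))
  -- cut against an identity
  | cut_id_left (r : R) (Δ₁ Δ₃ : GCtx R) {X Y : GTy R} (c : GS (Δ₁ ++ [(r, X)] ++ Δ₃) Y) :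
      EqG (.cut r Δ₁ Δ₃ (.id X) c) c
  | cut_id_right {Δ : GCtx R} {X : GTy R} (a : GS Δ X) : EqG (.cut 1 [] [] a (.id X)) a
  -- principal formula against principal formula
  | cut_tensor (r : R) (Δ₁ Δ₃ : GCtx R) {E F : GCtx R} {X Y Z : GTy R} (a : GS E X) (b : GS F Y)
      (c : GS (Δ₁ ++ [(r, X), (r, Y)] ++ Δ₃) Z) :
      EqG (.cut r Δ₁ Δ₃ (.tenR a b) (.left (.tensor r X Y) Δ₁ Δ₃ c))
        (.cut r (Δ₁ ++ scale r E) Δ₃ b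
          ((GS.cut r Δ₁ ([(r, Y)] ++ Δ₃) a (c.cast (by simp))).cast (by simp)))
  | cut_unit (r : R) (Δ₁ Δ₃ : GCtx R) {Z : GTy R} (c : GS (Δ₁ ++ [] ++ Δ₃) Z) :
      EqG (.cut r Δ₁ Δ₃ .unitR (.left (.unit r) Δ₁ Δ₃ c)) c
  -- the left premise of the cut ends in a left rule
  | cut_left_left (r : R) (Δ₁ Δ₃ : GCtx R) {P Q : GCtx R} (l : GLeft P Q) (D₁ D₂ : GCtx R)
      {X Y : GTy R} (a : GS (D₁ ++ P ++ D₂) X) (c : GS (Δ₁ ++ [(r, X)] ++ Δ₃) Y) :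
      EqG (.cut r Δ₁ Δ₃ (.left l D₁ D₂ a) c)
        (.left (l.scaled r) (Δ₁ ++ scale r D₁) (scale r D₂ ++ Δ₃)
          ((GS.cut r Δ₁ Δ₃ a c).cast (by simp [scale])))
  -- the cut formula is passive in the last rule of the right premise
  | cut_tenR_fst (r : R) (Δ₁ Δ₃ : GCtx R) {E F : GCtx R} {X Y Z : GTy R} (a : GS E X)
      (b : GS (Δ₁ ++ [(r, X)] ++ Δ₃) Y) (c : GS F Z) :
      EqG (.cut r Δ₁ (Δ₃ ++ F) a ((GS.tenR b c).cast (by simp)))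
        (.tenR (.cut r Δ₁ Δ₃ a b) c)
  | cut_tenR_snd (r : R) (Δ₁ Δ₃ : GCtx R) {E F : GCtx R} {X Y Z : GTy R} (a : GS E X)
      (b : GS F Y) (c : GS (Δ₁ ++ [(r, X)] ++ Δ₃) Z) :
      EqG (.cut r (F ++ Δ₁) Δ₃ a ((GS.tenR b c).cast (by simp)))
        (.tenR b (.cut r Δ₁ Δ₃ a c))
  | cut_left_before (r : R) {P Q : GCtx R} (l : GLeft P Q) (D₁ D₂ D₃ : GCtx R) {E : GCtx R}
      {X Y : GTy R} (a : GS E X) (c : GS (D₁ ++ P ++ (D₂ ++ [(r, X)] ++ D₃)) Y) :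
      EqG
        (.cut r (D₁ ++ Q ++ D₂) D₃ a
          ((GS.left l D₁ (D₂ ++ [(r, X)] ++ D₃) c).cast (by simp)))
        (.left l D₁ (D₂ ++ scale r E ++ D₃)
          ((GS.cut r (D₁ ++ P ++ D₂) D₃ a (c.cast (by simp))).cast (by simp)))
  | cut_left_after (r : R) {P Q : GCtx R} (l : GLeft P Q) (D₁ D₂ D₃ : GCtx R) {E : GCtx R}
      {X Y : GTy R} (a : GS E X) (c : GS ((D₁ ++ [(r, X)] ++ D₂) ++ P ++ D₃) Y) :
      EqG
        (.cut r D₁ (D₂ ++ Q ++ D₃) a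
          ((GS.left l (D₁ ++ [(r, X)] ++ D₂) D₃ c).cast (by simp)))
        (.left l (D₁ ++ scale r E ++ D₂) D₃
          ((GS.cut r D₁ (D₂ ++ P ++ D₃) a (c.cast (by simp))).cast (by simp)))
  | cut_linR (r : R) (Δ₁ Δ₃ : GCtx R) {E : GCtx R} {X : GTy R} {A : LTy R} (a : GS E X)
      (c : MS (Δ₁ ++ [(r, X)] ++ Δ₃) [] A) :
      EqG (.cut r Δ₁ Δ₃ a (.linR c)) (.linR (.gcut r Δ₁ Δ₃ a c))
  -- the cut formula is introduced or moved by a structural rule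
  | cut_weak (r : R) (h : r = 0) (Δ₁ Δ₃ : GCtx R) {E : GCtx R} {X Y : GTy R} (a : GS E X)
      (c : GS (Δ₁ ++ [] ++ Δ₃) Y) :
      EqG (.cut r Δ₁ Δ₃ a (.left (.weak r X h) Δ₁ Δ₃ c)) (c.path Δ₁ Δ₃ (weakBlock r h E))
  | cut_cont (r₁ r₂ r : R) (h : r = r₁ + r₂) (Δ₁ Δ₃ : GCtx R) {E : GCtx R} {X Y : GTy R}
      (a : GS E X) (c : GS (Δ₁ ++ [(r₁, X), (r₂, X)] ++ Δ₃) Y) :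
      EqG (.cut r Δ₁ Δ₃ a (.left (.cont r₁ r₂ r X h) Δ₁ Δ₃ c))
        (GS.path Δ₁ Δ₃ (contBlock r₁ r₂ r h E)
          ((GS.cut r₁ Δ₁ (scale r₂ E ++ Δ₃) a
            ((GS.cut r₂ (Δ₁ ++ [(r₁, X)]) Δ₃ a (c.cast (by simp))).cast (by simp))).cast
              (by simp)))
  | cut_ex_fst (r : R) (b : R × GTy R) (Δ₁ Δ₃ : GCtx R) {E : GCtx R} {X Y : GTy R} (a : GS E X)
      (c : GS (Δ₁ ++ [(r, X), b] ++ Δ₃) Y) :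
      EqG (.cut r (Δ₁ ++ [b]) Δ₃ a ((GS.left (.ex (r, X) b) Δ₁ Δ₃ c).cast (by simp)))
        (GS.path Δ₁ Δ₃ (gswap (scale r E) [b])
          ((GS.cut r Δ₁ ([b] ++ Δ₃) a (c.cast (by simp))).cast (by simp)))
  | cut_ex_snd (r : R) (b : R × GTy R) (Δ₁ Δ₃ : GCtx R) {E : GCtx R} {X Y : GTy R} (a : GS E X)
      (c : GS (Δ₁ ++ [b, (r, X)] ++ Δ₃) Y) :
      EqG (.cut r Δ₁ ([b] ++ Δ₃) a ((GS.left (.ex b (r, X)) Δ₁ Δ₃ c).cast (by simp)))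
        (GS.path Δ₁ Δ₃ (gswap [b] (scale r E))
          ((GS.cut r (Δ₁ ++ [b]) Δ₃ a (c.cast (by simp))).cast (by simp)))
  -- structural rules
  | struct {P Q : GCtx R} {p q : Path GLeft P Q} (h : GStructEq p q) (Δ₁ Δ₂ : GCtx R) {X : GTy R}
      (c : GS (Δ₁ ++ P ++ Δ₂) X) : EqG (c.path Δ₁ Δ₂ p) (c.path Δ₁ Δ₂ q)
  -- approximation
  | sub_refl {Δ : GCtx R} (h : CtxLe Δ Δ) {X : GTy R} (a : GS Δ X) : EqG (.sub h a) a
  | sub_trans {Δ Δ' Δ'' : GCtx R} (h : CtxLe Δ Δ') (h' : CtxLe Δ' Δ'') (h'' : CtxLe Δ Δ'')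
      {X : GTy R} (a : GS Δ X) : EqG (.sub h' (.sub h a)) (.sub h'' a)
  | sub_tenR {Δ₁ Δ₁' Δ₂ Δ₂' : GCtx R} (h₁ : CtxLe Δ₁ Δ₁') (h₂ : CtxLe Δ₂ Δ₂')
      (h : CtxLe (Δ₁ ++ Δ₂) (Δ₁' ++ Δ₂')) {X Y : GTy R} (a : GS Δ₁ X) (b : GS Δ₂ Y) :
      EqG (.sub h (.tenR a b)) (.tenR (.sub h₁ a) (.sub h₂ b))
  | sub_linR {Δ Δ' : GCtx R} (h : CtxLe Δ Δ') {A : LTy R} (a : MS Δ [] A) :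
      EqG (.sub h (.linR a)) (.linR (.sub h a))
  | sub_left {P Q P' Q' : GCtx R} {l : GLeft P Q} {l' : GLeft P' Q'} (hl : GLeft.Le l l')
      {Δ₁ Δ₂ Δ₁' Δ₂' : GCtx R} (h₁ : CtxLe Δ₁ Δ₁') (h₂ : CtxLe Δ₂ Δ₂')
      (h : CtxLe (Δ₁ ++ P ++ Δ₂) (Δ₁' ++ P' ++ Δ₂'))
      (h' : CtxLe (Δ₁ ++ Q ++ Δ₂) (Δ₁' ++ Q' ++ Δ₂')) {X : GTy R} (a : GS (Δ₁ ++ P ++ Δ₂) X) :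
      EqG (.sub h' (.left l Δ₁ Δ₂ a)) (.left l' Δ₁' Δ₂' (.sub h a))
  | sub_cut {r r' : R} (hr : r ≤ r') {Δ₁ Δ₂ Δ₃ Δ₁' Δ₂' Δ₃' : GCtx R} (h₁ : CtxLe Δ₁ Δ₁')
      (h₂ : CtxLe Δ₂ Δ₂') (h₃ : CtxLe Δ₃ Δ₃') {X Y : GTy R}
      (h : CtxLe (Δ₁ ++ [(r, X)] ++ Δ₃) (Δ₁' ++ [(r', X)] ++ Δ₃'))
      (h' : CtxLe (Δ₁ ++ scale r Δ₂ ++ Δ₃) (Δ₁' ++ scale r' Δ₂' ++ Δ₃'))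
      (a : GS Δ₂ X) (c : GS (Δ₁ ++ [(r, X)] ++ Δ₃) Y) :
      EqG (.sub h' (.cut r Δ₁ Δ₃ a c)) (.cut r' Δ₁' Δ₃' (.sub h₂ a) (.sub h c))
/-- The equational theory `≡` on derivations of the mixed system. -/
inductive EqM : ∀ {Δ Δ' : GCtx R} {Γ Γ' : LCtx R} {A : LTy R}, MS Δ Γ A → MS Δ' Γ' A → Prop
  -- equivalence and congruence
  | refl {Δ : GCtx R} {Γ : LCtx R} {A : LTy R} (π : MS Δ Γ A) : EqM π π
  | symm {Δ Δ' : GCtx R} {Γ Γ' : LCtx R} {A : LTy R} {π : MS Δ Γ A} {ρ : MS Δ' Γ' A} :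
      EqM π ρ → EqM ρ π
  | trans {Δ Δ' Δ'' : GCtx R} {Γ Γ' Γ'' : LCtx R} {A : LTy R} {π : MS Δ Γ A} {ρ : MS Δ' Γ' A}
      {σ : MS Δ'' Γ'' A} : EqM π ρ → EqM ρ σ → EqM π σ
  | congr_tenR {Δ₁ Δ₂ : GCtx R} {Γ₁ Γ₂ : LCtx R} {A B : LTy R} {a a' : MS Δ₁ Γ₁ A}
      {b b' : MS Δ₂ Γ₂ B} : EqM a a' → EqM b b' → EqM (.tenR a b) (.tenR a' b')
  | congr_impR {Δ : GCtx R} {Γ : LCtx R} {A B : LTy R} {a a' : MS Δ (Γ ++ [A]) B} :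
      EqM a a' → EqM (.impR a) (.impR a')
  | congr_impL {Δ₁ Δ₂ : GCtx R} (Γ₁ Γ₃ : LCtx R) {Γ₂ : LCtx R} {A B C : LTy R}
      {a a' : MS Δ₂ Γ₂ A} {c c' : MS Δ₁ (Γ₁ ++ [B] ++ Γ₃) C} :
      EqM a a' → EqM c c' → EqM (.impL Γ₁ Γ₃ a c) (.impL Γ₁ Γ₃ a' c')
  | congr_grdR (r : R) {Δ : GCtx R} {X : GTy R} {a a' : GS Δ X} :
      EqG a a' → EqM (.grdR r a) (.grdR r a')
  | congr_grdL {Δ : GCtx R} (r : R) (X : GTy R) {Γ : LCtx R} {B : LTy R}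
      {a a' : MS (Δ ++ [(r, X)]) Γ B} : EqM a a' → EqM (.grdL r X a) (.grdL r X a')
  | congr_linL {Δ : GCtx R} {A : LTy R} {Γ : LCtx R} {B : LTy R} {a a' : MS Δ (A :: Γ) B} :
      EqM a a' → EqM (.linL a) (.linL a')
  | congr_left {P Q : GCtx R} (l : GLeft P Q) (Δ₁ Δ₂ : GCtx R) {Γ : LCtx R} {B : LTy R}
      {a a' : MS (Δ₁ ++ P ++ Δ₂) Γ B} :
      EqM a a' → EqM (.left l Δ₁ Δ₂ a) (.left l Δ₁ Δ₂ a')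
  | congr_lleft {P Q : LCtx R} (l : LLeft P Q) {Δ : GCtx R} (Γ₁ Γ₂ : LCtx R) {B : LTy R}
      {a a' : MS Δ (Γ₁ ++ P ++ Γ₂) B} :
      EqM a a' → EqM (.lleft l Γ₁ Γ₂ a) (.lleft l Γ₁ Γ₂ a')
  | congr_cut {Δ₁ Δ₂ : GCtx R} (Γ₁ Γ₃ : LCtx R) {Γ₂ : LCtx R} {A B : LTy R} {a a' : MS Δ₂ Γ₂ A}
      {c c' : MS Δ₁ (Γ₁ ++ [A] ++ Γ₃) B} :
      EqM a a' → EqM c c' → EqM (.cut Γ₁ Γ₃ a c) (.cut Γ₁ Γ₃ a' c')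
  | congr_gcut (r : R) (Δ₁ Δ₃ : GCtx R) {Δ₂ : GCtx R} {X : GTy R} {Γ : LCtx R} {B : LTy R}
      {a a' : GS Δ₂ X} {c c' : MS (Δ₁ ++ [(r, X)] ++ Δ₃) Γ B} :
      EqG a a' → EqM c c' → EqM (.gcut r Δ₁ Δ₃ a c) (.gcut r Δ₁ Δ₃ a' c')
  | congr_sub {Δ Δ' : GCtx R} (h : CtxLe Δ Δ') {Γ : LCtx R} {B : LTy R} {a a' : MS Δ Γ B} :
      EqM a a' → EqM (.sub h a) (.sub h a')
  -- linear cut against cut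
  | cut_assoc (Γ₁ Γ₃ G₁ G₃ : LCtx R) {Δ D E : GCtx R} {H : LCtx R} {A B C : LTy R} (a : MS E H A)
      (b : MS D (G₁ ++ [A] ++ G₃) B) (c : MS Δ (Γ₁ ++ [B] ++ Γ₃) C) :
      EqM (.cut Γ₁ Γ₃ (.cut G₁ G₃ a b) c)
        (.cut (Γ₁ ++ G₁) (G₃ ++ Γ₃) a ((MS.cut Γ₁ Γ₃ b c).cast rfl (by simp)))
  | cut_cut (Γ₁ Γ₂ Γ₃ : LCtx R) {Δ E F : GCtx R} {G H : LCtx R} {A B C : LTy R} (a : MS E G A)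
      (b : MS F H B) (c : MS Δ (Γ₁ ++ [A] ++ Γ₂ ++ [B] ++ Γ₃) C) :
      EqM
        (.cut Γ₁ (Γ₂ ++ H ++ Γ₃) a
          ((MS.cut (Γ₁ ++ [A] ++ Γ₂) Γ₃ b c).cast rfl (by simp)))
        (MS.path Δ [] (gswap E F)
          ((MS.cut (Γ₁ ++ G ++ Γ₂) Γ₃ b
            ((MS.cut Γ₁ (Γ₂ ++ [B] ++ Γ₃) a (c.cast rfl (by simp))).cast rfl (by simp))).cast
              (by simp) rfl))
  -- graded cut against cut
  | gcut_assoc (r s : R) (Δ₁ Δ₃ D₁ D₃ : GCtx R) {E : GCtx R} {X Y : GTy R} {Γ : LCtx R}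
      {B : LTy R} (a : GS E X) (b : GS (D₁ ++ [(s, X)] ++ D₃) Y)
      (c : MS (Δ₁ ++ [(r, Y)] ++ Δ₃) Γ B) :
      EqM (.gcut r Δ₁ Δ₃ (.cut s D₁ D₃ a b) c)
        (.gcut (r * s) (Δ₁ ++ scale r D₁) (scale r D₃ ++ Δ₃) a
          ((MS.gcut r Δ₁ Δ₃ b c).cast (by simp [scale]) rfl))
  | gcut_gcut (r s : R) (Δ₁ Δ₂ Δ₃ : GCtx R) {E F : GCtx R} {X Y : GTy R} {Γ : LCtx R} {B : LTy R}
      (a : GS E X) (b : GS F Y) (c : MS (Δ₁ ++ [(r, X)] ++ Δ₂ ++ [(s, Y)] ++ Δ₃) Γ B) :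
      EqM
        (.gcut r Δ₁ (Δ₂ ++ scale s F ++ Δ₃) a
          ((MS.gcut s (Δ₁ ++ [(r, X)] ++ Δ₂) Δ₃ b c).cast (by simp) rfl))
        (.gcut s (Δ₁ ++ scale r E ++ Δ₂) Δ₃ b
          ((MS.gcut r Δ₁ (Δ₂ ++ [(s, Y)] ++ Δ₃) a (c.cast (by simp) rfl)).cast (by simp) rfl))
  | gcut_cut_fst (r : R) (Δ₁ Δ₃ : GCtx R) (Γ₁ Γ₃ : LCtx R) {D E : GCtx R} {X : GTy R}
      {H : LCtx R} {A B : LTy R} (a : GS E X) (b : MS (Δ₁ ++ [(r, X)] ++ Δ₃) H A)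
      (c : MS D (Γ₁ ++ [A] ++ Γ₃) B) :
      EqM (.gcut r (D ++ Δ₁) Δ₃ a ((MS.cut Γ₁ Γ₃ b c).cast (by simp) rfl))
        (.cut Γ₁ Γ₃ (.gcut r Δ₁ Δ₃ a b) c)
  | gcut_cut_snd (r : R) (Δ₁ Δ₃ : GCtx R) (Γ₁ Γ₃ : LCtx R) {D E : GCtx R} {X : GTy R}
      {H : LCtx R} {A B : LTy R} (a : GS E X) (b : MS D H A)
      (c : MS (Δ₁ ++ [(r, X)] ++ Δ₃) (Γ₁ ++ [A] ++ Γ₃) B) :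
      EqM (.gcut r Δ₁ (Δ₃ ++ D) a ((MS.cut Γ₁ Γ₃ b c).cast (by simp) rfl))
        (.cut Γ₁ Γ₃ b (.gcut r Δ₁ Δ₃ a c))
  -- expansion of identities
  | eta_tensor (A B : LTy R) :
      EqM (.id (.tensor A B)) (.lleft (.tensor A B) [] [] ((MS.tenR (.id A) (.id B)).cast rfl rfl))
  | eta_unit : EqM (.id .unit) (.lleft .unit [] [] .unitR)
  | eta_imp (A B : LTy R) : EqM (.id (.imp A B)) (.impR (Γ := [.imp A B]) ((MS.impL [] [] (.id A) (.id B)).cast rfl rfl))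
  | eta_grd (r : R) (X : GTy R) :
      EqM (.id (.grd r X))
        (.grdL (Δ := []) r X ((MS.grdR r (.id X)).cast (by simp [scale]) rfl))
  -- cut against an identity
  | cut_id_left (Γ₁ Γ₃ : LCtx R) {Δ : GCtx R} {A B : LTy R} (c : MS Δ (Γ₁ ++ [A] ++ Γ₃) B) :
      EqM (.cut Γ₁ Γ₃ (.id A) c) c
  | cut_id_right {Δ : GCtx R} {Γ : LCtx R} {A : LTy R} (a : MS Δ Γ A) :
      EqM (.cut [] [] a (.id A)) a
  | gcut_id (r : R) (Δ₁ Δ₃ : GCtx R) {X : GTy R} {Γ : LCtx R} {B : LTy R}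
      (c : MS (Δ₁ ++ [(r, X)] ++ Δ₃) Γ B) : EqM (.gcut r Δ₁ Δ₃ (.id X) c) c
  -- principal formula against principal formula
  | cut_tensor (Γ₁ Γ₃ : LCtx R) {Δ E F : GCtx R} {G H : LCtx R} {A B C : LTy R} (a : MS E G A)
      (b : MS F H B) (c : MS Δ (Γ₁ ++ [A, B] ++ Γ₃) C) :
      EqM (.cut Γ₁ Γ₃ (.tenR a b) (.lleft (.tensor A B) Γ₁ Γ₃ c))
        (.cut (Γ₁ ++ G) Γ₃ b
          ((MS.cut Γ₁ ([B] ++ Γ₃) a (c.cast rfl (by simp))).cast rfl (by simp)))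
  | cut_unit (Γ₁ Γ₃ : LCtx R) {Δ : GCtx R} {C : LTy R} (c : MS Δ (Γ₁ ++ [] ++ Γ₃) C) :
      EqM (.cut Γ₁ Γ₃ .unitR (.lleft .unit Γ₁ Γ₃ c)) c
  | cut_imp (Γ₁ Γ₃ : LCtx R) {D₁ D₂ E : GCtx R} {G H : LCtx R} {A B C : LTy R}
      (a : MS E (G ++ [A]) B) (b : MS D₂ H A) (c : MS D₁ (Γ₁ ++ [B] ++ Γ₃) C) :
      EqM
        (.cut Γ₁ (H ++ Γ₃) (.impR a) ((MS.impL Γ₁ Γ₃ b c).cast rfl (by simp)))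
        (MS.path D₁ [] (gswap E D₂)
          ((MS.cut Γ₁ Γ₃ (.cut G [] b (a.cast rfl (by simp))) c).cast (by simp) rfl))
  | cut_grd (r : R) {Δ E : GCtx R} {X : GTy R} {Γ : LCtx R} {B : LTy R} (a : GS E X)
      (c : MS (Δ ++ [(r, X)]) Γ B) :
      EqM (.cut [] Γ (.grdR r a) (.grdL r X c)) (.gcut r Δ [] a (c.cast (by simp) rfl))
  | gcut_tensor (r : R) (Δ₁ Δ₃ : GCtx R) {E F : GCtx R} {X Y : GTy R} {Γ : LCtx R} {C : LTy R}
      (a : GS E X) (b : GS F Y) (c : MS (Δ₁ ++ [(r, X), (r, Y)] ++ Δ₃) Γ C) :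
      EqM (.gcut r Δ₁ Δ₃ (.tenR a b) (.left (.tensor r X Y) Δ₁ Δ₃ c))
        (.gcut r (Δ₁ ++ scale r E) Δ₃ b
          ((MS.gcut r Δ₁ ([(r, Y)] ++ Δ₃) a (c.cast (by simp) rfl)).cast (by simp) rfl))
  | gcut_unit (r : R) (Δ₁ Δ₃ : GCtx R) {Γ : LCtx R} {C : LTy R} (c : MS (Δ₁ ++ [] ++ Δ₃) Γ C) :
      EqM (.gcut r Δ₁ Δ₃ .unitR (.left (.unit r) Δ₁ Δ₃ c)) c
  | gcut_lin {Δ E : GCtx R} {A : LTy R} {Γ : LCtx R} {B : LTy R} (a : MS E [] A)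
      (c : MS Δ (A :: Γ) B) :
      EqM (.gcut 1 Δ [] (.linR a) ((MS.linL c).cast (by simp) rfl)) (.cut [] Γ a c)
  -- the left premise of the cut ends in a left rule
  | cut_left_left (Γ₁ Γ₃ : LCtx R) {P Q : GCtx R} (l : GLeft P Q) (D₁ D₂ : GCtx R) {Δ : GCtx R}
      {G : LCtx R} {A B : LTy R} (a : MS (D₁ ++ P ++ D₂) G A) (c : MS Δ (Γ₁ ++ [A] ++ Γ₃) B) :
      EqM (.cut Γ₁ Γ₃ (.left l D₁ D₂ a) c)
        (.left l (Δ ++ D₁) D₂ ((MS.cut Γ₁ Γ₃ a c).cast (by simp) rfl))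
  | cut_lleft_left (Γ₁ Γ₃ : LCtx R) {P Q : LCtx R} (l : LLeft P Q) (G₁ G₂ : LCtx R) {Δ E : GCtx R}
      {A B : LTy R} (a : MS E (G₁ ++ P ++ G₂) A) (c : MS Δ (Γ₁ ++ [A] ++ Γ₃) B) :
      EqM (.cut Γ₁ Γ₃ (.lleft l G₁ G₂ a) c)
        (.lleft l (Γ₁ ++ G₁) (G₂ ++ Γ₃) ((MS.cut Γ₁ Γ₃ a c).cast rfl (by simp)))
  | cut_impL_left (Γ₁ Γ₃ G₁ G₃ : LCtx R) {Δ D₁ D₂ : GCtx R} {H : LCtx R} {A B C C' : LTy R}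
      (b : MS D₂ H A) (a : MS D₁ (G₁ ++ [B] ++ G₃) C) (c : MS Δ (Γ₁ ++ [C] ++ Γ₃) C') :
      EqM (.cut Γ₁ Γ₃ (.impL G₁ G₃ b a) c)
        (.impL (B := B) (Γ₁ ++ G₁) (G₃ ++ Γ₃) b ((MS.cut Γ₁ Γ₃ a c).cast rfl (by simp)))
  | cut_linL_left (Γ₁ Γ₃ : LCtx R) {Δ D : GCtx R} {G : LCtx R} {A B C : LTy R}
      (a : MS D (A :: G) B) (c : MS Δ (Γ₁ ++ [B] ++ Γ₃) C) :
      EqM (.cut Γ₁ Γ₃ (.linL a) c)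
        (.linL (A := A) (Γ := Γ₁ ++ G ++ Γ₃)
          ((MS.lpath [] (G ++ Γ₃) (lswap Γ₁ [A])
            ((MS.cut Γ₁ Γ₃ a c).cast rfl (by simp))).cast rfl (by simp)))
  | cut_grdL_left (r : R) (X : GTy R) (Γ₁ Γ₃ : LCtx R) {Δ D : GCtx R} {G : LCtx R} {B C : LTy R}
      (a : MS (D ++ [(r, X)]) G B) (c : MS Δ (Γ₁ ++ [B] ++ Γ₃) C) :
      EqM (.cut Γ₁ Γ₃ (.grdL r X a) c)
        (MS.lpath [] (G ++ Γ₃) (lswap [.grd r X] Γ₁)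
          ((MS.grdL (Δ := Δ ++ D) r X ((MS.cut Γ₁ Γ₃ a c).cast (by simp) rfl)).cast rfl
            (by simp)))
  | gcut_left_left (r : R) (Δ₁ Δ₃ : GCtx R) {P Q : GCtx R} (l : GLeft P Q) (D₁ D₂ : GCtx R)
      {X : GTy R} {Γ : LCtx R} {B : LTy R} (a : GS (D₁ ++ P ++ D₂) X)
      (c : MS (Δ₁ ++ [(r, X)] ++ Δ₃) Γ B) :
      EqM (.gcut r Δ₁ Δ₃ (.left l D₁ D₂ a) c)
        (.left (l.scaled r) (Δ₁ ++ scale r D₁) (scale r D₂ ++ Δ₃)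
          ((MS.gcut r Δ₁ Δ₃ a c).cast (by simp [scale]) rfl))
  -- linear cut, the cut formula is passive in the last rule of the right premise
  | cut_tenR_fst (Γ₁ Γ₃ : LCtx R) {D₁ D₂ E : GCtx R} {G H : LCtx R} {A B C : LTy R} (a : MS E G A)
      (b : MS D₁ (Γ₁ ++ [A] ++ Γ₃) B) (c : MS D₂ H C) :
      EqM (.cut Γ₁ (Γ₃ ++ H) a ((MS.tenR b c).cast rfl (by simp)))
        (MS.path D₁ [] (gswap E D₂)
          ((MS.tenR (.cut Γ₁ Γ₃ a b) c).cast (by simp) rfl))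
  | cut_tenR_snd (Γ₁ Γ₃ : LCtx R) {D₁ D₂ E : GCtx R} {G H : LCtx R} {A B C : LTy R} (a : MS E G A)
      (b : MS D₁ H B) (c : MS D₂ (Γ₁ ++ [A] ++ Γ₃) C) :
      EqM (.cut (H ++ Γ₁) Γ₃ a ((MS.tenR b c).cast rfl (by simp)))
        (.tenR b (.cut Γ₁ Γ₃ a c))
  | cut_left (Γ₁ Γ₃ : LCtx R) {P Q : GCtx R} (l : GLeft P Q) (D₁ D₂ : GCtx R) {E : GCtx R}
      {G : LCtx R} {A B : LTy R} (a : MS E G A) (c : MS (D₁ ++ P ++ D₂) (Γ₁ ++ [A] ++ Γ₃) B) :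
      EqM (.cut Γ₁ Γ₃ a (.left l D₁ D₂ c))
        (.left l D₁ (D₂ ++ E) ((MS.cut Γ₁ Γ₃ a c).cast (by simp) rfl))
  | cut_lleft_before {P Q : LCtx R} (l : LLeft P Q) (G₁ G₂ G₃ : LCtx R) {D E : GCtx R} {H : LCtx R}
      {A B : LTy R} (a : MS E H A) (c : MS D (G₁ ++ P ++ (G₂ ++ [A] ++ G₃)) B) :
      EqM
        (.cut (G₁ ++ Q ++ G₂) G₃ a
          ((MS.lleft l G₁ (G₂ ++ [A] ++ G₃) c).cast rfl (by simp)))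
        (.lleft l G₁ (G₂ ++ H ++ G₃)
          ((MS.cut (G₁ ++ P ++ G₂) G₃ a (c.cast rfl (by simp))).cast rfl (by simp)))
  | cut_lleft_after {P Q : LCtx R} (l : LLeft P Q) (G₁ G₂ G₃ : LCtx R) {D E : GCtx R} {H : LCtx R}
      {A B : LTy R} (a : MS E H A) (c : MS D ((G₁ ++ [A] ++ G₂) ++ P ++ G₃) B) :
      EqM
        (.cut G₁ (G₂ ++ Q ++ G₃) a
          ((MS.lleft l (G₁ ++ [A] ++ G₂) G₃ c).cast rfl (by simp)))
        (.lleft l (G₁ ++ H ++ G₂) G₃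
          ((MS.cut G₁ (G₂ ++ P ++ G₃) a (c.cast rfl (by simp))).cast rfl (by simp)))
  | cut_impR (Γ₁ Γ₃ : LCtx R) {D E : GCtx R} {G : LCtx R} {A B C : LTy R} (a : MS E G A)
      (c : MS D (Γ₁ ++ [A] ++ Γ₃ ++ [B]) C) :
      EqM (.cut Γ₁ Γ₃ a (.impR c))
        (.impR (Γ := Γ₁ ++ G ++ Γ₃) ((MS.cut Γ₁ (Γ₃ ++ [B]) a (c.cast rfl (by simp))).cast rfl (by simp)))
  | cut_impL_arg (G₁ G₃ Γ₁ Γ₃ : LCtx R) {D₁ D₂ E : GCtx R} {H : LCtx R} {A B C C' : LTy R}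
      (a : MS E H A) (b : MS D₂ (G₁ ++ [A] ++ G₃) B) (c : MS D₁ (Γ₁ ++ [C] ++ Γ₃) C') :
      EqM
        (.cut (Γ₁ ++ .imp B C :: G₁) (G₃ ++ Γ₃) a
          ((MS.impL Γ₁ Γ₃ b c).cast rfl (by simp)))
        (.impL Γ₁ Γ₃ (.cut G₁ G₃ a b) c)
  | cut_impL_after (Γ₁ Γ₂ Γ₃ : LCtx R) {D₁ D₂ E : GCtx R} {G H : LCtx R} {A B C C' : LTy R}
      (a : MS E H A) (b : MS D₂ G B) (c : MS D₁ (Γ₁ ++ [C] ++ (Γ₂ ++ [A] ++ Γ₃)) C') :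
      EqM
        (.cut (Γ₁ ++ (.imp B C :: G) ++ Γ₂) Γ₃ a
          ((MS.impL Γ₁ (Γ₂ ++ [A] ++ Γ₃) b c).cast rfl (by simp)))
        (MS.path D₁ [] (gswap E D₂)
          ((MS.impL (B := C) Γ₁ (Γ₂ ++ H ++ Γ₃) b
            ((MS.cut (Γ₁ ++ [C] ++ Γ₂) Γ₃ a (c.cast rfl (by simp))).cast rfl (by simp))).cast
              (by simp) rfl))
  | cut_impL_before (Γ₁ Γ₂ Γ₃ : LCtx R) {D₁ D₂ E : GCtx R} {G H : LCtx R} {A B C C' : LTy R}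
      (a : MS E H A) (b : MS D₂ G B) (c : MS D₁ (Γ₁ ++ [A] ++ Γ₂ ++ [C] ++ Γ₃) C') :
      EqM
        (.cut Γ₁ (Γ₂ ++ (.imp B C :: G) ++ Γ₃) a
          ((MS.impL (Γ₁ ++ [A] ++ Γ₂) Γ₃ b c).cast rfl (by simp)))
        (MS.path D₁ [] (gswap E D₂)
          ((MS.impL (B := C) (Γ₁ ++ H ++ Γ₂) Γ₃ b
            ((MS.cut Γ₁ (Γ₂ ++ [C] ++ Γ₃) a (c.cast rfl (by simp))).cast rfl (by simp))).cast
              (by simp) rfl))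
  | cut_linL (Γ₁ Γ₃ : LCtx R) {D E : GCtx R} {G : LCtx R} {A B C : LTy R} (a : MS E G B)
      (c : MS D (A :: (Γ₁ ++ [B] ++ Γ₃)) C) :
      EqM (.cut Γ₁ Γ₃ a (.linL c))
        (MS.path D [] (gswap E [(1, .lin A)])
          ((MS.linL (A := A) (Γ := Γ₁ ++ G ++ Γ₃)
            (MS.cut (A :: Γ₁) Γ₃ a c)).cast (by simp) rfl))
  | cut_grdL (r : R) (X : GTy R) (Γ₁ Γ₃ : LCtx R) {D E : GCtx R} {G : LCtx R} {A B : LTy R}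
      (a : MS E G A) (c : MS (D ++ [(r, X)]) (Γ₁ ++ [A] ++ Γ₃) B) :
      EqM (.cut (.grd r X :: Γ₁) Γ₃ a (.grdL r X c))
        (.grdL (Δ := D ++ E) r X
          ((MS.path D [] (gswap [(r, X)] E)
            ((MS.cut Γ₁ Γ₃ a c).cast (by simp) rfl)).cast (by simp) rfl))
  -- linear cut, the cut formula is moved by exchange
  | cut_ex_fst (Γ₁ Γ₃ : LCtx R) {D E : GCtx R} {H : LCtx R} {A B C : LTy R} (a : MS E H A)
      (c : MS D (Γ₁ ++ [A, B] ++ Γ₃) C) :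
      EqM (.cut (Γ₁ ++ [B]) Γ₃ a ((MS.lleft (.ex A B) Γ₁ Γ₃ c).cast rfl (by simp)))
        (MS.lpath Γ₁ Γ₃ (lswap H [B])
          ((MS.cut Γ₁ ([B] ++ Γ₃) a (c.cast rfl (by simp))).cast rfl (by simp)))
  | cut_ex_snd (Γ₁ Γ₃ : LCtx R) {D E : GCtx R} {H : LCtx R} {A B C : LTy R} (a : MS E H A)
      (c : MS D (Γ₁ ++ [B, A] ++ Γ₃) C) :
      EqM (.cut Γ₁ ([B] ++ Γ₃) a ((MS.lleft (.ex B A) Γ₁ Γ₃ c).cast rfl (by simp)))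
        (MS.lpath Γ₁ Γ₃ (lswap [B] H)
          ((MS.cut (Γ₁ ++ [B]) Γ₃ a (c.cast rfl (by simp))).cast rfl (by simp)))
  -- graded cut, the cut formula is passive in the last rule of the right premise
  | gcut_tenR_fst (r : R) (Δ₁ Δ₃ : GCtx R) {E F : GCtx R} {X : GTy R} {G H : LCtx R} {A B : LTy R}
      (a : GS E X) (b : MS (Δ₁ ++ [(r, X)] ++ Δ₃) G A) (c : MS F H B) :
      EqM (.gcut r Δ₁ (Δ₃ ++ F) a ((MS.tenR b c).cast (by simp) rfl))
        (.tenR (.gcut r Δ₁ Δ₃ a b) c)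
  | gcut_tenR_snd (r : R) (Δ₁ Δ₃ : GCtx R) {E F : GCtx R} {X : GTy R} {G H : LCtx R} {A B : LTy R}
      (a : GS E X) (b : MS F G A) (c : MS (Δ₁ ++ [(r, X)] ++ Δ₃) H B) :
      EqM (.gcut r (F ++ Δ₁) Δ₃ a ((MS.tenR b c).cast (by simp) rfl))
        (.tenR b (.gcut r Δ₁ Δ₃ a c))
  | gcut_left_before (r : R) {P Q : GCtx R} (l : GLeft P Q) (D₁ D₂ D₃ : GCtx R) {E : GCtx R}
      {X : GTy R} {Γ : LCtx R} {B : LTy R} (a : GS E X)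
      (c : MS (D₁ ++ P ++ (D₂ ++ [(r, X)] ++ D₃)) Γ B) :
      EqM
        (.gcut r (D₁ ++ Q ++ D₂) D₃ a
          ((MS.left l D₁ (D₂ ++ [(r, X)] ++ D₃) c).cast (by simp) rfl))
        (.left l D₁ (D₂ ++ scale r E ++ D₃)
          ((MS.gcut r (D₁ ++ P ++ D₂) D₃ a (c.cast (by simp) rfl)).cast (by simp) rfl))
  | gcut_left_after (r : R) {P Q : GCtx R} (l : GLeft P Q) (D₁ D₂ D₃ : GCtx R) {E : GCtx R}
      {X : GTy R} {Γ : LCtx R} {B : LTy R} (a : GS E X)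
      (c : MS ((D₁ ++ [(r, X)] ++ D₂) ++ P ++ D₃) Γ B) :
      EqM
        (.gcut r D₁ (D₂ ++ Q ++ D₃) a
          ((MS.left l (D₁ ++ [(r, X)] ++ D₂) D₃ c).cast (by simp) rfl))
        (.left l (D₁ ++ scale r E ++ D₂) D₃
          ((MS.gcut r D₁ (D₂ ++ P ++ D₃) a (c.cast (by simp) rfl)).cast (by simp) rfl))
  | gcut_lleft (r : R) (Δ₁ Δ₃ : GCtx R) {P Q : LCtx R} (l : LLeft P Q) (Γ₁ Γ₂ : LCtx R) {E : GCtx R}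
      {X : GTy R} {B : LTy R} (a : GS E X) (c : MS (Δ₁ ++ [(r, X)] ++ Δ₃) (Γ₁ ++ P ++ Γ₂) B) :
      EqM (.gcut r Δ₁ Δ₃ a (.lleft l Γ₁ Γ₂ c)) (.lleft l Γ₁ Γ₂ (.gcut r Δ₁ Δ₃ a c))
  | gcut_impR (r : R) (Δ₁ Δ₃ : GCtx R) {E : GCtx R} {X : GTy R} {Γ : LCtx R} {A B : LTy R}
      (a : GS E X) (c : MS (Δ₁ ++ [(r, X)] ++ Δ₃) (Γ ++ [A]) B) :
      EqM (.gcut r Δ₁ Δ₃ a (.impR c)) (.impR (.gcut r Δ₁ Δ₃ a c))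
  | gcut_impL_arg (r : R) (Δ₁ Δ₃ : GCtx R) (Γ₁ Γ₃ : LCtx R) {D E : GCtx R} {X : GTy R} {H : LCtx R}
      {A B C : LTy R} (a : GS E X) (b : MS (Δ₁ ++ [(r, X)] ++ Δ₃) H A)
      (c : MS D (Γ₁ ++ [B] ++ Γ₃) C) :
      EqM (.gcut r (D ++ Δ₁) Δ₃ a ((MS.impL Γ₁ Γ₃ b c).cast (by simp) rfl))
        (.impL Γ₁ Γ₃ (.gcut r Δ₁ Δ₃ a b) c)
  | gcut_impL_body (r : R) (Δ₁ Δ₃ : GCtx R) (Γ₁ Γ₃ : LCtx R) {D E : GCtx R} {X : GTy R} {H : LCtx R}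
      {A B C : LTy R} (a : GS E X) (b : MS D H A)
      (c : MS (Δ₁ ++ [(r, X)] ++ Δ₃) (Γ₁ ++ [B] ++ Γ₃) C) :
      EqM (.gcut r Δ₁ (Δ₃ ++ D) a ((MS.impL Γ₁ Γ₃ b c).cast (by simp) rfl))
        (.impL Γ₁ Γ₃ b (.gcut r Δ₁ Δ₃ a c))
  | gcut_grdR (r s : R) (Δ₁ Δ₃ : GCtx R) {E : GCtx R} {X Y : GTy R} (a : GS E X)
      (c : GS (Δ₁ ++ [(r, X)] ++ Δ₃) Y) :
      EqM
        (.gcut (s * r) (scale s Δ₁) (scale s Δ₃) a ((MS.grdR s c).cast (by simp [scale]) rfl))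
        (.grdR s (.cut r Δ₁ Δ₃ a c))
  | gcut_grdL (r s : R) (Y : GTy R) (Δ₁ Δ₃ : GCtx R) {E : GCtx R} {X : GTy R} {Γ : LCtx R}
      {B : LTy R} (a : GS E X) (c : MS (Δ₁ ++ [(r, X)] ++ Δ₃ ++ [(s, Y)]) Γ B) :
      EqM (.gcut r Δ₁ Δ₃ a (.grdL s Y c))
        (.grdL (Δ := Δ₁ ++ scale r E ++ Δ₃) s Y
          ((MS.gcut r Δ₁ (Δ₃ ++ [(s, Y)]) a (c.cast (by simp) rfl)).cast (by simp) rfl))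
  | gcut_linL (r : R) (Δ₁ Δ₃ : GCtx R) {E : GCtx R} {X : GTy R} {A : LTy R} {Γ : LCtx R} {B : LTy R}
      (a : GS E X) (c : MS (Δ₁ ++ [(r, X)] ++ Δ₃) (A :: Γ) B) :
      EqM (.gcut r Δ₁ (Δ₃ ++ [(1, .lin A)]) a ((MS.linL c).cast (by simp) rfl))
        (.linL (.gcut r Δ₁ Δ₃ a c))
  -- graded cut, the cut formula is introduced or moved by a structural rule
  | gcut_weak (r : R) (h : r = 0) (Δ₁ Δ₃ : GCtx R) {E : GCtx R} {X : GTy R} {Γ : LCtx R}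
      {B : LTy R} (a : GS E X) (c : MS (Δ₁ ++ [] ++ Δ₃) Γ B) :
      EqM (.gcut r Δ₁ Δ₃ a (.left (.weak r X h) Δ₁ Δ₃ c)) (c.path Δ₁ Δ₃ (weakBlock r h E))
  | gcut_cont (r₁ r₂ r : R) (h : r = r₁ + r₂) (Δ₁ Δ₃ : GCtx R) {E : GCtx R} {X : GTy R}
      {Γ : LCtx R} {B : LTy R} (a : GS E X) (c : MS (Δ₁ ++ [(r₁, X), (r₂, X)] ++ Δ₃) Γ B) :
      EqM (.gcut r Δ₁ Δ₃ a (.left (.cont r₁ r₂ r X h) Δ₁ Δ₃ c))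
        (MS.path Δ₁ Δ₃ (contBlock r₁ r₂ r h E)
          ((MS.gcut r₁ Δ₁ (scale r₂ E ++ Δ₃) a
            ((MS.gcut r₂ (Δ₁ ++ [(r₁, X)]) Δ₃ a (c.cast (by simp) rfl)).cast (by simp) rfl)).cast
              (by simp) rfl))
  | gcut_ex_fst (r : R) (b : R × GTy R) (Δ₁ Δ₃ : GCtx R) {E : GCtx R} {X : GTy R} {Γ : LCtx R}
      {B : LTy R} (a : GS E X) (c : MS (Δ₁ ++ [(r, X), b] ++ Δ₃) Γ B) :
      EqM (.gcut r (Δ₁ ++ [b]) Δ₃ a ((MS.left (.ex (r, X) b) Δ₁ Δ₃ c).cast (by simp) rfl))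
        (MS.path Δ₁ Δ₃ (gswap (scale r E) [b])
          ((MS.gcut r Δ₁ ([b] ++ Δ₃) a (c.cast (by simp) rfl)).cast (by simp) rfl))
  | gcut_ex_snd (r : R) (b : R × GTy R) (Δ₁ Δ₃ : GCtx R) {E : GCtx R} {X : GTy R} {Γ : LCtx R}
      {B : LTy R} (a : GS E X) (c : MS (Δ₁ ++ [b, (r, X)] ++ Δ₃) Γ B) :
      EqM (.gcut r Δ₁ ([b] ++ Δ₃) a ((MS.left (.ex b (r, X)) Δ₁ Δ₃ c).cast (by simp) rfl))
        (MS.path Δ₁ Δ₃ (gswap [b] (scale r E))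
          ((MS.gcut r (Δ₁ ++ [b]) Δ₃ a (c.cast (by simp) rfl)).cast (by simp) rfl))
  -- structural rules
  | struct {P Q : GCtx R} {p q : Path GLeft P Q} (h : GStructEq p q) (Δ₁ Δ₂ : GCtx R) {Γ : LCtx R}
      {B : LTy R} (c : MS (Δ₁ ++ P ++ Δ₂) Γ B) : EqM (c.path Δ₁ Δ₂ p) (c.path Δ₁ Δ₂ q)
  | ex_ex (A B : LTy R) {Δ : GCtx R} (Γ₁ Γ₂ : LCtx R) {C : LTy R}
      (c : MS Δ (Γ₁ ++ [A, B] ++ Γ₂) C) :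
      EqM (.lleft (.ex B A) Γ₁ Γ₂ (.lleft (.ex A B) Γ₁ Γ₂ c)) c
  -- approximation
  | sub_refl {Δ : GCtx R} (h : CtxLe Δ Δ) {Γ : LCtx R} {B : LTy R} (a : MS Δ Γ B) :
      EqM (.sub h a) a
  | sub_trans {Δ Δ' Δ'' : GCtx R} (h : CtxLe Δ Δ') (h' : CtxLe Δ' Δ'') (h'' : CtxLe Δ Δ'')
      {Γ : LCtx R} {B : LTy R} (a : MS Δ Γ B) : EqM (.sub h' (.sub h a)) (.sub h'' a)
  | sub_tenR {Δ₁ Δ₁' Δ₂ Δ₂' : GCtx R} (h₁ : CtxLe Δ₁ Δ₁') (h₂ : CtxLe Δ₂ Δ₂')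
      (h : CtxLe (Δ₁ ++ Δ₂) (Δ₁' ++ Δ₂')) {G H : LCtx R} {A B : LTy R} (a : MS Δ₁ G A)
      (b : MS Δ₂ H B) : EqM (.sub h (.tenR a b)) (.tenR (.sub h₁ a) (.sub h₂ b))
  | sub_impR {Δ Δ' : GCtx R} (h : CtxLe Δ Δ') {Γ : LCtx R} {A B : LTy R}
      (a : MS Δ (Γ ++ [A]) B) : EqM (.sub h (.impR a)) (.impR (.sub h a))
  | sub_impL {Δ₁ Δ₁' Δ₂ Δ₂' : GCtx R} (h₁ : CtxLe Δ₁ Δ₁') (h₂ : CtxLe Δ₂ Δ₂')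
      (h : CtxLe (Δ₁ ++ Δ₂) (Δ₁' ++ Δ₂')) (Γ₁ Γ₃ : LCtx R) {Γ₂ : LCtx R} {A B C : LTy R}
      (a : MS Δ₂ Γ₂ A) (c : MS Δ₁ (Γ₁ ++ [B] ++ Γ₃) C) :
      EqM (.sub h (.impL Γ₁ Γ₃ a c)) (.impL Γ₁ Γ₃ (.sub h₂ a) (.sub h₁ c))
  | sub_grdR (r : R) {Δ Δ' : GCtx R} (h : CtxLe Δ Δ') (h' : CtxLe (scale r Δ) (scale r Δ'))
      {X : GTy R} (a : GS Δ X) : EqM (.sub h' (.grdR r a)) (.grdR r (.sub h a))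
  | sub_grdL (r : R) (X : GTy R) {Δ Δ' : GCtx R} (h : CtxLe Δ Δ')
      (h' : CtxLe (Δ ++ [(r, X)]) (Δ' ++ [(r, X)])) {Γ : LCtx R} {B : LTy R}
      (a : MS (Δ ++ [(r, X)]) Γ B) : EqM (.sub h (.grdL r X a)) (.grdL r X (.sub h' a))
  | sub_linL {Δ Δ' : GCtx R} {A : LTy R} (h : CtxLe Δ Δ')
      (h' : CtxLe (Δ ++ [(1, .lin A)]) (Δ' ++ [(1, .lin A)])) {Γ : LCtx R} {B : LTy R}
      (a : MS Δ (A :: Γ) B) : EqM (.sub h' (.linL a)) (.linL (.sub h a))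
  | sub_left {P Q P' Q' : GCtx R} {l : GLeft P Q} {l' : GLeft P' Q'} (hl : GLeft.Le l l')
      {Δ₁ Δ₂ Δ₁' Δ₂' : GCtx R} (h₁ : CtxLe Δ₁ Δ₁') (h₂ : CtxLe Δ₂ Δ₂')
      (h : CtxLe (Δ₁ ++ P ++ Δ₂) (Δ₁' ++ P' ++ Δ₂'))
      (h' : CtxLe (Δ₁ ++ Q ++ Δ₂) (Δ₁' ++ Q' ++ Δ₂')) {Γ : LCtx R} {B : LTy R}
      (a : MS (Δ₁ ++ P ++ Δ₂) Γ B) :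
      EqM (.sub h' (.left l Δ₁ Δ₂ a)) (.left l' Δ₁' Δ₂' (.sub h a))
  | sub_lleft {P Q : LCtx R} (l : LLeft P Q) {Δ Δ' : GCtx R} (h : CtxLe Δ Δ') (Γ₁ Γ₂ : LCtx R)
      {B : LTy R} (a : MS Δ (Γ₁ ++ P ++ Γ₂) B) :
      EqM (.sub h (.lleft l Γ₁ Γ₂ a)) (.lleft l Γ₁ Γ₂ (.sub h a))
  | sub_cut {Δ₁ Δ₁' Δ₂ Δ₂' : GCtx R} (h₁ : CtxLe Δ₁ Δ₁') (h₂ : CtxLe Δ₂ Δ₂')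
      (h : CtxLe (Δ₁ ++ Δ₂) (Δ₁' ++ Δ₂')) (Γ₁ Γ₃ : LCtx R) {Γ₂ : LCtx R} {A B : LTy R}
      (a : MS Δ₂ Γ₂ A) (c : MS Δ₁ (Γ₁ ++ [A] ++ Γ₃) B) :
      EqM (.sub h (.cut Γ₁ Γ₃ a c)) (.cut Γ₁ Γ₃ (.sub h₂ a) (.sub h₁ c))
  | sub_gcut {r r' : R} (hr : r ≤ r') {Δ₁ Δ₂ Δ₃ Δ₁' Δ₂' Δ₃' : GCtx R} (h₁ : CtxLe Δ₁ Δ₁')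
      (h₂ : CtxLe Δ₂ Δ₂') (h₃ : CtxLe Δ₃ Δ₃') {X : GTy R} {Γ : LCtx R} {B : LTy R}
      (h : CtxLe (Δ₁ ++ [(r, X)] ++ Δ₃) (Δ₁' ++ [(r', X)] ++ Δ₃'))
      (h' : CtxLe (Δ₁ ++ scale r Δ₂ ++ Δ₃) (Δ₁' ++ scale r' Δ₂' ++ Δ₃'))
      (a : GS Δ₂ X) (c : MS (Δ₁ ++ [(r, X)] ++ Δ₃) Γ B) :
      EqM (.sub h' (.gcut r Δ₁ Δ₃ a c)) (.gcut r' Δ₁' Δ₃' (.sub h₂ a) (.sub h c))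
end

end Equations

/-! ## Models -/

section Actions

variable {R : Type u} [Preorder R] {C : Type u} [Category.{u} C]

/-- For a bifunctor `⊙ : Rᵒᵖ × C ⥤ C` (curried), the endofunctor `r ⊙ -`. -/
abbrev gobj (act : Rᵒᵖ ⥤ C ⥤ C) (r : R) : C ⥤ C := act.obj (op r)

/-- The morphism `s ⊙ X ⟶ r ⊙ X` given by `r ≤ s`. -/
abbrev gle (act : Rᵒᵖ ⥤ C ⥤ C) {r s : R} (h : r ≤ s) (X : C) :
    (gobj act s).obj X ⟶ (gobj act r).obj X := (act.map (homOfLE h).op).app X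

/-- The identity morphism `r ⊙ X ⟶ s ⊙ X` for equal grades `r = s`. -/
def gcast (act : Rᵒᵖ ⥤ C ⥤ C) {r s : R} (h : r = s) (X : C) :
    (gobj act r).obj X ⟶ (gobj act s).obj X := eqToHom (by rw [h])

end Actions

/-- Strict exponential actions of a preordered semiring on a symmetric monoidal category. -/
structure ExpAction (R : Type u) [Semiring R] [Preorder R] (C : Type u) [Category.{u} C]
    [MonoidalCategory C] [SymmetricCategory C] where
  /-- The bifunctor `⊙ : Rᵒᵖ × C ⥤ C`, curried. -/
  act : Rᵒᵖ ⥤ C ⥤ C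
  -- strict action: `1 ⊙ X = X` and `(r * s) ⊙ X = r ⊙ (s ⊙ X)`
  act_one : gobj act 1 = 𝟭 C
  act_mul : ∀ r s : R, gobj act (r * s) = gobj act s ⋙ gobj act r
  act_mul_natural : ∀ {r r' s s' : R} (hr : r ≤ r') (hs : s ≤ s') (h : r * s ≤ r' * s') (X : C),
    gle act h X ≫ eqToHom (congrArg (fun F : C ⥤ C => F.obj X) (act_mul r s)) =
      eqToHom (congrArg (fun F : C ⥤ C => F.obj X) (act_mul r' s')) ≫
        (gobj act r').map (gle act hs X) ≫ gle act hr ((gobj act s).obj X)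
  -- strict symmetric monoidality in the second argument
  [lax : ∀ r : R, (gobj act r).LaxBraided]
  unit_obj : ∀ r : R, 𝟙_ C = (gobj act r).obj (𝟙_ C)
  unit_eq : ∀ r : R, Functor.LaxMonoidal.ε (gobj act r) = eqToHom (unit_obj r)
  tensor_obj : ∀ (r : R) (X Y : C),
    (gobj act r).obj X ⊗ (gobj act r).obj Y = (gobj act r).obj (X ⊗ Y)
  tensor_eq : ∀ (r : R) (X Y : C),
    Functor.LaxMonoidal.μ (gobj act r) X Y = eqToHom (tensor_obj r X Y)
  unit_natural : ∀ {r s : R} (h : r ≤ s),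
    eqToHom (unit_obj s) ≫ gle act h (𝟙_ C) = eqToHom (unit_obj r)
  tensor_natural : ∀ {r s : R} (h : r ≤ s) (X Y : C),
    eqToHom (tensor_obj s X Y) ≫ gle act h (X ⊗ Y) =
      (gle act h X ⊗ₘ gle act h Y) ≫ eqToHom (tensor_obj r X Y)
  -- symmetric colax monoidality in the first argument
  weak : ∀ X : C, (gobj act 0).obj X ⟶ 𝟙_ C
  weak_natural : ∀ {X Y : C} (f : X ⟶ Y), (gobj act 0).map f ≫ weak Y = weak X
  contr : ∀ (r s : R) (X : C), (gobj act (r + s)).obj X ⟶ (gobj act r).obj X ⊗ (gobj act s).obj X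
  contr_natural : ∀ (r s : R) {X Y : C} (f : X ⟶ Y),
    (gobj act (r + s)).map f ≫ contr r s Y =
      contr r s X ≫ ((gobj act r).map f ⊗ₘ (gobj act s).map f)
  contr_natural_grade : ∀ {r r' s s' : R} (hr : r ≤ r') (hs : s ≤ s') (h : r + s ≤ r' + s')
    (X : C), gle act h X ≫ contr r s X = contr r' s' X ≫ (gle act hr X ⊗ₘ gle act hs X)
  contr_weak_right : ∀ (r : R) (X : C),
    contr r 0 X ≫ ((gobj act r).obj X ◁ weak X) ≫ (ρ_ _).hom = gcast act (add_zero r) X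
  contr_weak_left : ∀ (r : R) (X : C),
    contr 0 r X ≫ (weak X ▷ (gobj act r).obj X) ≫ (λ_ _).hom = gcast act (zero_add r) X
  contr_assoc : ∀ (r s t : R) (X : C),
    contr (r + s) t X ≫ (contr r s X ▷ (gobj act t).obj X) ≫ (α_ _ _ _).hom =
      gcast act (add_assoc r s t) X ≫ contr r (s + t) X ≫ ((gobj act r).obj X ◁ contr s t X)
  contr_symm : ∀ (r s : R) (X : C),
    contr r s X = gcast act (add_comm r s) X ≫ contr s r X ≫ (β_ _ _).hom
  -- compatibility of the colax structure with the action and with the monoidal structure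
  zero_mul_weak : ∀ (s : R) (X : C),
    weak X = gcast act (zero_mul s).symm X ≫
      eqToHom (congrArg (fun F : C ⥤ C => F.obj X) (act_mul 0 s)) ≫ weak ((gobj act s).obj X)
  mul_zero_weak : ∀ (s : R) (X : C),
    gcast act (mul_zero s).symm X ≫
        eqToHom (congrArg (fun F : C ⥤ C => F.obj X) (act_mul s 0)) ≫ (gobj act s).map (weak X) =
      weak X ≫ eqToHom (unit_obj s)
  mul_add_contr : ∀ (r s₁ s₂ : R) (X : C),
    eqToHom (congrArg (fun F : C ⥤ C => F.obj X) (act_mul r (s₁ + s₂))) ≫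
        (gobj act r).map (contr s₁ s₂ X) =
      gcast act (mul_add r s₁ s₂) X ≫ contr (r * s₁) (r * s₂) X ≫
        (eqToHom (congrArg (fun F : C ⥤ C => F.obj X) (act_mul r s₁)) ⊗ₘ
          eqToHom (congrArg (fun F : C ⥤ C => F.obj X) (act_mul r s₂))) ≫
        eqToHom (tensor_obj r _ _)
  add_mul_contr : ∀ (s₁ s₂ r : R) (X : C),
    eqToHom (congrArg (fun F : C ⥤ C => F.obj X) (act_mul (s₁ + s₂) r)) ≫
        contr s₁ s₂ ((gobj act r).obj X) =
      gcast act (add_mul s₁ s₂ r) X ≫ contr (s₁ * r) (s₂ * r) X ≫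
        (eqToHom (congrArg (fun F : C ⥤ C => F.obj X) (act_mul s₁ r)) ⊗ₘ
          eqToHom (congrArg (fun F : C ⥤ C => F.obj X) (act_mul s₂ r)))

/-- Mixed graded/linear models over `R`: a symmetric monoidal category `C`, a symmetric monoidal
closed category `M`, a symmetric monoidal adjunction `Mny ⊣ Lin` between them and a
strict exponential action of `R` on `C`. -/
structure Model (R : Type u) [Semiring R] [Preorder R] where
  C : Type u
  M : Type u
  [catC : Category.{u} C]
  [monC : MonoidalCategory C]
  [symC : SymmetricCategory C]
  [catM : Category.{u} M]
  [monM : MonoidalCategory M]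
  [symM : SymmetricCategory M]
  [closedM : MonoidalClosed M]
  Mny : C ⥤ M
  Lin : M ⥤ C
  [laxMny : Mny.LaxBraided]
  [laxLin : Lin.LaxBraided]
  adj : Mny ⊣ Lin
  [monUnit : NatTrans.IsMonoidal adj.unit]
  [monCounit : NatTrans.IsMonoidal adj.counit]
  exp : ExpAction R C

attribute [instance] Model.catC Model.monC Model.symC Model.catM Model.monM Model.symM
  Model.closedM Model.laxMny Model.laxLin

/-! ## Interpretation -/

section Lists

variable {α : Type u} {C : Type u} [Category.{u} C] [MonoidalCategory C] (f : α → C)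

/-- The tensor product of the objects `f a` for `a` in a list. -/
def tens : List α → C
  | [] => 𝟙_ C
  | a :: l => f a ⊗ tens l

/-- The tensor product of a concatenation. -/
def tensAppend : ∀ l l' : List α, tens f (l ++ l') ≅ tens f l ⊗ tens f l'
  | [], l' => (λ_ (tens f l')).symm
  | a :: l, l' => whiskerLeftIso (f a) (tensAppend l l') ≪≫ (α_ (f a) (tens f l) (tens f l')).symm

/-- The tensor product of a list in three parts. -/
def tensSplit (l₁ l l₂ : List α) : tens f (l₁ ++ l ++ l₂) ≅ (tens f l₁ ⊗ tens f l) ⊗ tens f l₂ :=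
  tensAppend f (l₁ ++ l) l₂ ≪≫ whiskerRightIso (tensAppend f l₁ l) (tens f l₂)

/-- A morphism on the middle part of a list. -/
def tensMid (l₁ l₂ : List α) {P Q : List α} (g : tens f Q ⟶ tens f P) :
    tens f (l₁ ++ Q ++ l₂) ⟶ tens f (l₁ ++ P ++ l₂) :=
  (tensSplit f l₁ Q l₂).hom ≫ ((tens f l₁ ◁ g) ▷ tens f l₂) ≫ (tensSplit f l₁ P l₂).inv

end Lists

/-- `(D ⊗ E) ⊗ ((U ⊗ G) ⊗ V) ⟶ D ⊗ ((U ⊗ (E ⊗ G)) ⊗ V)`, which moves `E` past `U`. -/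
def insertMid {M : Type u} [Category.{u} M] [MonoidalCategory M] [SymmetricCategory M]
    (D E U G V : M) : (D ⊗ E) ⊗ ((U ⊗ G) ⊗ V) ⟶ D ⊗ ((U ⊗ (E ⊗ G)) ⊗ V) :=
  (α_ D E ((U ⊗ G) ⊗ V)).hom ≫
    D ◁ ((α_ E (U ⊗ G) V).inv ≫
      ((α_ E U G).inv ≫ ((β_ E U).hom ▷ G) ≫ (α_ U E G).hom) ▷ V)

namespace Model

variable {R : Type u} [Semiring R] [Preorder R] (𝓜 : Model R)

mutual
/-- Interpretation of the graded types. -/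
def objG : GTy R → 𝓜.C
  | .unit => 𝟙_ 𝓜.C
  | .tensor X Y => objG X ⊗ objG Y
  | .lin A => 𝓜.Lin.obj (objM A)
/-- Interpretation of the linear types. -/
def objM : LTy R → 𝓜.M
  | .unit => 𝟙_ 𝓜.M
  | .tensor A B => objM A ⊗ objM B
  | .imp A B => (ihom (objM A)).obj (objM B)
  | .grd r X => 𝓜.Mny.obj ((gobj 𝓜.exp.act r).obj (objG X))
end

/-- Interpretation of a graded hypothesis in the graded system, `r ⊙ X`. -/
def hypG (p : R × GTy R) : 𝓜.C := (gobj 𝓜.exp.act p.1).obj (𝓜.objG p.2)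

/-- Interpretation of a graded hypothesis in the mixed system, `Mny (r ⊙ X)`. -/
def hypM (p : R × GTy R) : 𝓜.M := 𝓜.Mny.obj (𝓜.hypG p)

/-- Interpretation of the graded contexts in the graded system. -/
abbrev ctxG (Δ : GCtx R) : 𝓜.C := tens 𝓜.hypG Δ

/-- Interpretation of the graded contexts in the mixed system. -/
abbrev ctxM (Δ : GCtx R) : 𝓜.M := tens 𝓜.hypM Δ

/-- Interpretation of the linear contexts. -/
abbrev ctxL (Γ : LCtx R) : 𝓜.M := tens 𝓜.objM Γ

/-- The equality `1 ⊙ X = X`. -/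
def oneMap (X : 𝓜.C) : (gobj 𝓜.exp.act 1).obj X ⟶ X :=
  eqToHom (congrArg (fun F : 𝓜.C ⥤ 𝓜.C => F.obj X) 𝓜.exp.act_one)

/-- The equality `(r * s) ⊙ X = r ⊙ (s ⊙ X)`. -/
def mulMap (r s : R) (X : 𝓜.C) :
    (gobj 𝓜.exp.act (r * s)).obj X ⟶ (gobj 𝓜.exp.act r).obj ((gobj 𝓜.exp.act s).obj X) :=
  eqToHom (congrArg (fun F : 𝓜.C ⥤ 𝓜.C => F.obj X) (𝓜.exp.act_mul r s))

/-- The morphism `Mny (X ⊠ Y) ⟶ Mny X ⊗ Mny Y`. -/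
def nTensor (X Y : 𝓜.C) : 𝓜.Mny.obj (X ⊗ Y) ⟶ 𝓜.Mny.obj X ⊗ 𝓜.Mny.obj Y :=
  𝓜.Mny.map (𝓜.adj.unit.app X ⊗ₘ 𝓜.adj.unit.app Y) ≫
    𝓜.Mny.map (Functor.LaxMonoidal.μ 𝓜.Lin (𝓜.Mny.obj X) (𝓜.Mny.obj Y)) ≫
      𝓜.adj.counit.app (𝓜.Mny.obj X ⊗ 𝓜.Mny.obj Y)

/-- The morphism `Mny J ⟶ I`. -/
def nUnit : 𝓜.Mny.obj (𝟙_ 𝓜.C) ⟶ 𝟙_ 𝓜.M :=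
  𝓜.Mny.map (Functor.LaxMonoidal.ε 𝓜.Lin) ≫ 𝓜.adj.counit.app (𝟙_ 𝓜.M)

/-- `Mny (r₁ ⊙ X₁) ⊗ ⋯ ⊗ Mny (rₙ ⊙ Xₙ) ⟶ Mny ((r₁ ⊙ X₁) ⊠ ⋯ ⊠ (rₙ ⊙ Xₙ))`. -/
def mMny : ∀ Δ : GCtx R, 𝓜.ctxM Δ ⟶ 𝓜.Mny.obj (𝓜.ctxG Δ)
  | [] => Functor.LaxMonoidal.ε 𝓜.Mny
  | p :: Δ => (𝓜.hypM p ◁ mMny Δ) ≫ Functor.LaxMonoidal.μ 𝓜.Mny (𝓜.hypG p) (𝓜.ctxG Δ)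

/-- `(r₁ ⊙ X₁) ⊠ ⋯ ⊠ (rₙ ⊙ Xₙ) ⟶ Lin (Mny (r₁ ⊙ X₁) ⊗ ⋯ ⊗ Mny (rₙ ⊙ Xₙ))`. -/
def etaLin : ∀ Δ : GCtx R, 𝓜.ctxG Δ ⟶ 𝓜.Lin.obj (𝓜.ctxM Δ)
  | [] => Functor.LaxMonoidal.ε 𝓜.Lin
  | p :: Δ => (𝓜.adj.unit.app (𝓜.hypG p) ⊗ₘ etaLin Δ) ≫
      Functor.LaxMonoidal.μ 𝓜.Lin (𝓜.hypM p) (𝓜.ctxM Δ)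

/-- `((r * r₁) ⊙ X₁) ⊠ ⋯ ⊠ ((r * rₙ) ⊙ Xₙ) ⟶ r ⊙ ((r₁ ⊙ X₁) ⊠ ⋯ ⊠ (rₙ ⊙ Xₙ))`. -/
def scaleMap (r : R) : ∀ Δ : GCtx R, 𝓜.ctxG (scale r Δ) ⟶ (gobj 𝓜.exp.act r).obj (𝓜.ctxG Δ)
  | [] => eqToHom (𝓜.exp.unit_obj r)
  | p :: Δ => (𝓜.mulMap r p.1 (𝓜.objG p.2) ⊗ₘ scaleMap r Δ) ≫
      eqToHom (𝓜.exp.tensor_obj r (𝓜.hypG p) (𝓜.ctxG Δ))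

/-- Promotion of a morphism in the graded system. -/
def promoteG (r : R) {Δ : GCtx R} {X : GTy R} (g : 𝓜.ctxG Δ ⟶ 𝓜.objG X) :
    𝓜.ctxG (scale r Δ) ⟶ 𝓜.ctxG [(r, X)] :=
  𝓜.scaleMap r Δ ≫ (gobj 𝓜.exp.act r).map g ≫ (ρ_ (𝓜.hypG (r, X))).inv

/-- Promotion of a morphism of the graded system to the mixed system. -/
def promoteM (r : R) {Δ : GCtx R} {X : GTy R} (g : 𝓜.ctxG Δ ⟶ 𝓜.objG X) :
    𝓜.ctxM (scale r Δ) ⟶ 𝓜.hypM (r, X) :=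
  𝓜.mMny (scale r Δ) ≫ 𝓜.Mny.map (𝓜.scaleMap r Δ) ≫ 𝓜.Mny.map ((gobj 𝓜.exp.act r).map g)

/-- Approximation in the graded system. -/
def subG : ∀ Δ Δ' : GCtx R, CtxLe Δ Δ' → (𝓜.ctxG Δ' ⟶ 𝓜.ctxG Δ)
  | [], [], _ => 𝟙 _
  | p :: Δ, q :: Δ', h =>
      (gle 𝓜.exp.act h.1 (𝓜.objG q.2) ≫ eqToHom (by rw [hypG, h.2.1])) ⊗ₘ subG Δ Δ' h.2.2
  | [], _ :: _, h => h.elim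
  | _ :: _, [], h => h.elim

/-- Approximation in the mixed system. -/
def subM : ∀ Δ Δ' : GCtx R, CtxLe Δ Δ' → (𝓜.ctxM Δ' ⟶ 𝓜.ctxM Δ)
  | [], [], _ => 𝟙 _
  | p :: Δ, q :: Δ', h =>
      𝓜.Mny.map (gle 𝓜.exp.act h.1 (𝓜.objG q.2) ≫ eqToHom (by rw [hypG, h.2.1])) ⊗ₘ
        subM Δ Δ' h.2.2
  | [], _ :: _, h => h.elim
  | _ :: _, [], h => h.elim

/-- Weakening of one hypothesis of grade `0`. -/
def weakHyp (r : R) (X : GTy R) (h : r = 0) : 𝓜.hypG (r, X) ⟶ 𝟙_ 𝓜.C :=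
  gcast 𝓜.exp.act h (𝓜.objG X) ≫ 𝓜.exp.weak (𝓜.objG X)

/-- Contraction of two hypotheses. -/
def contHyp (r₁ r₂ r : R) (X : GTy R) (h : r = r₁ + r₂) :
    𝓜.hypG (r, X) ⟶ 𝓜.hypG (r₁, X) ⊗ 𝓜.hypG (r₂, X) :=
  gcast 𝓜.exp.act h (𝓜.objG X) ≫ 𝓜.exp.contr r₁ r₂ (𝓜.objG X)

/-- Elimination of a hypothesis `r ⊙ J`. -/
def unitHyp (r : R) : 𝓜.hypG (r, .unit) ⟶ 𝟙_ 𝓜.C := eqToHom (𝓜.exp.unit_obj r).symm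

/-- Elimination of a hypothesis `r ⊙ (X ⊠ Y)`. -/
def tensorHyp (r : R) (X Y : GTy R) :
    𝓜.hypG (r, .tensor X Y) ⟶ 𝓜.hypG (r, X) ⊗ 𝓜.hypG (r, Y) :=
  eqToHom (𝓜.exp.tensor_obj r (𝓜.objG X) (𝓜.objG Y)).symm

/-- Interpretation of the graded left rules in the graded system. -/
def leftG : ∀ {P Q : GCtx R}, GLeft P Q → (𝓜.ctxG Q ⟶ 𝓜.ctxG P)
  | _, _, .unit r => (ρ_ (𝓜.hypG (r, .unit))).hom ≫ 𝓜.unitHyp r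
  | _, _, .tensor r X Y => (𝓜.tensorHyp r X Y ▷ 𝟙_ 𝓜.C) ≫
      (α_ (𝓜.hypG (r, X)) (𝓜.hypG (r, Y)) (𝟙_ 𝓜.C)).hom
  | _, _, .weak r X h => (ρ_ (𝓜.hypG (r, X))).hom ≫ 𝓜.weakHyp r X h
  | _, _, .cont r₁ r₂ r X h => (𝓜.contHyp r₁ r₂ r X h ▷ 𝟙_ 𝓜.C) ≫
      (α_ (𝓜.hypG (r₁, X)) (𝓜.hypG (r₂, X)) (𝟙_ 𝓜.C)).hom
  | _, _, .ex a b => (α_ (𝓜.hypG b) (𝓜.hypG a) (𝟙_ 𝓜.C)).inv ≫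
      ((β_ (𝓜.hypG b) (𝓜.hypG a)).hom ▷ 𝟙_ 𝓜.C) ≫ (α_ (𝓜.hypG a) (𝓜.hypG b) (𝟙_ 𝓜.C)).hom

/-- Interpretation of the graded left rules in the mixed system. -/
def leftM : ∀ {P Q : GCtx R}, GLeft P Q → (𝓜.ctxM Q ⟶ 𝓜.ctxM P)
  | _, _, .unit r => (ρ_ (𝓜.hypM (r, .unit))).hom ≫ 𝓜.Mny.map (𝓜.unitHyp r) ≫ 𝓜.nUnit
  | _, _, .tensor r X Y =>
      ((𝓜.Mny.map (𝓜.tensorHyp r X Y) ≫ 𝓜.nTensor (𝓜.hypG (r, X)) (𝓜.hypG (r, Y))) ▷ 𝟙_ 𝓜.M) ≫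
        (α_ (𝓜.hypM (r, X)) (𝓜.hypM (r, Y)) (𝟙_ 𝓜.M)).hom
  | _, _, .weak r X h => (ρ_ (𝓜.hypM (r, X))).hom ≫ 𝓜.Mny.map (𝓜.weakHyp r X h) ≫ 𝓜.nUnit
  | _, _, .cont r₁ r₂ r X h =>
      ((𝓜.Mny.map (𝓜.contHyp r₁ r₂ r X h) ≫
        𝓜.nTensor (𝓜.hypG (r₁, X)) (𝓜.hypG (r₂, X))) ▷ 𝟙_ 𝓜.M) ≫
        (α_ (𝓜.hypM (r₁, X)) (𝓜.hypM (r₂, X)) (𝟙_ 𝓜.M)).hom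
  | _, _, .ex a b => (α_ (𝓜.hypM b) (𝓜.hypM a) (𝟙_ 𝓜.M)).inv ≫
      ((β_ (𝓜.hypM b) (𝓜.hypM a)).hom ▷ 𝟙_ 𝓜.M) ≫ (α_ (𝓜.hypM a) (𝓜.hypM b) (𝟙_ 𝓜.M)).hom

/-- Interpretation of the linear left rules. -/
def leftL : ∀ {P Q : LCtx R}, LLeft P Q → (𝓜.ctxL Q ⟶ 𝓜.ctxL P)
  | _, _, .unit => (ρ_ (𝟙_ 𝓜.M)).hom
  | _, _, .tensor A B => (α_ (𝓜.objM A) (𝓜.objM B) (𝟙_ 𝓜.M)).hom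
  | _, _, .ex A B => (α_ (𝓜.objM B) (𝓜.objM A) (𝟙_ 𝓜.M)).inv ≫
      ((β_ (𝓜.objM B) (𝓜.objM A)).hom ▷ 𝟙_ 𝓜.M) ≫ (α_ (𝓜.objM A) (𝓜.objM B) (𝟙_ 𝓜.M)).hom

/-- Insertion of a morphism `E ⊗ G ⟶ A` into the middle of a linear context. -/
def splice (D E : GCtx R) (Γ₁ G Γ₃ : LCtx R) {A : LTy R} (g : 𝓜.ctxM E ⊗ 𝓜.ctxL G ⟶ 𝓜.objM A) :
    𝓜.ctxM (D ++ E) ⊗ 𝓜.ctxL (Γ₁ ++ G ++ Γ₃) ⟶ 𝓜.ctxM D ⊗ 𝓜.ctxL (Γ₁ ++ [A] ++ Γ₃) :=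
  ((tensAppend 𝓜.hypM D E).hom ⊗ₘ (tensSplit 𝓜.objM Γ₁ G Γ₃).hom) ≫
    insertMid _ _ _ _ _ ≫
      (𝓜.ctxM D ◁ (((𝓜.ctxL Γ₁ ◁ (g ≫ (ρ_ (𝓜.objM A)).inv)) ▷ 𝓜.ctxL Γ₃) ≫
        (tensSplit 𝓜.objM Γ₁ [A] Γ₃).inv))

mutual
/-- Interpretation of the derivations of the graded system. -/
def interpG : ∀ {Δ : GCtx R} {X : GTy R}, GS Δ X → (𝓜.ctxG Δ ⟶ 𝓜.objG X)
  | _, _, .id X => (ρ_ (𝓜.hypG (1, X))).hom ≫ 𝓜.oneMap (𝓜.objG X)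
  | _, _, .unitR => 𝟙 (𝟙_ 𝓜.C)
  | _, _, .tenR (Δ₁ := Δ₁) (Δ₂ := Δ₂) a b =>
      (tensAppend 𝓜.hypG Δ₁ Δ₂).hom ≫ (interpG a ⊗ₘ interpG b)
  | _, _, .linR (Δ := Δ) a => 𝓜.etaLin Δ ≫ 𝓜.Lin.map ((ρ_ (𝓜.ctxM Δ)).inv ≫ interpM a)
  | _, _, .left l Δ₁ Δ₂ a => tensMid 𝓜.hypG Δ₁ Δ₂ (𝓜.leftG l) ≫ interpG a
  | _, _, .cut r Δ₁ Δ₃ a c => tensMid 𝓜.hypG Δ₁ Δ₃ (𝓜.promoteG r (interpG a)) ≫ interpG c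
  | _, _, .sub (Δ := Δ) (Δ' := Δ') h a => 𝓜.subG Δ Δ' h ≫ interpG a
/-- Interpretation of the derivations of the mixed system. -/
def interpM : ∀ {Δ : GCtx R} {Γ : LCtx R} {A : LTy R},
    MS Δ Γ A → (𝓜.ctxM Δ ⊗ 𝓜.ctxL Γ ⟶ 𝓜.objM A)
  | _, _, _, .id A => (λ_ (𝓜.objM A ⊗ 𝟙_ 𝓜.M)).hom ≫ (ρ_ (𝓜.objM A)).hom
  | _, _, _, .unitR => (λ_ (𝟙_ 𝓜.M)).hom
  | _, _, _, .tenR (Δ₁ := Δ₁) (Δ₂ := Δ₂) (Γ₁ := Γ₁) (Γ₂ := Γ₂) a b =>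
      ((tensAppend 𝓜.hypM Δ₁ Δ₂).hom ⊗ₘ (tensAppend 𝓜.objM Γ₁ Γ₂).hom) ≫
        tensorμ _ _ _ _ ≫ (interpM a ⊗ₘ interpM b)
  | _, _, _, .impR (Δ := Δ) (Γ := Γ) (A := A) a =>
      MonoidalClosed.curry ((β_ (𝓜.objM A) (𝓜.ctxM Δ ⊗ 𝓜.ctxL Γ)).hom ≫
        (α_ (𝓜.ctxM Δ) (𝓜.ctxL Γ) (𝓜.objM A)).hom ≫
        (𝓜.ctxM Δ ◁ ((𝓜.ctxL Γ ◁ (ρ_ (𝓜.objM A)).inv) ≫ (tensAppend 𝓜.objM Γ [A]).inv)) ≫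
        interpM a)
  | _, _, _, .impL (Δ₁ := Δ₁) (Δ₂ := Δ₂) Γ₁ Γ₃ (Γ₂ := Γ₂) (A := A) (B := B) a c =>
      𝓜.splice Δ₁ Δ₂ Γ₁ (.imp A B :: Γ₂) Γ₃
        ((α_ (𝓜.ctxM Δ₂) (𝓜.objM (.imp A B)) (𝓜.ctxL Γ₂)).inv ≫
          ((β_ (𝓜.ctxM Δ₂) (𝓜.objM (.imp A B))).hom ▷ 𝓜.ctxL Γ₂) ≫
          (α_ (𝓜.objM (.imp A B)) (𝓜.ctxM Δ₂) (𝓜.ctxL Γ₂)).hom ≫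
          (𝓜.objM (.imp A B) ◁ interpM a) ≫
          (β_ (𝓜.objM (.imp A B)) (𝓜.objM A)).hom ≫
          (ihom.ev (𝓜.objM A)).app (𝓜.objM B)) ≫ interpM c
  | _, _, _, .grdR r (Δ := Δ) a =>
      (ρ_ (𝓜.ctxM (scale r Δ))).hom ≫ 𝓜.promoteM r (interpG a)
  | _, _, _, .grdL (Δ := Δ) r X (Γ := Γ) a =>
      (α_ (𝓜.ctxM Δ) (𝓜.hypM (r, X)) (𝓜.ctxL Γ)).inv ≫
        (((𝓜.ctxM Δ ◁ (ρ_ (𝓜.hypM (r, X))).inv) ≫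
          (tensAppend 𝓜.hypM Δ [(r, X)]).inv) ▷ 𝓜.ctxL Γ) ≫ interpM a
  | _, _, _, .linL (Δ := Δ) (A := A) (Γ := Γ) a =>
      (((tensAppend 𝓜.hypM Δ [(1, .lin A)]).hom ≫
        (𝓜.ctxM Δ ◁ ((ρ_ (𝓜.hypM (1, .lin A))).hom ≫
          𝓜.Mny.map (𝓜.oneMap (𝓜.objG (.lin A))) ≫ 𝓜.adj.counit.app (𝓜.objM A)))) ▷
            𝓜.ctxL Γ) ≫
        (α_ (𝓜.ctxM Δ) (𝓜.objM A) (𝓜.ctxL Γ)).hom ≫ interpM a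
  | _, _, _, .left l Δ₁ Δ₂ (Γ := Γ) a =>
      (tensMid 𝓜.hypM Δ₁ Δ₂ (𝓜.leftM l) ▷ 𝓜.ctxL Γ) ≫ interpM a
  | _, _, _, .lleft l (Δ := Δ) Γ₁ Γ₂ a =>
      (𝓜.ctxM Δ ◁ tensMid 𝓜.objM Γ₁ Γ₂ (𝓜.leftL l)) ≫ interpM a
  | _, _, _, .cut (Δ₁ := Δ₁) (Δ₂ := Δ₂) Γ₁ Γ₃ (Γ₂ := Γ₂) a c =>
      𝓜.splice Δ₁ Δ₂ Γ₁ Γ₂ Γ₃ (interpM a) ≫ interpM c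
  | _, _, _, .gcut r Δ₁ Δ₃ (X := X) (Γ := Γ) a c =>
      (tensMid 𝓜.hypM Δ₁ Δ₃ (P := [(r, X)])
        (𝓜.promoteM r (interpG a) ≫ (ρ_ (𝓜.hypM (r, X))).inv) ▷ 𝓜.ctxL Γ) ≫ interpM c
  | _, _, _, .sub (Δ := Δ) (Δ' := Δ') h (Γ := Γ) a => (𝓜.subM Δ Δ' h ▷ 𝓜.ctxL Γ) ≫ interpM a
end

end Model

end MGL

namespace MGL

local notation:max "◾" => by simp

set_option linter.unusedSectionVars false

/-! ## Families of sets with an action of left rules -/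

structure Act {α : Type u} (L : List α → List α → Type u) where
  β : Type u
  F : β → List α → Type u
  E : ∀ {b : β} {D D' : List α}, F b D → F b D' → Prop
  refl : ∀ {b : β} {D : List α} (c : F b D), E c c
  symm : ∀ {b : β} {D D' : List α} {c : F b D} {c' : F b D'}, E c c' → E c' c
  trans : ∀ {b : β} {D D' D'' : List α} {c : F b D} {c' : F b D'} {c'' : F b D''},
    E c c' → E c' c'' → E c c''
  run : ∀ {P Q : List α}, L P Q → ∀ (D1 D2 : List α) {b : β},
    F b (D1 ++ P ++ D2) → F b (D1 ++ Q ++ D2)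
  run_congr : ∀ {P Q : List α} (l : L P Q) (D1 D2 : List α) {b : β}
    {c c' : F b (D1 ++ P ++ D2)}, E c c' → E (run l D1 D2 c) (run l D1 D2 c')

namespace Act

variable {α : Type u} {L : List α → List α → Type u} (A : Act L)

def cast {b : A.β} {D D' : List α} (c : A.F b D) (h : D = D') : A.F b D' := h ▸ c

variable {A}

lemma cast_E (c : A.F b D) (h : D = D') : A.E (A.cast c h) c := by
  subst h; exact A.refl _

lemma E_cast (c : A.F b D) (h : D = D') : A.E c (A.cast c h) :=
  A.symm (cast_E c h)

lemma E.cL {c : A.F b D} {c' : A.F b D''} (e : A.E c c')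
    (h : D = D') : A.E (A.cast c h) c' := A.trans (cast_E c h) e

lemma E.cR {c : A.F b D''} {c' : A.F b D} (e : A.E c c')
    (h : D = D') : A.E c (A.cast c' h) := A.trans e (E_cast c' h)

lemma E.cast2 {c : A.F b D} {c' : A.F b K} (e : A.E c c')
    (h : D = D') (h' : K = K') : A.E (A.cast c h) (A.cast c' h') := cR (cL e h) h'

lemma run_congr' (l : L P Q) (h1 : D1 = D1')
    (h2 : D2 = D2') {c : A.F b (D1 ++ P ++ D2)} {c' : A.F b (D1' ++ P ++ D2')}
    (e : A.E c c') : A.E (A.run l D1 D2 c) (A.run l D1' D2' c') := by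
  subst h1; subst h2; exact A.run_congr l _ _ e

variable (A)

def act (D1 D2 : List α) {P : List α} {b : A.β} :
    ∀ {Q : List α}, Path L P Q → A.F b (D1 ++ P ++ D2) → A.F b (D1 ++ Q ++ D2)
  | _, .nil h, c => A.cast c (by rw [h])
  | _, .snoc p E1 E2 l hN hK, c =>
      A.cast (A.run l (D1 ++ E1) (E2 ++ D2) (A.cast (act D1 D2 p c) (by simp [hN])))
        (by simp [hK])

variable {A}

lemma act_nil (D1 D2) (h : P = Q) (c : A.F b (D1 ++ P ++ D2)) : A.E (A.act D1 D2 (.nil h) c) c := cast_E ..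

lemma act_congr (p : Path L P Q) (h1 : D1 = D1')
    (h2 : D2 = D2') {c : A.F b (D1 ++ P ++ D2)} {c' : A.F b (D1' ++ P ++ D2')}
    (e : A.E c c') : A.E (A.act D1 D2 p c) (A.act D1' D2' p c') := by
  subst h1; subst h2
  induction p with
  | nil h => exact E.cast2 e _ _
  | snoc p E1 E2 l hN hK ih => exact E.cast2 (A.run_congr l _ _ (E.cast2 ih _ _)) _ _

lemma act_snoc (p : Path L P N) (E1 E2) (l : L X Y) (hN : N = E1 ++ X ++ E2) (hK : K = E1 ++ Y ++ E2) (D1 D2)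
    (c : A.F b (D1 ++ P ++ D2)) :
    A.E (A.act D1 D2 (.snoc p E1 E2 l hN hK) c)
      (A.run l (D1 ++ E1) (E2 ++ D2) (A.cast (A.act D1 D2 p c) (by simp [hN]))) :=
  cast_E ..

lemma act_trans (p : Path L P Q) (q : Path L Q K) (D1 D2) (c : A.F b (D1 ++ P ++ D2)) :
    A.E (A.act D1 D2 (p.trans q) c) (A.act D1 D2 q (A.act D1 D2 p c)) := by
  induction q with
  | nil h => subst h; exact A.symm (act_nil _ _ _ _)
  | snoc q E1 E2 l hN hK ih =>
    exact E.cast2 (A.run_congr l _ _ (E.cast2 ih ..)) ..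

lemma act_inside (p : Path L P Q) (E1 E2) (hM : M = E1 ++ P ++ E2) (hK : K = E1 ++ Q ++ E2) (D1 D2)
    (c : A.F b (D1 ++ M ++ D2)) :
    A.E (A.act D1 D2 (p.inside E1 E2 hM hK) c) (A.act (D1 ++ E1) (E2 ++ D2) p (A.cast c (by simp [hM]))) := by
  induction p generalizing K with
  | nil h => exact A.trans (act_nil _ _ _ _) (A.symm (A.trans (act_nil _ _ _ _) (cast_E _ _)))
  | snoc p F1 F2 l hN hK' ih =>
    exact E.cast2 (run_congr' l ◾ ◾ (E.cast2 (ih rfl) ..)) ..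

lemma act_single (l : L P Q) (D1 D2) (c : A.F b (D1 ++ P ++ D2)) :
    A.E (A.act D1 D2 (.single l) c) (A.run l D1 D2 c) :=
  A.trans (cast_E ..) (run_congr' l ◾ ◾ (A.trans (cast_E ..) (cast_E ..)))

lemma act_single' (l : L P Q) (h1 : D1 = D1')
    (h2 : D2 = D2') {c : A.F b (D1 ++ P ++ D2)} {c' : A.F b (D1' ++ P ++ D2')}
    (e : A.E c c') : A.E (A.act D1 D2 (.single l) c) (A.run l D1' D2' c') :=
  A.trans (act_single ..) (run_congr' _ h1 h2 e)

end Act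

/-! ## Casts and congruence -/

section Congruence

variable {R : Type u} [Semiring R]

@[simp] lemma scale_nil (r : R) : scale r ([] : GCtx R) = [] := rfl

@[simp] lemma scale_cons (r : R) (p : R × GTy R) (Δ : GCtx R) :
    scale r (p :: Δ) = (r * p.1, p.2) :: scale r Δ := rfl

@[simp] lemma scale_append (r : R) (Δ Δ' : GCtx R) :
    scale r (Δ ++ Δ') = scale r Δ ++ scale r Δ' := by simp [scale]

@[simp] lemma scale_one (Δ : GCtx R) : scale 1 Δ = Δ := by
  induction Δ with
  | nil => rfl
  | cons p Δ ih => simp [ih]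

lemma scale_scale (r s : R) (Δ) : scale r (scale s Δ) = scale (r * s) Δ := by
  induction Δ with
  | nil => rfl
  | cons p Δ ih => simp [ih, mul_assoc]

variable [Preorder R]

lemma CtxLe.refl : ∀ Δ : GCtx R, CtxLe Δ Δ
  | [] => trivial
  | _ :: Δ => ⟨le_rfl, rfl, CtxLe.refl Δ⟩

lemma CtxLe.of_eq {Δ Δ' : GCtx R} (h : Δ = Δ') : CtxLe Δ Δ' := h ▸ CtxLe.refl Δ

lemma CtxLe.trans : ∀ {Δ Δ' Δ'' : GCtx R}, CtxLe Δ Δ' → CtxLe Δ' Δ'' → CtxLe Δ Δ''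
  | [], [], [], _, _ => trivial
  | _ :: _, _ :: _, _ :: _, h, h' => ⟨h.1.trans h'.1, h.2.1.trans h'.2.1, h.2.2.trans h'.2.2⟩
  | [], [], _ :: _, _, h => h.elim
  | [], _ :: _, _, h, _ => h.elim
  | _ :: _, [], _, h, _ => h.elim
  | _ :: _, _ :: _, [], _, h => h.elim

lemma CtxLe.append : ∀ {Δ Δ' K K' : GCtx R}, CtxLe Δ Δ' → CtxLe K K' → CtxLe (Δ ++ K) (Δ' ++ K')
  | [], [], _, _, _, h => h
  | _ :: _, _ :: _, _, _, h, h' => ⟨h.1, h.2.1, h.2.2.append h'⟩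
  | [], _ :: _, _, _, h, _ => h.elim
  | _ :: _, [], _, _, h, _ => h.elim

lemma CtxLe.inside (D1 D2 : GCtx R) (h : CtxLe Δ Δ') :
    CtxLe (D1 ++ Δ ++ D2) (D1 ++ Δ' ++ D2) := ((CtxLe.refl _).append h).append (CtxLe.refl _)

lemma CtxLe.scale [MulLeftMono R] (r : R) : ∀ {Δ Δ'}, CtxLe Δ Δ' → CtxLe (scale r Δ) (scale r Δ')
  | [], [], _ => trivial
  | _ :: _, _ :: _, h => ⟨mul_le_mul_right h.1 r, h.2.1, h.2.2.scale r⟩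
  | [], _ :: _, h => h.elim
  | _ :: _, [], h => h.elim

lemma CtxLe.scale_grade [MulRightMono R] (h : r ≤ s) : ∀ Δ : GCtx R, CtxLe (MGL.scale r Δ) (MGL.scale s Δ)
  | [] => trivial
  | p :: Δ => ⟨mul_le_mul_left h p.1, rfl, CtxLe.scale_grade h Δ⟩

lemma EqG.cast_left {Δ Δ' : GCtx R} (π : GS Δ X) (h : Δ = Δ') : EqG (π.cast h) π := by subst h; exact .refl _

lemma EqM.cast_left {Δ Δ' : GCtx R} (π : MS Δ Γ A) (h : Δ = Δ')
    (h' : Γ = Γ') : EqM (π.cast h h') π := by subst h; subst h'; exact .refl _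

lemma EqG.cL {Δ Δ' D : GCtx R} {π : GS Δ X} {ρ : GS D X} (e : EqG π ρ)
    (h : Δ = Δ') : EqG (π.cast h) ρ := (EqG.cast_left π h).trans e

lemma EqG.cR {Δ D D' : GCtx R} {π : GS Δ X} {ρ : GS D X} (e : EqG π ρ)
    (h : D = D') : EqG π (ρ.cast h) := e.trans (EqG.cast_left ρ h).symm

lemma EqG.cast2 {Δ Δ' D : GCtx R} {X : GTy R} {π : GS Δ X} (h : Δ = Δ') (h' : Δ = D) :
    EqG (π.cast h) (π.cast h') := cL (cR (.refl _) _) _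

lemma EqM.cL {Δ Δ' D : GCtx R} {π : MS Δ Γ A} {ρ : MS D G A}
    (e : EqM π ρ) (h : Δ = Δ') (h' : Γ = Γ') : EqM (π.cast h h') ρ :=
  (EqM.cast_left π h h').trans e

lemma EqM.cR {Δ D D' : GCtx R} {π : MS Δ Γ A} {ρ : MS D G A}
    (e : EqM π ρ) (h : D = D') (h' : G = G') : EqM π (ρ.cast h h') :=
  e.trans (EqM.cast_left ρ h h').symm

lemma EqG.tenR {Δ₁ Δ₂ Δ₁' Δ₂' : GCtx R} (h1 : Δ₁ = Δ₁') (h2 : Δ₂ = Δ₂')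
    {a : GS Δ₁ X} {a' : GS Δ₁' X} {b : GS Δ₂ Y} {b' : GS Δ₂' Y} (ea : EqG a a') (eb : EqG b b') :
    EqG (.tenR a b) (.tenR a' b') := by
  subst h1; subst h2; exact .congr_tenR ea eb

lemma EqG.linR {Δ Δ' : GCtx R} (h : Δ = Δ') {a : MS Δ [] A} {a' : MS Δ' [] A}
    (e : EqM a a') : EqG (.linR a) (.linR a') := by subst h; exact .congr_linR e

lemma EqG.left {P Q : GCtx R} (l : GLeft P Q)
    (h1 : D1 = D1') (h2 : D2 = D2') {a : GS (D1 ++ P ++ D2) X} {a' : GS (D1' ++ P ++ D2') X}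
    (e : EqG a a') : EqG (.left l D1 D2 a) (.left l D1' D2' a') := by
  subst h1; subst h2; exact .congr_left l _ _ e

lemma EqG.cut {r r' : R} (hr : r = r') (h1 : D1 = D1') (h2 : D2 = D2') (hE : E = E') {a : GS E X} {a' : GS E' X}
    {c : GS (D1 ++ [(r, X)] ++ D2) Y} {c' : GS (D1' ++ [(r', X)] ++ D2') Y}
    (ea : EqG a a') (e : EqG c c') : EqG (.cut r D1 D2 a c) (.cut r' D1' D2' a' c') := by
  subst hr; subst h1; subst h2; subst hE; exact .congr_cut _ _ _ ea e

lemma EqG.sub {Δ Δ' D D' : GCtx R} (h : CtxLe Δ Δ') (k : CtxLe D D') (e1 : Δ = D)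
    (e2 : Δ' = D') {a : GS Δ X} {a' : GS D X} (e : EqG a a') : EqG (.sub h a) (.sub k a') := by
  subst e1; subst e2; exact .congr_sub h e

lemma EqM.tenR {Δ₁ Δ₂ Δ₁' Δ₂' : GCtx R} (h1 : Δ₁ = Δ₁') (h2 : Δ₂ = Δ₂') (k1 : Γ₁ = Γ₁') (k2 : Γ₂ = Γ₂')
    {a : MS Δ₁ Γ₁ A} {a' : MS Δ₁' Γ₁' A} {b : MS Δ₂ Γ₂ B} {b' : MS Δ₂' Γ₂' B} (ea : EqM a a')
    (eb : EqM b b') : EqM (.tenR a b) (.tenR a' b') := by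
  subst h1; subst h2; subst k1; subst k2; exact .congr_tenR ea eb

lemma EqM.left {P Q : GCtx R} (l : GLeft P Q) (h1 : D1 = D1') (h2 : D2 = D2') (k : Γ = Γ') {a : MS (D1 ++ P ++ D2) Γ B}
    {a' : MS (D1' ++ P ++ D2') Γ' B} (e : EqM a a') :
    EqM (.left l D1 D2 a) (.left l D1' D2' a') := by
  subst h1; subst h2; subst k; exact .congr_left l _ _ e

lemma EqM.lleft {P Q : LCtx R} (l : LLeft P Q) (h : Δ = Δ') (h1 : G1 = G1') (h2 : G2 = G2') {a : MS Δ (G1 ++ P ++ G2) B}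
    {a' : MS Δ' (G1' ++ P ++ G2') B} (e : EqM a a') :
    EqM (.lleft l G1 G2 a) (.lleft l G1' G2' a') := by
  subst h; subst h1; subst h2; exact .congr_lleft l _ _ e

lemma EqM.cut {Δ₁ Δ₂ Δ₁' Δ₂' : GCtx R} (h1 : Δ₁ = Δ₁') (h2 : Δ₂ = Δ₂') (k1 : G1 = G1') (k3 : G3 = G3') (k : H = H')
    {a : MS Δ₂ H A} {a' : MS Δ₂' H' A} {c : MS Δ₁ (G1 ++ [A] ++ G3) B}
    {c' : MS Δ₁' (G1' ++ [A] ++ G3') B} (ea : EqM a a') (e : EqM c c') :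
    EqM (.cut G1 G3 a c) (.cut G1' G3' a' c') := by
  subst h1; subst h2; subst k1; subst k3; subst k; exact .congr_cut _ _ ea e

lemma EqM.gcut {r r' : R} (hr : r = r') (h1 : D1 = D1') (h2 : D2 = D2') (hE : E = E') (k : Γ = Γ') {a : GS E X}
    {a' : GS E' X} {c : MS (D1 ++ [(r, X)] ++ D2) Γ B} {c' : MS (D1' ++ [(r', X)] ++ D2') Γ' B}
    (ea : EqG a a') (e : EqM c c') : EqM (.gcut r D1 D2 a c) (.gcut r' D1' D2' a' c') := by
  subst hr; subst h1; subst h2; subst hE; subst k; exact .congr_gcut _ _ _ ea e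

lemma EqM.sub {Δ Δ' D D' : GCtx R} (h : CtxLe Δ Δ')
    (k : CtxLe D D') (e1 : Δ = D) (e2 : Δ' = D') (e3 : Γ = Γ') {a : MS Δ Γ B} {a' : MS D Γ' B}
    (e : EqM a a') : EqM (.sub h a) (.sub k a') := by
  subst e1; subst e2; subst e3; exact .congr_sub h e

lemma EqM.impR {Δ Δ' : GCtx R} (h : Δ = Δ') (k : Γ = Γ')
    {a : MS Δ (Γ ++ [A]) B} {a' : MS Δ' (Γ' ++ [A]) B} (e : EqM a a') :
    EqM (.impR a) (.impR a') := by subst h; subst k; exact .congr_impR e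

lemma EqM.impL {Δ₁ Δ₂ Δ₁' Δ₂' : GCtx R} (h1 : Δ₁ = Δ₁') (h2 : Δ₂ = Δ₂') (k1 : G1 = G1') (k3 : G3 = G3') (k : H = H')
    {a : MS Δ₂ H A} {a' : MS Δ₂' H' A} {c : MS Δ₁ (G1 ++ [B] ++ G3) C}
    {c' : MS Δ₁' (G1' ++ [B] ++ G3') C} (ea : EqM a a') (e : EqM c c') :
    EqM (.impL G1 G3 a c) (.impL G1' G3' a' c') := by
  subst h1; subst h2; subst k1; subst k3; subst k; exact .congr_impL _ _ ea e

lemma EqM.grdL (r : R) (X) (h : Δ = Δ')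
    (k : Γ = Γ') {a : MS (Δ ++ [(r, X)]) Γ B} {a' : MS (Δ' ++ [(r, X)]) Γ' B} (e : EqM a a') :
    EqM (.grdL r X a) (.grdL r X a') := by subst h; subst k; exact .congr_grdL r X e

lemma EqM.linL {Δ Δ' : GCtx R} (h : Δ = Δ')
    (k : Γ = Γ') {a : MS Δ (A :: Γ) B} {a' : MS Δ' (A :: Γ') B} (e : EqM a a') :
    EqM (.linL a) (.linL a') := by subst h; subst k; exact .congr_linL e

end Congruence

def Path.All {α : Type u} {L : List α → List α → Type u} (φ : ∀ {P Q : List α}, L P Q → Prop)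
    {P : List α} : ∀ {Q : List α}, Path L P Q → Prop
  | _, .nil _ => True
  | _, .snoc p _ _ l _ _ => Path.All φ p ∧ φ l

namespace Path

variable {α : Type u} {L : List α → List α → Type u} {φ : ∀ {P Q : List α}, L P Q → Prop}

lemma All.trans {p : Path L P Q} {q : Path L Q K} (hp : p.All φ) (hq : q.All φ) : (p.trans q).All φ := by
  induction q with
  | nil h => subst h; exact hp
  | snoc q E1 E2 l hN hK ih => exact ⟨ih hq.1, hq.2⟩

lemma All.inside {p : Path L P Q} (hp : p.All φ) (D1 D2)
    (hM : M = D1 ++ P ++ D2) (hK : K = D1 ++ Q ++ D2) : (p.inside D1 D2 hM hK).All φ := by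
  induction p generalizing K with
  | nil h => trivial
  | snoc p F1 F2 l hN hK' ih => exact ⟨ih hp.1 rfl, hp.2⟩

lemma all_single {l : L P Q} (h : φ l) : (Path.single l).All φ := ⟨trivial, h⟩

lemma all_true (p : Path L P Q) : p.All (fun _ => True) := by
  induction p with
  | nil h => trivial
  | snoc p F1 F2 l hN hK' ih => exact ⟨ih, trivial⟩

def map {L' : List α → List α → Type u} (f : ∀ {P Q : List α}, L P Q → L' P Q) {P : List α} :
    ∀ {Q : List α}, Path L P Q → Path L' P Q
  | _, .nil h => .nil h
  | _, .snoc p D1 D2 l hN hK => .snoc (map f p) D1 D2 (f l) hN hK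

end Path

namespace Act

variable {α : Type u} {L : List α → List α → Type u} {A : Act L}

variable (A) in
def StepComm {P Q P' Q' : List α} (l : L P Q) (l' : L P' Q') : Prop :=
  ∀ {b : A.β} (D1 D2 D3 : List α) (c1 : A.F b (D1 ++ P ++ (D2 ++ P' ++ D3)))
    (c2 : A.F b (D1 ++ P ++ D2 ++ P' ++ D3)) (d1 : A.F b (D1 ++ Q ++ D2 ++ P' ++ D3))
    (d2 : A.F b (D1 ++ P ++ (D2 ++ Q' ++ D3))), A.E c1 c2 →
    A.E d1 (A.run l D1 (D2 ++ P' ++ D3) c1) → A.E d2 (A.run l' (D1 ++ P ++ D2) D3 c2) →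
    A.E (A.run l D1 (D2 ++ Q' ++ D3) d2) (A.run l' (D1 ++ Q ++ D2) D3 d1)

variable (A) in
def Comm {P Q P' Q' : List α} (p : Path L P Q) (p' : Path L P' Q') : Prop :=
  ∀ {b : A.β} (D1 D2 D3 : List α) (c1 : A.F b (D1 ++ P ++ (D2 ++ P' ++ D3)))
    (c2 : A.F b (D1 ++ P ++ D2 ++ P' ++ D3)) (d1 : A.F b (D1 ++ Q ++ D2 ++ P' ++ D3))
    (d2 : A.F b (D1 ++ P ++ (D2 ++ Q' ++ D3))), A.E c1 c2 →
    A.E d1 (A.act D1 (D2 ++ P' ++ D3) p c1) → A.E d2 (A.act (D1 ++ P ++ D2) D3 p' c2) →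
    A.E (A.act D1 (D2 ++ Q' ++ D3) p d2) (A.act (D1 ++ Q ++ D2) D3 p' d1)

lemma comm_of_all {φ ψ : ∀ {P Q}, L P Q → Prop}
    (H : ∀ {P Q P' Q'} (l : L P Q) (l' : L P' Q'), φ l → ψ l' → A.StepComm l l')
    {P Q P' Q'} {p : Path L P Q} (hp : p.All φ) {p' : Path L P' Q'} (hp' : p'.All ψ) :
    A.Comm p p' := by
  induction p with
  | nil h =>
    subst h
    intro b D1 D2 D3 c1 c2 d1 d2 hc h₁ h2
    refine A.trans (act_nil ..) (A.trans h2 (act_congr _ rfl rfl ?_))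
    exact A.trans (A.symm hc) (A.symm (A.trans h₁ (act_nil ..)))
  | @snoc N X Y K p E1 E2 l hN hK ih =>
    subst hN; subst hK
    intro b D1 D2 D3 c1 c2 d1 d2 hc h₁ h2
    have key : ∀ {R'} {q : Path L P' R'}, q.All ψ → ∀ (D1 D2 D3) (c1 : A.F b (D1 ++ X ++ (D2 ++ P' ++ D3)))
          (c2 : A.F b (D1 ++ X ++ D2 ++ P' ++ D3)) (d1 : A.F b (D1 ++ Y ++ D2 ++ P' ++ D3))
          (d2 : A.F b (D1 ++ X ++ (D2 ++ R' ++ D3))), A.E c1 c2 →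
        A.E d1 (A.run l D1 (D2 ++ P' ++ D3) c1) → A.E d2 (A.act (D1 ++ X ++ D2) D3 q c2) →
        A.E (A.run l D1 (D2 ++ R' ++ D3) d2) (A.act (D1 ++ Y ++ D2) D3 q d1) := by
      intro R' q hq
      induction q with
      | nil h =>
        subst h
        intro D1 D2 D3 c1 c2 d1 d2 hc h₁ h2
        refine A.trans (A.run_congr _ _ _ (A.trans h2 (A.trans (act_nil ..) (A.symm hc)))) ?_
        exact A.symm (A.trans (act_nil ..) h₁)
      | snoc q F1 F2 l' hN hK ih' =>
        subst hN; subst hK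
        intro D1 D2 D3 c1 c2 d1 d2 hc h₁ h2
        have h3 := ih' hq.1 D1 D2 D3 c1 c2 d1 (A.cast (A.act (D1 ++ _ ++ D2) D3 q c2) ◾) hc h₁ (cast_E ..)
        have h4 := H l l' hp.2 hq.2 D1 (D2 ++ F1) (F2 ++ D3) (A.cast (A.act (D1 ++ _ ++ D2) D3 q c2) ◾)
          (A.cast (A.act (D1 ++ _ ++ D2) D3 q c2) ◾)
          (A.cast (A.act (D1 ++ _ ++ D2) D3 q d1) ◾)
          (A.cast d2 ◾)
          (E.cast2 (A.refl _) ..)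
          (E.cL (A.trans (A.symm h3) (run_congr' _ rfl ◾ (E.cast2 (A.refl _) ..))) _)
          (E.cL (A.trans h2 (A.trans (act_snoc ..)
            (run_congr' _ ◾ rfl (E.cast2 (A.refl _) ..)))) _)
        refine A.trans (run_congr' _ rfl ◾ (E_cast ..)) (A.trans h4 (A.symm ?_))
        refine A.trans (act_snoc ..) (run_congr' _ ◾ rfl ?_)
        exact E.cast2 (A.refl _) ..
    have h3 := ih hp.1 D1 D2 D3 c1 c2 (A.cast (A.act D1 (D2 ++ P' ++ D3) p c1) ◾) d2 hc (cast_E ..) h2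
    have h4 := key hp' (D1 ++ E1) (E2 ++ D2) D3 (A.cast (A.act D1 (D2 ++ P' ++ D3) p c1) ◾)
      (A.cast (A.act D1 (D2 ++ P' ++ D3) p c1) ◾) (A.cast d1 ◾)
      (A.cast (A.act D1 (D2 ++ Q' ++ D3) p d2) ◾) (E.cast2 (A.refl _) ..)
      (E.cL (A.trans h₁ (A.trans (act_snoc ..)
        (run_congr' _ rfl ◾ (E.cast2 (A.refl _) ..)))) _)
      (E.cL (A.trans h3 (act_congr _ ◾ rfl (E.cast2 (A.refl _) ..))) _)
    refine A.trans (act_snoc ..) (A.trans (run_congr' _ rfl ◾ ?_)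
      (A.trans h4 (act_congr _ ◾ rfl (cast_E ..))))
    exact E.cast2 (A.refl _) ..

end Act

/-! ## Steps in the graded system -/

section Steps

variable {R : Type u} [Semiring R] [Preorder R]

inductive GStep : GCtx R → GCtx R → Type u
  | left {P Q : GCtx R} (l : GLeft P Q) : GStep P Q
  | cut (r : R) {E Q : GCtx R} {X : GTy R} (a : GS E X) (hQ : Q = scale r E) : GStep [(r, X)] Q
  | sub {P Q : GCtx R} (h : CtxLe P Q) : GStep P Q

namespace GStep

def runG {P Q : GCtx R} (D1 D2 : GCtx R) {Y : GTy R} :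
    GStep P Q → GS (D1 ++ P ++ D2) Y → GS (D1 ++ Q ++ D2) Y
  | .left l, c => .left l D1 D2 c
  | .cut r a hQ, c => (GS.cut r D1 D2 a c).cast (by rw [hQ])
  | .sub h, c => .sub (h.inside D1 D2) c

def runM {P Q : GCtx R} (D1 D2 : GCtx R) {Γ : LCtx R} {B : LTy R} :
    GStep P Q → MS (D1 ++ P ++ D2) Γ B → MS (D1 ++ Q ++ D2) Γ B
  | .left l, c => .left l D1 D2 c
  | .cut r a hQ, c => (MS.gcut r D1 D2 a c).cast (by rw [hQ]) rfl
  | .sub h, c => .sub (h.inside D1 D2) c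

def scaled [MulLeftMono R] (r : R) {P Q : GCtx R} : GStep P Q → GStep (scale r P) (scale r Q)
  | .left l => .left (l.scaled r)
  | .cut s a hQ => .cut (r * s) a (by rw [hQ, scale_scale])
  | .sub h => .sub (h.scale r)

def IsCut {P Q : GCtx R} : GStep P Q → Prop
  | .cut _ _ _ => True
  | _ => False

def IsStruct {P Q : GCtx R} : GStep P Q → Prop
  | .cut _ _ _ => False
  | _ => True

end GStep

variable (R) in
def actG : Act (GStep (R := R)) where
  β := GTy R
  F Y Δ := GS Δ Y
  E := EqG
  refl := .refl
  symm := .symm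
  trans := .trans
  run l D1 D2 _ c := l.runG D1 D2 c
  run_congr l D1 D2 _ _ _ e := by
    cases l with
    | left l => exact .congr_left _ _ _ e
    | cut r a hQ => exact .cL (.cR (.congr_cut _ _ _ (.refl _) e) _) _
    | sub h => exact .congr_sub _ e

variable (R) in
def actM : Act (GStep (R := R)) where
  β := LCtx R × LTy R
  F b Δ := MS Δ b.1 b.2
  E := EqM
  refl := .refl
  symm := .symm
  trans := .trans
  run l D1 D2 _ c := l.runM D1 D2 c
  run_congr l D1 D2 _ _ _ e := by
    cases l with
    | left l => exact .congr_left _ _ _ e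
    | cut r a hQ => exact .cL (.cR (.congr_gcut _ _ _ (.refl _) e) _ rfl) _ rfl
    | sub h => exact .congr_sub _ e

abbrev GS.act (D1 D2 : GCtx R) {P Q : GCtx R} (p : Path GStep P Q) {Y : GTy R}
    (c : GS (D1 ++ P ++ D2) Y) : GS (D1 ++ Q ++ D2) Y := (actG R).act D1 D2 (b := Y) p c

abbrev MS.act (D1 D2 : GCtx R) {P Q : GCtx R} (p : Path GStep P Q) {Γ : LCtx R} {B : LTy R}
    (c : MS (D1 ++ P ++ D2) Γ B) : MS (D1 ++ Q ++ D2) Γ B :=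
  (actM R).act D1 D2 (b := (Γ, B)) p c

lemma GS.path_eq (D1 D2 : GCtx R) (p : Path GLeft P Q)
    (c : GS (D1 ++ P ++ D2) Y) : EqG (c.path D1 D2 p) (c.act D1 D2 (p.map GStep.left)) := by
  induction p with
  | nil h => exact .cL (.symm (Act.act_nil (A := actG R) _ _ _ _)) _
  | snoc p E1 E2 l hN hK ih =>
    refine .cL (.symm ((Act.act_snoc (A := actG R) ..).trans ?_)) _
    exact .congr_left _ _ _ (.cR ((Act.cast_E (A := actG R) ..).trans ih.symm) _)

lemma MS.path_eq (D1 D2 : GCtx R) (p : Path GLeft P Q)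
    (c : MS (D1 ++ P ++ D2) Γ B) : EqM (c.path D1 D2 p) (c.act D1 D2 (p.map GStep.left)) := by
  induction p with
  | nil h => exact .cL (.symm (Act.act_nil (A := actM R) (b := (Γ, B)) _ _ _ _)) _ rfl
  | snoc p E1 E2 l hN hK ih =>
    refine .cL (.symm ((Act.act_snoc (A := actM R) (b := (Γ, B)) ..).trans ?_)) _ rfl
    exact .congr_left _ _ _ (.cR ((Act.cast_E (A := actM R) (b := (Γ, B)) ..).trans ih.symm) _ rfl)

def Path.scaled [MulLeftMono R] (r : R) {P : GCtx R} :
    ∀ {Q : GCtx R}, Path GStep P Q → Path GStep (scale r P) (scale r Q)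
  | _, .nil h => .nil (by rw [h])
  | _, .snoc p D1 D2 l hN hK =>
      .snoc (Path.scaled r p) (scale r D1) (scale r D2) (l.scaled r) (by simp [hN]) (by simp [hK])

lemma GS.cut_run [MulLeftMono R] (r : R) (Δ₁ Δ₃) (st : GStep P Q)
    (D1 D2) (a : GS (D1 ++ P ++ D2) X) (c : GS (Δ₁ ++ [(r, X)] ++ Δ₃) Y) :
    EqG (.cut r Δ₁ Δ₃ (st.runG D1 D2 a) c) ((st.scaled r).runG (Δ₁ ++ scale r D1) (scale r D2 ++ Δ₃)
        ((GS.cut r Δ₁ Δ₃ a c).cast ◾)) := by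
  cases st with
  | left l => exact .cut_left_left _ _ _ _ _ _ _ _
  | cut s b hQ => subst hQ; exact .cR (.cut_assoc _ _ _ _ _ _ _ _ _) _
  | sub h =>
    have h1 : CtxLe (Δ₁ ++ scale r (D1 ++ P ++ D2) ++ Δ₃) (Δ₁ ++ scale r (D1 ++ Q ++ D2) ++ Δ₃) :=
      ((h.inside ..).scale r).inside ..
    have e := EqG.sub_cut (le_refl r) (CtxLe.refl Δ₁) (h.inside D1 D2) (CtxLe.refl Δ₃) (CtxLe.refl _) h1 a c
    refine ((EqG.congr_cut _ _ _ (.refl _) (EqG.sub_refl ..).symm).trans e.symm).trans ?_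
    exact EqG.sub _ _ ◾ ◾ (EqG.cR (.refl _) _)

lemma MS.gcut_run [MulLeftMono R] (r : R) (Δ₁ Δ₃) (st : GStep P Q) (D1 D2) (a : GS (D1 ++ P ++ D2) X)
    (c : MS (Δ₁ ++ [(r, X)] ++ Δ₃) Γ B) :
    EqM (.gcut r Δ₁ Δ₃ (st.runG D1 D2 a) c) ((st.scaled r).runM (Δ₁ ++ scale r D1) (scale r D2 ++ Δ₃)
        ((MS.gcut r Δ₁ Δ₃ a c).cast ◾ rfl)) := by
  cases st with
  | left l => exact .gcut_left_left _ _ _ _ _ _ _ _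
  | cut s b hQ => subst hQ; exact .cR (.gcut_assoc _ _ _ _ _ _ _ _ _) _ rfl
  | sub h =>
    have h1 : CtxLe (Δ₁ ++ scale r (D1 ++ P ++ D2) ++ Δ₃) (Δ₁ ++ scale r (D1 ++ Q ++ D2) ++ Δ₃) :=
      ((h.inside ..).scale r).inside ..
    have e := EqM.sub_gcut (le_refl r) (CtxLe.refl Δ₁) (h.inside D1 D2) (CtxLe.refl Δ₃) (CtxLe.refl _) h1 a c
    refine ((EqM.congr_gcut _ _ _ (.refl _) (EqM.sub_refl ..).symm).trans e.symm).trans ?_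
    exact EqM.sub _ _ ◾ ◾ rfl (EqM.cR (.refl _) _ rfl)

lemma GS.cut_act [MulLeftMono R] (r : R) (Δ₁ Δ₃) (p : Path GStep P Q)
    (D1 D2) (a : GS (D1 ++ P ++ D2) X) (c : GS (Δ₁ ++ [(r, X)] ++ Δ₃) Y) :
    EqG (.cut r Δ₁ Δ₃ (a.act D1 D2 p) c) (GS.act (Δ₁ ++ scale r D1) (scale r D2 ++ Δ₃) (p.scaled r)
        ((GS.cut r Δ₁ Δ₃ a c).cast ◾)) := by
  induction p with
  | nil h =>
    subst h
    refine .trans ?_ (.symm (Act.act_nil (A := actG R) ..))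
    exact .cR (.refl _) _
  | snoc p E1 E2 l hN hK ih =>
    subst hN; subst hK
    refine .trans (.cut (D1' := Δ₁) (D2' := Δ₃) rfl rfl rfl ◾
      (Act.act_snoc (A := actG R) ..) (.refl _)) ?_
    refine .trans (GS.cut_run ..) ?_
    refine .trans ?_ (.symm (Act.act_snoc (A := actG R) ..))
    refine Act.run_congr' (A := actG R) _ ◾ ◾ ?_
    refine EqG.cL (EqG.trans (EqG.cut rfl rfl rfl ◾ (Act.cast_E (A := actG R) ..)
      (.refl _)) (ih.trans ?_)) _
    exact Act.E_cast (A := actG R) ..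

lemma MS.gcut_act [MulLeftMono R] (r : R) (Δ₁ Δ₃) (p : Path GStep P Q) (D1 D2) (a : GS (D1 ++ P ++ D2) X)
    (c : MS (Δ₁ ++ [(r, X)] ++ Δ₃) Γ B) :
    EqM (.gcut r Δ₁ Δ₃ (a.act D1 D2 p) c) (MS.act (Δ₁ ++ scale r D1) (scale r D2 ++ Δ₃) (p.scaled r)
        ((MS.gcut r Δ₁ Δ₃ a c).cast ◾ rfl)) := by
  induction p with
  | nil h =>
    subst h
    refine .trans ?_ (.symm (Act.act_nil (A := actM R) (b := (Γ, B)) ..))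
    exact .cR (.refl _) ..
  | snoc p E1 E2 l hN hK ih =>
    subst hN; subst hK
    refine .trans (.gcut (D1' := Δ₁) (D2' := Δ₃) rfl rfl rfl ◾ rfl
      (Act.act_snoc (A := actG R) ..) (.refl _)) ?_
    refine .trans (MS.gcut_run ..) ?_
    refine .trans ?_ (.symm (Act.act_snoc (A := actM R) (b := (Γ, B)) ..))
    refine Act.run_congr' (A := actM R) (b := (Γ, B)) _ ◾ ◾ ?_
    refine EqM.cL (EqM.trans (EqM.gcut rfl rfl rfl ◾ rfl (Act.cast_E (A := actG R) ..)
      (.refl _)) (ih.trans ?_)) _ rfl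
    exact Act.E_cast (A := actM R) (b := (Γ, B)) ..

lemma stepComm_cut_left (r : R) (a : GS E X)
    (hK : K = scale r E) (st : GStep P Q) : (actG R).StepComm (.cut r a hK) st := by
  subst hK
  intro Y D1 D2 D3 c1 c2 d1 d2 hc h₁ h2
  have key : EqG (GS.cut r D1 (D2 ++ Q ++ D3) a ((st.runG (D1 ++ [(r, X)] ++ D2) D3 c2).cast
      ◾)) (st.runG (D1 ++ scale r E ++ D2) D3
        ((GS.cut r D1 (D2 ++ P ++ D3) a (c2.cast ◾)).cast ◾)) := by
    cases st with
    | left l => exact .cut_left_after _ _ _ _ _ _ _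
    | cut s b hQ =>
      subst hQ
      refine .trans (EqG.cut_cut ..) ?_
      exact .refl _
    | sub h =>
      have e := EqG.sub_cut (le_refl r) (CtxLe.refl D1) (CtxLe.refl E) (h.inside D2 D3)
        (h := by simpa using CtxLe.inside (D1 ++ [(r, X)] ++ D2) D3 h)
        (h' := by simpa using CtxLe.inside (D1 ++ scale r E ++ D2) D3 h)
        a (c2.cast ◾)
      refine .trans ?_ (e.symm.trans (.sub _ _ ◾ ◾ (.cR (.refl _) _)))
      refine .congr_cut _ _ _ (EqG.sub_refl ..).symm (.cL ?_ _)
      exact .sub _ _ ◾ ◾ (.cR (.refl _) _)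
  refine .trans (.congr_cut _ _ _ (.refl _) ?_) (key.trans (Act.run_congr (actG R) _ _ _ ?_))
  · exact .cR h2 _
  · exact EqG.cL ((EqG.congr_cut _ _ _ (.refl _) (EqG.cL hc.symm _)).trans h₁.symm) _

lemma stepComm_cut_right (r : R) (a : GS E X)
    (hK : K = scale r E) (st : GStep P Q) : (actG R).StepComm st (.cut r a hK) := by
  subst hK
  intro Y D1 D2 D3 c1 c2 d1 d2 hc h₁ h2
  have key : EqG (GS.cut r (D1 ++ Q ++ D2) D3 a ((st.runG D1 (D2 ++ [(r, X)] ++ D3) c1).cast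
      ◾)) (st.runG D1 (D2 ++ scale r E ++ D3)
        ((GS.cut r (D1 ++ P ++ D2) D3 a (c1.cast ◾)).cast ◾)) := by
    cases st with
    | left l => exact .cut_left_before _ _ _ _ _ _ _
    | cut s b hQ =>
      subst hQ
      have e := EqG.cut_cut s r D1 D2 D3 b a (c1.cast ◾)
      refine .trans ?_ (e.symm.trans ?_)
      · exact .congr_cut _ _ _ (.refl _) (.cL (.cR (.congr_cut _ _ _ (.refl _)
          (.cR (.cR (.refl _) _) _)) _) _)
      · exact .refl _
    | sub h =>
      have e := EqG.sub_cut (le_refl r) (h.inside D1 D2) (CtxLe.refl E) (CtxLe.refl D3)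
        (h := by simpa using CtxLe.inside D1 (D2 ++ [(r, X)] ++ D3) h)
        (h' := by simpa using CtxLe.inside D1 (D2 ++ scale r E ++ D3) h)
        a (c1.cast ◾)
      refine .trans ?_ (e.symm.trans (.sub _ _ ◾ ◾ (.cR (.refl _) _)))
      refine .congr_cut _ _ _ (EqG.sub_refl ..).symm (.cL ?_ _)
      exact .sub _ _ ◾ ◾ (.cR (.refl _) _)
  refine .symm (.trans (.congr_cut _ _ _ (.refl _) ?_) (key.trans (Act.run_congr (actG R) _ _ _ ?_)))
  · exact .cR h₁ _
  · exact EqG.cL ((EqG.congr_cut _ _ _ (.refl _) (EqG.cL hc _)).trans h2.symm) _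

lemma comm_of_cut_left {P Q P' Q'} {p : Path GStep P Q} (hp : p.All GStep.IsCut)
    (p' : Path GStep P' Q') : (actG R).Comm p p' := by
  refine Act.comm_of_all (ψ := fun _ => True) ?_ hp p'.all_true
  intro P Q P' Q' l l' hl _
  cases l with
  | cut r a hQ => exact stepComm_cut_left _ _ _ _
  | left l => exact hl.elim
  | sub l => exact hl.elim

lemma comm_of_cut_right {P Q P' Q'} {p' : Path GStep P' Q'} (hp : p'.All GStep.IsCut)
    (p : Path GStep P Q) : (actG R).Comm p p' := by
  refine Act.comm_of_all (φ := fun _ => True) ?_ p.all_true hp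
  intro P Q P' Q' l l' _ hl
  cases l' with
  | cut r a hQ => exact stepComm_cut_right _ _ _ _
  | left l => exact hl.elim
  | sub l => exact hl.elim

end Steps

/-! ## Simultaneous substitutions -/

namespace Path

variable {α : Type u} {L : List α → List α → Type u} {ι : Type u} (f : ι → α) (g : ι → List α)
  (st : ∀ i, L [f i] (g i))

def par : ∀ σ : List ι, Path L (σ.map f) (σ.flatMap g)
  | [] => .nil rfl
  | i :: σ => .trans (Q := g i ++ σ.map f) (inside [] (σ.map f) (single (st i)) rfl rfl)
      (inside (g i) [] (par σ) ◾ ◾)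

lemma par_all {φ : ∀ {P Q}, L P Q → Prop} (h : ∀ i, φ (st i)) (σ : List ι) : (par f g st σ).All φ := by
  induction σ with
  | nil => trivial
  | cons i σ ih => exact ((all_single (h i)).inside _ _ _ _).trans (ih.inside _ _ _ _)

variable {f g st} {A : Act L}

lemma act_par_cons (i : ι) (σ : List ι) (D1 D2) (c : A.F b (D1 ++ (i :: σ).map f ++ D2)) :
    A.E (A.act D1 D2 (par f g st (i :: σ)) c) (A.act (D1 ++ g i) D2 (par f g st σ)
        (A.cast (A.run (st i) D1 (σ.map f ++ D2) (A.cast c ◾)) ◾)) := by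
  refine A.trans (Act.act_trans ..) ?_
  refine A.trans (Act.act_inside ..) (Act.act_congr _ rfl rfl ?_)
  refine Act.E.cast2 (A.trans (Act.act_inside ..) ?_) ..
  exact Act.act_single' _ ◾ rfl (Act.E.cast2 (A.refl _) ..)

lemma act_par_append (σ τ : List ι) (D1 D2)
    (c : A.F b (D1 ++ (σ ++ τ).map f ++ D2)) (d : A.F b (D1 ++ σ.map f ++ (τ.map f ++ D2)))
    (h : A.E c d) :
    A.E (A.act D1 D2 (par f g st (σ ++ τ)) c) (A.act (D1 ++ σ.flatMap g) D2 (par f g st τ)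
        (A.cast (A.act D1 (τ.map f ++ D2) (par f g st σ) d) ◾)) := by
  induction σ generalizing D1 with
  | nil =>
    refine Act.act_congr _ ◾ rfl ?_
    exact Act.E.cR (A.trans h (A.symm (Act.act_nil ..))) _
  | cons i σ ih =>
    refine A.trans (act_par_cons i (σ ++ τ) D1 D2 c) ?_
    refine A.trans (ih (D1 ++ g i) _ (A.cast (A.run (st i) D1 (σ.map f ++ (τ.map f ++ D2))
      (A.cast c ◾)) ◾) ?_) ?_
    · exact Act.E.cast2 (Act.run_congr' _ rfl ◾ (Act.E.cast2 (A.refl _) ..)) ..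
    · refine Act.act_congr _ ◾ rfl (Act.E.cast2 ?_ ..)
      refine A.symm (A.trans (act_par_cons ..) (Act.act_congr _ rfl rfl ?_))
      exact Act.E.cast2 (Act.run_congr' _ rfl ◾ (Act.E.cast2 (A.symm h) ..)) ..

end Path

section Canon

variable {R : Type u} [Semiring R] [Preorder R]

inductive Canon : ∀ {Δ : GCtx R} {X : GTy R}, GS Δ X → Prop
  | unitR : Canon .unitR
  | tenR {Δ₁ Δ₂ : GCtx R} {X Y : GTy R} {a : GS Δ₁ X} {b : GS Δ₂ Y} :
      Canon a → Canon b → Canon (.tenR a b)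
  | linR {Δ : GCtx R} {A : LTy R} (m : MS Δ [] A) : Canon (.linR m)
  | step {P Q : GCtx R} (st : GStep P Q) (h : st.IsStruct) (D1 D2 : GCtx R) {X : GTy R}
      {c : GS (D1 ++ P ++ D2) X} : Canon c → Canon (st.runG D1 D2 c)
  | eqv {Δ : GCtx R} {X : GTy R} {π ρ : GS Δ X} : EqG π ρ → Canon π → Canon ρ

lemma Canon.of_eq {Δ Δ' : GCtx R} {π : GS Δ X} {ρ : GS Δ' X} (hπ : Canon π)
    (h : Δ = Δ') (e : EqG π ρ) : Canon ρ := by subst h; exact .eqv e hπ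

lemma Canon.act {p : Path GStep P Q} (hp : p.All GStep.IsStruct)
    (D1 D2 : GCtx R) {c : GS (D1 ++ P ++ D2) X} (hc : Canon c) :
    Canon (c.act D1 D2 p) := by
  induction p with
  | nil h => subst h; exact hc.of_eq rfl (Act.act_nil (A := actG R) _ _ _ _).symm
  | snoc p E1 E2 l hN hK ih =>
    subst hN; subst hK
    refine Canon.of_eq (Canon.step l hp.2 (D1 ++ E1) (E2 ++ D2) (Canon.of_eq (ih hp.1) ◾
      (Act.E_cast (A := actG R) _ ◾))) ◾
      (Act.act_snoc (A := actG R) ..).symm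

def CanonForm {Δ : GCtx R} : ∀ {X : GTy R}, GS Δ X → Prop
  | .unit, a => ∃ p : Path GStep [] Δ, p.All GStep.IsStruct ∧ EqG a (GS.act [] [] p .unitR)
  | .tensor X Y, a => ∃ (E1 E2 : GCtx R) (a1 : GS E1 X) (a2 : GS E2 Y)
      (p : Path GStep (E1 ++ E2) Δ), Canon a1 ∧ Canon a2 ∧ p.All GStep.IsStruct ∧
        EqG a (GS.act [] [] p ((GS.tenR a1 a2).cast ◾))
  | .lin _, _ => True

lemma Canon.form {Δ : GCtx R} {a : GS Δ X} (h : Canon a) : CanonForm a := by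
  induction h with
  | unitR => exact ⟨.nil rfl, trivial, EqG.symm (Act.act_nil (A := actG R) (b := .unit) [] [] (P := []) (Q := []) rfl .unitR)⟩
  | tenR ha hb =>
    exact ⟨_, _, _, _, .nil rfl, ha, hb, trivial, ((Act.act_nil (A := actG R) ..).trans (.cast_left ..)).symm⟩
  | linR m => trivial
  | @step P Q st h D1 D2 X c hc ih =>
    have key : ∀ {K} (p : Path GStep K (D1 ++ P ++ D2)) (d : GS ([] ++ K ++ []) X), EqG c (GS.act [] [] p d) →
          EqG (st.runG D1 D2 c) (GS.act [] [] (.snoc p D1 D2 st rfl rfl) d) := by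
      intro K p d e
      refine .trans ?_ (Act.act_snoc (A := actG R) ..).symm
      exact Act.run_congr' (A := actG R) _ ◾ ◾ (e.trans (Act.E_cast (A := actG R) ..))
    cases X with
    | unit => obtain ⟨p, hp, e⟩ := ih; exact ⟨.snoc p D1 D2 st rfl rfl, ⟨hp, h⟩, key p _ e⟩
    | tensor X Y =>
      obtain ⟨E1, E2, a1, a2, p, h₁, h₂, hp, e⟩ := ih
      exact ⟨E1, E2, a1, a2, .snoc p D1 D2 st rfl rfl, h₁, h₂, ⟨hp, h⟩, key p _ e⟩
    | lin A => trivial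
  | @eqv Δ X π ρ e hc ih =>
    cases X with
    | unit => obtain ⟨p, hp, e'⟩ := ih; exact ⟨p, hp, e.symm.trans e'⟩
    | tensor X Y =>
      obtain ⟨E1, E2, a1, a2, p, h₁, h₂, hp, e'⟩ := ih
      exact ⟨E1, E2, a1, a2, p, h₁, h₂, hp, e.symm.trans e'⟩
    | lin A => trivial

variable (R) in
structure CBlk where
  r : R
  X : GTy R
  E : GCtx R
  a : GS E X
  canon : Canon a

namespace CBlk

def dom (b : CBlk R) : R × GTy R := (b.r, b.X)

def cod (b : CBlk R) : GCtx R := scale b.r b.E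

def step (b : CBlk R) : GStep [b.dom] b.cod := .cut b.r b.a rfl

abbrev path (σ : List (CBlk R)) : Path GStep (σ.map dom) (σ.flatMap cod) := .par dom cod step σ

lemma path_all (σ : List (CBlk R)) : (path σ).All GStep.IsCut :=
  Path.par_all _ _ _ (fun _ => trivial) σ

end CBlk

lemma Path.map_all {α : Type u} {L L' : List α → List α → Type u}
    {φ : ∀ {P Q}, L' P Q → Prop} (f : ∀ {P Q}, L P Q → L' P Q)
    (h : ∀ {P Q} (l : L P Q), φ (f l)) {P Q} (p : Path L P Q) :
    (p.map f).All φ := by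
  induction p with
  | nil => trivial
  | snoc p D1 D2 l hN hK ih => exact ⟨ih, h l⟩

lemma Path.scaled_all [MulLeftMono R] (r : R) {p : Path GStep P Q}
    (hp : p.All GStep.IsStruct) : (p.scaled r).All GStep.IsStruct := by
  induction p with
  | nil => trivial
  | snoc p D1 D2 l hN hK ih =>
    refine ⟨ih hp.1, ?_⟩
    have h2 := hp.2
    cases l <;> trivial

def GStep.IsAtom {P Q : GCtx R} : GStep P Q → Prop
  | .left _ => True
  | .cut _ _ _ => False
  | .sub _ => ∃ (r s : R) (X : GTy R), r ≤ s ∧ P = [(r, X)] ∧ Q = [(s, X)]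

lemma GStep.IsAtom.struct {P Q : GCtx R} {st : GStep P Q} (h : st.IsAtom) : st.IsStruct := by
  cases st <;> trivial

lemma GS.sub_sub {Δ Δ' D D' K K' : GCtx R} (h : CtxLe Δ Δ') (h' : CtxLe D D')
    (h'' : CtxLe K K') (e1 : Δ' = D) (e2 : K = Δ) (e3 : K' = D') {c : GS Δ X} {d : GS D X}
    {k : GS K X} (hd : EqG d (.sub h c)) (hk : EqG k c) : EqG (.sub h' d) (.sub h'' k) := by
  subst e1; subst e2; subst e3
  exact (EqG.congr_sub _ hd).trans ((EqG.sub_trans _ _ h'' _).trans (EqG.congr_sub _ hk.symm))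

lemma exists_sub_path : ∀ {P Q : GCtx R} (h : CtxLe P Q), ∃ p : Path GStep P Q,
    p.All GStep.IsAtom ∧ ∀ (D1 D2) (Y) (c : GS (D1 ++ P ++ D2) Y), EqG (.sub (h.inside D1 D2) c) (c.act D1 D2 p)
  | [], [], h => ⟨.nil rfl, trivial, fun D1 D2 Y c => (EqG.sub_refl _ _).trans
      (.symm (Act.act_nil (A := actG R) ..))⟩
  | (r, X) :: P, (s, Y) :: Q, h => by
    obtain ⟨h₁, h₂, h3⟩ := h
    obtain ⟨p, hp, ep⟩ := exists_sub_path h3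
    dsimp only at h₁ h₂ h3
    subst h₂
    have h1 : CtxLe [(r, X)] [(s, X)] := ⟨h₁, rfl, trivial⟩
    refine ⟨.trans (Q := (s, X) :: P) (.inside [] P (.single (.sub h1)) rfl rfl)
      (.inside [(s, X)] [] p ◾ ◾), ?_, ?_⟩
    · exact (Path.All.inside (Path.all_single ⟨r, s, X, h₁, rfl, rfl⟩) ..).trans (hp.inside ..)
    · intro D1 D2 Y c
      refine .symm (.trans (Act.act_trans (A := actG R) ..) ?_)
      refine .trans (Act.act_inside (A := actG R) ..) ?_
      refine .trans (ep ..).symm ?_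
      refine GS.sub_sub (h1.inside D1 (P ++ D2)) _ _ ◾ ◾ ◾
        (c := c.cast ◾) ?_ (.cR (.refl _) _)
      refine (Act.cast_E (A := actG R) ..).trans ((Act.act_inside (A := actG R) ..).trans ?_)
      exact Act.act_single' (A := actG R) _ ◾ rfl (EqG.cR (EqG.cL (.refl _) _) _)
  | [], _ :: _, h => h.elim
  | _ :: _, [], h => h.elim

end Canon

namespace Path

variable {α : Type u} {L : List α → List α → Type u}

def recast {P Q P' Q' : List α} (p : Path L P Q) (h : P' = P) (h' : Q = Q') : Path L P' Q' :=
  trans (trans (.nil h) p) (.nil h')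

lemma All.recast {φ : ∀ {P Q}, L P Q → Prop} {P Q P' Q'} {p : Path L P Q}
    (hp : p.All φ) (h : P' = P) (h' : Q = Q') : (p.recast h h').All φ := by
  subst h; subst h'; exact All.trans (All.trans (p := .nil rfl) trivial hp) (q := .nil rfl) trivial

lemma act_recast {A : Act L} {P Q P' Q'} (p : Path L P Q) (h : P' = P) (h' : Q = Q')
    {D1 D2 D1' D2'} (h1 : D1 = D1') (h2 : D2 = D2') {b}
    {c : A.F b (D1 ++ P' ++ D2)} {d : A.F b (D1' ++ P ++ D2')} (e : A.E c d) :
    A.E (A.act D1 D2 (p.recast h h') c) (A.act D1' D2' p d) := by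
  refine A.trans (Act.act_trans ..) (A.trans (Act.act_nil ..)
    (A.trans (Act.act_trans ..) (Act.act_congr _ h1 h2 ?_)))
  exact A.trans (Act.act_nil ..) e

lemma map_trans {L' : List α → List α → Type u} (f : ∀ {P Q}, L P Q → L' P Q)
    {P Q K} (p : Path L P Q) (q : Path L Q K) :
    (p.trans q).map f = (p.map f).trans (q.map f) := by
  induction q with
  | nil h => subst h; rfl
  | snoc q E1 E2 l hN hK ih => simp only [trans, map, ih]

lemma map_inside {L' : List α → List α → Type u} (f : ∀ {P Q}, L P Q → L' P Q)
    {P Q} (p : Path L P Q) (D1 D2) {M K} (hM : M = D1 ++ P ++ D2)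
    (hK : K = D1 ++ Q ++ D2) : (p.inside D1 D2 hM hK).map f = (p.map f).inside D1 D2 hM hK := by
  induction p generalizing K with
  | nil h => rfl
  | snoc q E1 E2 l hN hK ih => simp only [inside, map, ih]

lemma map_move {L' : List α → List α → Type u} (f : ∀ {P Q}, L P Q → L' P Q)
    (ex : ∀ a b, L [a, b] [b, a]) (a : α) (Q) :
    (move ex a Q).map f = move (fun a b => f (ex a b)) a Q := by
  induction Q with
  | nil => rfl
  | cons b Q ih => simp only [move, map_trans, map_inside, ih]; rfl

lemma map_swap {L' : List α → List α → Type u} (f : ∀ {P Q}, L P Q → L' P Q) (ex : ∀ a b, L [a, b] [b, a]) (P Q) :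
    (swap ex P Q).map f = swap (fun a b => f (ex a b)) P Q := by
  induction P with
  | nil => rfl
  | cons b P ih => simp only [swap, map_trans, map_inside, map_move, ih]

end Path

lemma Act.act_swap_one {α : Type u} {L : List α → List α → Type u} {A : Act L}
    (ex : ∀ a b, L [a, b] [b, a]) (a : α) (Q D1 D2) {b}
    (c : A.F b (D1 ++ ([a] ++ Q) ++ D2)) :
    A.E (A.act D1 D2 (Path.swap ex [a] Q) c) (A.act D1 D2 (Path.move ex a Q) c) := by
  refine A.trans (act_trans ..) ?_
  refine A.trans (act_inside ..) (act_congr _ ◾ ◾ ?_)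
  refine E.cL (A.trans (act_inside ..) ?_) _
  exact A.trans (act_nil ..) (cast_E ..)

section Canon

variable {R : Type u} [Semiring R] [Preorder R]

lemma CBlk.run_step (b : CBlk R) (D1 D2) (c : GS (D1 ++ [(b.r, b.X)] ++ D2) Y) :
    EqG ((actG R).run b.step D1 D2 (b := Y) c) (GS.cut b.r D1 D2 b.a c) :=
  EqG.cast_left (GS.cut b.r D1 D2 b.a c) rfl

lemma CBlk.act_path_one (b : CBlk R) (D1 D2) (c : GS (D1 ++ [b.dom] ++ D2) Y) :
    EqG (GS.act D1 D2 (CBlk.path [b]) c) (GS.cut b.r D1 D2 b.a c) := by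
  refine .trans (Path.act_par_cons (A := actG R) ..) ?_
  refine .trans (Act.act_nil (A := actG R) ..) ?_
  refine .trans (Act.cast_E (A := actG R) ..) (.trans (CBlk.run_step ..) ?_)
  exact .cut rfl rfl ◾ rfl (.refl _) (Act.cast_E (A := actG R) ..)

lemma CBlk.act_path_two (b b' : CBlk R) (D1 D2) (c : GS (D1 ++ [b.dom, b'.dom] ++ D2) Y) :
    EqG (GS.act D1 D2 (CBlk.path [b, b']) c) (GS.cut b'.r (D1 ++ scale b.r b.E) D2 b'.a
        ((GS.cut b.r D1 ([b'.dom] ++ D2) b.a (c.cast (by simp [CBlk.dom]))).cast (by simp [CBlk.dom]))) := by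
  refine .trans (Path.act_par_cons (A := actG R) ..) ?_
  refine .trans (CBlk.act_path_one ..) (.cut rfl rfl rfl rfl (.refl _) ?_)
  refine .trans (Act.cast_E (A := actG R) ..) (.trans (CBlk.run_step ..) (.cR ?_ _))
  exact .cut rfl rfl ◾ rfl (.refl _) (.cR (Act.cast_E (A := actG R) ..) _)

lemma GS.cut_congr {r : R} (h1 : D1 = D1') (h2 : D2 = D2') {a : GS E X} {c : GS (D1 ++ [(r, X)] ++ D2) Y}
    {c' : GS (D1' ++ [(r, X)] ++ D2') Y} (e : EqG c c') :
    EqG (.cut r D1 D2 a c) (.cut r D1' D2' a c') := .cut rfl h1 h2 rfl (.refl _) e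

lemma GS.cut_comm (r s : R) (D1 D2 D3) (a : GS E X)
    (b : GS F Y) {c1 : GS (D1 ++ [(r, X)] ++ (D2 ++ [(s, Y)] ++ D3)) Z}
    {c2 : GS (D1 ++ [(r, X)] ++ D2 ++ [(s, Y)] ++ D3) Z}
    {d1 : GS (D1 ++ scale r E ++ D2 ++ [(s, Y)] ++ D3) Z}
    {d2 : GS (D1 ++ [(r, X)] ++ (D2 ++ scale s F ++ D3)) Z} (hc : EqG c1 c2)
    (h1 : EqG d1 (.cut r D1 _ a c1)) (h2 : EqG d2 (.cut s _ D3 b c2)) :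
    EqG (.cut r D1 _ a d2) (.cut s _ D3 b d1) :=
  stepComm_cut_left r a rfl (.cut s b rfl) D1 D2 D3 c1 c2 d1 d2 hc h1 h2

lemma gswap_single (a b : R × GTy R) (D1 D2 : GCtx R)
    (c : GS (D1 ++ [a, b] ++ D2) Y) : EqG (c.path D1 D2 (gswap [a] [b])) (.left (.ex a b) D1 D2 c) := by
  refine .trans (GS.path_eq ..) ?_
  simp only [gswap, Path.swap, Path.move, Path.trans, Path.inside, Path.single, Path.map]
  refine .trans (Act.act_snoc (A := actG R) ..) ?_
  refine .left _ ◾ ◾ ?_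
  exact (Act.cast_E (A := actG R) ..).trans (Act.act_nil (A := actG R) ..)

lemma exists_cut_move (r : R) (a : GS A X) : ∀ E : GCtx R,
    ∃ q : Path GStep (scale r A ++ E) (E ++ scale r A), q.All GStep.IsStruct ∧
      ∀ (D1 D2) (Y) (c : GS (D1 ++ ((r, X) :: E) ++ D2) Y), EqG (.cut r (D1 ++ E) D2 a
            ((GS.act D1 D2 (Path.move (fun a b => .left (.ex a b)) (r, X) E) c).cast ◾))
          (GS.act D1 D2 q ((GS.cut r D1 (E ++ D2) a (c.cast ◾)).cast ◾))
  | [] => by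
    refine ⟨.nil ◾, by exact trivial, fun D1 D2 Y c => ?_⟩
    refine .trans ?_ (.symm (Act.act_nil (A := actG R) ..))
    refine .cR (.cut rfl ◾ rfl rfl (.refl _) (.cL (.cR ?_ _) _)) _
    exact Act.act_nil (A := actG R) ..
  | b :: E => by
    obtain ⟨q, hq, e⟩ := exists_cut_move r a E
    refine ⟨.trans (Q := b :: scale r A ++ E)
      (.inside [] E ((gswap (scale r A) [b]).map GStep.left) ◾ ◾)
      (.inside [b] [] q ◾ ◾), .trans (.inside (Path.map_all _ (fun _ => trivial) _)
        _ ..) (hq.inside ..), fun D1 D2 Y c => ?_⟩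
    refine .trans ?_ (.symm (Act.act_trans (A := actG R) ..))
    refine .trans ?_ (.symm (Act.act_inside (A := actG R) ..))
    have e1 := e (D1 ++ [b]) D2 Y (GS.cast (.left (.ex (r, X) b) D1 (E ++ D2) (c.cast ◾)) ◾)
    refine .trans (.cut rfl ◾ rfl rfl (.refl _) (.cL (.cR ?_ _) _))
      (e1.trans (Act.act_congr (A := actG R) _ rfl ◾ (.cL ?_ _)))
    · refine .trans (Act.act_trans (A := actG R) ..) ?_
      refine .trans (Act.act_inside (A := actG R) ..) (Act.act_congr (A := actG R) _ rfl ◾ ?_)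
      refine .trans (Act.cast_E (A := actG R) ..) (.cR ?_ _)
      refine .trans (Act.act_inside (A := actG R) ..) ?_
      refine Act.act_single' (A := actG R) _ ◾ rfl ?_
      exact .cR (Act.cast_E (A := actG R) ..) _
    · refine .trans ?_ (Act.E_cast (A := actG R) ..)
      refine .trans ?_ (.symm (Act.act_inside (A := actG R) ..))
      refine .trans (.trans (GS.cut_congr rfl rfl (.cL (.cast2 ..) _))
        (EqG.cut_ex_fst r b D1 (E ++ D2) a (c.cast ◾))) ?_
      refine .trans (GS.path_eq ..) (Act.act_congr (A := actG R) _ ◾ rfl ?_)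
      refine .cL ?_ _
      refine .trans ?_ (Act.E_cast (A := actG R) ..)
      exact .cR (GS.cut_congr rfl ◾ (.cL (.cR (.cL (.refl _) _) _) _)) _

lemma canon_step [MulLeftMono R] [MulRightMono R] {P Q} (st : GStep P Q)
    (hst : st.IsAtom) (τ : List (CBlk R)) (hτ : τ.map CBlk.dom = Q) :
    ∃ (τ' : List (CBlk R)) (hτ' : τ'.map CBlk.dom = P)
      (q : Path GStep (τ'.flatMap CBlk.cod) (τ.flatMap CBlk.cod)), q.All GStep.IsStruct ∧
      ∀ (D1 D2) (Y) (c : GS (D1 ++ P ++ D2) Y), EqG (GS.act D1 D2 (CBlk.path τ) ((st.runG D1 D2 c).cast (by rw [hτ])))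
          (GS.act D1 D2 q (GS.act D1 D2 (CBlk.path τ') (c.cast (by rw [hτ'])))) := by
  have one : ∀ {x} {τ : List (CBlk R)}, τ.map CBlk.dom = [x] →
      ∃ (E : GCtx R) (a : GS E x.2) (h : Canon a), τ = [⟨x.1, x.2, E, a, h⟩] := by
    intro x τ h
    match τ, h with
    | [⟨r, X, E, a, ha⟩], h =>
      simp only [List.map_cons, List.map_nil, CBlk.dom, List.cons.injEq, and_true] at h
      subst h; exact ⟨E, a, ha, rfl⟩
  have two : ∀ {x y} {τ : List (CBlk R)}, τ.map CBlk.dom = [y, x] →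
      ∃ (E F : GCtx R) (a : GS E x.2) (b : GS F y.2) (h : Canon a) (h' : Canon b),
        τ = [⟨y.1, y.2, F, b, h'⟩, ⟨x.1, x.2, E, a, h⟩] := by
    intro x y τ h
    match τ, h with
    | [⟨r, X, E, a, ha⟩, ⟨s, Y, F, b, hb⟩], h =>
      simp only [List.map_cons, List.map_nil, CBlk.dom, List.cons.injEq, and_true] at h
      obtain ⟨rfl, rfl⟩ := h; exact ⟨F, E, b, a, hb, ha, rfl⟩
  cases st with
  | cut r a hQ => exact hst.elim
  | sub h =>
    obtain ⟨r, s, X, hrs, rfl, rfl⟩ := hst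
    obtain ⟨E, a, ha, rfl⟩ := one hτ
    refine ⟨[⟨r, X, E, a, ha⟩], rfl, .recast (.single (.sub (CtxLe.scale_grade hrs E)))
      (by simp [CBlk.cod]) (by simp [CBlk.cod]), (Path.all_single trivial).recast _ _, ?_⟩
    intro D1 D2 Y c
    refine .trans (CBlk.act_path_one ..) ?_
    refine .trans ?_ (.symm (Path.act_recast (A := actG R) _ _ _ rfl rfl
      (Act.E_cast (A := actG R) (D' := D1 ++ scale r E ++ D2) _ (by simp [CBlk.cod]))))
    refine .trans ?_ (.symm (Act.act_single (A := actG R) ..))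
    have e := EqG.sub_cut hrs (CtxLe.refl D1) (CtxLe.refl E) (CtxLe.refl D2) (h.inside D1 D2)
      ((CtxLe.scale_grade hrs E).inside D1 D2) a c
    refine .trans ?_ (e.symm.trans (.congr_sub _ ?_))
    · exact .cut rfl rfl rfl rfl (EqG.sub_refl ..).symm (.cL (.refl _) _)
    · refine .trans ?_ (Act.E_cast (A := actG R) ..)
      exact .symm (.trans (CBlk.act_path_one ..) (GS.cut_congr rfl rfl (.cL (.refl _) _)))
  | left l =>
    cases l with
    | unit r =>
      obtain ⟨E, a, ha, rfl⟩ := one hτ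
      obtain ⟨p, hp, e⟩ := ha.form
      refine ⟨[], rfl, (p.scaled r).recast ◾ (by simp [CBlk.cod]), (Path.scaled_all r hp).recast _ _, ?_⟩
      intro D1 D2 Y c
      refine .trans (CBlk.act_path_one ..) ?_
      refine .trans (.cut rfl rfl rfl ◾ e (.cL (.refl _) _)) ?_
      refine .trans (GS.cut_act ..) ?_
      refine .symm (Path.act_recast (A := actG R) _ _ _ ◾ ◾ ?_)
      refine .trans (Act.act_nil (A := actG R) ..) (.cR (.cL ?_ _) _)
      exact (EqG.cut_unit ..).symm
    | tensor r X Y =>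
      obtain ⟨E, a, ha, rfl⟩ := one hτ
      obtain ⟨E1, E2, a1, a2, p, h1, h2, hp, e⟩ := ha.form
      refine ⟨[⟨r, X, E1, a1, h1⟩, ⟨r, Y, E2, a2, h2⟩], rfl,
        (p.scaled r).recast (by simp [CBlk.cod]) (by simp [CBlk.cod]),
        (Path.scaled_all r hp).recast _ _, ?_⟩
      intro D1 D2 Z c
      refine .trans (CBlk.act_path_one ..) ?_
      refine .trans (.cut rfl rfl rfl ◾ e (.cL (.refl _) _)) ?_
      refine .trans (GS.cut_act ..) ?_
      refine .symm (Path.act_recast (A := actG R) _ _ _ ◾ ◾ ?_)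
      refine .trans (CBlk.act_path_two ..) (.cR (.symm ?_) _)
      refine .trans (.cut rfl rfl rfl ◾ (.cast_left ..) (.refl _)) ?_
      refine .trans (EqG.cut_tensor ..) (GS.cut_congr rfl rfl
        (.cL (.cR (GS.cut_congr rfl rfl ?_) _) _))
      exact .cL (.cR (.cR (.refl _) _) _) _
    | weak r X h =>
      obtain ⟨E, a, ha, rfl⟩ := one hτ
      refine ⟨[], rfl, ((weakBlock r h E).map GStep.left).recast ◾ (by simp [CBlk.cod]),
        (Path.map_all _ (fun _ => trivial) _).recast _ _, ?_⟩
      intro D1 D2 Y c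
      refine .trans (CBlk.act_path_one ..) ?_
      refine .trans (GS.cut_congr rfl rfl (.cL (.refl _) _)) ?_
      refine .trans (EqG.cut_weak ..) (.trans (GS.path_eq ..) ?_)
      refine .symm (Path.act_recast (A := actG R) _ _ _ rfl rfl ?_)
      exact .trans (Act.act_nil (A := actG R) ..) (.cL (.refl _) _)
    | cont r1 r2 r X h =>
      obtain ⟨E, a, ha, rfl⟩ := one hτ
      refine ⟨[⟨r1, X, E, a, ha⟩, ⟨r2, X, E, a, ha⟩], rfl,
        ((contBlock r1 r2 r h E).map GStep.left).recast (by simp [CBlk.cod]) (by simp [CBlk.cod]),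
        (Path.map_all _ (fun _ => trivial) _).recast _ _, ?_⟩
      intro D1 D2 Y c
      refine .trans (CBlk.act_path_one ..) ?_
      refine .trans (GS.cut_congr rfl rfl (.cL (.refl _) _)) ?_
      refine .trans (EqG.cut_cont ..) (.trans (GS.path_eq ..) ?_)
      refine .symm (Path.act_recast (A := actG R) _ _ _ rfl rfl ?_)
      refine .trans (CBlk.act_path_two ..) (.cR (.symm ?_) _)
      have e := GS.cut_comm r1 r2 D1 [] D2 a a (c1 := c.cast ◾) (c2 := c.cast ◾)
        (.cast2 ..) (.cast_left _ ◾) (.cast_left _ ◾)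
      refine .trans (GS.cut_congr rfl rfl (.cL ?_ _)) (e.trans (GS.cut_congr ◾ rfl
        (.cL (.cR (GS.cut_congr rfl rfl ?_) _) _)))
      · exact .cR (GS.cut_congr ◾ rfl (.cast2 ..)) _
      · exact .cL (.cR (.cR (.refl _) _) _) _
    | ex x y =>
      obtain ⟨E, F, a, b, ha, hb, rfl⟩ := two hτ
      obtain ⟨q, hq, e⟩ := exists_cut_move x.1 a (scale y.1 F)
      refine ⟨[⟨x.1, x.2, E, a, ha⟩, ⟨y.1, y.2, F, b, hb⟩], rfl,
        q.recast (by simp [CBlk.cod]) (by simp [CBlk.cod]), hq.recast _ _, ?_⟩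
      intro D1 D2 Y c
      refine .trans (CBlk.act_path_two ..) ?_
      refine .trans ?_ (.symm (Path.act_recast (A := actG R) _ _ _ rfl rfl
        (Act.E_cast (A := actG R) _ (by simp [CBlk.cod]))))
      have e1 := e D1 D2 Y ((GS.cut y.1 (D1 ++ [x]) D2 b (c.cast ◾)).cast ◾)
      refine .trans (GS.cut_congr rfl rfl (.cL (.cR ?_ _) _)) (e1.trans
        (Act.act_congr (A := actG R) _ rfl rfl (EqG.cL (EqG.symm
          (.trans (.symm (Act.E_cast (A := actG R) _ (by simp [CBlk.cod]))) ?_)) _)))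
      · refine .trans (GS.cut_congr rfl rfl (.cL (.cast2 ..) _)) (.trans (EqG.cut_ex_snd y.1 x D1 D2 b c) ?_)
        refine .trans (GS.path_eq ..) ?_
        rw [gswap, Path.map_swap]
        refine .trans (Act.act_swap_one (A := actG R) ..) ?_
        exact Act.act_congr (A := actG R) _ rfl rfl (EqG.cL (EqG.cR (.refl _) _) _)
      · refine EqG.trans (CBlk.act_path_two ..) ?_
        have e2 := GS.cut_comm x.1 y.1 D1 [] D2 a b (c1 := c.cast ◾) (c2 := c.cast ◾) (.cast2 ..)
          (.cast_left _ ◾) (.cast_left _ ◾)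
        refine .trans ?_ (e2.symm.trans ?_)
        · refine GS.cut_congr ◾ rfl (.cL (.cR (GS.cut_congr rfl rfl (.cL (.cast2 ..) _)) _) _)
        · exact GS.cut_congr rfl ◾ (.cL (.cR (.cR (GS.cut_congr ◾ rfl (.cast2 ..)) _) _) _)

end Canon

lemma Path.act_par_three {α : Type u} {L : List α → List α → Type u} {A : Act L} {ι : Type u}
    {f : ι → α} {g : ι → List α} {st : ∀ i, L [f i] (g i)} {σ1 τ σ2 : List ι} {b}
    {c : A.F b ([] ++ (σ1 ++ τ ++ σ2).map f ++ [])}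
    {d : A.F b ([] ++ σ1.map f ++ (τ.map f ++ σ2.map f))}
    {x1 : A.F b (σ1.flatMap g ++ τ.map f ++ σ2.map f)}
    {x2 : A.F b (σ1.flatMap g ++ τ.flatMap g ++ σ2.map f ++ [])} (h : A.E c d)
    (h1 : A.E x1 (A.act [] (τ.map f ++ σ2.map f) (par f g st σ1) d))
    (h2 : A.E x2 (A.act (σ1.flatMap g) (σ2.map f) (par f g st τ) x1)) :
    A.E (A.act [] [] (par f g st (σ1 ++ τ ++ σ2)) c) (A.act (σ1.flatMap g ++ τ.flatMap g) [] (par f g st σ2) x2) := by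
  refine A.trans (act_par_append (σ1 ++ τ) σ2 [] [] c (A.cast d ◾) (h.cR _)) ?_
  refine Act.act_congr _ ◾ rfl (Act.E.cL (A.trans ?_ (A.symm h2)) _)
  refine A.trans (act_par_append σ1 τ [] _ _ (A.cast d ◾) (Act.E.cast2 (A.refl _) ..)) ?_
  refine Act.act_congr _ ◾ ◾ (Act.E.cL (A.trans ?_ (A.symm h1)) _)
  exact Act.act_congr _ rfl ◾ (Act.cast_E ..)

section Canon

variable {R : Type u} [Semiring R] [Preorder R]

lemma GStep.run_cut (r : R) (a : GS E X) (hQ : Q = scale r E) (D1 D2) (c : GS (D1 ++ [(r, X)] ++ D2) Y) :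
    EqG ((actG R).run (.cut r a hQ) D1 D2 (b := Y) c) (GS.cut r D1 D2 a c) :=
  EqG.cast_left (GS.cut r D1 D2 a c) (by rw [hQ])

lemma GS.act_cut_linR {p : Path GStep P Q} (hp : p.All GStep.IsCut) (D1 D2 : GCtx R) (m : MS (D1 ++ P ++ D2) [] A) :
    EqG (GS.act D1 D2 p (.linR m)) (.linR (m.act D1 D2 p)) := by
  induction p with
  | nil h =>
    subst h
    exact (Act.act_nil (A := actG R) ..).trans
      (EqG.linR rfl (.symm (Act.act_nil (A := actM R) (b := ([], A)) ..)))
  | snoc p E1 E2 l hN hK ih =>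
    subst hN; subst hK
    cases l with
    | left l => exact hp.2.elim
    | sub l => exact hp.2.elim
    | cut r a hQ =>
      subst hQ
      refine (Act.act_snoc (A := actG R) ..).trans ?_
      refine .trans ?_ (EqG.linR ◾ (Act.act_snoc (A := actM R) (b := ([], A)) ..).symm)
      refine .trans ?_ (EqG.cut_linR ..)
      refine GS.cut_congr rfl rfl ((Act.cast_E (A := actG R) ..).trans ((ih hp.1).trans ?_))
      exact .linR ◾ (Act.E_cast (A := actM R) (b := ([], A)) ..)

lemma GS.act_cut_tenR_fst {p : Path GStep P Q} (hp : p.All GStep.IsCut)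
    (D1 D2 F : GCtx R) (b : GS (D1 ++ P ++ D2) X) (c : GS F Y)
    {d : GS (D1 ++ P ++ (D2 ++ F)) (.tensor X Y)} (hd : EqG d (.tenR b c)) :
    EqG (GS.act D1 (D2 ++ F) p d) (.tenR (b.act D1 D2 p) c) := by
  induction p with
  | nil h =>
    subst h
    exact (Act.act_nil (A := actG R) ..).trans (hd.trans
      (EqG.tenR rfl rfl (.symm (Act.act_nil (A := actG R) ..)) (.refl _)))
  | snoc p E1 E2 l hN hK ih =>
    subst hN; subst hK
    cases l with
    | left l => exact hp.2.elim
    | sub l => exact hp.2.elim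
    | cut r a hQ =>
      subst hQ
      refine (Act.act_snoc (A := actG R) ..).trans ?_
      refine .trans ?_ (EqG.tenR ◾ rfl (Act.act_snoc (A := actG R) ..).symm (.refl _))
      refine .trans ?_ (EqG.cut_tenR_fst ..)
      refine GS.cut_congr rfl ◾ ((Act.cast_E (A := actG R) ..).trans ((ih hp.1).trans (.cR ?_ _)))
      exact .tenR ◾ rfl (Act.E_cast (A := actG R) ..) (.refl _)

lemma GS.act_cut_tenR_snd {p : Path GStep P Q} (hp : p.All GStep.IsCut)
    (D1 D2 F : GCtx R) (b : GS F X) (c : GS (D1 ++ P ++ D2) Y)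
    {d : GS (F ++ D1 ++ P ++ D2) (.tensor X Y)} (hd : EqG d (.tenR b c)) :
    EqG (GS.act (F ++ D1) D2 p d) (.tenR b (c.act D1 D2 p)) := by
  induction p with
  | nil h =>
    subst h
    exact (Act.act_nil (A := actG R) ..).trans (hd.trans
      (EqG.tenR rfl rfl (.refl _) (.symm (Act.act_nil (A := actG R) ..))))
  | snoc p E1 E2 l hN hK ih =>
    subst hN; subst hK
    cases l with
    | left l => exact hp.2.elim
    | sub l => exact hp.2.elim
    | cut r a hQ =>
      subst hQ
      refine (Act.act_snoc (A := actG R) ..).trans ?_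
      refine .trans ?_ (EqG.tenR rfl ◾ (.refl _) (Act.act_snoc (A := actG R) ..).symm)
      refine .trans ?_ (EqG.cut_tenR_snd ..)
      refine GS.cut_congr ◾ rfl ((Act.cast_E (A := actG R) ..).trans ((ih hp.1).trans (.cR ?_ _)))
      exact .tenR rfl ◾ (.refl _) (Act.E_cast (A := actG R) ..)

def Reducible {Δ : GCtx R} {Y : GTy R} (c : GS Δ Y) : Prop :=
  ∀ (σ : List (CBlk R)) (d : GS ([] ++ σ.map CBlk.dom ++ []) Y), Δ = σ.map CBlk.dom →
    EqG c d → Canon (GS.act [] [] (CBlk.path σ) d)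

lemma Reducible.of_eq {Δ Δ' : GCtx R} {c : GS Δ Y} {c' : GS Δ' Y} (hc : Reducible c)
    (h : Δ = Δ') (e : EqG c c') : Reducible c' := by
  subst h; exact fun σ d hσ hd => hc σ d hσ (e.trans hd)

variable [MulLeftMono R]

lemma Path.scaled_trans (r : R) (p : Path GStep P Q) (q : Path GStep Q K) :
    (p.trans q).scaled r = (p.scaled r).trans (q.scaled r) := by
  induction q with
  | nil h => subst h; rfl
  | snoc q E1 E2 l hN hK ih => simp only [trans, scaled, ih]

lemma Path.act_scaled_inside {A : Act (GStep (R := R))} (r : R) {P Q}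
    (p : Path GStep P Q) (D1 D2) {M K} (hM : M = D1 ++ P ++ D2)
    (hK : K = D1 ++ Q ++ D2) (K1 K2) {b} {c : A.F b (K1 ++ scale r M ++ K2)}
    {d : A.F b (K1 ++ scale r D1 ++ scale r P ++ (scale r D2 ++ K2))} (e : A.E c d) :
    A.E (A.act K1 K2 ((p.inside D1 D2 hM hK).scaled r) c)
      (A.act (K1 ++ scale r D1) (scale r D2 ++ K2) (p.scaled r) d) := by
  induction p generalizing K with
  | nil h => exact A.trans (Act.act_nil _ _ _ _) (A.trans e (A.symm (Act.act_nil _ _ _ _)))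
  | snoc q E1 E2 l hN hK' ih =>
    refine A.trans (Act.act_snoc ..) (A.trans ?_ (A.symm (Act.act_snoc ..)))
    exact Act.run_congr' _ ◾ ◾ (Act.E.cast2 (ih rfl) ..)

lemma Path.act_scaled_single {A : Act (GStep (R := R))} (r : R) {P Q}
    (l : GStep P Q) (K1 K2) {b} (c : A.F b (K1 ++ scale r P ++ K2)) :
    A.E (A.act K1 K2 ((Path.single l).scaled r) c) (A.run (l.scaled r) K1 K2 c) := by
  refine A.trans (Act.act_snoc ..) (Act.run_congr' _ ◾ ◾ ?_)
  exact Act.E.cL (Act.act_nil ..) _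

lemma exists_unscale (r : R) : ∀ (E) (τ : List (CBlk R)), τ.map CBlk.dom = scale r E →
    ∃ (σ : List (CBlk R)) (_ : σ.map CBlk.dom = E), scale r (σ.flatMap CBlk.cod) =
      τ.flatMap CBlk.cod ∧ ∀ (D1 D2) (Y) (c : GS (D1 ++ τ.map CBlk.dom ++ D2) Y)
      (d : GS (D1 ++ scale r (σ.map CBlk.dom) ++ D2) Y), EqG c d →
        EqG (c.act D1 D2 (CBlk.path τ)) (d.act D1 D2 ((CBlk.path σ).scaled r))
  | [], τ, h => by
    have : τ = [] := by simpa using h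
    subst this
    refine ⟨[], rfl, rfl, fun D1 D2 Y c d e => ?_⟩
    exact (Act.act_nil (A := actG R) ..).trans (e.trans (.symm (Act.act_nil (A := actG R) ..)))
  | (s, X) :: E, τ, h => by
    match τ, h with
    | ⟨t, Y, K, a, ha⟩ :: τ, h =>
      have h' := h
      simp only [List.map_cons, scale_cons, List.cons.injEq, CBlk.dom, Prod.mk.injEq] at h'
      obtain ⟨⟨rfl, rfl⟩, h'⟩ := h'
      obtain ⟨σ, hσ, e, H⟩ := exists_unscale r E τ h'
      refine ⟨⟨s, Y, K, a, ha⟩ :: σ, by simp [CBlk.dom, hσ], by simp [CBlk.cod, e, scale_scale], ?_⟩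
      intro D1 D2 Z c d e
      refine .trans (Path.act_par_cons (A := actG R) ..) ?_
      rw [CBlk.path, Path.par, Path.scaled_trans]
      refine .trans ?_ (.symm (Act.act_trans (A := actG R) ..))
      refine .trans ?_ (.symm (Path.act_scaled_inside (A := actG R) _ _ _ _ _ _ _ _
        (Act.E_cast (A := actG R) _ ◾)))
      refine .trans (H _ _ _ _ (GS.cast (GS.cut (r * s) D1 (scale r (σ.map CBlk.dom) ++ D2) a
        (d.cast (by simp [CBlk.dom]))) (by simp [CBlk.cod, scale_scale])) ?_)
        (Act.act_congr (A := actG R) _ ?_ rfl (.trans ?_ (Act.E_cast (A := actG R) ..)))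
      · refine .trans (Act.cast_E (A := actG R) ..) (.cR ?_ _)
        refine .trans (CBlk.run_step ..) (GS.cut_congr rfl (by simp [h', hσ]) ?_)
        exact .trans (Act.cast_E (A := actG R) ..) (.cR e _)
      · simp [CBlk.cod, scale_scale]
      · refine .symm (.trans (Path.act_scaled_inside (A := actG R) _ _ _ _ _ _ _ _
          (Act.E_cast (A := actG R) _ ◾)) ?_)
        refine .trans (Path.act_scaled_single (A := actG R) ..) (.cR ?_ _)
        refine .trans (.cast_left (GS.cut ..) _) (GS.cut_congr ◾ rfl ?_)
        exact .trans (.symm (Act.E_cast (A := actG R) ..)) (.cR (.refl _) _)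

lemma Reducible.step [MulRightMono R] {P Q : GCtx R} (st : GStep P Q) (hst : st.IsAtom)
    (D1 D2) {Y} {c : GS (D1 ++ P ++ D2) Y} (hc : Reducible c) :
    Reducible (st.runG D1 D2 c) := by
  intro σ d hσ hd
  obtain ⟨σ', σ2, rfl, hσ', rfl⟩ := List.map_eq_append_iff.1 hσ.symm
  obtain ⟨σ1, τ, rfl, rfl, rfl⟩ := List.map_eq_append_iff.1 hσ'
  obtain ⟨τ', rfl, q, hq, e⟩ := canon_step st hst τ rfl
  -- the substitution into the premise
  let y1 : GS (σ1.flatMap CBlk.cod ++ τ'.map CBlk.dom ++ (σ2.map CBlk.dom)) Y :=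
    (GS.act [] (τ'.map CBlk.dom ++ (σ2.map CBlk.dom)) (CBlk.path σ1) (c.cast ◾)).cast ◾
  let y2 : GS (σ1.flatMap CBlk.cod ++ τ'.flatMap CBlk.cod ++ (σ2.map CBlk.dom)) Y := y1.act _ _ (CBlk.path τ')
  have hy : Canon (GS.act [] [] (CBlk.path (σ1 ++ τ' ++ σ2)) (c.cast ◾)) :=
    hc _ _ ◾ (EqG.cast_left ..).symm
  have hy' := hy.of_eq ◾ (Path.act_par_three (A := actG R) (b := Y) (f := CBlk.dom)
    (g := CBlk.cod) (st := CBlk.step)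
    (d := c.cast ◾) (x1 := y1) (x2 := y2.cast ◾)
    (EqG.cL (EqG.cR (.refl _) _) _) (EqG.cast_left ..) (EqG.cast_left ..))
  -- the substitution into the conclusion
  have e1 := comm_of_cut_left (CBlk.path_all σ1) (.single st) [] [] (σ2.map CBlk.dom) (c.cast ◾)
    (c.cast ◾) (y1.cast ◾) ((st.runG (σ1.map CBlk.dom) (σ2.map CBlk.dom) c).cast ◾)
    (EqG.cL (EqG.cR (.refl _) _) _)
    (.cL (.cL (Act.act_congr (A := actG R) _ rfl ◾ (EqG.cL (EqG.cR (.refl _) _) _)) _) _)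
    (EqG.cL (EqG.symm (Act.act_single' (A := actG R) _ ◾ ◾ (.cast_left ..))) _)
  have e2 := e (σ1.flatMap CBlk.cod) (σ2.map CBlk.dom) Y y1
  have e3 := comm_of_cut_right (CBlk.path_all σ2) q (σ1.flatMap CBlk.cod) [] []
    (y2.cast ◾) (y2.cast ◾)
    ((y2.act _ _ q).cast ◾)
    ((GS.act (σ1.flatMap CBlk.cod ++ τ'.flatMap CBlk.cod) [] (CBlk.path σ2) (y2.cast ◾)).cast ◾)
    (EqG.cL (EqG.cR (.refl _) _) _)
    (EqG.cL (Act.act_congr (A := actG R) _ rfl ◾ (EqG.cR (.refl _) _)) _)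
    (.cL (Act.act_congr (A := actG R) _ ◾ rfl (EqG.cL (EqG.cR (.refl _) _) _)) _)
  refine Canon.of_eq (Canon.act hq _ _ (hy'.of_eq ◾ (EqG.cast_left _ ◾).symm))
    ◾ (.trans e3 (.symm ?_))
  refine .trans (Path.act_par_three (A := actG R) (b := Y) (f := CBlk.dom) (g := CBlk.cod) (st := CBlk.step)
    (d := (st.runG (σ1.map CBlk.dom) (σ2.map CBlk.dom) c).cast ◾)
    (x1 := (st.runG (σ1.flatMap CBlk.cod) (σ2.map CBlk.dom) y1)) (x2 := (y2.act _ _ q).cast ◾)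
    (hd.symm.trans (.cR (.refl _) _)) ?_ ?_) ?_
  · exact (e1.trans (Act.act_single' (A := actG R) st (D1' := σ1.flatMap CBlk.cod)
      ◾ rfl (.cast_left y1 _))).symm.trans
      (Act.act_congr (A := actG R) _ rfl ◾ (EqG.cL (EqG.cR (.refl _) _) _))
  · exact EqG.cL (EqG.symm (EqG.trans (Act.act_congr (A := actG R) _ rfl rfl
      (EqG.cR (.refl _) _)) (e2.trans (Act.act_congr (A := actG R) _ rfl rfl
      (Act.act_congr (A := actG R) _ rfl rfl (EqG.cL (.refl _) _)))))) _
  · exact Act.act_congr (A := actG R) _ ◾ rfl (EqG.cL (EqG.cR (.refl _) _) _)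

lemma Reducible.act [MulRightMono R] {p : Path GStep P Q}
    (hp : p.All GStep.IsAtom) (D1 D2 : GCtx R) {c : GS (D1 ++ P ++ D2) Y}
    (hc : Reducible c) : Reducible (c.act D1 D2 p) := by
  induction p with
  | nil h => subst h; exact hc.of_eq rfl (Act.act_nil (A := actG R) _ _ _ _).symm
  | snoc p E1 E2 l hN hK ih =>
    subst hN; subst hK
    exact Reducible.of_eq (Reducible.step l hp.2 (D1 ++ E1) (E2 ++ D2) ((ih hp.1).of_eq ◾
      (Act.E_cast (A := actG R) _ ◾))) ◾
      (Act.act_snoc (A := actG R) ..).symm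

lemma Reducible.cut {r : R} {D1 D2 E} {X Y} {a : GS E X}
    {c : GS (D1 ++ [(r, X)] ++ D2) Y} (ha : Reducible a) (hc : Reducible c) :
    Reducible (.cut r D1 D2 a c) := by
  intro σ d hσ hd
  obtain ⟨σ', σ2, rfl, hσ', rfl⟩ := List.map_eq_append_iff.1 hσ.symm
  obtain ⟨σ1, τ, rfl, rfl, hτ⟩ := List.map_eq_append_iff.1 hσ'
  obtain ⟨τ', rfl, hτ', e⟩ := exists_unscale r E τ hτ
  let a' : GS (τ'.flatMap CBlk.cod) X := (GS.act [] [] (CBlk.path τ') (a.cast ◾)).cast ◾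
  have ha' : Canon a' := (ha τ' (a.cast ◾) rfl (EqG.cast_left ..).symm).of_eq ◾
    (EqG.cast_left ..).symm
  let β : CBlk R := ⟨r, X, _, a', ha'⟩
  let y1 : GS (σ1.flatMap CBlk.cod ++ [(r, X)] ++ σ2.map CBlk.dom) Y :=
    (GS.act [] ([(r, X)] ++ σ2.map CBlk.dom) (CBlk.path σ1) (c.cast ◾)).cast ◾
  have h1 := hc (σ1 ++ [β] ++ σ2) (c.cast (by simp; rfl)) (by simp; rfl) (EqG.cast_left ..).symm
  refine h1.of_eq (by simp [hτ', β, CBlk.cod]) ?_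
  refine .trans (Path.act_par_three (A := actG R) (b := Y) (f := CBlk.dom)
    (g := CBlk.cod) (st := CBlk.step) (τ := [β])
    (d := c.cast (by simp; rfl)) (x1 := y1)
    (x2 := GS.cast (.cut r (σ1.flatMap CBlk.cod) (σ2.map CBlk.dom) a' y1) (by simp [β, CBlk.cod]))
    (EqG.cL (EqG.cR (.refl _) _) _)
    (EqG.cL (Act.act_congr (A := actG R) _ rfl rfl (EqG.cL (EqG.cR (.refl _) _) _)) _)
    (EqG.cL (EqG.symm (CBlk.act_path_one β ..)) _)) (EqG.symm ?_)
  have e1 := comm_of_cut_left (CBlk.path_all σ1) (.single (.cut r a rfl)) [] [] (σ2.map CBlk.dom)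
    (c.cast ◾) (c.cast ◾) (y1.cast ◾)
    ((GS.cut r (σ1.map CBlk.dom) (σ2.map CBlk.dom) a c).cast ◾)
    (EqG.cL (EqG.cR (.refl _) _) _)
    (.cL (.cL (Act.act_congr (A := actG R) _ rfl ◾ (EqG.cL (EqG.cR (.refl _) _) _)) _) _)
    (EqG.cL (EqG.symm (Act.act_single' (A := actG R) _ ◾ ◾
      (.cast_left c ◾) |>.trans (GStep.run_cut ..))) _)
  refine Path.act_par_three (A := actG R) (b := Y) (f := CBlk.dom) (g := CBlk.cod) (st := CBlk.step)
    (d := (GS.cut r (σ1.map CBlk.dom) (σ2.map CBlk.dom) a c).cast (by simp [hτ]))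
    (x1 := (GS.cut r (σ1.flatMap CBlk.cod) (σ2.map CBlk.dom) a y1).cast (by simp [hτ]))
    (x2 := GS.cast (.cut r (σ1.flatMap CBlk.cod) (σ2.map CBlk.dom) a' y1) (by simp [hτ']))
    (hd.symm.trans (.cR (.refl _) _)) ?_ ?_ |>.trans ?_
  · refine EqG.cL (EqG.trans ?_ (e1.symm.trans (Act.act_congr (A := actG R) _ rfl
      (by simp [hτ]) (EqG.cL (EqG.cR (.refl _) _) _)))) _
    refine EqG.symm ((Act.act_single' (A := actG R) (.cut r a rfl) (D1' := σ1.flatMap CBlk.cod)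
      ◾ rfl (.cast_left y1 ◾)).trans (GStep.run_cut ..))
  · refine EqG.cL (EqG.symm ?_) _
    refine (e _ _ _ _ (GS.cut r (σ1.flatMap CBlk.cod) (σ2.map CBlk.dom) a y1) (.cast_left ..)).trans ?_
    refine .symm (.trans (.cut rfl rfl rfl ◾ (.cast_left ..) (.refl _))
      ((GS.cut_act r _ _ _ [] [] ..).trans ?_))
    refine Act.act_congr (A := actG R) _ ◾ rfl (.cL ?_ _)
    exact .cut rfl rfl rfl ◾ (.cast_left ..) (.refl _)
  · exact Act.act_congr (A := actG R) _ (by simp [hτ', β, CBlk.cod]) rfl (EqG.cL (EqG.cR (.refl _) _) _)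

lemma Reducible.tenR {D E : GCtx R} {a : GS D X} {b : GS E Y} (ha : Reducible a)
    (hb : Reducible b) : Reducible (.tenR a b) := by
  intro σ d hσ hd
  obtain ⟨σ1, σ2, rfl, rfl, rfl⟩ := List.map_eq_append_iff.1 hσ.symm
  have h1 := ha σ1 (a.cast ◾) rfl (EqG.cast_left ..).symm
  have h2 := hb σ2 (b.cast ◾) rfl (EqG.cast_left ..).symm
  refine (h1.tenR h2).of_eq ◾ (.symm ?_)
  refine (Path.act_par_append (A := actG R) σ1 σ2 [] [] _ (d.cast ◾) (EqG.cR (.refl _) _)).trans ?_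
  refine .trans (Act.act_congr (A := actG R) (b := .tensor ..)
    (D1' := [] ++ σ1.flatMap CBlk.cod ++ [] ++ []) (c' := GS.cast (.tenR (GS.act [] []
      (CBlk.path σ1) (a.cast ◾)) (b.cast ◾)) ◾) _ ◾ rfl ?_)
    (GS.act_cut_tenR_snd (CBlk.path_all σ2) [] [] _ _ _ (.cast_left ..))
  refine .trans (Act.cast_E (A := actG R) ..) (.cR (.trans (Act.act_congr (A := actG R)
    (D2' := [] ++ ([] ++ σ2.map CBlk.dom ++ [])) _ rfl ◾ (Act.E_cast _ ◾))
    (GS.act_cut_tenR_fst (CBlk.path_all σ1) [] [] _ _ _ ?_)) _)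
  refine .trans (Act.cast_E (A := actG R) ..) (.cL (.trans hd.symm ?_) _)
  exact .tenR ◾ ◾ (.cR (.refl _) _) (.cR (.refl _) _)

lemma reducible [MulRightMono R] : ∀ {Δ : GCtx R} {Y : GTy R} (c : GS Δ Y), Reducible c
  | _, _, .id X => by
    intro σ d hσ hd
    match σ, hσ with
    | [⟨r, Z, E, a, ha⟩], hσ =>
      simp only [List.map_cons, List.map_nil, CBlk.dom, List.cons.injEq, Prod.mk.injEq, and_true] at hσ
      obtain ⟨rfl, rfl⟩ := hσ
      refine ha.of_eq (by simp [CBlk.cod]) (.symm ?_)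
      refine (CBlk.act_path_one ..).trans ?_
      exact (GS.cut_congr rfl rfl hd.symm).trans (EqG.cut_id_right a)
  | _, _, .unitR => by
    intro σ d hσ hd
    obtain rfl : σ = [] := by simpa using hσ.symm
    exact Canon.unitR.of_eq rfl (hd.trans (.symm (Act.act_nil (A := actG R) ..)))
  | _, _, .tenR a b => (reducible a).tenR (reducible b)
  | _, _, .linR m => by
    intro σ d hσ hd
    refine (Canon.linR (MS.act [] [] (CBlk.path σ) (m.cast (by simp [hσ]) rfl))).of_eq rfl ?_
    refine .trans (GS.act_cut_linR (CBlk.path_all σ) ..).symm ?_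
    refine Act.act_congr (A := actG R) _ rfl rfl (.trans ?_ hd)
    exact .linR (by simp [hσ]) (.cast_left ..)
  | _, _, .left l D1 D2 c => Reducible.step (.left l) trivial D1 D2 (reducible c)
  | _, _, .cut r D1 D2 a c => (reducible a).cut (reducible c)
  | _, _, .sub h c => by
    obtain ⟨p, hp, e⟩ := exists_sub_path h
    refine Reducible.of_eq (Reducible.act hp [] [] (c := c.cast ◾) ((reducible c).of_eq
      ◾ (EqG.cast_left ..).symm)) ◾ (EqG.trans (e ..).symm ?_)
    exact .sub _ _ ◾ ◾ (.cast_left ..)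

end Canon

section Encapsulation

variable {R : Type u} [Semiring R] [Preorder R]

lemma canon_id : ∀ X : GTy R, Canon (.id X)
  | .unit => Canon.of_eq (Canon.step (R := R) (P := []) (.left (.unit 1)) (by exact trivial) [] []
      Canon.unitR) rfl EqG.eta_unit.symm
  | .tensor X Y => Canon.of_eq (Canon.step (R := R) (P := [(1, X), (1, Y)]) (.left (.tensor 1 X Y))
      (by exact trivial) [] [] (c := GS.cast (GS.tenR (.id X) (.id Y)) rfl)
      (Canon.tenR (canon_id X) (canon_id Y))) rfl (EqG.eta_tensor X Y).symm
  | .lin A => .eqv (EqG.eta_lin A).symm (.linR _)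

def idBlk (p : R × GTy R) : CBlk R := ⟨p.1, p.2, [(1, p.2)], .id p.2, canon_id p.2⟩

lemma map_dom_idBlk (Δ : GCtx R) : (Δ.map idBlk).map CBlk.dom = Δ := by
  induction Δ with
  | nil => rfl
  | cons p Δ ih => rw [List.map_cons, List.map_cons, ih]; rfl

lemma act_idBlk (Δ : GCtx R) : ∀ (D1 D2 : GCtx R) {Y : GTy R} (c : GS (D1 ++ (Δ.map idBlk).map CBlk.dom ++ D2) Y),
    EqG (c.act D1 D2 (CBlk.path (Δ.map idBlk))) c := by
  induction Δ with
  | nil => exact fun D1 D2 Y c => Act.act_nil (A := actG R) _ _ _ _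
  | cons p Δ ih =>
    intro D1 D2 Y c
    refine .trans (Path.act_par_cons (A := actG R) ..) ?_
    refine .trans (ih ..) ?_
    refine .trans (Act.cast_E (A := actG R) ..) (.trans (CBlk.run_step ..) ?_)
    exact (EqG.cut_id_left ..).trans (Act.cast_E (A := actG R) ..)

lemma canon [MulLeftMono R] [MulRightMono R] {Δ : GCtx R} {X : GTy R} (c : GS Δ X) : Canon c :=
  (reducible c (Δ.map idBlk) (c.cast (by rw [map_dom_idBlk]; simp)) (map_dom_idBlk Δ).symm
    (EqG.cast_left ..).symm).of_eq (by simp [idBlk, CBlk.cod, List.flatMap_map])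
    ((act_idBlk ..).trans (.cast_left ..))

lemma GLeft.scaled_one {P Q : GCtx R} (l : GLeft P Q) : HEq (l.scaled 1) l := by
  cases l with
  | unit r => show HEq (GLeft.unit (1 * r)) (GLeft.unit r); rw [one_mul]
  | tensor r X Y => show HEq (GLeft.tensor (1 * r) X Y) (GLeft.tensor r X Y); rw [one_mul]
  | weak r X h =>
    have : ∀ (s : R) (h' : s = 0), s = r → HEq (GLeft.weak s X h') (GLeft.weak r X h) := by
      rintro s h' rfl; rfl
    exact this (1 * r) _ (one_mul r)
  | cont r1 r2 r X h =>
    have : ∀ (s1 s2 s : R) (h' : s = s1 + s2), s1 = r1 → s2 = r2 → s = r →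
        HEq (GLeft.cont s1 s2 s X h') (GLeft.cont r1 r2 r X h) := by
      rintro s1 s2 s h' rfl rfl rfl; rfl
    exact this (1 * r1) (1 * r2) (1 * r) _ (one_mul _) (one_mul _) (one_mul _)
  | ex a b =>
    show HEq (GLeft.ex (1 * a.1, a.2) (1 * b.1, b.2)) (GLeft.ex a b)
    rw [one_mul, one_mul]

lemma EqG.left_heq {P Q P' Q' : GCtx R} {l : GLeft P Q} {l' : GLeft P' Q'} (hP : P = P')
    (hQ : Q = Q') (hl : HEq l l')
    (h1 : D1 = D1') (h2 : D2 = D2') {a : GS (D1 ++ P ++ D2) X} {a' : GS (D1' ++ P' ++ D2') X}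
    (e : EqG a a') : EqG (.left l D1 D2 a) (.left l' D1' D2' a') := by
  subst hP; subst hQ; subst hl; exact .left _ h1 h2 e

lemma EqM.left_heq {P Q P' Q' : GCtx R} {l : GLeft P Q} {l' : GLeft P' Q'} (hP : P = P')
    (hQ : Q = Q') (hl : HEq l l')
    (h1 : D1 = D1') (h2 : D2 = D2') {a : MS (D1 ++ P ++ D2) Γ B} {a' : MS (D1' ++ P' ++ D2') Γ B}
    (e : EqM a a') : EqM (.left l D1 D2 a) (.left l' D1' D2' a') := by
  subst hP; subst hQ; subst hl; exact .left _ h1 h2 rfl e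

variable [MulLeftMono R]

lemma GStep.runG_scaled_one {P Q : GCtx R} (st : GStep P Q)
    (h1 : D1 = D1') (h2 : D2 = D2') {c : GS (D1 ++ scale 1 P ++ D2) Y}
    {d : GS (D1' ++ P ++ D2') Y} (e : EqG c d) :
    EqG ((st.scaled 1).runG D1 D2 c) (st.runG D1' D2' d) := by
  cases st with
  | left l => exact .left_heq ◾ ◾ l.scaled_one h1 h2 e
  | cut r a hQ => exact .cL (.cR (.cut ◾ h1 h2 rfl (.refl _) e) _) _
  | sub h => exact .sub _ _ (by simp [h1, h2]) (by simp [h1, h2]) e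

lemma GStep.runM_scaled_one {P Q : GCtx R} (st : GStep P Q)
    (h1 : D1 = D1') (h2 : D2 = D2') {c : MS (D1 ++ scale 1 P ++ D2) Γ B}
    {d : MS (D1' ++ P ++ D2') Γ B} (e : EqM c d) :
    EqM ((st.scaled 1).runM D1 D2 c) (st.runM D1' D2' d) := by
  cases st with
  | left l => exact .left_heq ◾ ◾ l.scaled_one h1 h2 e
  | cut r a hQ =>
    exact .cL (.cR (.gcut ◾ h1 h2 rfl rfl (.refl _) e) _ rfl) _ rfl
  | sub h => exact .sub _ _ (by simp [h1, h2]) (by simp [h1, h2]) rfl e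

lemma GS.act_scaled_one {P Q : GCtx R} (p : Path GStep P Q)
    (h1 : D1 = D1') (h2 : D2 = D2') {c : GS (D1 ++ scale 1 P ++ D2) Y}
    {d : GS (D1' ++ P ++ D2') Y} (e : EqG c d) :
    EqG (GS.act D1 D2 (p.scaled 1) c) (GS.act D1' D2' p d) := by
  induction p with
  | nil h =>
    exact (Act.act_nil (A := actG R) ..).trans (e.trans (.symm (Act.act_nil (A := actG R) ..)))
  | snoc p E1 E2 l hN hK ih =>
    refine (Act.act_snoc (A := actG R) ..).trans
      (.trans ?_ (Act.act_snoc (A := actG R) ..).symm)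
    exact l.runG_scaled_one (by simp [h1]) (by simp [h2]) (Act.E.cast2 (A := actG R) ih ..)

lemma MS.act_scaled_one {P Q : GCtx R} (p : Path GStep P Q)
    (h1 : D1 = D1') (h2 : D2 = D2') {c : MS (D1 ++ scale 1 P ++ D2) Γ B}
    {d : MS (D1' ++ P ++ D2') Γ B} (e : EqM c d) :
    EqM (MS.act D1 D2 (p.scaled 1) c) (MS.act D1' D2' p d) := by
  induction p with
  | nil h =>
    exact (Act.act_nil (A := actM R) (b := (Γ, B)) ..).trans
      (e.trans (.symm (Act.act_nil (A := actM R) (b := (Γ, B)) ..)))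
  | snoc p E1 E2 l hN hK ih =>
    refine (Act.act_snoc (A := actM R) (b := (Γ, B)) ..).trans
      (.trans ?_ (Act.act_snoc (A := actM R) (b := (Γ, B)) ..).symm)
    exact l.runM_scaled_one (by simp [h1]) (by simp [h2]) (Act.E.cast2 (A := actM R) (b := (Γ, B)) ih ..)

lemma GS.cut_one_act (p : Path GStep P Q) (D1 D2 : GCtx R)
    {a : GS P X} {c : GS (D1 ++ [(1, X)] ++ D2) Y} {a' : GS Q X} {d : GS (D1 ++ P ++ D2) Y}
    (ha : EqG a' (GS.act [] [] p (a.cast ◾))) (hd : EqG d (.cut 1 D1 D2 a c)) :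
    EqG (.cut 1 D1 D2 a' c) (d.act D1 D2 p) := by
  refine .trans (.cut rfl rfl rfl ◾ ha (.refl _)) ((GS.cut_act ..).trans ?_)
  refine GS.act_scaled_one _ ◾ ◾ (.cL (.trans ?_ hd.symm) _)
  exact .cut rfl rfl rfl ◾ (.cast_left ..) (.refl _)

lemma MS.gcut_one_act (p : Path GStep P Q) (D1 D2 : GCtx R) {a : GS P X} {c : MS (D1 ++ [(1, X)] ++ D2) Γ B} {a' : GS Q X}
    {d : MS (D1 ++ P ++ D2) Γ B} (ha : EqG a' (GS.act [] [] p (a.cast ◾)))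
    (hd : EqM d (.gcut 1 D1 D2 a c)) : EqM (.gcut 1 D1 D2 a' c) (d.act D1 D2 p) := by
  refine .trans (.gcut rfl rfl rfl ◾ rfl ha (.refl _)) ((MS.gcut_act ..).trans ?_)
  refine MS.act_scaled_one _ ◾ ◾ (.cL (.trans ?_ hd.symm) _ rfl)
  exact .gcut rfl rfl rfl ◾ rfl (.cast_left ..) (.refl _)

def bunTy : List (GTy R) → GTy R
  | [] => .unit
  | X :: Zs => .tensor X (bunTy Zs)

abbrev ones (Zs : List (GTy R)) : GCtx R := Zs.map fun X => (1, X)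

def bunR : ∀ Zs : List (GTy R), GS (ones Zs) (bunTy Zs)
  | [] => .unitR
  | X :: Zs => .tenR (.id X) (bunR Zs)

def bunL : ∀ Zs : List (GTy R), Path GStep (ones Zs) [(1, bunTy Zs)]
  | [] => .single (.left (.unit 1))
  | X :: Zs => .trans (Q := [(1, X), (1, bunTy Zs)])
      (.inside [(1, X)] [] (bunL Zs) ◾ ◾) (.single (.left (.tensor 1 X (bunTy Zs))))

lemma GS.cut_bun : ∀ (Zs : List (GTy R)) (D1 D2 : GCtx R) {Y : GTy R}
    (T : GS (D1 ++ ones Zs ++ D2) Y), EqG T (.cut 1 D1 D2 (bunR Zs) (T.act D1 D2 (bunL Zs)))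
  | [], D1, D2, Y, T => by
    refine .trans ?_ (GS.cut_congr rfl rfl (.symm (Act.act_single (A := actG R) ..)))
    exact (EqG.cut_unit ..).symm
  | X :: Zs, D1, D2, Y, T => by
    refine .trans ?_ (GS.cut_congr rfl rfl (.symm (.trans
      (Act.act_trans (A := actG R) ..) (Act.act_single (A := actG R) ..))))
    refine .trans ?_ (EqG.cut_tensor ..).symm
    have e := GS.cut_bun Zs (D1 ++ [(1, X)]) D2 (T.cast (by simp [ones]))
    refine .trans (.cR (.refl _) _) (e.trans (.cut rfl ◾ rfl rfl (.refl _) ?_))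
    refine .cR (.symm ((EqG.cut_id_left ..).trans (.cL ?_ _))) _
    refine .trans (Act.act_inside (A := actG R) ..) ?_
    exact Act.act_congr (A := actG R) _ rfl rfl (.cR (Act.cast_E (A := actG R) ..) _)

lemma MS.gcut_bun : ∀ (Zs : List (GTy R)) (D1 D2 : GCtx R)
    (T : MS (D1 ++ ones Zs ++ D2) Γ B), EqM T (.gcut 1 D1 D2 (bunR Zs) (T.act D1 D2 (bunL Zs)))
  | [], D1, D2, T => by
    refine .trans ?_ (.congr_gcut _ _ _ (.refl _) (.symm (Act.act_single (A := actM R) (b := (Γ, B)) ..)))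
    exact (EqM.gcut_unit ..).symm
  | X :: Zs, D1, D2, T => by
    refine .trans ?_ (.congr_gcut _ _ _ (.refl _) (.symm (.trans (Act.act_trans (A := actM R) (b := (Γ, B)) ..)
      (Act.act_single (A := actM R) (b := (Γ, B)) ..))))
    refine .trans ?_ (EqM.gcut_tensor ..).symm
    have e := MS.gcut_bun Zs (D1 ++ [(1, X)]) D2 (T.cast (by simp [ones]) rfl)
    refine .trans (.cR (.refl _) _ rfl) (e.trans (.gcut rfl ◾ rfl rfl rfl (.refl _) ?_))
    refine .cR (.symm ((EqM.gcut_id ..).trans (.cL ?_ _ rfl))) _ rfl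
    refine .trans (Act.act_inside (A := actM R) (b := (Γ, B)) ..) ?_
    exact Act.act_congr (A := actM R) (b := (Γ, B)) _ rfl rfl
      (EqM.cR (Act.cast_E (A := actM R) (b := (Γ, B)) ..) _ rfl)

variable (R) in
structure KBlk where
  h : R × GTy R
  Z : GTy R
  k : GS [h] Z

namespace KBlk

def dom (b : KBlk R) : R × GTy R := (1, b.Z)

def cod (b : KBlk R) : GCtx R := [b.h]

def step (b : KBlk R) : GStep [b.dom] b.cod := .cut 1 b.k (by simp [cod])

abbrev path (σ : List (KBlk R)) : Path GStep (σ.map dom) (σ.flatMap cod) := .par dom cod step σ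

lemma path_all (σ : List (KBlk R)) : (path σ).All GStep.IsCut :=
  Path.par_all _ _ _ (fun _ => trivial) σ

@[simp] lemma flatMap_cod (σ : List (KBlk R)) : σ.flatMap cod = σ.map h := by
  induction σ with
  | nil => rfl
  | cons b σ ih => rw [List.flatMap_cons, ih]; rfl

lemma run_step (b : KBlk R) (D1 D2 : GCtx R) (c : GS (D1 ++ [(1, b.Z)] ++ D2) Y) :
    EqG ((actG R).run b.step D1 D2 (b := Y) c) (GS.cut 1 D1 D2 b.k c) := GStep.run_cut ..

lemma act_path_one (b : KBlk R) (D1 D2 : GCtx R) (c : GS (D1 ++ [b].map dom ++ D2) Y) :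
    EqG (GS.act D1 D2 (path [b]) c) (GS.cut 1 D1 D2 b.k c) := by
  refine .trans (Path.act_par_cons (A := actG R) ..) ?_
  refine .trans (Act.act_nil (A := actG R) ..) ?_
  refine .trans (Act.cast_E (A := actG R) ..) (.trans (run_step ..) ?_)
  exact .cut rfl rfl ◾ rfl (.refl _) (Act.cast_E (A := actG R) ..)

end KBlk

lemma exists_kblk_single (p : Path GStep P [x]) (τ' : List (KBlk R)) (hτ' : τ'.map KBlk.h = P) :
    ∃ (τ : List (KBlk R)) (_ : τ.map KBlk.h = [x]) (t : Path GStep (τ'.map KBlk.dom) (τ.map KBlk.dom)),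
      ∀ (D1 D2 : GCtx R) (Y : GTy R) (T : GS (D1 ++ τ'.map KBlk.dom ++ D2) Y),
        EqG (GS.act D1 D2 p ((T.act D1 D2 (KBlk.path τ')).cast (by simp [hτ'])))
          ((T.act D1 D2 t).act D1 D2 (KBlk.path τ)) := by
  subst hτ'
  obtain ⟨Z, κ, t, H⟩ : ∃ (Z : GTy R) (κ : GS (ones (τ'.map KBlk.Z)) Z)
      (t : Path GStep (ones (τ'.map KBlk.Z)) [(1, Z)]), ∀ (D1 D2 : GCtx R) (Y : GTy R)
        (T : GS (D1 ++ ones (τ'.map KBlk.Z) ++ D2) Y),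
        EqG T (.cut 1 D1 D2 κ (T.act D1 D2 t)) :=
    ⟨_, bunR _, bunL _, fun D1 D2 Y T => GS.cut_bun _ D1 D2 T⟩
  have hdom : τ'.map KBlk.dom = (τ'.map KBlk.Z).map (fun X => ((1 : R), X)) := by
    rw [List.map_map]; rfl
  let k : GS (τ'.map KBlk.h) Z := (GS.act [] [] (KBlk.path τ') (κ.cast (by simp [hdom]))).cast ◾
  let k' : GS [x] Z := (GS.act [] [] p (k.cast ◾)).cast ◾
  refine ⟨[⟨x, Z, k'⟩], rfl, t.recast hdom rfl, fun D1 D2 Y T => ?_⟩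
  have e := H D1 D2 Y (T.cast (by rw [hdom]))
  refine .symm (.trans (KBlk.act_path_one ..) ?_)
  have e' : EqG T (.cut 1 D1 D2 (κ.cast hdom.symm) (GS.act D1 D2 (t.recast hdom rfl) T)) := by
    refine .trans (.cR (.refl _) _) (e.trans ?_)
    refine .cut rfl rfl rfl hdom.symm (.cR (.refl _) _) (.symm ?_)
    exact Path.act_recast (A := actG R) _ _ _ rfl rfl (EqG.cR (.refl _) _)
  have e1 := GS.cut_one_act (KBlk.path τ') D1 D2 (a' := k.cast ◾) (d := T)
    (.cL (.cL (Act.act_congr (A := actG R) _ rfl rfl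
      (EqG.cL (EqG.cR (EqG.cR (.refl _) _) _) _)) _) _) e'
  refine GS.cut_one_act p D1 D2 (a := k) (.cast_left (GS.act [] [] p (k.cast ◾)) ◾) (.cL ?_ _)
  exact e1.symm.trans (.cut rfl rfl rfl ◾ (.cast_left ..) (.refl _))

end Encapsulation

section Encapsulation

variable {R : Type u} [Semiring R] [Preorder R]

abbrev uTy (p : R × GTy R) : GTy R := .lin (.grd p.1 p.2)

def uDer (p : R × GTy R) : GS [p] (uTy p) := .linR ((MS.grdR p.1 (.id p.2)).cast ◾ rfl)

def uBlk (p : R × GTy R) : KBlk R := ⟨p, _, uDer p⟩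

lemma MS.gcut_uDer_last (p : R × GTy R) (m : MS (D ++ [p]) Γ B) :
    EqM m (.gcut 1 D [] (uDer p) ((MS.linL (.grdL p.1 p.2 m)).cast ◾ rfl)) := by
  refine .trans ?_ (EqM.gcut_lin ..).symm
  refine EqM.trans ?_ (EqM.cut (h2 := by simp) rfl rfl rfl rfl (EqM.cast_left _ ◾ rfl).symm
    (.refl _))
  refine .trans ?_ (EqM.cut_grd ..).symm
  exact .trans (.cR (.refl _) _ rfl) (EqM.gcut_id ..).symm

lemma MS.exists_gcut_uDer (D1 D2 : GCtx R) (p : R × GTy R) (m : MS (D1 ++ [p] ++ D2) Γ B) :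
    ∃ m' : MS (D1 ++ [(1, uTy p)] ++ D2) Γ B, EqM m (.gcut 1 D1 D2 (uDer p) m') := by
  induction D2 using List.reverseRecOn generalizing Γ with
  | nil =>
    exact ⟨(MS.linL (.grdL p.1 p.2 (m.cast ◾ rfl))).cast ◾ rfl,
      EqM.trans (.cR (.refl _) ◾ rfl) ((MS.gcut_uDer_last p
      (m.cast ◾ rfl)).trans (.gcut rfl rfl rfl rfl rfl (.refl _) (.cL (.cR (.refl _) _ rfl) _ rfl)))⟩
  | append_singleton D2 q ih =>
    obtain ⟨n, hn⟩ := ih (.grdL q.1 q.2 (m.cast ◾ rfl))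
    refine ⟨(MS.gcut 1 (D1 ++ [(1, uTy p)] ++ D2) [] (uDer q)
      ((MS.linL n).cast ◾ rfl)).cast ◾ rfl, ?_⟩
    refine .trans (.cR (.refl _) ◾ rfl) ((MS.gcut_uDer_last (D := D1 ++ [p] ++ D2) q
        (m.cast ◾ rfl)).trans ?_)
    have e := EqM.gcut_gcut 1 1 D1 D2 [] (uDer p) (uDer q) ((MS.linL n).cast ◾ rfl)
    refine .symm (.trans ?_ (e.trans ?_))
    · exact .gcut rfl rfl ◾ rfl rfl (.refl _) (.cL (.cR
        (.gcut rfl rfl rfl rfl rfl (.refl _) (.cL (.cR (.refl _) _ rfl) _ rfl))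
        _ rfl) _ rfl)
    · refine .gcut rfl ◾ rfl rfl rfl (.refl _) (.cL ?_ _ rfl)
      refine .trans ?_ (.cR (EqM.linL ◾ rfl hn.symm) _ rfl)
      refine .trans ?_ (.cR (EqM.gcut_linL 1 D1 D2 (uDer p) n) ◾ rfl)
      exact .gcut rfl rfl ◾ rfl rfl (.refl _) (.cL (.cL (.cR (.refl _) _ rfl) _ rfl) _ rfl)

lemma MS.exists_act_uBlk : ∀ (P D1 D2 : GCtx R)
    (m : MS (D1 ++ P ++ D2) Γ B), ∃ m' : MS (D1 ++ (P.map uBlk).map KBlk.dom ++ D2) Γ B,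
      EqM m (m'.act D1 D2 (KBlk.path (P.map uBlk)))
  | [], D1, D2, m => ⟨m, EqM.symm (Act.act_nil (A := actM R) (b := (Γ, B)) _ _ _ _)⟩
  | p :: P, D1, D2, m => by
    obtain ⟨m1, h1⟩ := MS.exists_act_uBlk P (D1 ++ [p]) D2 (m.cast ◾ rfl)
    obtain ⟨m2, h2⟩ := MS.exists_gcut_uDer D1 ((P.map uBlk).map KBlk.dom ++ D2) p (m1.cast ◾ rfl)
    refine ⟨m2.cast (by simp [uBlk, KBlk.dom]) rfl, EqM.trans (.cR (.refl _) ◾ rfl) (h1.trans ?_)⟩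
    refine .symm (.trans (Path.act_par_cons (A := actM R) (b := (Γ, B)) ..) ?_)
    refine Act.act_congr (A := actM R) (b := (Γ, B)) _ rfl rfl ?_
    refine .trans (Act.cast_E (A := actM R) (b := (Γ, B)) ..) (.symm ?_)
    refine .trans (.cR (.refl _) (by simp [uBlk, KBlk.cod]) rfl) (h2.trans (.symm ?_))
    refine .trans (.cast_left (MS.gcut ..) (by rw [scale_one]; rfl) rfl) ?_
    refine .gcut rfl rfl rfl rfl rfl (.refl _) ?_
    exact .trans (Act.cast_E (A := actM R) (b := (Γ, B)) ..) (.cL (.refl _) _ rfl)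

def Full {Δ : GCtx R} {Y : GTy R} (c : GS Δ Y) : Prop :=
  ∃ (σ : List (KBlk R)) (T : GS ([] ++ σ.map KBlk.dom ++ []) Y), σ.map KBlk.h = Δ ∧
    EqG c (GS.act [] [] (KBlk.path σ) T)

variable [MulLeftMono R]

lemma GS.path_gswap_congr {P P' Q Q' D1 D2 D1' D2' : GCtx R} (hP : P = P') (hQ : Q = Q')
    (h1 : D1 = D1') (h2 : D2 = D2') {c : GS (D1 ++ (P ++ Q) ++ D2) Y}
    {c' : GS (D1' ++ (P' ++ Q') ++ D2') Y} (e : EqG c c') :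
    EqG (c.path D1 D2 (gswap P Q)) (c'.path D1' D2' (gswap P' Q')) := by
  subst hP; subst hQ; subst h1; subst h2
  exact (GS.path_eq ..).trans ((Act.act_congr (A := actG R) _ rfl rfl e).trans (GS.path_eq ..).symm)

lemma KBlk.act_path_two (b b' : KBlk R) (D1 D2 : GCtx R) (c : GS (D1 ++ [b, b'].map dom ++ D2) Y) :
    EqG (GS.act D1 D2 (KBlk.path [b, b']) c) (GS.cut 1 (D1 ++ [b.h]) D2 b'.k
        ((GS.cut 1 D1 ([(1, b'.Z)] ++ D2) b.k (c.cast (by simp [KBlk.dom]))).cast ◾)) := by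
  refine .trans (Path.act_par_cons (A := actG R) ..) ?_
  refine .trans (KBlk.act_path_one ..) (.cut rfl rfl rfl rfl (.refl _) ?_)
  refine .trans (Act.cast_E (A := actG R) ..) (.trans (KBlk.run_step ..) (.cR ?_ _))
  exact .cut rfl rfl (by simp [KBlk.dom]) rfl (.refl _) (.cR (Act.cast_E (A := actG R) ..) _)

lemma kblk_step (st : GStep P Q) (hst : st.IsAtom) (τ' : List (KBlk R)) (hτ' : τ'.map KBlk.h = P) :
    ∃ (τ : List (KBlk R)) (_ : τ.map KBlk.h = Q) (t : Path GStep (τ'.map KBlk.dom) (τ.map KBlk.dom)),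
      ∀ (D1 D2 : GCtx R) (Y : GTy R) (T : GS (D1 ++ τ'.map KBlk.dom ++ D2) Y),
        EqG (st.runG D1 D2 ((T.act D1 D2 (KBlk.path τ')).cast (by simp [hτ'])))
          ((T.act D1 D2 t).act D1 D2 (KBlk.path τ)) := by
  have one : ∀ {x : R × GTy R}, Q = [x] → ∃ (τ : List (KBlk R)) (_ : τ.map KBlk.h = Q)
      (t : Path GStep (τ'.map KBlk.dom) (τ.map KBlk.dom)),
      ∀ (D1 D2 : GCtx R) (Y : GTy R) (T : GS (D1 ++ τ'.map KBlk.dom ++ D2) Y),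
        EqG (st.runG D1 D2 ((T.act D1 D2 (KBlk.path τ')).cast (by simp [hτ'])))
          ((T.act D1 D2 t).act D1 D2 (KBlk.path τ)) := by
    rintro x rfl
    obtain ⟨τ, hτ, t, H⟩ := exists_kblk_single (.single st) τ' hτ'
    exact ⟨τ, hτ, t, fun D1 D2 Y T =>
      EqG.trans (.symm (Act.act_single (A := actG R) ..)) (H D1 D2 Y T)⟩
  cases st with
  | cut r a hQ => exact hst.elim
  | sub h => obtain ⟨r, s, X, hrs, hP, hQ⟩ := hst; exact one hQ
  | left l =>
    cases l with
    | unit r => exact one rfl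
    | tensor r X Y => exact one rfl
    | weak r X h => exact one rfl
    | cont r1 r2 r X h => exact one rfl
    | ex x0 y0 =>
      match τ', hτ' with
      | [⟨x, Z, k⟩, ⟨y, W, l⟩], hτ' =>
        simp only [List.map_cons, List.map_nil, List.cons.injEq, and_true] at hτ'
        obtain ⟨rfl, rfl⟩ := hτ'
        refine ⟨[⟨_, W, l⟩, ⟨_, Z, k⟩], rfl, .single (.left (.ex (1, Z) (1, W))), ?_⟩
        intro D1 D2 Y T
        refine .symm ((KBlk.act_path_two ..).trans ?_)
        let S : GS (D1 ++ [(1, Z), y] ++ D2) Y :=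
          (GS.cut 1 (D1 ++ [(1, Z)]) D2 l (T.cast (by simp [KBlk.dom]))).cast ◾
        have e1 : EqG (.cut 1 D1 ([(1, Z)] ++ D2) l ((GS.left (.ex (1, Z) (1, W)) D1 D2 T).cast
            ◾)) (.left (.ex (1, Z) y) D1 D2 S) :=
          (EqG.cut_ex_snd 1 (1, Z) D1 D2 l T).trans ((GS.path_gswap_congr rfl ◾ rfl rfl
            (.cast2 ..)).trans (gswap_single ..))
        have e2 : EqG (.cut 1 (D1 ++ [y]) D2 k ((GS.left (.ex (1, Z) y) D1 D2 S).cast ◾))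
            (.left (.ex x y) D1 D2 ((GS.cut 1 D1 ([y] ++ D2) k (S.cast ◾)).cast ◾)) :=
          (EqG.cut_ex_fst 1 y D1 D2 k S).trans ((GS.path_gswap_congr ◾ rfl rfl rfl
            (.cast2 ..)).trans (gswap_single ..))
        refine .trans (GS.cut_congr rfl rfl (.cL (.cR (.trans
          (GS.cut_congr rfl rfl (.cL (.cR (Act.act_single (A := actG R) ..) _) _))
          e1) _) _)) (e2.trans (.congr_left _ _ _ (.cL (.cR ?_ _) _)))
        refine .trans ?_ (KBlk.act_path_two ..).symm
        have e3 := GS.cut_comm 1 1 D1 [] D2 k l (c1 := T.cast (by simp [KBlk.dom]))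
          (c2 := T.cast (by simp [KBlk.dom])) (.cast2 ..)
          (.cast_left _ ◾) (.cast_left _ ◾)
        refine .trans ?_ (e3.trans ?_)
        · exact GS.cut_congr rfl ◾ (.cL (.cL (.cR (GS.cut_congr ◾ rfl (.cast2 ..)) _) _) _)
        · exact GS.cut_congr ◾ rfl (.cL (.cR (GS.cut_congr rfl rfl (.cast2 ..)) _) _)

lemma Full.step (st : GStep P Q) (hst : st.IsAtom) (D1 D2 : GCtx R) {c : GS (D1 ++ P ++ D2) Y} (hc : Full c) :
    Full (st.runG D1 D2 c) := by
  obtain ⟨σ, T, hσ, e⟩ := hc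
  obtain ⟨σ', σ2, rfl, hσ', rfl⟩ := List.map_eq_append_iff.1 hσ
  obtain ⟨σ1, τ', rfl, rfl, rfl⟩ := List.map_eq_append_iff.1 hσ'
  obtain ⟨τ, rfl, t, H⟩ := kblk_step st hst τ' rfl
  let x1 : GS (σ1.flatMap KBlk.cod ++ τ'.map KBlk.dom ++ σ2.map KBlk.dom) Y :=
    (GS.act [] (τ'.map KBlk.dom ++ σ2.map KBlk.dom) (KBlk.path σ1) (T.cast ◾)).cast ◾
  let x2 : GS (σ1.flatMap KBlk.cod ++ τ'.flatMap KBlk.cod ++ σ2.map KBlk.dom) Y := x1.act _ _ (KBlk.path τ')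
  let T' : GS (σ1.map KBlk.dom ++ τ.map KBlk.dom ++ σ2.map KBlk.dom) Y :=
    GS.act (σ1.map KBlk.dom) (σ2.map KBlk.dom) t (T.cast ◾)
  have e0 := Path.act_par_three (A := actG R) (b := Y) (f := KBlk.dom) (g := KBlk.cod)
    (st := KBlk.step) (c := T) (d := T.cast ◾) (x1 := x1) (x2 := x2.cast ◾)
    (EqG.cR (.refl _) _) (EqG.cast_left ..) (EqG.cast_left ..)
  have e1 := comm_of_cut_left (KBlk.path_all σ1) t [] [] (σ2.map KBlk.dom) (T.cast ◾)
    (T.cast ◾) (x1.cast ◾) (T'.cast ◾)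
    (EqG.cL (EqG.cR (.refl _) _) _)
    (.cL (.cL (Act.act_congr (A := actG R) _ rfl ◾ (EqG.cL (EqG.cR (.refl _) _) _)) _) _)
    (.cL (Act.act_congr (A := actG R) _ ◾ ◾ (EqG.cL (EqG.cR (.refl _) _) _)) _)
  have e2 := H (σ1.flatMap KBlk.cod) (σ2.map KBlk.dom) Y x1
  have e3 := comm_of_cut_right (KBlk.path_all σ2) (.single st) (σ1.flatMap KBlk.cod) [] []
    (x2.cast ◾) (x2.cast ◾)
    ((st.runG (σ1.flatMap KBlk.cod) (σ2.map KBlk.dom) (x2.cast ◾)).cast ◾)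
    ((GS.act (σ1.flatMap KBlk.cod ++ τ'.flatMap KBlk.cod) [] (KBlk.path σ2) (x2.cast ◾)).cast ◾)
    (EqG.cL (EqG.cR (.refl _) _) _)
    (EqG.cL (EqG.symm (Act.act_single' (A := actG R) _ rfl ◾ (EqG.cL (EqG.cR (.refl _) _) _))) _)
    (.cL (Act.act_congr (A := actG R) _ ◾ rfl (EqG.cL (EqG.cR (.refl _) _) _)) _)
  refine ⟨σ1 ++ τ ++ σ2, T'.cast ◾, by simp, ?_⟩
  refine .trans ?_ (.trans e3 (.symm (.trans (Path.act_par_three (A := actG R) (b := Y)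
    (f := KBlk.dom) (g := KBlk.cod) (st := KBlk.step) (d := T'.cast ◾)
    (x1 := x1.act (σ1.flatMap KBlk.cod) (σ2.map KBlk.dom) t)
    (x2 := (st.runG (σ1.flatMap KBlk.cod) (σ2.map KBlk.dom) (x2.cast ◾)).cast ◾)
    (EqG.cL (EqG.cR (.refl _) _) _) ?_ ?_) ?_)))
  · refine .symm (Act.act_single' (A := actG R) _ ◾ ◾ (.cL ?_ _))
    exact (e.trans e0).symm
  · refine EqG.trans (Act.act_congr (A := actG R) _ ◾ rfl (EqG.cR (.refl _) _))
      (e1.symm.trans (Act.act_congr (A := actG R) _ rfl ◾ (EqG.cL (EqG.cR (.refl _) _) _)))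
  · exact .cL e2 _
  · exact Act.act_congr (A := actG R) _ ◾ rfl (EqG.cL (EqG.cR (.refl _) _) _)

lemma Full.of_eq {Δ Δ' : GCtx R} {c : GS Δ Y} {c' : GS Δ' Y} (hc : Full c)
    (h : Δ = Δ') (e : EqG c' c) : Full c' := by
  subst h; obtain ⟨σ, T, hσ, e'⟩ := hc; exact ⟨σ, T, hσ, e.trans e'⟩

lemma Full.act {p : Path GStep P Q} (hp : p.All GStep.IsAtom) (D1 D2 : GCtx R) {c : GS (D1 ++ P ++ D2) Y} (hc : Full c) : Full (c.act D1 D2 p) := by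
  induction p with
  | nil h => subst h; exact hc.of_eq rfl (Act.act_nil (A := actG R) _ _ _ _)
  | snoc p E1 E2 l hN hK ih =>
    subst hN; subst hK
    exact Full.of_eq (Full.step l hp.2 (D1 ++ E1) (E2 ++ D2) ((ih hp.1).of_eq ◾
      (Act.cast_E (A := actG R) _ ◾))) ◾
      (Act.act_snoc (A := actG R) ..)

lemma Full.tenR {D E : GCtx R} {a : GS D X} {b : GS E Y} (ha : Full a) (hb : Full b) : Full (.tenR a b) := by
  obtain ⟨σ1, S, rfl, e1⟩ := ha
  obtain ⟨σ2, T, rfl, e2⟩ := hb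
  refine ⟨σ1 ++ σ2, (GS.tenR S T).cast ◾, by simp, EqG.symm ?_⟩
  refine (Path.act_par_append (A := actG R) σ1 σ2 [] [] _ ((GS.tenR S T).cast ◾)
    (EqG.cL (EqG.cR (.refl _) _) _)).trans ?_
  refine .trans (Act.act_congr (A := actG R) (b := .tensor ..)
    (D1' := [] ++ σ1.flatMap KBlk.cod ++ [] ++ []) (c' := GS.cast (.tenR (GS.act [] []
      (KBlk.path σ1) S) T) ◾) _ ◾ rfl ?_)
    (.trans (GS.act_cut_tenR_snd (KBlk.path_all σ2) [] [] _ _ _ (.cast_left ..)) ?_)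
  · refine .trans (Act.cast_E (A := actG R) ..) (.cR (.trans (Act.act_congr (A := actG R)
      (D2' := [] ++ ([] ++ σ2.map KBlk.dom ++ [])) _ rfl ◾ (Act.E_cast _ ◾))
      (GS.act_cut_tenR_fst (KBlk.path_all σ1) [] [] _ _ _ ?_)) _)
    refine .trans (Act.cast_E (A := actG R) ..) (.cL (.refl _) _)
  · exact .tenR ◾ ◾ e1.symm e2.symm

lemma Canon.full {Δ : GCtx R} {c : GS Δ Y} (hc : Canon c) : Full c := by
  induction hc with
  | unitR => exact ⟨[], .unitR, rfl, EqG.symm (Act.act_nil (A := actG R) (b := .unit) [] [] (P := []) rfl .unitR)⟩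
  | tenR _ _ ha hb => exact ha.tenR hb
  | @linR Δ A m =>
    obtain ⟨m', e⟩ := MS.exists_act_uBlk Δ [] [] (m.cast ◾ rfl)
    refine ⟨Δ.map uBlk, .linR m', by simp [uBlk, Function.comp_def], ?_⟩
    refine .trans ?_ (GS.act_cut_linR (KBlk.path_all _) ..).symm
    exact .linR (by simp [uBlk, Function.comp_def]) (.trans (.cR (.refl _) _ rfl) e)
  | step st hst D1 D2 _ ih =>
    cases st with
    | left l => exact ih.step (.left l) trivial D1 D2
    | cut r a hQ => exact hst.elim
    | sub h =>
      obtain ⟨p, hp, e⟩ := exists_sub_path h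
      exact (ih.act hp D1 D2).of_eq rfl (e ..)
  | eqv e _ ih => obtain ⟨σ, T, hσ, e'⟩ := ih; exact ⟨σ, T, hσ, e.symm.trans e'⟩

end Encapsulation

namespace Act

variable {α : Type u} {L : List α → List α → Type u}

structure Encaps (A : Act L) (ex : ∀ a b, L [a, b] [b, a])
    (IsBox : ∀ {P Q : List α}, L P Q → Prop) : Prop where
  encap : ∀ {b : A.β} (D1 P D2 : List α) (c : A.F b (D1 ++ P ++ D2)),
    ∃ (z : α) (s : L [z] P) (c' : A.F b (D1 ++ [z] ++ D2)),
      IsBox s ∧ A.E c (A.run s D1 D2 c')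
  push : ∀ {z : α} {P Q : List α} (s : L [z] P), IsBox s → ∀ (st : L P Q),
    ∃ s' : L [z] Q, IsBox s' ∧ ∀ {b : A.β} (D1 D2 : List α) (c : A.F b (D1 ++ [z] ++ D2)),
      A.E (A.run s' D1 D2 c) (A.run st D1 D2 (A.run s D1 D2 c))
  comm_left : ∀ {z : α} {P Q K : List α} (s : L [z] K), IsBox s → ∀ st : L P Q, A.StepComm s st
  comm_right : ∀ {z : α} {P Q K : List α} (s : L [z] K), IsBox s → ∀ st : L P Q, A.StepComm st s
  ex_snd : ∀ {z : α} {P : List α} (s : L [z] P), IsBox s → ∀ {b : A.β} (x : α) (D1 D2 : List α)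
    (c : A.F b (D1 ++ [x, z] ++ D2)),
    A.E (A.run s D1 ([x] ++ D2) (A.cast (A.run (ex x z) D1 D2 c) ◾))
      (A.act D1 D2 (.swap ex [x] P)
        (A.cast (A.run s (D1 ++ [x]) D2 (A.cast c ◾)) ◾))

namespace Encaps

variable {A : Act L} {ex : ∀ a b, L [a, b] [b, a]} {IsBox : ∀ {P Q : List α}, L P Q → Prop}

lemma stepComm (hA : A.Encaps ex IsBox) (st : L P Q) (st' : L P' Q') : A.StepComm st st' := by
  intro b D1 D2 D3 c1 c2 d1 d2 hc h1 h2
  obtain ⟨z, s, c', hs, e⟩ := hA.encap D1 P _ c1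
  obtain ⟨s', hs', hκ⟩ := hA.push s hs st
  let d : A.F b (D1 ++ [z] ++ (D2 ++ Q' ++ D3)) :=
    A.cast (A.run st' (D1 ++ [z] ++ D2) D3 (A.cast c' ◾)) ◾
  have e1 := hA.comm_left s hs st' D1 D2 D3 c' (A.cast c' ◾) (A.cast c2 ◾) d
    (E_cast ..) (E.cL (A.trans (A.symm hc) e) _) (cast_E ..)
  have e2 := hA.comm_left s' hs' st' D1 D2 D3 c' (A.cast c' ◾) d1 d
    (E_cast ..) (A.trans h1 (A.trans (A.run_congr _ _ _ e) (A.symm (hκ ..)))) (cast_E ..)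
  refine A.trans (A.run_congr _ _ _ ?_) (A.trans (A.symm (hκ ..)) e2)
  exact A.trans h2 (A.symm (A.trans e1 (A.run_congr _ _ _ (cast_E ..))))

lemma move_natural (hA : A.Encaps ex IsBox) (x : α) (st : L P Q)
    (D1 D2) {c : A.F b (D1 ++ (x :: P) ++ D2)} {c' : A.F b (D1 ++ [x] ++ P ++ D2)}
    {d : A.F b (D1 ++ (x :: Q) ++ D2)} {d' : A.F b (D1 ++ P ++ ([x] ++ D2))} (hc : A.E c c')
    (hd : A.E d (A.run st (D1 ++ [x]) D2 c')) (hd' : A.E d' (A.act D1 D2 (.move ex x P) c)) :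
    A.E (A.act D1 D2 (.move ex x Q) d) (A.run st D1 ([x] ++ D2) d') := by
  obtain ⟨z, s, c0, hs, e⟩ := hA.encap (D1 ++ [x]) P D2 c'
  obtain ⟨s', hs', hκ⟩ := hA.push s hs st
  have key : ∀ {K} (k : L [z] K) (_ : IsBox k) (c : A.F b (D1 ++ (x :: K) ++ D2)), A.E c (A.run k (D1 ++ [x]) D2 c0) →
      A.E (A.act D1 D2 (.move ex x K) c) (A.run k D1 ([x] ++ D2)
          (A.cast (A.run (ex x z) D1 D2 (A.cast c0 ◾)) ◾)) := by
    intro K k hk c h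
    refine A.symm (A.trans (hA.ex_snd k hk x D1 D2 (A.cast c0 ◾)) ?_)
    refine A.trans (Act.act_swap_one ..) (Act.act_congr _ rfl rfl ?_)
    exact Act.E.cL (A.trans (A.run_congr _ _ _ (Act.E.cL (Act.E.cL (A.refl _) _) _)) (A.symm h)) _
  refine A.trans (key s' hs' d ?_) (A.trans (hκ ..) (A.run_congr _ _ _ (A.symm ?_)))
  · exact A.trans hd (A.trans (A.run_congr _ _ _ e) (A.symm (hκ ..)))
  · exact A.trans hd' (key s hs c (A.trans hc e))

end Encaps

end Act

section Encapsulation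

variable {R : Type u} [Semiring R] [Preorder R]

/-- Cuts at grade `1`. -/
inductive GStep.IsBox : ∀ {P Q : GCtx R}, GStep P Q → Prop
  | mk {P : GCtx R} {Z : GTy R} (κ : GS P Z) : IsBox (.cut 1 κ (scale_one P).symm)

abbrev GStep.ex (a b : R × GTy R) : GStep [a, b] [b, a] := .left (.ex a b)

variable [MulLeftMono R] [MulRightMono R]

lemma KBlk.map_dom (τ : List (KBlk R)) : τ.map KBlk.dom = ones (τ.map KBlk.Z) := by
  rw [ones, List.map_map]; rfl

lemma GS.exists_encap_kblk (σ1 τ σ2 : List (KBlk R)) (T : GS ([] ++ (σ1 ++ τ ++ σ2).map KBlk.dom ++ []) Y) :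
    ∃ (Z : GTy R) (κ : GS (τ.flatMap KBlk.cod) Z)
      (c' : GS (σ1.flatMap KBlk.cod ++ [(1, Z)] ++ σ2.flatMap KBlk.cod) Y),
      EqG (GS.act [] [] (KBlk.path (σ1 ++ τ ++ σ2)) T) (.cut 1 _ _ κ c') := by
  have hdom := KBlk.map_dom τ
  let x1 : GS (σ1.flatMap KBlk.cod ++ τ.map KBlk.dom ++ σ2.map KBlk.dom) Y :=
    (GS.act [] (τ.map KBlk.dom ++ σ2.map KBlk.dom) (KBlk.path σ1) (T.cast ◾)).cast ◾
  let x2 : GS (σ1.flatMap KBlk.cod ++ τ.flatMap KBlk.cod ++ σ2.map KBlk.dom) Y := x1.act _ _ (KBlk.path τ)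
  have e0 := Path.act_par_three (A := actG R) (b := Y) (f := KBlk.dom) (g := KBlk.cod)
    (st := KBlk.step) (c := T) (d := T.cast ◾) (x1 := x1) (x2 := x2.cast ◾)
    (EqG.cR (.refl _) _) (EqG.cast_left ..) (EqG.cast_left ..)
  have e1 := GS.cut_bun (τ.map KBlk.Z) (σ1.flatMap KBlk.cod) (σ2.map KBlk.dom) (x1.cast (by rw [hdom]))
  let y := GS.act (σ1.flatMap KBlk.cod) (σ2.map KBlk.dom) (bunL (τ.map KBlk.Z)) (x1.cast (by rw [hdom]))
  let κ : GS (τ.flatMap KBlk.cod) (bunTy (τ.map KBlk.Z)) := (GS.act [] [] (KBlk.path τ)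
    ((bunR (τ.map KBlk.Z)).cast (by simp [hdom]))).cast ◾
  have e2 : EqG (.cut 1 (σ1.flatMap KBlk.cod) (σ2.map KBlk.dom) κ y) x2 := by
    refine GS.cut_one_act (KBlk.path τ) _ _
      (a := (bunR (τ.map KBlk.Z)).cast hdom.symm) (.cL (Act.act_congr (A := actG R)
        _ rfl rfl (EqG.cL (EqG.cR (EqG.cR (.refl _) _) _) _)) _) ?_
    exact .trans (.cR (.refl _) _) (e1.trans (.cut rfl rfl rfl hdom.symm (.cR (.refl _) _) (.refl _)))
  refine ⟨_, κ, GS.cast (GS.act (σ1.flatMap KBlk.cod ++ [(1, bunTy (τ.map KBlk.Z))]) []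
    (KBlk.path σ2) (y.cast ◾)) ◾, e0.trans ?_⟩
  have e3 := comm_of_cut_right (KBlk.path_all σ2) (.single (.cut 1 κ (scale_one _).symm))
    (σ1.flatMap KBlk.cod) [] [] (y.cast ◾) (y.cast ◾)
    ((GS.cut 1 (σ1.flatMap KBlk.cod) (σ2.map KBlk.dom) κ y).cast ◾)
    ((GS.act (σ1.flatMap KBlk.cod ++ [(1, bunTy (τ.map KBlk.Z))]) [] (KBlk.path σ2)
      (y.cast ◾)).cast ◾)
    (EqG.cL (EqG.cR (.refl _) _) _)
    (EqG.cL (EqG.symm ((Act.act_single' (A := actG R) _ rfl ◾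
      (.cast_left y _)).trans (GStep.run_cut ..))) _)
    (.cL (Act.act_congr (A := actG R) _ ◾ rfl (EqG.cL (EqG.cR (.refl _) _) _)) _)
  refine .trans ?_ (e3.symm.trans ((Act.act_single' (A := actG R) (.cut 1 κ (scale_one _).symm) rfl
    ◾ (EqG.cL (EqG.cR (.refl _) _) _)).trans (GStep.run_cut ..)))
  exact Act.act_congr (A := actG R) _ ◾ rfl (.cL (.cR e2.symm _) _)

lemma GS.exists_encap (D1 P D2) (c : GS (D1 ++ P ++ D2) Y) :
    ∃ (Z : GTy R) (κ : GS P Z) (c' : GS (D1 ++ [(1, Z)] ++ D2) Y), EqG c (.cut 1 D1 D2 κ c') := by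
  obtain ⟨σ, T, hσ, e⟩ := (MGL.canon c).full
  obtain ⟨σ', σ2, rfl, hσ', rfl⟩ := List.map_eq_append_iff.1 hσ
  obtain ⟨σ1, τ, rfl, rfl, rfl⟩ := List.map_eq_append_iff.1 hσ'
  obtain ⟨Z, κ, c', e'⟩ := GS.exists_encap_kblk σ1 τ σ2 T
  refine ⟨Z, κ.cast ◾, c'.cast ◾, e.trans (e'.trans ?_)⟩
  exact .cut rfl ◾ ◾ ◾ (.cR (.refl _) _) (.cR (.refl _) _)

lemma MS.exists_encap (D1 P D2) (m : MS (D1 ++ P ++ D2) Γ B) :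
    ∃ (Z : GTy R) (κ : GS P Z) (m' : MS (D1 ++ [(1, Z)] ++ D2) Γ B), EqM m (.gcut 1 D1 D2 κ m') := by
  obtain ⟨m', e⟩ := MS.exists_act_uBlk P D1 D2 m
  have hP : (P.map uBlk).flatMap KBlk.cod = P := by simp [uBlk, Function.comp_def]
  have hdom := KBlk.map_dom (P.map uBlk)
  let κ : GS ((P.map uBlk).flatMap KBlk.cod) (bunTy ((P.map uBlk).map KBlk.Z)) :=
    (GS.act [] [] (KBlk.path (P.map uBlk)) ((bunR ((P.map uBlk).map KBlk.Z)).cast (by simp [hdom]))).cast ◾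
  have e1 := MS.gcut_bun ((P.map uBlk).map KBlk.Z) D1 D2 (m'.cast (by rw [hdom]) rfl)
  have e2 := MS.gcut_one_act (KBlk.path (P.map uBlk)) D1 D2 (a' := κ) (d := m')
      (a := (bunR ((P.map uBlk).map KBlk.Z)).cast hdom.symm)
      (.cL (Act.act_congr (A := actG R) _ rfl rfl (EqG.cL (EqG.cR (EqG.cR (.refl _) _) _) _)) _)
      (.trans (.cR (.refl _) _ rfl) (e1.trans (.gcut rfl rfl rfl hdom.symm rfl
      (.cR (.refl _) _) (.refl _))))
  exact ⟨_, κ.cast hP, _, e.trans (e2.symm.trans (.gcut rfl rfl rfl hP rfl (.cR (.refl _) _) (.refl _)))⟩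

lemma actG_encaps : (actG R).Encaps GStep.ex GStep.IsBox where
  encap D1 P D2 c := by
    obtain ⟨Z, κ, c', e⟩ := GS.exists_encap D1 P D2 c
    exact ⟨_, _, c', .mk κ, e.trans (GStep.run_cut ..).symm⟩
  push s hs st := by
    cases hs with
    | mk κ =>
      refine ⟨_, .mk ((GS.act [] [] (.single st) (κ.cast ◾)).cast ◾), ?_⟩
      intro b D1 D2 c
      refine (GStep.run_cut ..).trans ((GS.cut_one_act (.single st) D1 D2
        (.cast_left ..) ?_).trans (Act.act_single (A := actG R) ..))
      exact GStep.run_cut ..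
  comm_left s hs st := by cases hs; exact stepComm_cut_left _ _ _ _
  comm_right s hs st := by cases hs; exact stepComm_cut_right _ _ _ _
  ex_snd {z P} s hs Y x D1 D2 c := by
    cases hs with
    | mk κ =>
      refine (GStep.run_cut ..).trans ((EqG.cut_ex_snd 1 x D1 D2 κ c).trans ?_)
      refine (GS.path_gswap_congr rfl (scale_one P) rfl rfl
        (c' := GS.cast (GS.cut 1 (D1 ++ [x]) D2 κ (GS.cast c ◾)) ◾)
        (.cast2 ..)).trans ?_
      refine (GS.path_eq ..).trans ?_
      rw [gswap, Path.map_swap]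
      exact Act.act_congr (A := actG R) _ rfl rfl (.cL (.cR (GStep.run_cut ..).symm _) _)

lemma actG_act_eq {p q : Path GStep P Q} (h : ∀ (Z : GTy R) (κ : GS P Z), EqG (GS.act [] [] p (κ.cast ◾))
      (GS.act [] [] q (κ.cast ◾))) (D1 D2 : GCtx R)
    (c : GS (D1 ++ P ++ D2) Y) : EqG (c.act D1 D2 p) (c.act D1 D2 q) := by
  obtain ⟨Z, κ, c', e⟩ := GS.exists_encap D1 P D2 c
  have k : ∀ r : Path GStep P Q, EqG (c.act D1 D2 r) (.cut 1 D1 D2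
      ((GS.act [] [] r (κ.cast ◾)).cast (Δ' := Q) ◾) c') := fun r =>
    (GS.cut_one_act r D1 D2 (.cast_left ..) e).symm
  exact (k p).trans ((EqG.cut rfl rfl rfl rfl (EqG.cL (EqG.cR (h Z κ) _) _) (.refl _)).trans (k q).symm)

lemma actM_act_eq {p q : Path GStep P Q} (h : ∀ (Z : GTy R) (κ : GS P Z), EqG (GS.act [] [] p (κ.cast ◾))
      (GS.act [] [] q (κ.cast ◾))) (D1 D2 : GCtx R)
    (c : MS (D1 ++ P ++ D2) Γ B) : EqM (c.act D1 D2 p) (c.act D1 D2 q) := by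
  obtain ⟨Z, κ, c', e⟩ := MS.exists_encap D1 P D2 c
  have k : ∀ r : Path GStep P Q, EqM (c.act D1 D2 r) (.gcut 1 D1 D2
      ((GS.act [] [] r (κ.cast ◾)).cast (Δ' := Q) ◾) c') := fun r =>
    (MS.gcut_one_act r D1 D2 (.cast_left ..) e).symm
  exact (k p).trans ((EqM.gcut rfl rfl rfl rfl rfl (EqG.cL (EqG.cR (h Z κ) _) _) (.refl _)).trans (k q).symm)

lemma GStep.run_gcut (a : GS E X) (hQ : Q = scale r E) (D1 D2) (c : MS (D1 ++ [(r, X)] ++ D2) Γ B) :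
    EqM ((actM R).run (.cut r a hQ) D1 D2 (b := (Γ, B)) c) (.gcut r D1 D2 a c) :=
  EqM.cast_left _ _ rfl

lemma stepComm_gcut_left (r : R) (a : GS E X)
    (hK : K = scale r E) (st : GStep P Q) : (actM R).StepComm (.cut r a hK) st := by
  subst hK
  rintro ⟨Γ, B⟩ D1 D2 D3 c1 c2 d1 d2 hc h1 h2
  have key : EqM (MS.gcut r D1 (D2 ++ Q ++ D3) a ((st.runM (D1 ++ [(r, X)] ++ D2) D3 c2).cast
      ◾ rfl)) (st.runM (D1 ++ scale r E ++ D2) D3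
        ((MS.gcut r D1 (D2 ++ P ++ D3) a (c2.cast ◾ rfl)).cast ◾ rfl)) := by
    cases st with
    | left l => exact .gcut_left_after _ _ _ _ _ _ _
    | cut s b hQ =>
      subst hQ
      exact .gcut_gcut ..
    | sub h =>
      have e := EqM.sub_gcut (le_refl r) (CtxLe.refl D1) (CtxLe.refl E) (h.inside D2 D3)
        (h := by simpa using CtxLe.inside (D1 ++ [(r, X)] ++ D2) D3 h)
        (h' := by simpa using CtxLe.inside (D1 ++ scale r E ++ D2) D3 h)
        a (c2.cast ◾ rfl)
      refine .trans ?_ (e.symm.trans (.sub _ _ ◾ ◾ rfl (.cR (.refl _) _ rfl)))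
      refine .congr_gcut _ _ _ (EqG.sub_refl ..).symm (.cL ?_ _ rfl)
      exact .sub _ _ ◾ ◾ rfl (.cR (.refl _) _ rfl)
  refine .trans (.congr_gcut _ _ _ (.refl _) ?_) (key.trans (Act.run_congr (actM R) (b := (Γ, B)) _ _ _ ?_))
  · exact .cR h2 _ rfl
  · exact EqM.cL ((EqM.congr_gcut _ _ _ (.refl _) (EqM.cL hc.symm _ rfl)).trans h1.symm) _ rfl

lemma stepComm_gcut_right (r : R) (a : GS E X)
    (hK : K = scale r E) (st : GStep P Q) : (actM R).StepComm st (.cut r a hK) := by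
  subst hK
  rintro ⟨Γ, B⟩ D1 D2 D3 c1 c2 d1 d2 hc h1 h2
  have key : EqM (MS.gcut r (D1 ++ Q ++ D2) D3 a ((st.runM D1 (D2 ++ [(r, X)] ++ D3) c1).cast
      ◾ rfl)) (st.runM D1 (D2 ++ scale r E ++ D3)
        ((MS.gcut r (D1 ++ P ++ D2) D3 a (c1.cast ◾ rfl)).cast ◾ rfl)) := by
    cases st with
    | left l => exact .gcut_left_before _ _ _ _ _ _ _
    | cut s b hQ =>
      subst hQ
      have e := EqM.gcut_gcut s r D1 D2 D3 b a (c1.cast ◾ rfl)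
      refine .trans ?_ (e.symm.trans (.refl _))
      exact .congr_gcut _ _ _ (.refl _) (.cL (.cR (.congr_gcut _ _ _ (.refl _)
        (.cR (.cR (.refl _) _ rfl) _ rfl)) _ rfl) _ rfl)
    | sub h =>
      have e := EqM.sub_gcut (le_refl r) (h.inside D1 D2) (CtxLe.refl E) (CtxLe.refl D3)
        (h := by simpa using CtxLe.inside D1 (D2 ++ [(r, X)] ++ D3) h)
        (h' := by simpa using CtxLe.inside D1 (D2 ++ scale r E ++ D3) h)
        a (c1.cast ◾ rfl)
      refine .trans ?_ (e.symm.trans (.sub _ _ ◾ ◾ rfl (.cR (.refl _) _ rfl)))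
      refine .congr_gcut _ _ _ (EqG.sub_refl ..).symm (.cL ?_ _ rfl)
      exact .sub _ _ ◾ ◾ rfl (.cR (.refl _) _ rfl)
  refine .symm (.trans (.congr_gcut _ _ _ (.refl _) ?_) (key.trans (Act.run_congr (actM R) (b := (Γ, B)) _ _ _ ?_)))
  · exact .cR h1 _ rfl
  · exact EqM.cL ((EqM.congr_gcut _ _ _ (.refl _) (EqM.cL hc _ rfl)).trans h2.symm) _ rfl

lemma MS.path_gswap_congr {P P' Q Q' D1 D2 : GCtx R} (hP : P = P') (hQ : Q = Q') {c : MS (D1 ++ (P ++ Q) ++ D2) Γ B}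
    {d : MS (D1 ++ (P' ++ Q') ++ D2) Γ B} (e : EqM c d) :
    EqM (MS.path D1 D2 (gswap P Q) c) (MS.path D1 D2 (gswap P' Q') d) := by
  subst hP; subst hQ
  refine (MS.path_eq ..).trans (.trans ?_ (MS.path_eq ..).symm)
  exact Act.act_congr (A := actM R) (b := (Γ, B)) _ rfl rfl e

lemma actM_encaps : (actM R).Encaps GStep.ex GStep.IsBox where
  encap {b} D1 P D2 c := by
    obtain ⟨Γ, B⟩ := b
    obtain ⟨Z, κ, c', e⟩ := MS.exists_encap D1 P D2 c
    exact ⟨_, _, c', .mk κ, e.trans (GStep.run_gcut ..).symm⟩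
  push s hs st := by
    cases hs with
    | mk κ =>
      refine ⟨_, .mk ((GS.act [] [] (.single st) (κ.cast ◾)).cast ◾), ?_⟩
      rintro ⟨Γ, B⟩ D1 D2 c
      refine (GStep.run_gcut ..).trans ((MS.gcut_one_act (.single st) D1 D2
        (.cast_left ..) ?_).trans (Act.act_single (A := actM R) (b := (Γ, B)) ..))
      exact GStep.run_gcut ..
  comm_left s hs st := by cases hs; exact stepComm_gcut_left _ _ _ _
  comm_right s hs st := by cases hs; exact stepComm_gcut_right _ _ _ _
  ex_snd {z P} s hs b x D1 D2 c := by
    obtain ⟨Γ, B⟩ := b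
    cases hs with
    | mk κ =>
      refine (GStep.run_gcut ..).trans ((EqM.gcut_ex_snd 1 x D1 D2 κ c).trans ?_)
      refine (MS.path_gswap_congr rfl (scale_one P)
        (d := MS.cast (MS.gcut 1 (D1 ++ [x]) D2 κ (MS.cast c ◾ rfl)) ◾ rfl)
        (.cL (.cR (.refl _) _ rfl) _ rfl)).trans ?_
      refine (MS.path_eq ..).trans ?_
      rw [gswap, Path.map_swap]
      exact Act.act_congr (A := actM R) (b := (Γ, B)) _ rfl rfl (EqM.cL (EqM.trans (GStep.run_gcut ..).symm
          (Act.E_cast (A := actM R) (b := (Γ, B)) ..)) _ rfl)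

lemma GS.ex_ex (a b : R × GTy R) (D1 D2 : GCtx R) (c : GS (D1 ++ [a, b] ++ D2) Y) :
    EqG (.left (.ex b a) D1 D2 (.left (.ex a b) D1 D2 c)) c := by
  have e := EqG.struct (.ex_ex a b) D1 D2 c
  refine .trans ?_ (e.trans (.cast_left ..))
  exact .cR (.left _ ◾ ◾ (.cR (.cR (.left _ ◾ ◾
      (.cR (.cR (.refl _) _) _)) _) _)) _

lemma MS.ex_ex (a b : R × GTy R) (D1 D2 : GCtx R) (c : MS (D1 ++ [a, b] ++ D2) Γ B) :
    EqM (.left (.ex b a) D1 D2 (.left (.ex a b) D1 D2 c)) c := by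
  have e := EqM.struct (.ex_ex a b) D1 D2 c
  refine .trans ?_ (e.trans (.cast_left ..))
  exact .cR (.left _ ◾ ◾ rfl (.cR (.cR (.left _ ◾ ◾ rfl
      (.cR (.cR (.refl _) _ rfl) _ rfl)) _ rfl) _ rfl)) _ rfl

end Encapsulation

/-! ## The symmetric monoidal category of sequences of rules -/

namespace Act

variable {α : Type u} {L : List α → List α → Type u}

structure Exch (A : Act L) (ex : ∀ a b, L [a, b] [b, a]) : Prop where
  stepComm : ∀ {P Q P' Q' : List α} (l : L P Q) (l' : L P' Q'), A.StepComm l l'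
  ex_ex : ∀ {b : A.β} (x y : α) (D1 D2 : List α) (c : A.F b (D1 ++ [x, y] ++ D2)),
    A.E (A.run (ex y x) D1 D2 (A.run (ex x y) D1 D2 c)) c
  move_natural : ∀ (x : α) {P Q : List α} (st : L P Q) {b : A.β} (D1 D2 : List α)
    {c : A.F b (D1 ++ (x :: P) ++ D2)} {c' : A.F b (D1 ++ [x] ++ P ++ D2)}
    {d : A.F b (D1 ++ (x :: Q) ++ D2)} {d' : A.F b (D1 ++ P ++ ([x] ++ D2))}, A.E c c' →
    A.E d (A.run st (D1 ++ [x]) D2 c') → A.E d' (A.act D1 D2 (.move ex x P) c) →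
    A.E (A.act D1 D2 (.move ex x Q) d) (A.run st D1 ([x] ++ D2) d')

variable (A : Act L)

/-- Two sequences of rules with the same action. -/
structure Same {P Q : List α} (p q : Path L P Q) : Prop where
  out : ∀ {b : A.β} (D1 D2 : List α) (c : A.F b (D1 ++ P ++ D2)),
    A.E (A.act D1 D2 p c) (A.act D1 D2 q c)

variable {A} {ex : ∀ a b, L [a, b] [b, a]}

lemma act_nil' (h : P = Q) {c : A.F b (D1 ++ P ++ D2)} {c' : A.F b D} (e : A.E c c') :
    A.E (A.act D1 D2 (.nil h) c) c' := A.trans (act_nil ..) e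

lemma act_trans' (p : Path L P Q) (q : Path L Q K) {c : A.F b (D1 ++ P ++ D2)} {c' : A.F b D}
    (e : A.E (A.act D1 D2 q (A.act D1 D2 p c)) c') :
    A.E (A.act D1 D2 (p.trans q) c) c' := A.trans (act_trans ..) e

lemma act_inside' (p : Path L P Q) (hM : M = E1 ++ P ++ E2) (hK : K = E1 ++ Q ++ E2)
    (h1 : D1 ++ E1 = D1') (h2 : E2 ++ D2 = D2')
    {c : A.F b (D1 ++ M ++ D2)} {c' : A.F b (D1' ++ P ++ D2')} (e : A.E c c') :
    A.E (A.act D1 D2 (p.inside E1 E2 hM hK) c) (A.act D1' D2' p c') :=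
  A.trans (act_inside ..) (act_congr _ h1 h2 (E.cL e _))

lemma Same.act {p q : Path L P Q} (h : A.Same p q) (h1 : D1 = D1') (h2 : D2 = D2') {c : A.F b (D1 ++ P ++ D2)}
    {c' : A.F b (D1' ++ P ++ D2')} (e : A.E c c') :
    A.E (A.act D1 D2 p c) (A.act D1' D2' q c') :=
  A.trans (h.out ..) (act_congr _ h1 h2 e)

lemma Same.trans {p p' : Path L P Q} {q q' : Path L Q K} (h : A.Same p p')
    (h' : A.Same q q') : A.Same (p.trans q) (p'.trans q') where
  out _ _ _ := act_trans' _ _ (A.trans (h'.act rfl rfl (h.out ..)) (A.symm (act_trans ..)))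

lemma Same.inside {p q : Path L P Q} (h : A.Same p q) (hM : M = E1 ++ P ++ E2) (hK : K = E1 ++ Q ++ E2) :
    A.Same (p.inside E1 E2 hM hK) (q.inside E1 E2 hM hK) where
  out _ _ c := A.trans (act_inside' p hM hK rfl rfl (c' := A.cast c (by simp [hM])) (E_cast ..))
    (A.trans (h.out ..) (A.symm (act_inside' q hM hK rfl rfl (E_cast ..))))

lemma act_move_cons (x y : α) (Q) {c : A.F b (D1 ++ (x :: y :: Q) ++ D2)} {c' : A.F b (D1 ++ [x, y] ++ (Q ++ D2))}
    {d : A.F b (D1 ++ [y] ++ (x :: Q) ++ D2)} (hc : A.E c c')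
    (hd : A.E d (A.run (ex x y) D1 (Q ++ D2) c')) :
    A.E (A.act D1 D2 (.move ex x (y :: Q)) c) (A.act (D1 ++ [y]) D2 (.move ex x Q) d) := by
  refine act_trans' _ _ (act_inside' _ _ _ rfl rfl ?_)
  refine A.trans (act_inside' _ _ _ (List.append_nil _) rfl (c' := c') hc) ?_
  exact A.trans (act_single ..) (A.symm hd)

lemma act_move_append (x : α) (P Q) : ∀ {D1 D2} {b}
    {c : A.F b (D1 ++ (x :: (P ++ Q)) ++ D2)} {c' : A.F b (D1 ++ (x :: P) ++ (Q ++ D2))}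
    {d : A.F b (D1 ++ P ++ (x :: Q) ++ D2)}, A.E c c' →
    A.E d (A.act D1 (Q ++ D2) (.move ex x P) c') →
    A.E (A.act D1 D2 (.move ex x (P ++ Q)) c) (A.act (D1 ++ P) D2 (.move ex x Q) d) := by
  induction P with
  | nil =>
    intro D1 D2 b c c' d hc hd
    exact act_congr _ ◾ rfl (A.trans hc (A.symm (A.trans hd (act_nil ..))))
  | cons y P ih =>
    intro D1 D2 b c c' d hc hd
    let c1 : A.F b (D1 ++ [x, y] ++ (P ++ Q ++ D2)) := A.cast c ◾
    let e1 : A.F b (D1 ++ [y] ++ (x :: (P ++ Q)) ++ D2) := A.cast (A.run (ex x y) D1 (P ++ Q ++ D2) c1) ◾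
    refine A.trans (act_move_cons x y (P ++ Q) (c' := c1) (d := e1) (E_cast ..) (cast_E ..)) ?_
    refine A.trans (ih (c' := A.cast e1 ◾) (d := A.cast d ◾) (E_cast ..) ?_)
      (act_congr _ ◾ rfl (cast_E ..))
    refine E.cL (A.trans hd ?_) _
    refine act_move_cons x y P (c' := A.cast c1 ◾) (E.cR (E.cR (A.symm hc) _) _) ?_
    exact E.cL (E.cL (run_congr' _ rfl ◾ (E_cast ..)) _) _

lemma act_swap_nil (Q) {c : A.F b (D1 ++ ([] ++ Q) ++ D2)}
    {c' : A.F b D} (hc : A.E c c') : A.E (A.act D1 D2 (.swap ex [] Q) c) c' := act_nil' _ hc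

lemma act_swap_cons (x : α) (P Q) {c : A.F b (D1 ++ (x :: P ++ Q) ++ D2)} {c' : A.F b (D1 ++ [x] ++ (P ++ Q) ++ D2)}
    {d : A.F b (D1 ++ (x :: Q) ++ (P ++ D2))} (hc : A.E c c')
    (hd : A.E d (A.act (D1 ++ [x]) D2 (.swap ex P Q) c')) :
    A.E (A.act D1 D2 (.swap ex (x :: P) Q) c) (A.act D1 (P ++ D2) (.move ex x Q) d) := by
  refine act_trans' _ _ (act_inside' _ _ _ (List.append_nil _) rfl ?_)
  exact A.trans (act_inside' _ _ _ rfl rfl hc) (A.symm hd)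

lemma act_swap_append_left (P P' Q) : ∀ {D1 D2} {b}
    {c : A.F b (D1 ++ (P ++ P' ++ Q) ++ D2)} {c' : A.F b (D1 ++ P ++ (P' ++ Q) ++ D2)}
    {d : A.F b (D1 ++ (P ++ Q) ++ (P' ++ D2))}, A.E c c' →
    A.E d (A.act (D1 ++ P) D2 (.swap ex P' Q) c') →
    A.E (A.act D1 D2 (.swap ex (P ++ P') Q) c) (A.act D1 (P' ++ D2) (.swap ex P Q) d) := by
  induction P with
  | nil =>
    intro D1 D2 b c c' d hc hd
    refine A.symm (act_swap_nil _ (A.trans hd ?_))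
    exact act_congr _ ◾ rfl (A.symm hc)
  | cons x P ih =>
    intro D1 D2 b c c' d hc hd
    let e := A.act (D1 ++ [x]) D2 (.swap ex (P ++ P') Q) (A.cast c ◾)
    refine A.trans (act_swap_cons x (P ++ P') Q (c' := A.cast c ◾)
      (d := A.cast e ◾) (E_cast ..) (cast_E ..)) ?_
    refine A.symm (A.trans (act_swap_cons x P Q (c' := A.cast d ◾)
      (d := A.cast e ◾) (E_cast ..) ?_) (act_congr _ rfl ◾ (E.cast2 (A.refl _) ..)))
    refine E.cL (A.trans (ih (c' := A.cast c' ◾) (E.cL (E.cR hc _) _) ?_) (A.refl _)) _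
    exact E.cL (A.trans hd (act_congr _ ◾ rfl (E_cast ..))) _

namespace Exch

lemma comm (S : A.Exch ex) (p : Path L P Q) (p' : Path L P' Q') : A.Comm p p' :=
  Act.comm_of_all (φ := fun _ => True) (ψ := fun _ => True) (fun l l' _ _ => S.stepComm l l') p.all_true p'.all_true

lemma stepComm_left (S : A.Exch ex) (p : Path L P Q) (l : L P' Q') (D1 D2 D3) (c1 : A.F b (D1 ++ P ++ (D2 ++ P' ++ D3)))
    (c2 : A.F b (D1 ++ P ++ D2 ++ P' ++ D3)) (d1 : A.F b (D1 ++ Q ++ D2 ++ P' ++ D3))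
    (d2 : A.F b (D1 ++ P ++ (D2 ++ Q' ++ D3))) (hc : A.E c1 c2)
    (h1 : A.E d1 (A.act D1 (D2 ++ P' ++ D3) p c1)) (h2 : A.E d2 (A.run l (D1 ++ P ++ D2) D3 c2)) :
    A.E (A.act D1 (D2 ++ Q' ++ D3) p d2) (A.run l (D1 ++ Q ++ D2) D3 d1) :=
  A.trans (S.comm p (.single l) D1 D2 D3 c1 c2 d1 d2 hc h1
    (A.trans h2 (A.symm (act_single ..)))) (act_single ..)

lemma stepComm_right (S : A.Exch ex) (l : L P Q) (p : Path L P' Q') (D1 D2 D3) (c1 : A.F b (D1 ++ P ++ (D2 ++ P' ++ D3)))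
    (c2 : A.F b (D1 ++ P ++ D2 ++ P' ++ D3)) (d1 : A.F b (D1 ++ Q ++ D2 ++ P' ++ D3))
    (d2 : A.F b (D1 ++ P ++ (D2 ++ Q' ++ D3))) (hc : A.E c1 c2)
    (h1 : A.E d1 (A.run l D1 (D2 ++ P' ++ D3) c1)) (h2 : A.E d2 (A.act (D1 ++ P ++ D2) D3 p c2)) :
    A.E (A.run l D1 (D2 ++ Q' ++ D3) d2) (A.act (D1 ++ Q ++ D2) D3 p d1) :=
  A.trans (A.symm (act_single ..)) (S.comm (.single l) p D1 D2 D3 c1 c2 d1 d2 hc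
    (A.trans h1 (A.symm (act_single ..))) h2)

lemma path_natural (S : A.Exch ex) (x : α) (p : Path L P Q)
    (D1 D2) {c : A.F b (D1 ++ (x :: P) ++ D2)} {c' : A.F b (D1 ++ [x] ++ P ++ D2)}
    {d : A.F b (D1 ++ (x :: Q) ++ D2)} {d' : A.F b (D1 ++ P ++ ([x] ++ D2))} (hc : A.E c c')
    (hd : A.E d (A.act (D1 ++ [x]) D2 p c')) (hd' : A.E d' (A.act D1 D2 (.move ex x P) c)) :
    A.E (A.act D1 D2 (.move ex x Q) d) (A.act D1 ([x] ++ D2) p d') := by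
  induction p with
  | nil h =>
    subst h
    refine A.trans (act_congr _ rfl rfl ?_) (A.trans (A.symm hd') (A.symm (act_nil ..)))
    exact A.trans hd (A.trans (act_nil ..) (A.symm hc))
  | @snoc N X Y K p E1 E2 l hN hK ih =>
    subst hN hK
    let m0 := A.act (D1 ++ [x]) D2 p c'
    let m0' : A.F b (D1 ++ (x :: E1) ++ (X ++ E2 ++ D2)) := A.cast m0 ◾
    let m1 := A.act D1 (X ++ E2 ++ D2) (.move ex x E1) m0'
    let m1' : A.F b (D1 ++ E1 ++ (x :: X) ++ (E2 ++ D2)) := A.cast m1 ◾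
    let m2 := A.act (D1 ++ E1) (E2 ++ D2) (.move ex x X) m1'
    let m2' : A.F b (D1 ++ E1 ++ X ++ (x :: E2) ++ D2) := A.cast m2 ◾
    let n0 := A.run l (D1 ++ [x] ++ E1) (E2 ++ D2) (A.cast m0 ◾)
    let n0' : A.F b (D1 ++ (x :: E1) ++ (Y ++ E2 ++ D2)) := A.cast n0 ◾
    let n1 := A.act D1 (Y ++ E2 ++ D2) (.move ex x E1) n0'
    let n1' : A.F b (D1 ++ E1 ++ (x :: Y) ++ (E2 ++ D2)) := A.cast n1 ◾
    let n2 := A.act (D1 ++ E1) (E2 ++ D2) (.move ex x Y) n1'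
    let n2' : A.F b (D1 ++ E1 ++ Y ++ (x :: E2) ++ D2) := A.cast n2 ◾
    have hm : A.E (A.act D1 D2 (.move ex x (E1 ++ X ++ E2)) (A.cast m0 ◾))
        (A.act (D1 ++ (E1 ++ X)) D2 (.move ex x E2) (A.cast m2' ◾)) := by
      refine act_move_append x (E1 ++ X) E2 (c' := A.cast m0 ◾)
        (E.cast2 (A.refl _) ..) (E.cL (E.cL (A.symm ?_) _) _)
      refine act_move_append x E1 X (c' := A.cast m0 ◾) (E.cast2 (A.refl _) ..) ?_
      exact E.cL (act_congr _ rfl ◾ (E.cast2 (A.refl _) ..)) _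
    have hn : A.E (A.act D1 D2 (.move ex x (E1 ++ Y ++ E2)) d)
        (A.act (D1 ++ (E1 ++ Y)) D2 (.move ex x E2) (A.cast n2' ◾)) := by
      have hd' : A.E d n0 := A.trans hd (A.trans (act_snoc ..) (A.refl _))
      refine act_move_append x (E1 ++ Y) E2 (c' := A.cast n0 ◾)
        (E.cR hd' _) (E.cL (E.cL (A.symm ?_) _) _)
      refine act_move_append x E1 Y (c' := A.cast n0 ◾) (E.cast2 (A.refl _) ..) ?_
      exact E.cL (act_congr _ rfl ◾ (E.cast2 (A.refl _) ..)) _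
    have k1 : A.E n1 (A.run l (D1 ++ E1 ++ [x]) (E2 ++ D2) (A.cast m1 ◾)) := by
      have := S.stepComm_left (.move ex x E1) l D1 [] (E2 ++ D2) (A.cast m0 ◾)
        (A.cast m0 ◾) (A.cast m1 ◾) (A.cast n0 ◾) (E.cast2 (A.refl _) ..)
        (E.cL (act_congr _ rfl ◾ (E.cast2 (A.refl _) ..)) _)
        (E.cL (run_congr' _ ◾ rfl (E.cast2 (A.refl _) ..)) _)
      refine A.trans (act_congr _ rfl ◾ (E.cast2 (A.refl _) ..)) (A.trans this ?_)
      exact run_congr' _ ◾ rfl (E.cast2 (A.refl _) ..)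
    have k2 : A.E n2 (A.run l (D1 ++ E1) ([x] ++ (E2 ++ D2)) (A.cast m2 ◾)) :=
      S.move_natural x l (D1 ++ E1) (E2 ++ D2) (c := m1') (c' := A.cast m1 ◾)
        (E.cast2 (A.refl _) ..) (E.cL k1 _) (cast_E ..)
    have k3 := S.stepComm_right l (.move ex x E2) (D1 ++ E1) [] D2 (A.cast m2 ◾)
        (A.cast m2 ◾) (A.cast n2 ◾)
        (A.cast (A.act (D1 ++ E1 ++ X) D2 (.move ex x E2) m2') ◾)
        (E.cast2 (A.refl _) ..)
        (E.cL (A.trans k2 (run_congr' _ rfl ◾ (E.cast2 (A.refl _) ..))) _)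
        (E.cL (act_congr _ ◾ rfl (E.cast2 (A.refl _) ..)) _)
    have hi := ih (d := A.cast m0 ◾) (cast_E ..)
    refine A.trans hn (A.trans (act_congr _ ◾ rfl (E.cL (E.cast2 (A.refl _) ..) _))
      (A.trans (A.symm k3) (A.symm ?_)))
    refine A.trans (act_snoc ..) (run_congr' _ rfl ◾ (E.cast2 ?_ ..))
    exact A.trans (A.symm hi) (A.trans hm (act_congr _ ◾ rfl (cast_E ..)))

lemma swap_natural (S : A.Exch ex) (K) (p : Path L P Q) : ∀ {b}
    (D1 D2) {c : A.F b (D1 ++ (K ++ P) ++ D2)} {c' : A.F b (D1 ++ K ++ P ++ D2)}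
    {d : A.F b (D1 ++ (K ++ Q) ++ D2)} {d' : A.F b (D1 ++ P ++ (K ++ D2))}, A.E c c' →
    A.E d (A.act (D1 ++ K) D2 p c') → A.E d' (A.act D1 D2 (.swap ex K P) c) →
    A.E (A.act D1 D2 (.swap ex K Q) d) (A.act D1 (K ++ D2) p d') := by
  induction K with
  | nil =>
    intro b D1 D2 c c' d d' hc hd hd'
    refine act_swap_nil _ (A.trans hd (act_congr _ ◾ rfl ?_))
    exact A.trans (A.symm hc) (A.symm (A.trans hd' (act_swap_nil _ (A.refl _))))
  | cons x K ih =>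
    intro b D1 D2 c c' d d' hc hd hd'
    let e := A.act (D1 ++ [x]) D2 (.swap ex K P) (A.cast c ◾)
    let e' := A.act (D1 ++ [x]) D2 (.swap ex K Q) (A.cast d ◾)
    refine A.trans (act_swap_cons x K Q (c' := A.cast d ◾) (d := A.cast e' ◾)
      (E_cast ..) (cast_E ..)) ?_
    have h := ih (D1 ++ [x]) D2 (c := A.cast c ◾) (c' := A.cast c' ◾)
      (d := A.cast d ◾) (d' := A.cast e ◾) (E.cast2 hc ..)
      (E.cL (A.trans hd (act_congr _ ◾ rfl (E_cast ..))) _) (cast_E ..)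
    refine A.trans (S.path_natural x p D1 (K ++ D2) (c := A.cast e ◾)
      (c' := A.cast e ◾) (d' := A.cast d' ◾) (E.cast2 (A.refl _) ..)
      (E.cL h _) (E.cL (A.trans hd' ?_) _)) (act_congr _ rfl ◾ (cast_E ..))
    exact act_swap_cons x K P (E_cast ..) (cast_E ..)

lemma act_swap_append_right (S : A.Exch ex) (P Q Q') : ∀ {b} {D1 D2}
    {c : A.F b (D1 ++ (P ++ (Q ++ Q')) ++ D2)} {c' : A.F b (D1 ++ (P ++ Q) ++ (Q' ++ D2))}
    {d : A.F b (D1 ++ Q ++ (P ++ Q') ++ D2)}, A.E c c' →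
    A.E d (A.act D1 (Q' ++ D2) (.swap ex P Q) c') →
    A.E (A.act D1 D2 (.swap ex P (Q ++ Q')) c) (A.act (D1 ++ Q) D2 (.swap ex P Q') d) := by
  induction P with
  | nil =>
    intro b D1 D2 c c' d hc hd
    refine act_swap_nil _ (A.trans hc (A.symm (act_swap_nil _ (A.trans hd ?_))))
    exact act_swap_nil _ (A.refl _)
  | cons x P ih =>
    intro b D1 D2 c c' d hc hd
    let e1 := A.act (D1 ++ [x]) (Q' ++ D2) (.swap ex P Q) (A.cast c ◾)
    let e2 := A.act (D1 ++ [x] ++ Q) D2 (.swap ex P Q') (A.cast e1 ◾)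
    let f1 := A.act D1 (P ++ Q' ++ D2) (.move ex x Q) (A.cast e1 ◾)
    have h1 := ih (D1 := D1 ++ [x]) (D2 := D2) (c := A.cast c ◾)
      (c' := A.cast c ◾) (d := A.cast e1 ◾) (E.cast2 (A.refl _) ..) (cast_E ..)
    have h2 := S.comm (.move ex x Q) (.swap ex P Q') D1 [] D2 (A.cast e1 ◾)
      (A.cast e1 ◾) (A.cast f1 ◾) (A.cast e2 ◾) (E.cast2 (A.refl _) ..)
      (E.cL (act_congr _ rfl ◾ (E.cast2 (A.refl _) ..)) _)
      (E.cL (act_congr _ ◾ rfl (E.cast2 (A.refl _) ..)) _)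
    have hd' : A.E d f1 := A.trans hd (A.trans (act_swap_cons x P Q (c' := A.cast c ◾)
      (d := A.cast e1 ◾) (E.cR (A.symm hc) _) (E.cL (A.refl _) _))
      (act_congr _ rfl ◾ (E.cast2 (A.refl _) ..)))
    refine A.trans (act_swap_cons x P (Q ++ Q') (c' := A.cast c ◾) (d := A.cast e2 ◾)
      (E_cast ..) (E.cL (A.symm h1) _)) ?_
    let g := A.act D1 (Q' ++ (P ++ D2)) (.move ex x Q) (A.cast e2 ◾)
    refine A.trans (act_move_append x Q Q' (c' := A.cast e2 ◾) (d := A.cast g ◾)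
      (E.cast2 (A.refl _) ..) (cast_E ..)) ?_
    refine A.symm (act_swap_cons x P Q' (c' := A.cast f1 ◾) (E.cR hd' _) ?_)
    refine E.cL (A.trans ?_ (A.trans h2 (act_congr _ ◾ rfl (E.cast2 (A.refl _) ..)))) _
    exact act_congr _ rfl ◾ (E.cast2 (A.refl _) ..)

lemma act_swap_move (S : A.Exch ex) (x : α) (Q) : ∀ {b} {D1 D2} {c : A.F b (D1 ++ (x :: Q) ++ D2)},
    A.E (A.act D1 D2 (.swap ex Q [x]) (A.act D1 D2 (.move ex x Q) c)) c := by
  induction Q with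
  | nil =>
    intro b D1 D2 c
    exact act_swap_nil _ (act_nil ..)
  | cons y Q ih =>
    intro b D1 D2 c
    let e : A.F b (D1 ++ [y] ++ (x :: Q) ++ D2) := A.cast (A.run (ex x y) D1 (Q ++ D2) (A.cast c ◾)) ◾
    have h := ih (D1 := D1 ++ [y]) (D2 := D2) (c := e)
    have h' := act_move_cons x y Q (D1 := D1) (D2 := D2) (c := c) (c' := A.cast c ◾)
      (d := e) (E_cast ..) (cast_E ..)
    refine A.trans (act_swap_cons y Q [x] (c' := A.cast (A.act D1 D2 (.move ex x (y :: Q)) c)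
      ◾) (d := A.cast e ◾) (E_cast ..) (E.cL (A.symm (A.trans ?_ h)) _)) ?_
    · exact act_congr _ rfl rfl (E.cL h' _)
    · refine A.trans (act_move_cons y x [] (c' := A.cast e ◾)
        (d := A.cast (A.run (ex y x) D1 (Q ++ D2) (A.cast e ◾)) ◾)
        (E.cast2 (A.refl _) ..) (E.cL (run_congr' _ rfl ◾ (E.cast2 (A.refl _) ..)) _)) ?_
      refine A.trans (act_nil ..) (E.cL (A.trans (A.run_congr _ _ _ (E.cL (E.cL
        (A.refl _) _) _)) (A.trans (S.ex_ex ..) (cast_E ..))) _)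

lemma act_swap_swap (S : A.Exch ex) (P Q) : ∀ {b} {D1 D2} {c : A.F b (D1 ++ (P ++ Q) ++ D2)},
    A.E (A.act D1 D2 (.swap ex Q P) (A.act D1 D2 (.swap ex P Q) c)) c := by
  induction P with
  | nil =>
    intro b D1 D2 c
    have : ∀ (Q) {D1 D2} {c : A.F b (D1 ++ (Q ++ []) ++ D2)}, A.E (A.act D1 D2 (.swap ex Q []) c) c := by
      intro Q
      induction Q with
      | nil => intro D1 D2 c; exact act_swap_nil _ (A.refl _)
      | cons y Q ih =>
        intro D1 D2 c
        refine A.trans (act_swap_cons y Q [] (c' := A.cast c ◾)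
          (d := A.cast c ◾) (E_cast ..) (E.cL (A.symm (A.trans ih (cast_E ..))) _)) ?_
        exact A.trans (act_nil ..) (cast_E ..)
    exact A.trans (this Q) (act_swap_nil _ (A.refl _))
  | cons x P ih =>
    intro b D1 D2 c
    let e := A.act (D1 ++ [x]) D2 (.swap ex P Q) (A.cast c ◾)
    have h := act_swap_cons x P Q (D1 := D1) (D2 := D2) (c := c) (c' := A.cast c ◾)
      (d := A.cast e ◾) (E_cast ..) (cast_E ..)
    refine A.trans (S.act_swap_append_right Q [x] P (c' := A.cast
      (A.act D1 (P ++ D2) (.move ex x Q) (A.cast e ◾)) ◾) (d := A.cast e ◾)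
      (E.cR h _) (E.cL (A.symm ?_) _)) ?_
    · refine A.trans (act_congr _ rfl rfl (cast_E ..)) (A.trans (S.act_swap_move x Q) (cast_E ..))
    · exact A.trans (act_congr _ rfl rfl (cast_E ..)) (A.trans ih (cast_E ..))

end Exch

end Act

namespace Act

variable {α : Type u} {L : List α → List α → Type u} {A : Act L} {ex : ∀ a b, L [a, b] [b, a]}

/-- Lists, as the objects of a category of sequences of rules. -/
structure Ob (S : A.Exch ex) : Type u where
  list : List α

variable (A) in
def pathSetoid (P Q : List α) : Setoid (Path L P Q) where
  r p q := A.Same p q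
  iseqv := ⟨fun _ => ⟨fun _ _ _ => A.refl _⟩, fun h => ⟨fun _ _ _ => A.symm (h.out ..)⟩,
    fun h h' => ⟨fun _ _ _ => A.trans (h.out ..) (h'.out ..)⟩⟩

namespace Ob

variable {S : A.Exch ex}

instance : Category.{u} (Ob S) where
  Hom X Y := Quotient (A.pathSetoid Y.list X.list)
  id _ := ⟦.nil rfl⟧
  comp f g := Quotient.map₂ (fun p q => q.trans p) (fun _ _ h _ _ h' => Same.trans h' h) f g
  id_comp f := by
    induction f using Quotient.inductionOn
    exact Quotient.sound ⟨fun _ _ _ => act_trans' _ _ (act_nil' _ (A.refl _))⟩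
  comp_id f := by
    induction f using Quotient.inductionOn
    exact Quotient.sound ⟨fun _ _ _ => act_trans' _ _ (act_congr _ rfl rfl (act_nil' _ (A.refl _)))⟩
  assoc f g h := by
    induction f using Quotient.inductionOn
    induction g using Quotient.inductionOn
    induction h using Quotient.inductionOn
    refine Quotient.sound ⟨fun _ _ _ => ?_⟩
    beta_reduce
    exact act_trans' _ _ (act_trans' _ _ (A.symm (act_trans' _ _
      (act_congr _ rfl rfl (act_trans ..)))))

def hom (X Y : Ob S) (p : Path L Y.list X.list) : X ⟶ Y := Quotient.mk (A.pathSetoid ..) p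

lemma hom_sound {X Y : Ob S} {p q : Path L Y.list X.list} (h : A.Same p q) :
    hom X Y p = hom X Y q := Quotient.sound (s := A.pathSetoid ..) h

lemma hom_exact {X Y : Ob S} {p q : Path L Y.list X.list} (h : hom X Y p = hom X Y q) :
    A.Same p q := Quotient.exact (s := A.pathSetoid ..) h

lemma hom_surj {X Y : Ob S} (f : X ⟶ Y) : ∃ p, f = hom X Y p :=
  (Quotient.exists_rep (s := A.pathSetoid ..) f).imp fun _ h => h.symm

lemma hom_comp (p : Path L Y.list X.list) (q : Path L Z.list Y.list) :
    hom X Y p ≫ hom Y Z q = hom X Z (q.trans p) := rfl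

lemma id_eq (X : Ob S) : 𝟙 X = hom X X (.nil rfl) := rfl

lemma hom_nil {X Y : Ob S} (h : Y.list = X.list) :
    hom X Y (.nil h) = eqToHom (by cases X; cases Y; cases h; rfl) := by
  cases X; cases Y; cases h; rfl

/-- A sequence of rules without effect. -/
structure _root_.MGL.Act.Neutral (A : Act L) {P Q : List α} (p : Path L P Q) : Prop where
  out : ∀ {b : A.β} (D1 D2 : List α) (c : A.F b (D1 ++ P ++ D2)), A.E (A.act D1 D2 p c) c

lemma _root_.MGL.Act.Neutral.nil (h : P = Q) : A.Neutral (.nil h) :=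
  ⟨fun _ _ _ => act_nil _ _ _ _⟩

lemma _root_.MGL.Act.Neutral.trans {p : Path L P Q} {q : Path L Q K}
    (hp : A.Neutral p) (hq : A.Neutral q) : A.Neutral (p.trans q) :=
  ⟨fun _ _ _ => act_trans' _ _ (A.trans (hq.out ..) (hp.out ..))⟩

lemma _root_.MGL.Act.Neutral.inside {p : Path L P Q} (hp : A.Neutral p) (hM : M = E1 ++ P ++ E2) (hK : K = E1 ++ Q ++ E2) :
    A.Neutral (p.inside E1 E2 hM hK) :=
  ⟨fun _ _ c => A.trans (act_inside' p hM hK rfl rfl (c' := A.cast c (by simp [hM])) (E_cast ..))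
    (A.trans (hp.out ..) (cast_E ..))⟩

lemma _root_.MGL.Act.Neutral.same {p q : Path L P Q} (hp : A.Neutral p)
    (hq : A.Neutral q) : A.Same p q := ⟨fun _ _ _ => A.trans (hp.out ..) (A.symm (hq.out ..))⟩

@[simps] def nilIso (X Y : Ob S) (h : X.list = Y.list) : X ≅ Y where
  hom := hom X Y (.nil h.symm)
  inv := hom Y X (.nil h)
  hom_inv_id := hom_sound (((Neutral.nil _).trans (.nil _)).same (.nil _))
  inv_hom_id := hom_sound (((Neutral.nil _).trans (.nil _)).same (.nil _))

instance : MonoidalCategoryStruct (Ob S) where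
  tensorObj X Y := ⟨X.list ++ Y.list⟩
  tensorUnit := ⟨[]⟩
  whiskerLeft X _ _ f := Quotient.map (fun p => p.inside X.list [] ◾ ◾)
    (fun _ _ h => Same.inside h ..) f
  whiskerRight f Y := Quotient.map (fun p => p.inside [] Y.list ◾ ◾)
    (fun _ _ h => Same.inside h ..) f
  tensorHom {X1 Y1 X2 Y2} f g := Quotient.map₂ (fun p q =>
      Path.trans (Q := Y1.list ++ X2.list) (q.inside Y1.list [] ◾ ◾)
        (p.inside [] X2.list ◾ ◾))
    (fun _ _ h _ _ h' => Same.trans (Same.inside h' ..) (Same.inside h ..)) f g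
  associator X Y Z := nilIso _ _ ◾
  leftUnitor X := nilIso _ _ ◾
  rightUnitor X := nilIso _ _ ◾

lemma whiskerLeft_hom (X) (p : Path L Z.list Y.list) : X ◁ hom Y Z p = hom (X ⊗ Y) (X ⊗ Z)
      (p.inside X.list [] (List.append_nil _).symm (List.append_nil _).symm) := rfl

lemma whiskerRight_hom (p : Path L Y.list X.list) (Z) :
    hom X Y p ▷ Z = hom (X ⊗ Z) (Y ⊗ Z) (p.inside [] Z.list rfl rfl) := rfl

lemma tensorHom_hom (p : Path L Y1.list X1.list)
    (q : Path L Y2.list X2.list) : hom X1 Y1 p ⊗ₘ hom X2 Y2 q = hom (X1 ⊗ X2) (Y1 ⊗ Y2)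
      (Path.trans (Q := Y1.list ++ X2.list) (q.inside Y1.list []
        (List.append_nil _).symm (List.append_nil _).symm) (p.inside [] X2.list rfl rfl)) := rfl

lemma associator_eq (X Y Z : Ob S) : α_ X Y Z = nilIso _ _ (List.append_assoc ..) := rfl

lemma leftUnitor_eq (X : Ob S) : λ_ X = nilIso _ _ rfl := rfl

lemma rightUnitor_eq (X : Ob S) : ρ_ X = nilIso _ _ (List.append_nil _) := rfl

@[simp] lemma list_tensor (X Y : Ob S) : (X ⊗ Y).list = X.list ++ Y.list := rfl

@[simp] lemma list_unit : (𝟙_ (Ob S)).list = [] := rfl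

lemma act_left (p : Path L Z Y) (h1 : D1 ++ X = D1')
    (h2 : D2 = D2') {c : A.F b (D1 ++ (X ++ Z) ++ D2)} {c' : A.F b (D1' ++ Z ++ D2')}
    (e : A.E c c') : A.E (A.act D1 D2 (p.inside X [] (List.append_nil _).symm
      (List.append_nil (X ++ Y)).symm) c) (A.act D1' D2' p c') :=
  act_inside' _ _ _ h1 (by simpa using h2) e

lemma act_right (p : Path L Z Y) (h1 : D1 = D1')
    (h2 : X ++ D2 = D2') {c : A.F b (D1 ++ (Z ++ X) ++ D2)} {c' : A.F b (D1' ++ Z ++ D2')}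
    (e : A.E c c') : A.E (A.act D1 D2 (p.inside [] X rfl (K := Y ++ X) rfl) c) (A.act D1' D2' p c') :=
  act_inside' _ _ _ (by simpa using h1) h2 e

lemma act_tensor (p : Path L Y1 X1) (q : Path L Y2 X2) (h1 : D1 = D1') (h2 : X2 ++ D2 = D2')
    {c : A.F b (D1 ++ (Y1 ++ Y2) ++ D2)} {c' : A.F b (D1 ++ Y1 ++ Y2 ++ D2)}
    {d : A.F b (D1' ++ Y1 ++ D2')} (hc : A.E c c') (hd : A.E d (A.act (D1 ++ Y1) D2 q c')) :
    A.E (A.act D1 D2 (Path.trans (Q := Y1 ++ X2) (q.inside Y1 []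
        (List.append_nil _).symm (List.append_nil _).symm) (p.inside [] X2 rfl rfl)) c)
      (A.act D1' D2' p d) := by
  refine act_trans' _ _ (act_right p h1 h2 ?_)
  exact A.trans (act_left q rfl rfl hc) (A.symm hd)

instance : MonoidalCategory (Ob S) where
  tensorHom_def _ _ := by
    rename_i f g
    obtain ⟨p, rfl⟩ := hom_surj f
    obtain ⟨q, rfl⟩ := hom_surj g
    rfl
  id_tensorHom_id X Y := hom_sound (((Neutral.nil _).inside ..).trans
    ((Neutral.nil _).inside ..) |>.same (.nil _))
  tensorHom_comp_tensorHom {X1 Y1 Z1 X2 Y2 Z2} f1 f2 g1 g2 := by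
    obtain ⟨p1, rfl⟩ := hom_surj f1
    obtain ⟨p2, rfl⟩ := hom_surj f2
    obtain ⟨q1, rfl⟩ := hom_surj g1
    obtain ⟨q2, rfl⟩ := hom_surj g2
    refine hom_sound ⟨fun D1 D2 c => ?_⟩
    beta_reduce
    let a := A.act (D1 ++ Z1.list) D2 q2 (A.cast c ◾)
    let b1 := A.act D1 (Y2.list ++ D2) q1 (A.cast a ◾)
    let b2 := A.act (D1 ++ Z1.list) D2 p2 a
    let e := A.act D1 (X2.list ++ D2) q1 (A.cast b2 ◾)
    have h := S.comm q1 p2 D1 [] D2 (A.cast a ◾) (A.cast a ◾)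
      (A.cast b1 ◾) (A.cast b2 ◾) (E.cast2 (A.refl _) ..)
      (E.cL (act_congr _ rfl ◾ (E.cast2 (A.refl _) ..)) _)
      (E.cL (act_congr _ ◾ rfl (E.cR (A.refl _) _)) _)
    have h1 := act_tensor q1 q2 (D1 := D1) (D2 := D2) rfl rfl (c := c) (c' := A.cast c ◾)
      (d := A.cast a ◾) (E_cast ..) (cast_E ..)
    refine act_trans' _ _ (A.trans (act_tensor p1 p2 rfl rfl (c' := A.cast b1 ◾)
      (d := A.cast e ◾) (E.cR h1 _) (E.cL ?_ _)) (A.symm ?_))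
    · refine A.trans (A.trans (act_congr _ rfl ◾ (E.cast2 (A.refl _) ..)) h) ?_
      exact act_congr _ ◾ rfl (E.cast2 (A.refl _) ..)
    · refine A.trans (act_tensor _ _ rfl rfl (c' := A.cast c ◾) (d := A.cast b2 ◾)
        (E_cast ..) (E.cL (A.symm (act_trans ..)) _)) (act_trans' _ _ ?_)
      exact act_congr _ rfl rfl (E.cR (A.refl _) _)
  whiskerLeft_id X Y := hom_sound (((Neutral.nil _).inside ..).same (.nil _))
  id_whiskerRight X Y := hom_sound (((Neutral.nil _).inside ..).same (.nil _))
  associator_naturality {X1 X2 X3 Y1 Y2 Y3} f1 f2 f3 := by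
    obtain ⟨p1, rfl⟩ := hom_surj f1
    obtain ⟨p2, rfl⟩ := hom_surj f2
    obtain ⟨p3, rfl⟩ := hom_surj f3
    refine hom_sound ⟨fun D1 D2 c => ?_⟩
    beta_reduce
    let a := A.act (D1 ++ Y1.list ++ Y2.list) D2 p3 (A.cast c ◾)
    let e := A.act (D1 ++ Y1.list) (X3.list ++ D2) p2 (A.cast a ◾)
    refine act_trans' _ _ (A.trans (act_tensor _ p3 rfl rfl (c' := A.cast c ◾)
      (d := A.cast a ◾) (act_nil' _ (E_cast ..)) (E.cL (act_congr _ ◾ rfl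
        (E.cast2 (A.refl _) ..)) _)) ?_)
    refine A.trans (act_tensor p1 p2 rfl rfl (c' := A.cast a ◾) (d := A.cast e ◾)
      (E.cast2 (A.refl _) ..) (cast_E ..)) (A.symm (act_trans' _ _ (act_nil' _ ?_)))
    refine act_tensor p1 _ rfl ◾ (c' := A.cast c ◾) (E_cast ..) (E.cL ?_ _)
    exact A.symm (act_tensor p2 p3 rfl rfl (c' := A.cast c ◾) (E.cast2 (A.refl _) ..)
      (cast_E ..))
  leftUnitor_naturality f := by
    obtain ⟨p, rfl⟩ := hom_surj f
    refine hom_sound ⟨fun D1 D2 c => act_trans' _ _ (A.symm (act_trans' _ _ (act_nil' _ ?_)))⟩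
    exact A.symm (act_left p ◾ rfl (act_nil' _ (A.refl _)))
  rightUnitor_naturality f := by
    obtain ⟨p, rfl⟩ := hom_surj f
    refine hom_sound ⟨fun D1 D2 c => act_trans' _ _ (A.symm (act_trans' _ _ (act_nil' _ ?_)))⟩
    exact A.symm (act_right p rfl ◾ (act_nil' _ (A.refl _)))
  pentagon W X Y Z := hom_sound (by
    refine ((Neutral.trans ?_ (.inside (.nil _) ..))).same (.trans (.nil _) (.nil _))
    exact .trans (.inside (.nil _) ..) (.nil _))
  triangle X Y := hom_sound (Neutral.same (.trans (.inside (.nil _) ..) (.nil _))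
    (.inside (.nil _) ..))

@[simps] def swapIso (X Y : Ob S) : X ⊗ Y ≅ Y ⊗ X where
  hom := hom (X ⊗ Y) (Y ⊗ X) (.swap ex Y.list X.list)
  inv := hom (Y ⊗ X) (X ⊗ Y) (.swap ex X.list Y.list)
  hom_inv_id := hom_sound ⟨fun _ _ _ => act_trans' _ _ (A.trans (S.act_swap_swap ..)
    (A.symm (act_nil ..)))⟩
  inv_hom_id := hom_sound ⟨fun _ _ _ => act_trans' _ _ (A.trans (S.act_swap_swap ..)
    (A.symm (act_nil ..)))⟩

lemma swapIso_natural_left (f : X ⟶ Y) (Z : Ob S) : f ▷ Z ≫ (swapIso Y Z).hom = (swapIso X Z).hom ≫ Z ◁ f := by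
  obtain ⟨p, rfl⟩ := hom_surj f
  refine hom_sound ⟨fun D1 D2 c => act_trans' _ _ (A.symm (act_trans' _ _ ?_))⟩
  refine A.trans (S.swap_natural Z.list p D1 D2 (c' := A.cast c ◾)
    (d' := A.cast (A.act D1 D2 (.swap ex Z.list Y.list) c) ◾) (E_cast ..)
    (act_left p rfl rfl (E_cast ..)) (cast_E ..)) (A.symm ?_)
  exact act_right p rfl rfl (E_cast ..)

instance : SymmetricCategory (Ob S) where
  braiding := swapIso
  braiding_naturality_left := swapIso_natural_left
  braiding_naturality_right X Y Z f := by
    have h := swapIso_natural_left f X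
    have e1 : (swapIso X Y).hom ≫ (swapIso Y X).hom = 𝟙 _ := (swapIso X Y).hom_inv_id
    have e2 : (swapIso Z X).hom ≫ (swapIso X Z).hom = 𝟙 _ := (swapIso Z X).hom_inv_id
    calc X ◁ f ≫ (swapIso X Z).hom
        = ((swapIso X Y).hom ≫ (swapIso Y X).hom) ≫ X ◁ f ≫ (swapIso X Z).hom := by
          rw [e1, Category.id_comp]
      _ = (swapIso X Y).hom ≫ ((swapIso Y X).hom ≫ X ◁ f) ≫ (swapIso X Z).hom := by
          simp only [Category.assoc]
      _ = (swapIso X Y).hom ≫ f ▷ X := by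
          rw [← h, Category.assoc, e2, Category.comp_id]
  hexagon_forward X Y Z := hom_sound ⟨fun D1 D2 c => by
    beta_reduce
    refine act_trans' _ _ (act_nil' _ (act_trans' _ _ ?_))
    let c' : A.F _ (D1 ++ (Y.list ++ Z.list ++ X.list) ++ D2) := A.cast c ◾
    let d := A.act (D1 ++ Y.list) D2 (.swap ex Z.list X.list) (A.cast c ◾)
    refine A.trans (act_congr _ rfl rfl (act_nil' _ (E_cast _ _ : A.E c c'))) ?_
    refine A.trans (act_swap_append_left Y.list Z.list X.list (c' := A.cast c ◾)
      (d := A.cast d ◾) (E.cast2 (A.refl _) ..) (cast_E ..)) (A.symm ?_)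
    refine act_trans' _ _ (act_right _ rfl rfl (E.cR (act_trans' _ _ (act_nil' _ ?_)) _))
    exact act_left _ rfl rfl (E_cast ..)⟩
  hexagon_reverse X Y Z := hom_sound ⟨fun D1 D2 c => by
    beta_reduce
    refine act_trans' _ _ (act_nil' _ (act_trans' _ _ ?_))
    let c' : A.F _ (D1 ++ (Z.list ++ (X.list ++ Y.list)) ++ D2) := A.cast c ◾
    let d := A.act D1 (Y.list ++ D2) (.swap ex Z.list X.list) (A.cast c ◾)
    refine A.trans (act_congr _ rfl rfl (act_nil' _ (E_cast _ _ : A.E c c'))) ?_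
    refine A.trans (S.act_swap_append_right Z.list X.list Y.list (c' := A.cast c ◾)
      (d := A.cast d ◾) (E.cast2 (A.refl _) ..) (cast_E ..)) (A.symm ?_)
    refine act_trans' _ _ (act_left _ rfl rfl (E.cR (act_trans' _ _ (act_nil' _ ?_)) _))
    exact act_right _ rfl rfl (E_cast ..)⟩
  symmetry X Y := (swapIso X Y).hom_inv_id

end Ob

end Act

/-! ## The syntactic category of the graded system -/

section

variable {R : Type u} [Semiring R]

lemma GLeft.scaled_scaled (r s : R) (l : GLeft P Q) : HEq ((l.scaled s).scaled r) (l.scaled (r * s)) := by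
  cases l with
  | unit t =>
    show HEq (GLeft.unit (r * (s * t))) (GLeft.unit (r * s * t))
    rw [mul_assoc]
  | tensor t X Y =>
    show HEq (GLeft.tensor (r * (s * t)) X Y) (GLeft.tensor (r * s * t) X Y)
    rw [mul_assoc]
  | weak t X h =>
    have : ∀ (a b : R) (h : a = 0) (h' : b = 0), HEq (GLeft.weak a X h) (GLeft.weak b X h') := by
      intro a b h h'; subst h; subst h'; rfl
    exact this ..
  | cont t1 t2 t X h =>
    have : ∀ (a a1 a2 b b1 b2 : R) (h : a = a1 + a2) (h' : b = b1 + b2), a1 = b1 → a2 = b2 →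
        HEq (GLeft.cont a1 a2 a X h) (GLeft.cont b1 b2 b X h') := by
      intro a a1 a2 b b1 b2 h h' e1 e2; subst e1; subst e2; subst h; subst h'; rfl
    exact this _ _ _ _ _ _ _ _ (mul_assoc ..).symm (mul_assoc ..).symm
  | ex a b =>
    show HEq (GLeft.ex (r * (s * a.1), a.2) (r * (s * b.1), b.2)) (GLeft.ex (r * s * a.1, a.2) (r * s * b.1, b.2))
    rw [mul_assoc, mul_assoc]

variable [Preorder R] [MulLeftMono R]

lemma GStep.runG_scaled_scaled (r s : R) (st : GStep P Q) (h1 : D1 = D1') (h2 : D2 = D2')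
    {c : GS (D1 ++ scale r (scale s P) ++ D2) Y} {d : GS (D1' ++ scale (r * s) P ++ D2') Y}
    (e : EqG c d) : EqG (((st.scaled s).scaled r).runG D1 D2 c) ((st.scaled (r * s)).runG D1' D2' d) := by
  cases st with
  | left l =>
    exact .left_heq (scale_scale ..) (scale_scale ..) (l.scaled_scaled r s) h1 h2 e
  | cut t a hQ =>
    exact .cL (.cR (.cut (mul_assoc ..).symm h1 h2 rfl (.refl _) e) _) _
  | sub h =>
    exact .sub _ _ (by rw [h1, h2, scale_scale]) (by rw [h1, h2, scale_scale]) e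

lemma GS.act_scaled_scaled (r s : R) (p : Path GStep P Q) (h1 : D1 = D1') (h2 : D2 = D2')
    {c : GS (D1 ++ scale r (scale s P) ++ D2) Y} {d : GS (D1' ++ scale (r * s) P ++ D2') Y}
    (e : EqG c d) :
    EqG (GS.act D1 D2 ((p.scaled s).scaled r) c) (GS.act D1' D2' (p.scaled (r * s)) d) := by
  induction p with
  | nil h =>
    exact (Act.act_nil (A := actG R) ..).trans (e.trans (.symm (Act.act_nil (A := actG R) ..)))
  | snoc p E1 E2 l hN hK ih =>
    refine (Act.act_snoc (A := actG R) ..).trans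
      (.trans ?_ (Act.act_snoc (A := actG R) ..).symm)
    exact l.runG_scaled_scaled r s (by simp [h1, scale_scale]) (by simp [h2, scale_scale])
      (Act.E.cast2 (A := actG R) ih ..)

variable (R) in
def actC : Act (GStep (R := R)) where
  β := R × GTy R
  F b Δ := GS (scale b.1 Δ) b.2
  E := EqG
  refl := .refl
  symm := .symm
  trans := .trans
  run l D1 D2 b c := ((l.scaled b.1).runG (scale b.1 D1) (scale b.1 D2)
    (c.cast ◾)).cast ◾
  run_congr l D1 D2 b _ _ e := .cL (.cR
    ((actG R).run_congr _ _ _ (.cL (.cR e _) _)) _) _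

lemma actC_run {P Q : GCtx R} (l : GStep P Q) {D1 D2 : GCtx R} {b : R × GTy R}
    {c : GS (scale b.1 (D1 ++ P ++ D2)) b.2}
    {c' : GS (scale b.1 D1 ++ scale b.1 P ++ scale b.1 D2) b.2} (e : EqG c c') :
    EqG ((actC R).run l D1 D2 (b := b) c) ((l.scaled b.1).runG (scale b.1 D1) (scale b.1 D2) c') :=
  EqG.cL ((actG R).run_congr _ _ _ (.cL e _)) _

lemma actC_act {P Q : GCtx R} (p : Path GStep P Q) {D1 D2 : GCtx R} {b : R × GTy R}
    {c : GS (scale b.1 (D1 ++ P ++ D2)) b.2}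
    {c' : GS (scale b.1 D1 ++ scale b.1 P ++ scale b.1 D2) b.2} (e : EqG c c') :
    EqG ((actC R).act D1 D2 (b := b) p c) (GS.act (scale b.1 D1) (scale b.1 D2) (p.scaled b.1) c') := by
  induction p with
  | nil h =>
    exact .trans (Act.act_nil (A := actC R) (b := b) ..) (e.trans (.symm (Act.act_nil (A := actG R) ..)))
  | snoc p E1 E2 l hN hK ih =>
    refine .trans (Act.act_snoc (A := actC R) (b := b) ..)
      (.trans ?_ (Act.act_snoc (A := actG R) ..).symm)
    refine .trans (actC_run (b := b) l (Act.E_cast (A := actG R) (b := b.2) _ ◾)) ?_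
    refine Act.run_congr' (A := actG R) _ ◾ ◾ ?_
    refine Act.E.cL (A := actG R) (Act.E.cR (A := actG R) ?_ _) _
    exact .trans (Act.cast_E (A := actC R) (b := b) ..) ih

lemma Act.act_scaled_move {A : Act (GStep (R := R))} (t : R) (x) :
    ∀ (P) {D1 D2} {b} {c : A.F b (D1 ++ scale t (x :: P) ++ D2)}
    {c' : A.F b (D1 ++ ((t * x.1, x.2) :: scale t P) ++ D2)},
    A.E c c' → A.E (A.act D1 D2 ((Path.move GStep.ex x P).scaled t) c)
      (A.act D1 D2 (Path.move GStep.ex (t * x.1, x.2) (scale t P)) c')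
  | [], D1, D2, b, c, c', e => A.trans (act_nil _ _ _ _) (A.trans e (A.symm (act_nil _ _ _ _)))
  | y :: P, D1, D2, b, c, c', e => by
    let d : A.F b (D1 ++ [(t * y.1, y.2)] ++ ((t * x.1, x.2) :: scale t P) ++ D2) :=
      A.cast (A.run (GStep.ex (t * x.1, x.2) (t * y.1, y.2)) D1 (scale t P ++ D2) (A.cast c' ◾)) ◾
    have h := act_move_cons (A := A) (ex := GStep.ex) (t * x.1, x.2) (t * y.1, y.2)
      (scale t P) (D1 := D1) (D2 := D2) (c := c') (c' := A.cast c' ◾)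
      (d := d) (E_cast ..) (cast_E ..)
    refine A.trans ?_ (A.symm h)
    rw [Path.move, Path.scaled_trans]
    refine act_trans' _ _ ?_
    refine A.trans (Path.act_scaled_inside t _ _ _ _ _ _ _ (d := A.cast d ◾)
      (E.cR ?_ _)) (A.trans (act_scaled_move t x P (c' := A.cast d ◾) (E.cast2 (A.refl _) ..)) ?_)
    · refine E.cR ?_ _
      refine A.trans (Path.act_scaled_inside t _ _ _ _ _ _ _ (d := A.cast c' ◾) (E.cR e _)) ?_
      refine A.trans (Path.act_scaled_single ..) ?_
      exact run_congr' _ ◾ rfl (E.cast2 (A.refl _) ..)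
    · exact act_congr _ rfl rfl (cast_E ..)

lemma Act.act_scaled_swap {A : Act (GStep (R := R))} (t : R) : ∀ (P Q) {D1 D2}
    {b} {c : A.F b (D1 ++ scale t (P ++ Q) ++ D2)}
    {c' : A.F b (D1 ++ (scale t P ++ scale t Q) ++ D2)},
    A.E c c' → A.E (A.act D1 D2 ((Path.swap GStep.ex P Q).scaled t) c)
      (A.act D1 D2 (Path.swap GStep.ex (scale t P) (scale t Q)) c')
  | [], Q, D1, D2, b, c, c', e => A.trans (act_nil _ _ _ _) (A.trans e (A.symm (act_nil _ _ _ _)))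
  | x :: P, Q, D1, D2, b, c, c', e => by
    let d : A.F b (D1 ++ ((t * x.1, x.2) :: scale t Q) ++ (scale t P ++ D2)) :=
      A.cast (A.act (D1 ++ [(t * x.1, x.2)]) D2 (.swap GStep.ex (scale t P) (scale t Q))
        (A.cast c' ◾)) ◾
    have h := act_swap_cons (A := A) (ex := GStep.ex) (t * x.1, x.2) (scale t P) (scale t Q)
      (D1 := D1) (D2 := D2) (c := c') (c' := A.cast c' ◾) (d := d) (E_cast ..) (cast_E ..)
    refine A.trans ?_ (A.symm h)
    rw [Path.swap, Path.scaled_trans]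
    refine act_trans' _ _ ?_
    refine A.trans (Path.act_scaled_inside t _ _ _ _ _ _ _ (d := A.cast d ◾)
      (E.cR ?_ _)) (A.trans (act_scaled_move t x Q (c' := A.cast d ◾) (E.cast2 (A.refl _) ..)) ?_)
    · refine E.cR ?_ _
      refine A.trans (Path.act_scaled_inside t _ _ _ _ _ _ _ (d := A.cast c' ◾) (E.cR e _)) ?_
      exact A.trans (act_scaled_swap t P Q (c' := A.cast c' ◾) (E.cast2 (A.refl _) ..))
        (act_congr _ rfl rfl (E.cast2 (A.refl _) ..))
    · exact act_congr _ ◾ rfl (cast_E ..)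

variable [MulRightMono R]

lemma actG_exch : (actG R).Exch GStep.ex where
  stepComm := actG_encaps.stepComm
  ex_ex x y D1 D2 c := GS.ex_ex x y D1 D2 c
  move_natural x _ _ st _ D1 D2 _ _ _ _ := actG_encaps.move_natural x st D1 D2

lemma actM_exch : (actM R).Exch GStep.ex where
  stepComm := actM_encaps.stepComm
  ex_ex x y D1 D2 c := MS.ex_ex x y D1 D2 c
  move_natural x _ _ st _ D1 D2 _ _ _ _ := actM_encaps.move_natural x st D1 D2

lemma actC_exch : (actC R).Exch GStep.ex where
  stepComm {P Q P' Q'} l l' b D1 D2 D3 c1 c2 d1 d2 hc h1 h2 := by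
    have h := (actG_exch (R := R)).stepComm (l.scaled b.1) (l'.scaled b.1) (b := b.2) (scale b.1 D1)
      (scale b.1 D2) (scale b.1 D3) (GS.cast c1 ◾) (GS.cast c1 ◾)
      (GS.cast d1 ◾) (GS.cast d2 ◾) (EqG.cL (EqG.cR (.refl _) _) _)
      (EqG.cL (EqG.trans h1 (EqG.trans (actC_run (b := b) l (EqG.cR (.refl _) ◾))
        (Act.run_congr' (A := actG R) _ rfl ◾ (EqG.cL (EqG.cR (.refl _) _) _)))) _)
      (EqG.cL (EqG.trans h2 (EqG.trans (actC_run (b := b) l' (EqG.cR (.refl _) ◾))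
        (Act.run_congr' (A := actG R) _ ◾ rfl (.cL (.cR hc.symm _) _)))) _)
    refine .trans (actC_run (b := b) l (c' := GS.cast d2 ◾) (.cR (.refl _) _)) ?_
    refine .trans (Act.run_congr' (A := actG R) _ rfl ◾
      (EqG.cL (EqG.cR (.refl _) _) _)) (EqG.trans h (EqG.symm ?_))
    refine .trans (actC_run (b := b) l' (c' := GS.cast d1 ◾) (.cR (.refl _) _)) ?_
    exact Act.run_congr' (A := actG R) _ ◾ rfl (EqG.cL (EqG.cR (.refl _) _) _)
  ex_ex {b} x y D1 D2 c := by
    refine .trans (actC_run (b := b) _ (.cR (actC_run (b := b) _ (.cR (.refl _) ◾)) ◾)) ?_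
    refine .trans (.congr_left _ _ _ (.cast_left ..)) ?_
    exact .trans (GS.ex_ex ..) (.cast_left ..)
  move_natural x {P Q} st b D1 D2 c c' d d' hc hd hd' := by
    have h := (actG_exch (R := R)).move_natural (b.1 * x.1, x.2) (st.scaled b.1) (b := b.2)
      (scale b.1 D1) (scale b.1 D2) (c := GS.cast c ◾) (c' := GS.cast c' ◾)
      (d := GS.cast d ◾) (d' := GS.cast d' ◾)
      (EqG.cL (EqG.cR hc _) _)
      (EqG.cL (EqG.trans hd (EqG.trans (actC_run (b := b) st (EqG.cR (.refl _) ◾))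
        (Act.run_congr' (A := actG R) _ ◾ rfl (EqG.cL (EqG.cR (.refl _) _) _)))) _)
      (EqG.cL (EqG.trans hd' (EqG.trans (actC_act (b := b) _ (EqG.cR (.refl _) ◾))
        (Act.act_scaled_move (A := actG R) _ _ _ (EqG.cL (EqG.cR (.refl _) _) _)))) _)
    refine .trans (actC_act (b := b) _ (.cR (.refl _) ◾)) (.trans
      (Act.act_scaled_move (A := actG R) _ _ _ (EqG.cL (EqG.cR (.refl _) _) _)) (h.trans (EqG.symm ?_)))
    refine .trans (actC_run (b := b) st (.cR (.refl _) ◾)) ?_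
    exact Act.run_congr' (A := actG R) _ rfl ◾ (EqG.cL (EqG.cR (.refl _) _) _)

lemma same_actC_iff {p q : Path GStep P Q} : (actC R).Same p q ↔
    ∀ (t : R) (D1 D2) (Y) (c : GS (D1 ++ scale t P ++ D2) Y),
      EqG (GS.act D1 D2 (p.scaled t) c) (GS.act D1 D2 (q.scaled t) c) := by
  constructor
  · intro h t D1 D2 Y c
    refine actG_act_eq (fun Z κ => ?_) D1 D2 c
    have e := h.out (b := (t, Z)) [] [] (GS.cast κ ◾)
    have k : ∀ r : Path GStep P Q, EqG ((actC R).act [] [] (b := (t, Z)) r (GS.cast κ ◾))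
        (GS.act [] [] (r.scaled t) (κ.cast ◾)) := fun r =>
      actC_act (b := (t, Z)) r (.cast2 ..)
    exact ((k p).symm.trans e).trans (k q)
  · intro h
    refine ⟨fun {b} D1 D2 c => ?_⟩
    have k : ∀ r : Path GStep P Q, EqG ((actC R).act D1 D2 (b := b) r c)
        (GS.act (scale b.1 D1) (scale b.1 D2) (r.scaled b.1) (GS.cast c ◾)) := fun r =>
      actC_act (b := b) r (.cR (.refl _) _)
    exact ((k p).trans (h ..)).trans (k q).symm

lemma same_actG_of_same {p q : Path GStep P Q} (h : (actC R).Same p q) : (actG R).Same p q := by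
  refine ⟨fun {Y} D1 D2 c => ?_⟩
  have e := same_actC_iff.1 h 1 D1 D2 Y (GS.cast c ◾)
  have k : ∀ r : Path GStep P Q, EqG (GS.act D1 D2 (r.scaled 1) (GS.cast c ◾))
    (c.act D1 D2 r) := fun r => GS.act_scaled_one r rfl rfl (.cast_left ..)
  exact ((k p).symm.trans e).trans (k q)

lemma same_actM_of_same {p q : Path GStep P Q} (h : (actC R).Same p q) : (actM R).Same p q :=
  ⟨fun D1 D2 c => actM_act_eq (fun _ _ => (same_actG_of_same h).out ..) D1 D2 c⟩

lemma same_scaled {p q : Path GStep P Q} (h : (actC R).Same p q) (r : R) :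
    (actC R).Same (p.scaled r) (q.scaled r) := by
  refine same_actC_iff.2 fun t D1 D2 Y c => ?_
  have k : ∀ s : Path GStep P Q, EqG (GS.act D1 D2 ((s.scaled r).scaled t) c)
    (GS.act D1 D2 (s.scaled (t * r)) (c.cast (by rw [scale_scale]))) := fun s =>
      GS.act_scaled_scaled t r s rfl rfl (.cR (.refl _) _)
  exact ((k p).trans (same_actC_iff.1 h ..)).trans (k q).symm

variable (R) in
abbrev CCat : Type u := Act.Ob (actC_exch (R := R))

end

namespace Act.Ob

variable {α : Type u} {L : List α → List α → Type u} {A : Act L} {ex : ∀ a b, L [a, b] [b, a]}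
  {S : A.Exch ex}

/-- Morphisms given by equalities of lists. -/
class Nil {X Y : Ob S} (f : X ⟶ Y) : Prop where
  out : ∃ h, f = hom X Y (.nil h)

lemma Nil.of {X Y : Ob S} (h : Y.list = X.list) {p : Path L Y.list X.list} (hp : A.Neutral p) :
    Nil (hom X Y p) := ⟨h, hom_sound (hp.same (.nil h))⟩

lemma Nil.eq (f g : X ⟶ Y) [hf : Nil f] [hg : Nil g] : f = g := by
  obtain ⟨p, rfl⟩ := hf.out
  obtain ⟨q, rfl⟩ := hg.out
  rfl

instance {X Y : Ob S} (h : Y.list = X.list) : Nil (hom X Y (.nil h)) := ⟨h, rfl⟩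

instance (X : Ob S) : Nil (𝟙 X) := ⟨rfl, rfl⟩

instance {X Y : Ob S} (h : X = Y) : Nil (eqToHom h) := by subst h; exact inferInstanceAs (Nil (𝟙 X))

instance {X Y Z : Ob S} (f : X ⟶ Y) (g : Y ⟶ Z) [hf : Nil f] [hg : Nil g] : Nil (f ≫ g) := by
  obtain ⟨h, rfl⟩ := hf.out
  obtain ⟨h', rfl⟩ := hg.out
  exact .of (h'.trans h) ((Neutral.nil h').trans (.nil h))

instance {X Y : Ob S} (f : X ⟶ Y) (Z : Ob S) [hf : Nil f] : Nil (f ▷ Z) := by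
  obtain ⟨h, rfl⟩ := hf.out
  exact .of (by simp [h]) ((Neutral.nil h).inside ..)

instance {X Y : Ob S} (f : X ⟶ Y) (Z : Ob S) [hf : Nil f] : Nil (Z ◁ f) := by
  obtain ⟨h, rfl⟩ := hf.out
  exact .of (by simp [h]) ((Neutral.nil h).inside ..)

instance {X Y X' Y' : Ob S} (f : X ⟶ Y) (g : X' ⟶ Y') [Nil f] [Nil g] : Nil (f ⊗ₘ g) := by
  rw [MonoidalCategory.tensorHom_def]; infer_instance

instance (X Y Z : Ob S) : Nil (α_ X Y Z).hom := ⟨_, rfl⟩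
instance (X Y Z : Ob S) : Nil (α_ X Y Z).inv := ⟨_, rfl⟩
instance (X : Ob S) : Nil (λ_ X).hom := ⟨_, rfl⟩
instance (X : Ob S) : Nil (λ_ X).inv := ⟨_, rfl⟩
instance (X : Ob S) : Nil (ρ_ X).hom := ⟨_, rfl⟩
instance (X : Ob S) : Nil (ρ_ X).inv := ⟨_, rfl⟩

instance (X Y : Ob S) (h : X.list = Y.list) : Nil (nilIso X Y h).hom := ⟨_, rfl⟩
instance (X Y : Ob S) (h : X.list = Y.list) : Nil (nilIso X Y h).inv := ⟨_, rfl⟩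

lemma comp_nil_eq {X Y X' Y' : Ob S} {p : Path L Y.list X.list} {q : Path L Y'.list X'.list}
    (f : X ⟶ X') (g : Y ⟶ Y') [hf : Nil f] [hg : Nil g]
    (h : ∀ {b : A.β} (D1 D2 : List α) (c : A.F b (D1 ++ Y.list ++ D2))
      (c' : A.F b (D1 ++ Y'.list ++ D2)), A.E c c' → A.E (A.act D1 D2 p c) (A.act D1 D2 q c')) :
    hom X Y p ≫ g = f ≫ hom X' Y' q := by
  obtain ⟨k, rfl⟩ := hf.out
  obtain ⟨k', rfl⟩ := hg.out
  refine hom_sound ⟨fun D1 D2 c => act_trans' _ _ (A.symm (act_trans' _ _ ?_))⟩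
  exact act_nil' _ (A.symm (h _ _ _ _ (act_nil ..)))

end Act.Ob

open Act.Ob

section

variable {R : Type u} [Semiring R] [Preorder R] [MulLeftMono R] [MulRightMono R]

abbrev CCat.of (Δ : GCtx R) : CCat R := ⟨Δ⟩

def scaleF (r : R) : CCat R ⥤ CCat R where
  obj X := ⟨scale r X.list⟩
  map {X Y} f := Quotient.map (fun p => p.scaled r) (fun _ _ h => same_scaled h r) f
  map_id X := hom_sound (Act.Neutral.same (.nil _) (.nil _))
  map_comp {X Y Z} f g := by
    obtain ⟨p, rfl⟩ := hom_surj f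
    obtain ⟨q, rfl⟩ := hom_surj g
    exact congrArg (hom (S := actC_exch) ⟨scale r X.list⟩ ⟨scale r Z.list⟩) (Path.scaled_trans r q p)

lemma scaleF_hom (r : R) {X Y : CCat R} (p : Path GStep Y.list X.list) :
    (scaleF r).map (hom X Y p) = hom ((scaleF r).obj X) ((scaleF r).obj Y) (p.scaled r) := rfl

@[simp] lemma scaleF_list (r : R) (X : CCat R) : ((scaleF r).obj X).list = scale r X.list := rfl

instance {X Y : CCat R} (r : R) (f : X ⟶ Y) [hf : Nil f] : Nil ((scaleF r).map f) := by
  obtain ⟨h, rfl⟩ := hf.out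
  exact ⟨congrArg (scale r) h, rfl⟩

lemma scale_unit (r : R) : 𝟙_ (CCat R) = (scaleF r).obj (𝟙_ (CCat R)) := rfl

lemma scale_tensor (r : R) (X Y) : (scaleF r).obj X ⊗ (scaleF r).obj Y = (scaleF r).obj (X ⊗ Y) :=
  congrArg Act.Ob.mk (scale_append r X.list Y.list).symm

instance (r : R) : (scaleF (R := R) r).LaxMonoidal where
  ε := eqToHom (scale_unit r)
  μ X Y := eqToHom (scale_tensor r X Y)
  μ_natural_left {X Y} f Z := by
    obtain ⟨p, rfl⟩ := hom_surj f
    refine comp_nil_eq (S := actC_exch) (eqToHom (scale_tensor r X Z))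
      (eqToHom (scale_tensor r Y Z)) fun {b} D1 D2 c c' e => ?_
    have hc : (actC R).E c' ((actC R).cast (b := b) c' ◾ :
      (actC R).F b (D1 ++ scale r Y.list ++ (scale r Z.list ++ D2))) := Act.E_cast ..
    refine (actC R).trans (Act.Ob.act_right _ rfl rfl ((actC R).trans e hc)) ((actC R).symm ?_)
    refine (actC R).trans (Path.act_scaled_inside r p [] Z.list _ _ D1 D2
      (Act.E.cR hc ◾)) ?_
    exact Act.act_congr _ ◾ rfl (Act.cast_E ..)
  μ_natural_right {X Y} Z f := by
    obtain ⟨p, rfl⟩ := hom_surj f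
    refine comp_nil_eq (S := actC_exch) (eqToHom (scale_tensor r Z X))
      (eqToHom (scale_tensor r Z Y)) fun {b} D1 D2 c c' e => ?_
    have hc : (actC R).E c' ((actC R).cast (b := b) c' ◾ :
      (actC R).F b (D1 ++ scale r Z.list ++ scale r Y.list ++ D2)) := Act.E_cast ..
    refine (actC R).trans (Act.Ob.act_left _ rfl rfl ((actC R).trans e hc)) ((actC R).symm ?_)
    refine (actC R).trans (Path.act_scaled_inside r p Z.list [] _ _ D1 D2
      (Act.E.cR hc ◾)) ?_
    exact Act.act_congr _ rfl ◾ (Act.cast_E ..)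
  associativity X Y Z := Nil.eq ..
  left_unitality X := Nil.eq ..
  right_unitality X := Nil.eq ..

instance (r : R) : (scaleF (R := R) r).LaxBraided where
  braided X Y := by
    symm
    refine comp_nil_eq (S := actC_exch) (eqToHom (scale_tensor r X Y))
      (eqToHom (scale_tensor r Y X)) fun {b} D1 D2 c c' e => ?_
    exact (actC R).symm (Act.act_scaled_swap r Y.list X.list ((actC R).symm e))

lemma GS.act_scaled_congr {r s : R} (h : r = s) (p : Path GStep P Q) (h1 : D1 = D1') (h2 : D2 = D2')
    {c : GS (D1 ++ scale r P ++ D2) Y} {d : GS (D1' ++ scale s P ++ D2') Y} (e : EqG c d) :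
    EqG (GS.act D1 D2 (p.scaled r) c) (GS.act D1' D2' (p.scaled s) d) := by
  subst h; exact Act.act_congr (A := actG R) _ h1 h2 e

lemma functor_ext {C D : Type u} [Category.{u} C] [Category.{u} D] {F G : C ⥤ D} (h_obj : ∀ X, F.obj X = G.obj X)
    (h_map : ∀ (X Y : C) (f : X ⟶ Y), F.map f ≫ eqToHom (h_obj Y) = eqToHom (h_obj X) ≫ G.map f) : F = G :=
  CategoryTheory.Functor.ext h_obj fun X Y f => by
    rw [← Category.assoc, ← h_map, Category.assoc, eqToHom_trans, eqToHom_refl, Category.comp_id]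

lemma scaleF_one : scaleF 1 = 𝟭 (CCat R) := by
  have h : ∀ X : CCat R, (scaleF 1).obj X = X := fun X => congrArg Act.Ob.mk (scale_one X.list)
  refine functor_ext h fun X Y f => ?_
  obtain ⟨p, rfl⟩ := hom_surj f
  refine comp_nil_eq (S := actC_exch) (eqToHom (h X)) (eqToHom (h Y)) fun {b} D1 D2 c c' e => ?_
  refine .trans (actC_act (b := b) _ (.cR (.refl _) ◾)) (.trans ?_
    (.symm (actC_act (b := b) _ (.cR (.refl _) ◾))))
  refine .trans (GS.act_scaled_scaled b.1 1 p rfl rfl (.cR (.refl _) ◾))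
    (GS.act_scaled_congr (mul_one _) p rfl rfl ?_)
  exact .cL (.cL (.cR e _) _) _

lemma scaleF_mul (r s : R) : scaleF (r * s) = scaleF s ⋙ scaleF (R := R) r := by
  have h : ∀ X : CCat R, (scaleF (r * s)).obj X = (scaleF r).obj ((scaleF s).obj X) :=
    fun X => congrArg Act.Ob.mk (scale_scale r s X.list).symm
  refine functor_ext h fun X Y f => ?_
  obtain ⟨p, rfl⟩ := hom_surj f
  refine comp_nil_eq (S := actC_exch) (eqToHom (h X)) (eqToHom (h Y)) fun {b} D1 D2 c c' e => ?_
  refine .trans (actC_act (b := b) _ (.cR (.refl _) ◾)) (.trans ?_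
    (.symm (actC_act (b := b) _ (.cR (.refl _) ◾))))
  refine .trans (GS.act_scaled_scaled b.1 (r * s) p rfl rfl (.cR (.refl _) (by simp [scale_scale]))) ?_
  refine .trans (GS.act_scaled_congr (mul_assoc ..).symm p rfl rfl ?_) (.symm
    (.trans (GS.act_scaled_scaled b.1 r (p.scaled s) rfl rfl (.cR (.refl _) (by simp [scale_scale, mul_assoc])))
      (GS.act_scaled_scaled (b.1 * r) s p rfl rfl (.cR (.refl _) (by simp [scale_scale, mul_assoc])))))
  exact .cL (.cL (.cR (.cR (.cR e _) _) _) _) _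

/-! ### Approximation -/

structure Path.SubNat {P Q P' Q' : GCtx R} (p : Path GStep P Q) (p' : Path GStep P' Q') :
    Prop where
  out : ∀ {D1 D2 D1' D2' : GCtx R} (_ : CtxLe D1 D1') (_ : CtxLe D2 D2')
    (h : CtxLe (D1 ++ P ++ D2) (D1' ++ P' ++ D2')) (h' : CtxLe (D1 ++ Q ++ D2) (D1' ++ Q' ++ D2'))
    {Y : GTy R} {c : GS (D1 ++ P ++ D2) Y} {c' : GS (D1' ++ P' ++ D2') Y}, EqG c' (.sub h c) →
    EqG (.sub h' (GS.act D1 D2 p c)) (GS.act D1' D2' p' c')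

namespace Path.SubNat

lemma nil {P Q P' Q' : GCtx R} (k : P = Q) (k' : P' = Q') : SubNat (.nil k) (.nil k') where
  out {D1 D2 D1' D2'} h1 h2 h h' {Y c c'} e := by
    refine .trans ?_ (.trans e.symm (.symm (Act.act_nil (A := actG R) ..)))
    exact .sub _ _ (by rw [k]) (by rw [k']) (Act.act_nil (A := actG R) ..)

lemma trans {P Q K P' Q' K' : GCtx R} {p : Path GStep P Q} {q : Path GStep Q K}
    {p' : Path GStep P' Q'} {q' : Path GStep Q' K'} (hp : SubNat p p') (hq : SubNat q q')
    (k : CtxLe Q Q') : SubNat (p.trans q) (p'.trans q') where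
  out {D1 D2 D1' D2'} h1 h2 h h' {Y c c'} e := by
    refine .trans (.congr_sub _ (Act.act_trans (A := actG R) ..)) (.trans ?_
      (.symm (Act.act_trans (A := actG R) ..)))
    exact hq.out h1 h2 ((h1.append k).append h2) h' (hp.out h1 h2 h ((h1.append k).append h2) e).symm

lemma inside {P Q P' Q' : GCtx R} {p : Path GStep P Q} {p' : Path GStep P' Q'}
    (hp : SubNat p p') (hM : M = E1 ++ P ++ E2)
    (hK : K = E1 ++ Q ++ E2) (hM' : M' = E1' ++ P' ++ E2') (hK' : K' = E1' ++ Q' ++ E2')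
    (k1 : CtxLe E1 E1') (k2 : CtxLe E2 E2') :
    SubNat (p.inside E1 E2 hM hK) (p'.inside E1' E2' hM' hK') where
  out {D1 D2 D1' D2'} h1 h2 h h' {Y c c'} e := by
    subst hM; subst hK; subst hM'; subst hK'
    refine .trans ?_ (.symm (Act.act_inside' (A := actG R) _ _ _ rfl rfl
      (c' := GS.cast c' ◾) (EqG.cR (.refl _) _)))
    have k' : CtxLe (D1 ++ E1 ++ Q ++ (E2 ++ D2)) (D1' ++ E1' ++ Q' ++ (E2' ++ D2')) := by
      simpa using h'
    refine .trans (.sub _ k' ◾ ◾ (Act.act_inside'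
      (A := actG R) _ _ _ rfl rfl (c' := GS.cast c ◾) (EqG.cR (.refl _) _))) ?_
    refine hp.out (h1.append k1) (k2.append h2) (by simpa using h) k'
      (c := GS.cast c ◾) (c' := GS.cast c' ◾) (.cL (e.trans ?_) _)
    exact .sub _ _ ◾ ◾ (.cR (.refl _) _)

lemma single {P Q P' Q' : GCtx R} {st : GStep P Q} {st' : GStep P' Q'}
    (H : ∀ {D1 D2 D1' D2' : GCtx R} (_ : CtxLe D1 D1') (_ : CtxLe D2 D2')
      (h : CtxLe (D1 ++ P ++ D2) (D1' ++ P' ++ D2'))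
      (h' : CtxLe (D1 ++ Q ++ D2) (D1' ++ Q' ++ D2')) {Y : GTy R} (c : GS (D1 ++ P ++ D2) Y),
      EqG (.sub h' (st.runG D1 D2 c)) (st'.runG D1' D2' (.sub h c))) :
    SubNat (.single st) (.single st') where
  out {D1 D2 D1' D2'} h1 h2 h h' {Y c c'} e := by
    refine .trans (.congr_sub _ (Act.act_single (A := actG R) ..)) (.trans ?_
      (.symm (Act.act_single (A := actG R) ..)))
    exact (H h1 h2 h h' c).trans ((actG R).run_congr _ _ _ e.symm)

lemma left {P Q P' Q' : GCtx R} {l : GLeft P Q} {l' : GLeft P' Q'} (h : GLeft.Le l l') :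
    SubNat (.single (.left l)) (.single (.left l')) :=
  single fun h1 h2 k k' _ c => .sub_left h h1 h2 k k' c

end Path.SubNat

lemma Path.scaled_single (r : R) (st : GStep P Q) : (Path.single st).scaled r = .single (st.scaled r) := rfl

/-- Two rules that correspond to each other under approximation. -/
structure GStep.SubNat {P Q P' Q' : GCtx R} (st : GStep P Q) (st' : GStep P' Q') : Prop where
  out : ∀ {D1 D2 D1' D2' : GCtx R} (_ : CtxLe D1 D1') (_ : CtxLe D2 D2')
    (h : CtxLe (D1 ++ P ++ D2) (D1' ++ P' ++ D2')) (h' : CtxLe (D1 ++ Q ++ D2) (D1' ++ Q' ++ D2'))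
    {Y : GTy R} (c : GS (D1 ++ P ++ D2) Y),
    EqG (.sub h' (st.runG D1 D2 c)) (st'.runG D1' D2' (.sub h c))

lemma GStep.SubNat.left {P Q P' Q' : GCtx R} {l : GLeft P Q} {l' : GLeft P' Q'}
    (h : GLeft.Le l l') : GStep.SubNat (.left l) (.left l') :=
  ⟨fun h1 h2 k k' _ c => .sub_left h h1 h2 k k' c⟩

lemma Path.SubNat.snoc {P N X Y K P' N' X' Y' K' : GCtx R} {p : Path GStep P N}
    {p' : Path GStep P' N'} (hp : SubNat p p') {st : GStep X Y} {st' : GStep X' Y'}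
    (hst : st.SubNat st') (k1 : CtxLe E1 E1') (k2 : CtxLe E2 E2')
    (k : CtxLe X X') (hN : N = E1 ++ X ++ E2) (hK : K = E1 ++ Y ++ E2)
    (hN' : N' = E1' ++ X' ++ E2') (hK' : K' = E1' ++ Y' ++ E2') :
    SubNat (.snoc p E1 E2 st hN hK) (.snoc p' E1' E2' st' hN' hK') where
  out {D1 D2 D1' D2'} h1 h2 h h' {Z c c'} e := by
    subst hN; subst hN'; subst hK; subst hK'
    refine .trans ?_ (.symm (Act.act_snoc (A := actG R) ..))
    have m : CtxLe (D1 ++ E1 ++ Y ++ (E2 ++ D2)) (D1' ++ E1' ++ Y' ++ (E2' ++ D2')) := by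
      simpa using h'
    have m' : CtxLe (D1 ++ E1 ++ X ++ (E2 ++ D2)) (D1' ++ E1' ++ X' ++ (E2' ++ D2')) :=
      ((h1.append k1).append k).append (k2.append h2)
    refine .trans (.sub _ m ◾ ◾ (Act.act_snoc (A := actG R) ..)) ?_
    refine .trans (hst.out (h1.append k1) (k2.append h2) m' m _) ?_
    refine (actG R).run_congr _ _ _ (Act.E.cR (A := actG R) ?_ _)
    refine .trans ?_ (hp.out h1 h2 h (by simpa using m') e)
    exact .sub _ _ ◾ ◾ (Act.cast_E (A := actG R) ..)

structure Path.HSame {P Q P' Q' : GCtx R} (p : Path GStep P Q) (p' : Path GStep P' Q') :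
    Prop where
  out : ∀ (D1 D2 : GCtx R) {Y : GTy R} {c : GS (D1 ++ P ++ D2) Y} {c' : GS (D1 ++ P' ++ D2) Y},
    EqG c c' → EqG (GS.act D1 D2 p c) (GS.act D1 D2 p' c')

namespace Path.HSame

variable {P Q P' Q' P'' Q'' : GCtx R} {p : Path GStep P Q} {p' : Path GStep P' Q'}
  {p'' : Path GStep P'' Q''}

lemma of_sub (h : SubNat p p') (hP : P = P') (hQ : Q = Q') : HSame p p' where
  out D1 D2 {Y c c'} e := by
    subst hP; subst hQ
    refine .trans (EqG.sub_refl (CtxLe.refl _) _).symm (h.out (CtxLe.refl _) (CtxLe.refl _)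
      (CtxLe.refl _) (CtxLe.refl _) (e.symm.trans (EqG.sub_refl ..).symm))

lemma symm (h : HSame p p') : HSame p' p := ⟨fun _ _ _ _ _ e => (h.out _ _ e.symm).symm⟩

lemma trans (h : HSame p p') (h' : HSame p' p'') (hP : P = P') : HSame p p'' where
  out D1 D2 {Y c c'} e := (h.out D1 D2 (c' := c.cast (by rw [hP]))
    (EqG.cast_left ..).symm).trans (h'.out D1 D2 (EqG.cL e _))

lemma scaled_scaled (r s : R) (p : Path GStep P Q) : HSame ((p.scaled s).scaled r) (p.scaled (r * s)) :=
  ⟨fun _ _ _ _ _ e => GS.act_scaled_scaled r s p rfl rfl e⟩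

end Path.HSame

lemma comp_nil_eq_of_hsame {X Y X' Y' : CCat R} {p : Path GStep Y.list X.list}
    {q : Path GStep Y'.list X'.list} (f : X ⟶ X') (g : Y ⟶ Y') [hf : Nil f] [hg : Nil g]
    (h : ∀ t, Path.HSame (p.scaled t) (q.scaled t)) :
    hom X Y p ≫ g = f ≫ hom X' Y' q := by
  refine comp_nil_eq (S := actC_exch) f g fun {b} D1 D2 c c' e => ?_
  refine .trans (actC_act (b := b) _ (.cR (.refl _) ◾)) (.trans ?_
    (.symm (actC_act (b := b) _ (.cR (.refl _) ◾))))
  exact (h b.1).out _ _ (.cL (.cR e _) _)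

def subHom {X Y : CCat R} (h : CtxLe Y.list X.list) : X ⟶ Y := hom X Y (.single (.sub h))

lemma subHom_natural {X Y X' Y' : CCat R} {p : Path GStep Y.list X.list}
    {p' : Path GStep Y'.list X'.list} (H : ∀ t, Path.SubNat (p.scaled t) (p'.scaled t))
    (hX : CtxLe X.list X'.list) (hY : CtxLe Y.list Y'.list) :
    hom X' Y' p' ≫ subHom hY = subHom hX ≫ hom X Y p := by
  refine hom_sound (S := actC_exch) (same_actC_iff.2 fun t D1 D2 Z c => ?_)
  beta_reduce
  rw [Path.scaled_trans, Path.scaled_trans]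
  refine Act.act_trans' (A := actG R) _ _ (.symm (Act.act_trans' (A := actG R) _ _ ?_))
  refine .trans (Act.act_single (A := actG R) ..) ?_
  refine (H t).out (CtxLe.refl _) (CtxLe.refl _) (CtxLe.inside D1 D2 (hY.scale t))
    (CtxLe.inside D1 D2 (hX.scale t)) ?_
  exact Act.act_single (A := actG R) ..

lemma subHom_comp {X Y Z : CCat R} (h : CtxLe Y.list X.list) (h' : CtxLe Z.list Y.list) :
    subHom h ≫ subHom h' = subHom (h'.trans h) := by
  refine hom_sound (S := actC_exch) (same_actC_iff.2 fun t D1 D2 W c => ?_)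
  beta_reduce
  rw [Path.scaled_trans]
  refine Act.act_trans' (A := actG R) _ _ (.trans (Act.act_single (A := actG R) ..)
    (.symm (.trans (Act.act_single (A := actG R) ..) ?_)))
  exact (.symm (GS.sub_sub _ _ _ rfl rfl rfl (Act.act_single (A := actG R) ..) (.refl _)))

lemma subHom_eq {X Y : CCat R} (h : CtxLe Y.list X.list) (e : Y.list = X.list) : subHom h = hom X Y (.nil e) := by
  cases X; cases Y; cases e
  refine hom_sound (S := actC_exch) (same_actC_iff.2 fun t D1 D2 W c => ?_)
  refine .trans (Act.act_single (A := actG R) ..) (.trans (EqG.sub_refl ..) ?_)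
  exact .symm (Act.act_nil (A := actG R) ..)

lemma subHom_tensor {X Y X' Y' : CCat R} (h : CtxLe Y.list X.list) (h' : CtxLe Y'.list X'.list) :
    subHom h ⊗ₘ subHom h' = subHom (X := X ⊗ X') (Y := Y ⊗ Y') (h.append h') := by
  refine hom_sound (S := actC_exch) (same_actC_iff.2 fun t D1 D2 W c => ?_)
  beta_reduce
  rw [Path.scaled_trans]
  refine Act.act_trans' (A := actG R) _ _ (.trans (Path.act_scaled_inside (A := actG R) _ _ _ _
    _ _ _ _ (EqG.cR (.refl _) ◾)) ?_)
  refine .trans (Act.act_single (A := actG R) ..) (.symm (.trans (Act.act_single (A := actG R) ..) ?_))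
  let d' : GS (D1 ++ scale t Y.list ++ scale t Y'.list ++ (scale t [] ++ D2)) W := GS.cast c ◾
  have hd : EqG c d' := .cR (.refl _) _
  have e := EqG.trans (Path.act_scaled_inside (A := actG R) t (Path.single (GStep.sub h')) Y.list []
    (List.append_nil _).symm (List.append_nil _).symm D1 D2 (d := d') hd) (Act.act_single (A := actG R) ..)
  have m : CtxLe (D1 ++ scale t Y.list ++ scale t Y'.list ++ (scale t [] ++ D2))
      (D1 ++ scale t Y.list ++ scale t X'.list ++ (scale t [] ++ D2)) :=
    CtxLe.inside _ _ (h'.scale t)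
  exact .symm (GS.sub_sub (c := d') m (CtxLe.inside (D1 ++ scale t []) (scale t X'.list ++ D2) (h.scale t))
    (CtxLe.inside D1 D2 ((h.append h').scale t)) ◾ ◾ ◾
    (.cL e ◾) hd)

lemma Path.scaled_subNat (h : r ≤ s) (t : R) (p : Path GStep P Q) :
    SubNat ((p.scaled r).scaled t) ((p.scaled s).scaled t) := by
  induction p with
  | nil k => exact .nil _ _
  | snoc p E1 E2 st hN hK ih =>
    refine .snoc ih ?_ ((CtxLe.scale_grade h _).scale t) ((CtxLe.scale_grade h _).scale t)
      ((CtxLe.scale_grade h _).scale t) ..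
    have hr : ∀ a, t * (r * a) ≤ t * (s * a) := fun a => mul_le_mul_right (mul_le_mul_left h a) t
    cases st with
    | left l =>
      refine .left ?_
      cases l with
      | unit t => exact .unit (hr _)
      | tensor t X Y => exact .tensor (hr _) X Y
      | weak t X ht => exact .weak _ _ _ _ X
      | cont t1 t2 t X ht => exact .cont (hr _) (hr _) _ _ X
      | ex a b => exact .ex (hr _) (hr _) _ _
    | @cut u E _ _ a hQ =>
      refine ⟨fun {D1 D2 D1' D2'} h1 h2 k k' Y c => ?_⟩
      subst hQ
      have k'' : CtxLe (D1 ++ scale (t * (r * u)) E ++ D2) (D1' ++ scale (t * (s * u)) E ++ D2') :=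
        by simpa [scale_scale] using k'
      refine .trans (.sub _ k'' (by simp [scale_scale]) (by simp [scale_scale]) (.cast_left ..)) (.cR ?_ _)
      refine (EqG.sub_cut (hr u) h1 (CtxLe.refl _) h2 k k'' ..).trans ?_
      exact .congr_cut _ _ _ (EqG.sub_refl ..) (.refl _)
    | sub m =>
      refine ⟨fun {D1 D2 D1' D2'} h1 h2 k k' Y c => ?_⟩
      exact (EqG.sub_trans _ _ (CtxLe.trans (CtxLe.inside _ _ ((m.scale r).scale t)) k') _).trans
        (EqG.sub_trans ..).symm

variable (R) in
def actF : Rᵒᵖ ⥤ CCat R ⥤ CCat R where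
  obj r := scaleF r.unop
  map {s r} f :=
    { app := fun X => subHom (X := (scaleF s.unop).obj X) (Y := (scaleF r.unop).obj X)
        (CtxLe.scale_grade f.unop.le X.list)
      naturality := fun X Y g => by
        obtain ⟨p, rfl⟩ := hom_surj g
        exact subHom_natural (fun t => Path.scaled_subNat f.unop.le t p) _ _ }
  map_id r := by
    ext X; exact subHom_eq _ rfl
  map_comp f g := by
    ext X; exact (subHom_comp ..).symm

end

section

variable {R : Type u} [Semiring R] [Preorder R] [MulLeftMono R] [MulRightMono R]

namespace Path.SubNat

lemma scaled_inside {t t' : R} {p : Path GStep P Q} {p' : Path GStep P' Q'}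
    (hp : SubNat (p.scaled t) (p'.scaled t'))
    (hM : M = E1 ++ P ++ E2) (hK : K = E1 ++ Q ++ E2) (hM' : M' = E1' ++ P' ++ E2')
    (hK' : K' = E1' ++ Q' ++ E2') (k1 : CtxLe (scale t E1) (scale t' E1'))
    (k2 : CtxLe (scale t E2) (scale t' E2')) :
    SubNat ((p.inside E1 E2 hM hK).scaled t) ((p'.inside E1' E2' hM' hK').scaled t') where
  out {D1 D2 D1' D2'} h1 h2 h h' {Y c c'} e := by
    subst hM; subst hK; subst hM'; subst hK'
    refine .trans ?_ (.symm (Path.act_scaled_inside (A := actG R) _ _ _ _ rfl rfl _ _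
      (d := GS.cast c' ◾) (EqG.cR (.refl _) _)))
    have k' : CtxLe (D1 ++ scale t E1 ++ scale t Q ++ (scale t E2 ++ D2))
        (D1' ++ scale t' E1' ++ scale t' Q' ++ (scale t' E2' ++ D2')) := by
      simpa using h'
    refine .trans (.sub _ k' ◾ ◾ (Path.act_scaled_inside (A := actG R)
      _ _ _ _ rfl rfl _ _ (d := GS.cast c ◾) (EqG.cR (.refl _) _))) ?_
    refine hp.out (h1.append k1) (k2.append h2) (by simpa using h) k'
      (c := GS.cast c ◾) (c' := GS.cast c' ◾) (.cL (e.trans ?_) _)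
    exact .sub _ _ ◾ ◾ (.cR (.refl _) _)

lemma ex : ∀ {a b a' b' : R × GTy R} (_ : CtxLe (scale t [a]) (scale t' [a']))
    (_ : CtxLe (scale t [b]) (scale t' [b'])),
    SubNat ((Path.single (GStep.ex a b)).scaled t) ((Path.single (GStep.ex a' b')).scaled t')
  | (r, X), (s, Y), (r', X'), (s', Y'), ⟨h, hX, _⟩, ⟨k, hY, _⟩ => by
    obtain rfl : X = X' := hX
    obtain rfl : Y = Y' := hY
    exact .left (.ex h k X Y)

lemma move (h : CtxLe (scale t [a]) (scale t' [a'])) : ∀ {P P' : GCtx R} (_ : CtxLe (scale t P) (scale t' P')),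
    SubNat ((Path.move GStep.ex a P).scaled t) ((Path.move GStep.ex a' P').scaled t')
  | [], [], _ => .nil _ _
  | b :: P, b' :: P', k => by
    rw [Path.move, Path.move, Path.scaled_trans, Path.scaled_trans]
    exact .trans (.scaled_inside (.ex h ⟨k.1, k.2.1, trivial⟩) _ _ _ _ trivial k.2.2)
      (.scaled_inside (move h k.2.2) _ _ _ _ ⟨k.1, k.2.1, trivial⟩ trivial)
      ⟨k.1, k.2.1, h.1, h.2.1, k.2.2⟩
  | [], _ :: _, h => h.elim
  | _ :: _, [], h => h.elim

lemma swap (h : CtxLe (scale t Q) (scale t' Q')) : ∀ {P P' : GCtx R} (_ : CtxLe (scale t P) (scale t' P')),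
    SubNat ((Path.swap GStep.ex P Q).scaled t) ((Path.swap GStep.ex P' Q').scaled t')
  | [], [], _ => .nil _ _
  | b :: P, b' :: P', k => by
    rw [Path.swap, Path.swap, Path.scaled_trans, Path.scaled_trans]
    refine .trans (.scaled_inside (swap h k.2.2) _ _ _ _ ⟨k.1, k.2.1, trivial⟩ trivial)
      (.scaled_inside (move ⟨k.1, k.2.1, trivial⟩ h) _ _ _ _ trivial k.2.2)
      ⟨k.1, k.2.1, ?_⟩
    change CtxLe (scale t (Q ++ P)) (scale t' (Q' ++ P'))
    rw [scale_append, scale_append]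
    exact h.append k.2.2
  | [], _ :: _, h => h.elim
  | _ :: _, [], h => h.elim

end Path.SubNat

abbrev weakPath (r : R) (h : r = 0) (E : GCtx R) : Path GStep [] (scale r E) :=
  (weakBlock r h E).map GStep.left

abbrev contPath (r1 r2 r : R) (h : r = r1 + r2) (E : GCtx R) :
    Path GStep (scale r1 E ++ scale r2 E) (scale r E) :=
  (contBlock r1 r2 r h E).map GStep.left

lemma weakPath_subNat (h : r = 0) (h' : r' = 0) :
    ∀ {E E' : GCtx R} (_ : CtxLe (scale t (scale r E)) (scale t' (scale r' E'))),
    Path.SubNat ((weakPath r h E).scaled t) ((weakPath r' h' E').scaled t')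
  | [], [], _ => .nil _ _
  | (a, X) :: E, (b, Y) :: E', ⟨_, hX, k⟩ => by
    obtain rfl : X = Y := hX
    exact .snoc (weakPath_subNat h h' k) (.left (.weak _ _ _ _ X)) (E1 := []) (E1' := []) trivial k trivial ..
  | [], _ :: _, h => h.elim
  | _ :: _, [], h => h.elim

lemma contPath_cons (r1 r2 r : R) (h : r = r1 + r2) (a : R) (X : GTy R) (E : GCtx R) :
    contPath r1 r2 r h ((a, X) :: E) = Path.trans (Q := [(r * a, X)] ++ (scale r1 E ++ scale r2 E)) (.snoc
          (Path.inside [(r1 * a, X)] (scale r2 E) (Path.swap GStep.ex (scale r1 E) [(r2 * a, X)])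
            (by simp [scale]) rfl)
          [] (scale r1 E ++ scale r2 E)
          (.left (.cont (r1 * a) (r2 * a) (r * a) X (by rw [h, add_mul]))) ◾ ◾)
        (Path.inside [(r * a, X)] [] (contPath r1 r2 r h E) ◾ (by simp [scale])) := by
  rw [contPath, contBlock, Path.map_trans, Path.map_inside, Path.map, Path.map_inside]
  rw [gswap, Path.map_swap]

lemma contPath_subNat (h : r = r1 + r2) (h' : r' = r1' + r2') :
    ∀ {E E' : GCtx R} (_ : CtxLe (scale t (scale r1 E)) (scale t' (scale r1' E')))
      (_ : CtxLe (scale t (scale r2 E)) (scale t' (scale r2' E')))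
      (_ : CtxLe (scale t (scale r E)) (scale t' (scale r' E'))),
    Path.SubNat ((contPath r1 r2 r h E).scaled t) ((contPath r1' r2' r' h' E').scaled t')
  | [], [], _, _, _ => .nil _ _
  | (a, X) :: E, (b, Y) :: E', ⟨l1, hX, k1⟩, ⟨l2, _, k2⟩, ⟨l, _, k⟩ => by
    obtain rfl : X = Y := hX
    have m : CtxLe (scale t (scale r1 E ++ scale r2 E)) (scale t' (scale r1' E' ++ scale r2' E')) := by
      rw [scale_append, scale_append]; exact k1.append k2
    rw [contPath_cons, contPath_cons, Path.scaled_trans, Path.scaled_trans]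
    have n1 : CtxLe (scale t [(r1 * a, X)]) (scale t' [(r1' * b, X)]) := ⟨l1, rfl, trivial⟩
    have n2 : CtxLe (scale t [(r2 * a, X)]) (scale t' [(r2' * b, X)]) := ⟨l2, rfl, trivial⟩
    refine .trans (.snoc (.scaled_inside (.swap n2 k1) _ _ _ _ n1 k2)
      (.left (.cont l1 l2 _ _ X)) (E1 := []) (E1' := []) trivial m ⟨l1, rfl, l2, rfl, trivial⟩ _ ..)
      (.scaled_inside (contPath_subNat h h' k1 k2 k) _ _ _ _ ⟨l, rfl, trivial⟩ trivial) ⟨l, rfl, m⟩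
  | [], _ :: _, h, _, _ => h.elim
  | _ :: _, [], h, _, _ => h.elim

lemma weakPath_hsame {t t' r r' : R} (h : r = 0) (h' : r' = 0) (k : scale t (scale r E) = scale t' (scale r' E')) :
    Path.HSame ((weakPath r h E).scaled t) ((weakPath r' h' E').scaled t') :=
  .of_sub (weakPath_subNat h h' (.of_eq k)) rfl k

lemma contPath_hsame {t t' r1 r2 r r1' r2' r' : R} (h : r = r1 + r2) (h' : r' = r1' + r2') (k1 : scale t (scale r1 E) = scale t' (scale r1' E'))
    (k2 : scale t (scale r2 E) = scale t' (scale r2' E'))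
    (k : scale t (scale r E) = scale t' (scale r' E')) :
    Path.HSame ((contPath r1 r2 r h E).scaled t) ((contPath r1' r2' r' h' E').scaled t') :=
  .of_sub (contPath_subNat h h' (.of_eq k1) (.of_eq k2) (.of_eq k)) (by rw [scale_append, scale_append, k1, k2]) k

lemma Path.HSame.scaled_one {P Q : GCtx R} (p : Path GStep P Q) : HSame (p.scaled 1) p :=
  ⟨fun _ _ _ _ _ e => GS.act_scaled_one p rfl rfl e⟩

def weakAt (r : R) (h : r = 0) (X : CCat R) : (scaleF r).obj X ⟶ 𝟙_ (CCat R) :=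
  hom ((scaleF r).obj X) (𝟙_ (CCat R)) (weakPath r h X.list)

def contrAt (r1 r2 r : R) (h : r = r1 + r2) (X : CCat R) :
    (scaleF r).obj X ⟶ (scaleF r1).obj X ⊗ (scaleF r2).obj X :=
  hom ((scaleF r).obj X) ((scaleF r1).obj X ⊗ (scaleF r2).obj X) (contPath r1 r2 r h X.list)

def weak1 (r : R) (h : r = 0) (X : GTy R) : CCat.of [(r, X)] ⟶ 𝟙_ (CCat R) :=
  hom (CCat.of [(r, X)]) (𝟙_ (CCat R)) (.single (.left (.weak r X h)))

def cont1 (r1 r2 r : R) (h : r = r1 + r2) (X : GTy R) :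
    CCat.of [(r, X)] ⟶ CCat.of [(r1, X)] ⊗ CCat.of [(r2, X)] :=
  hom (CCat.of [(r, X)]) (CCat.of [(r1, X)] ⊗ CCat.of [(r2, X)]) (.single (.left (.cont r1 r2 r X h)))

def cutHom (r : R) {E : CCat R} {X : GTy R} (a : GS E.list X) :
    (scaleF r).obj E ⟶ CCat.of [(r, X)] :=
  hom ((scaleF r).obj E) (CCat.of [(r, X)]) (.single (.cut r a rfl))

lemma act_cutHom (t r : R) (a : GS E X) (D1 D2 : GCtx R)
    {c : GS (D1 ++ scale t [(r, X)] ++ D2) Y} {c' : GS (D1 ++ [(t * r, X)] ++ D2) Y}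
    (e : EqG c c') : EqG (GS.act D1 D2 ((Path.single (GStep.cut r a rfl)).scaled t) c)
      (GS.cut (t * r) D1 D2 a c') := by
  refine .trans (Act.act_single (A := actG R) ..) ?_
  exact .cL (.cut rfl rfl rfl rfl (.refl _) e) _

lemma act_inside_cut (t r : R) (a : GS E X) (E1 E2 : GCtx R) (hM : M = E1 ++ [(r, X)] ++ E2) (hK : K = E1 ++ scale r E ++ E2)
    (D1 D2 : GCtx R) (h1 : D1 ++ scale t E1 = D1') (h2 : scale t E2 ++ D2 = D2') {c : GS (D1 ++ scale t M ++ D2) Y} {c' : GS (D1' ++ [(t * r, X)] ++ D2') Y}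
    (e : EqG c c') : EqG (GS.act D1 D2 (((Path.single (GStep.cut r a rfl)).inside E1 E2 hM hK).scaled t) c)
      (GS.cut (t * r) D1' D2' a c') := by
  subst h1; subst h2
  exact .trans (Path.act_scaled_inside (A := actG R) t _ E1 E2 hM hK D1 D2 (d := c') e)
    (act_cutHom t r a _ _ (.refl _))

lemma act_scaled_trans (t : R) (p : Path GStep P Q) (q : Path GStep Q K) {c : GS (D1 ++ scale t P ++ D2) Y} {d : GS D Y}
    (h : EqG (GS.act D1 D2 (q.scaled t) (GS.act D1 D2 (p.scaled t) c)) d) :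
    EqG (GS.act D1 D2 ((p.trans q).scaled t) c) d := by
  rw [Path.scaled_trans]; exact (Act.act_trans (A := actG R) ..).trans h

lemma hom_eq_of_act {X Y : CCat R} {p q : Path GStep Y.list X.list}
    (h : ∀ (t : R) (D1 D2 : GCtx R) (Z : GTy R) (c : GS (D1 ++ scale t Y.list ++ D2) Z),
      EqG (GS.act D1 D2 (p.scaled t) c) (GS.act D1 D2 (q.scaled t) c)) : hom X Y p = hom X Y q :=
  hom_sound (S := actC_exch) (same_actC_iff.2 h)

lemma scaleF_map_cutHom (r : R) {E F : CCat R} (p : Path GStep F.list E.list)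
    (a : GS F.list X) (a' : GS E.list X) (e : EqG a' (GS.act [] [] p (GS.cast a ◾))) :
    (scaleF r).map (hom E F p) ≫ cutHom r a = cutHom r a' := by
  refine hom_eq_of_act fun t D1 D2 Y c => act_scaled_trans t _ _ ?_
  refine .trans (GS.act_scaled_scaled t r p (D1' := D1) (D2' := D2) rfl rfl
    (d := GS.cast (GS.cut (t * r) D1 D2 a c) (by simp [scale_scale]))
    (.cR (act_cutHom t r a D1 D2 (.refl _)) _)) ?_
  refine .symm (.trans (act_cutHom t r a' D1 D2 (.refl _)) (.trans (.cut rfl rfl rfl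
    ◾ e (.refl _)) (.trans (GS.cut_act _ _ _ p [] [] ..) ?_)))
  refine Act.act_congr (A := actG R) _ ◾ ◾ (EqG.cL (EqG.cR ?_ _) _)
  exact .cut rfl rfl rfl ◾ (.cast_left ..) (.refl _)

lemma cutHom_weak1 (r : R) (h : r = 0) {E : CCat R} (a : GS E.list X) :
    cutHom r a ≫ weak1 r h X = weakAt r h E := by
  refine hom_eq_of_act fun t D1 D2 Y c => act_scaled_trans t _ _ ?_
  have h' : t * r = 0 := by rw [h, mul_zero]
  refine .trans (act_cutHom t r a D1 D2 (Act.act_single (A := actG R) ..)) ?_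
  refine .trans (EqG.cut_weak (t * r) h' D1 D2 a c) ?_
  refine .trans (GS.path_eq ..) (.symm (((weakPath_hsame (t := t) (t' := 1) (r' := t * r)
    (E := E.list) (E' := E.list) h h' (by simp [scale_scale])).trans (.scaled_one _) rfl).out D1 D2 (.refl _)))

lemma cutHom_cont1 (r1 r2 r : R) (h : r = r1 + r2) {E : CCat R} (a : GS E.list X) :
    cutHom r a ≫ cont1 r1 r2 r h X = contrAt r1 r2 r h E ≫ (cutHom r1 a ⊗ₘ cutHom r2 a) := by
  refine hom_eq_of_act fun t D1 D2 Y c => act_scaled_trans t _ _ ?_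
  have h' : t * r = t * r1 + t * r2 := by rw [h, mul_add]
  refine .trans (act_cutHom t r a D1 D2 (Act.act_single (A := actG R) ..)) ?_
  refine .trans (EqG.cut_cont (t * r1) (t * r2) (t * r) h' D1 D2 a c) ?_
  refine .trans (GS.path_eq ..) (.symm (act_scaled_trans t _ _ ?_))
  refine ((contPath_hsame (t := t) (E := E.list) (t' := 1) (r' := t * r) (r1' := t * r1) (r2' := t * r2)
    (E' := E.list) h h' (by simp [scale_scale]) (by simp [scale_scale])
    (by simp [scale_scale])).trans (.scaled_one _) (by simp [scale_scale])).out D1 D2 ?_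
  refine .cR (act_scaled_trans t _ _ ?_) _
  refine act_inside_cut t r1 a [] (scale r2 E.list) _ _ D1 D2 ◾ (by simp [scale_scale]) (.cR ?_ _)
  exact act_inside_cut t r2 a [(r1, X)] [] _ _ D1 D2 rfl rfl (.cR (.refl _) _)

end

namespace Act.Ob

variable {α : Type u} {L : List α → List α → Type u} {A : Act L} {ex : ∀ a b, L [a, b] [b, a]}
  {S : A.Exch ex}

/-- Equality of morphisms whose ends are equal lists. -/
structure NEq {X Y X' Y' : Ob S} (f : X ⟶ Y) (g : X' ⟶ Y') : Prop where
  src : X = X'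
  tgt : Y = Y'
  heq : HEq f g

namespace NEq

variable {X Y Z X' Y' Z' X'' Y'' U V U' V' : Ob S}

lemma refl (f : X ⟶ Y) : NEq f f := ⟨rfl, rfl, .rfl⟩

lemma of_eq {f g : X ⟶ Y} (h : f = g) : NEq f g := h ▸ refl f

lemma eq {f g : X ⟶ Y} (h : NEq f g) : f = g := eq_of_heq h.heq

lemma symm {f : X ⟶ Y} {g : X' ⟶ Y'} (h : NEq f g) : NEq g f := ⟨h.1.symm, h.2.symm, h.3.symm⟩

lemma trans {f : X ⟶ Y} {g : X' ⟶ Y'} {k : X'' ⟶ Y''} (h : NEq f g) (h' : NEq g k) : NEq f k :=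
  ⟨h.1.trans h'.1, h.2.trans h'.2, h.3.trans h'.3⟩

lemma comp {f : X ⟶ Y} {f' : X' ⟶ Y'} {g : Y ⟶ Z} {g' : Y' ⟶ Z'} (h : NEq f f')
    (k : NEq g g') : NEq (f ≫ g) (f' ≫ g') := by
  obtain ⟨rfl, rfl, ⟨⟩⟩ := h
  obtain ⟨-, rfl, ⟨⟩⟩ := k
  exact refl _

lemma tensor {f : X ⟶ Y} {f' : X' ⟶ Y'} {g : U ⟶ V} {g' : U' ⟶ V'} (h : NEq f f')
    (k : NEq g g') : NEq (f ⊗ₘ g) (f' ⊗ₘ g') := by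
  obtain ⟨rfl, rfl, ⟨⟩⟩ := h
  obtain ⟨rfl, rfl, ⟨⟩⟩ := k
  exact refl _

lemma left (e : Z = Z') {f : X ⟶ Y} {f' : X' ⟶ Y'} (h : NEq f f') : NEq (Z ◁ f) (Z' ◁ f') := by
  obtain ⟨rfl, rfl, ⟨⟩⟩ := h; subst e; exact refl _

lemma right {f : X ⟶ Y} {f' : X' ⟶ Y'} (h : NEq f f') (e : Z = Z') : NEq (f ▷ Z) (f' ▷ Z') := by
  obtain ⟨rfl, rfl, ⟨⟩⟩ := h; subst e; exact refl _

lemma nil (f : X ⟶ Y) [hf : Nil f] : NEq f (𝟙 X) := by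
  obtain ⟨h, rfl⟩ := hf.out
  cases X; cases Y; cases h; exact refl _

lemma id (h : X = Y) : NEq (𝟙 X) (𝟙 Y) := by subst h; exact refl _

lemma comp_nil (f : X ⟶ Y) (g : Y ⟶ Z) [hg : Nil g] : NEq (f ≫ g) f := by
  obtain ⟨h, rfl⟩ := hg.out
  cases Y; cases Z; cases h; exact of_eq (Category.comp_id f)

lemma nil_comp (f : X ⟶ Y) (g : Y ⟶ Z) [hf : Nil f] : NEq (f ≫ g) g := by
  obtain ⟨h, rfl⟩ := hf.out
  cases X; cases Y; cases h; exact of_eq (Category.id_comp g)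

lemma of_sq {f : X ⟶ Y} {g : X' ⟶ Y'} (i : X ⟶ X') (j : Y ⟶ Y') [Nil i] [Nil j] (h : f ≫ j = i ≫ g) : NEq f g :=
  (comp_nil f j).symm.trans ((of_eq h).trans (nil_comp i g))

lemma of_act {p : Path L Y.list X.list} {q : Path L Y'.list X'.list} (hX : X = X') (hY : Y = Y')
    (h : ∀ {b} (D1 D2) (c : A.F b (D1 ++ Y.list ++ D2))
      (c' : A.F b (D1 ++ Y'.list ++ D2)), A.E c c' → A.E (A.act D1 D2 p c) (A.act D1 D2 q c')) :
    NEq (hom X Y p) (hom X' Y' q) :=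
  .of_sq (eqToHom hX) (eqToHom hY) (comp_nil_eq _ _ h)

lemma tensor_assoc (f : X ⟶ X') (g : Y ⟶ Y') (h : Z ⟶ Z') :
    NEq ((f ⊗ₘ g) ⊗ₘ h) (f ⊗ₘ (g ⊗ₘ h)) := .of_sq _ _ (associator_naturality f g h)

lemma left_left (X Y) (f : Z ⟶ Z') : NEq ((X ⊗ Y) ◁ f) (X ◁ Y ◁ f) :=
  .of_sq _ _ (associator_naturality_right X Y f)

lemma right_right (f : Z ⟶ Z') (X Y) : NEq (f ▷ (X ⊗ Y)) ((f ▷ X) ▷ Y) :=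
  .symm (.of_sq _ _ (associator_naturality_left f X Y))

lemma left_right (X) (f : Z ⟶ Z') (Y) : NEq ((X ◁ f) ▷ Y) (X ◁ f ▷ Y) :=
  .of_sq _ _ (associator_naturality_middle X f Y)

lemma unit_left (f : Z ⟶ Z') : NEq (𝟙_ (Ob S) ◁ f) f := .of_sq _ _ (leftUnitor_naturality f)

lemma right_unit (f : Z ⟶ Z') : NEq (f ▷ 𝟙_ (Ob S)) f := .of_sq _ _ (rightUnitor_naturality f)

lemma tensorμ_mid (X1 X2 Y1 Y2 : Ob S) : NEq (tensorμ X1 X2 Y1 Y2) (X1 ◁ (β_ X2 Y1).hom ▷ Y2) := by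
  unfold tensorμ
  refine (nil_comp ..).trans ?_
  rw [← Category.assoc]
  refine (comp_nil ..).trans (nil_comp ..)

end NEq

instance (X : Ob S) : Nil (β_ (𝟙_ (Ob S)) X).hom := by
  rw [braiding_tensorUnit_left]; infer_instance

instance (X : Ob S) : Nil (β_ X (𝟙_ (Ob S))).hom := by
  rw [braiding_tensorUnit_right]; infer_instance

lemma tensorμ_nil (X1 X2 Y1 Y2 : Ob S) [Nil (β_ X2 Y1).hom] : Nil (tensorμ X1 X2 Y1 Y2) := by
  unfold tensorμ; infer_instance

end Act.Ob

section

variable {C : Type u} [Category.{u} C] [MonoidalCategory C] [SymmetricCategory C]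

lemma tensorμ_braiding (X1 X2 Y1 Y2 : C) : tensorμ X1 X2 Y1 Y2 ≫ (β_ (X1 ⊗ Y1) (X2 ⊗ Y2)).hom =
      ((β_ X1 X2).hom ⊗ₘ (β_ Y1 Y2).hom) ≫ tensorμ X2 X1 Y2 Y1 := by
  simp [tensorμ, SymmetricCategory.braiding_swap_eq_inv_braiding Y1 X2, MonoidalCategory.tensorHom_def]

lemma tensorμ_tensor_assoc {A A1 A2 B B1 B2 D D1 D2 : C} (a : A ⟶ A1 ⊗ A2) (b : B ⟶ B1 ⊗ B2) (d : D ⟶ D1 ⊗ D2) :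
    ((((a ⊗ₘ b) ≫ tensorμ A1 A2 B1 B2) ⊗ₘ d) ≫ tensorμ (A1 ⊗ B1) (A2 ⊗ B2) D1 D2) ≫
      ((α_ A1 B1 D1).hom ⊗ₘ (α_ A2 B2 D2).hom) =
    (α_ A B D).hom ≫ ((a ⊗ₘ ((b ⊗ₘ d) ≫ tensorμ B1 B2 D1 D2)) ≫ tensorμ A1 A2 (B1 ⊗ D1) (B2 ⊗ D2)) := by
  have h1 : ((a ⊗ₘ b) ≫ tensorμ A1 A2 B1 B2) ⊗ₘ d = ((a ⊗ₘ b) ⊗ₘ d) ≫ tensorμ A1 A2 B1 B2 ▷ (D1 ⊗ D2) := by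
    rw [← tensorHom_id, tensorHom_comp_tensorHom, Category.comp_id]
  have h2 : a ⊗ₘ ((b ⊗ₘ d) ≫ tensorμ B1 B2 D1 D2) = (a ⊗ₘ (b ⊗ₘ d)) ≫ (A1 ⊗ A2) ◁ tensorμ B1 B2 D1 D2 := by
    rw [← id_tensorHom, tensorHom_comp_tensorHom, Category.comp_id]
  rw [h1, h2, Category.assoc, Category.assoc, Category.assoc, tensor_associativity, associator_naturality_assoc]

end

section

variable {R : Type u} [Semiring R] [Preorder R] [MulLeftMono R] [MulRightMono R]

lemma Act.Ob.NEq.tensorμ_congr {X1 X2 Y1 Y2 X1' X2' Y1' Y2' : CCat R} (h1 : X1 = X1') (h2 : X2 = X2')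
    (k1 : Y1 = Y1') (k2 : Y2 = Y2') :
    NEq (tensorμ X1 X2 Y1 Y2) (tensorμ X1' X2' Y1' Y2') := by
  subst h1; subst h2; subst k1; subst k2; exact .refl _

lemma Act.Ob.NEq.of_hsame {X Y X' Y' : CCat R} {p : Path GStep Y.list X.list}
    {q : Path GStep Y'.list X'.list} (hX : X = X') (hY : Y = Y')
    (h : ∀ t, Path.HSame (p.scaled t) (q.scaled t)) : NEq (hom X Y p) (hom X' Y' q) :=
  .of_sq (eqToHom hX) (eqToHom hY) (comp_nil_eq_of_hsame _ _ h)

lemma Act.Ob.NEq.map_scaleF (r : R) {f : X ⟶ Y} {g : X' ⟶ Y'} (h : NEq f g) :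
    NEq ((scaleF r).map f) ((scaleF r).map g) := by
  obtain ⟨rfl, rfl, ⟨⟩⟩ := h; exact .refl _

lemma Act.Ob.NEq.map_tensor (r : R) (f : X ⟶ Y) (g : X' ⟶ Y') :
    NEq ((scaleF r).map (f ⊗ₘ g)) ((scaleF r).map f ⊗ₘ (scaleF r).map g) :=
  .symm (.of_sq (eqToHom (scale_tensor r X X')) (eqToHom (scale_tensor r Y Y'))
    (Functor.LaxMonoidal.μ_natural (scaleF r) f g))

lemma Act.Ob.NEq.map_map (r s : R) (f : X ⟶ Y) :
    NEq ((scaleF (r * s)).map f) ((scaleF r).map ((scaleF s).map f)) := by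
  have h : ∀ {F G : CCat R ⥤ CCat R} (_ : F = G), NEq (F.map f) (G.map f) := by
    rintro F _ rfl; exact .refl _
  exact h (scaleF_mul r s)

/-! ### Contraction of a context -/

lemma weakAt_neq {r r' : R} (h : r = 0) (h' : r' = 0)
    (k : scale r X.list = scale r' X'.list) : NEq (weakAt r h X) (weakAt r' h' X') :=
  .of_hsame (congrArg Act.Ob.mk k) rfl fun t => weakPath_hsame h h' (by rw [k])

lemma contrAt_neq {r1 r2 r r1' r2' r' : R} (h : r = r1 + r2) (h' : r' = r1' + r2') (k1 : scale r1 X.list = scale r1' X'.list)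
    (k2 : scale r2 X.list = scale r2' X'.list) (k : scale r X.list = scale r' X'.list) :
    NEq (contrAt r1 r2 r h X) (contrAt r1' r2' r' h' X') :=
  .of_hsame (congrArg Act.Ob.mk k) (congrArg Act.Ob.mk (congrArg₂ _ k1 k2))
    fun t => contPath_hsame h h' (by rw [k1]) (by rw [k2]) (by rw [k])

lemma scaleF_weakAt (t r : R) (h : r = 0) (X : CCat R) :
    NEq ((scaleF t).map (weakAt r h X)) (weakAt (t * r) (by rw [h, mul_zero]) X) :=
  .of_hsame (congrArg Act.Ob.mk (scale_scale ..)) rfl fun u =>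
    (Path.HSame.scaled_scaled u t _).trans (weakPath_hsame _ _ (by simp [scale_scale, mul_assoc])) rfl

lemma scaleF_contrAt (t r1 r2 r : R) (h : r = r1 + r2) (X : CCat R) : NEq ((scaleF t).map (contrAt r1 r2 r h X))
      (contrAt (t * r1) (t * r2) (t * r) (by rw [h, mul_add]) X) :=
  .of_hsame (congrArg Act.Ob.mk (scale_scale ..)) (congrArg Act.Ob.mk (by simp [scale_scale])) fun u =>
    (Path.HSame.scaled_scaled u t _).trans (contPath_hsame _ _ (by simp [scale_scale, mul_assoc])
      (by simp [scale_scale, mul_assoc]) (by simp [scale_scale, mul_assoc]))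
      (by simp [scale_scale, mul_assoc])

lemma act_contPath_cons {A : Act (GStep (R := R))} (r1 r2 r : R) (h : r = r1 + r2) (a : R) (X) (E D1 D2) {b}
    {c : A.F b (D1 ++ (scale r1 ((a, X) :: E) ++ scale r2 ((a, X) :: E)) ++ D2)}
    {c' : A.F b (D1 ++ [(r1 * a, X)] ++ (scale r1 E ++ [(r2 * a, X)]) ++ (scale r2 E ++ D2))}
    {d : A.F b (D1 ++ [(r1 * a, X), (r2 * a, X)] ++ (scale r1 E ++ scale r2 E ++ D2))}
    {e : A.F b (D1 ++ [(r * a, X)] ++ (scale r1 E ++ scale r2 E) ++ D2)} (hc : A.E c c')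
    (hd : A.E (A.act (D1 ++ [(r1 * a, X)]) (scale r2 E ++ D2) (Path.swap GStep.ex (scale r1 E) [(r2 * a, X)]) c') d)
    (he : A.E (A.run (.left (.cont (r1 * a) (r2 * a) (r * a) X (by rw [h, add_mul]))) D1
      (scale r1 E ++ scale r2 E ++ D2) d) e) :
    A.E (A.act D1 D2 (contPath r1 r2 r h ((a, X) :: E)) c)
      (A.act (D1 ++ [(r * a, X)]) D2 (contPath r1 r2 r h E) e) := by
  rw [contPath_cons]
  refine Act.act_trans' _ _ (Act.act_inside' _ _ _ rfl rfl ?_)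
  refine A.trans (Act.act_snoc ..) (A.trans ?_ he)
  refine Act.run_congr' _ ◾ rfl (Act.E.cL (A.trans ?_ hd) _)
  exact Act.act_inside' _ _ _ rfl rfl hc

lemma contrAt_one (r1 r2 r : R) (h : r = r1 + r2) (a : R) (X) : NEq (contrAt r1 r2 r h (CCat.of [(a, X)]))
      (cont1 (r1 * a) (r2 * a) (r * a) (by rw [h, add_mul]) X) :=
  .of_act rfl rfl fun {b} D1 D2 c c' e => by
    refine Act.trans _ (act_contPath_cons r1 r2 r h a X [] D1 D2
      (Act.E_cast c ◾) (d := c') ?_ (Act.E_cast _ ◾)) ?_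
    · exact Act.act_swap_nil _ (Act.E.cL e _)
    · refine Act.act_nil' _ (Act.E.cL ?_ _)
      exact Act.symm _ (Act.act_single ..)

lemma contrAt_cons (r1 r2 r : R) (h : r = r1 + r2) (p) (Y) : NEq (contrAt r1 r2 r h (CCat.of [p] ⊗ Y))
      ((contrAt r1 r2 r h (CCat.of [p]) ⊗ₘ contrAt r1 r2 r h Y) ≫ tensorμ ..) := by
  obtain ⟨a, X⟩ := p
  let k : (CCat.of [(r1 * a, X)] ⊗ CCat.of [(r2 * a, X)]) ⊗ (scaleF r1).obj Y ⊗ (scaleF r2).obj Y ⟶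
      CCat.of [(r1 * a, X)] ⊗ (CCat.of [(r2 * a, X)] ⊗ (scaleF r1).obj Y) ⊗ (scaleF r2).obj Y :=
    (nilIso _ _ ◾).hom
  have hk : Nil k := ⟨_, rfl⟩
  refine .trans ?_ (.comp (.tensor (contrAt_one r1 r2 r h a X).symm (.refl _))
    (.refl (tensorμ (CCat.of [(r1 * a, X)]) (CCat.of [(r2 * a, X)]) ..)))
  refine .trans ?_ (.comp (.comp_nil _ k) (NEq.tensorμ_mid ..).symm)
  rw [tensorHom_def']
  refine .of_act rfl (congrArg Act.Ob.mk ◾) fun {b} D1 D2 c c' e => ?_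
  let d := (actC R).act (b := b) (D1 ++ [(r1 * a, X)]) (scale r2 Y.list ++ D2)
    (Path.swap GStep.ex (scale r1 Y.list) [(r2 * a, X)]) ((actC R).cast c ◾)
  let d' := (actC R).run (b := b) (.left (.cont (r1 * a) (r2 * a) (r * a) X (by rw [h, add_mul]))) D1
      (scale r1 Y.list ++ scale r2 Y.list ++ D2) ((actC R).cast d ◾)
  refine Act.trans _ (act_contPath_cons r1 r2 r h a X Y.list D1 D2
      (Act.E_cast c ◾) (Act.E_cast d ◾) (Act.E_cast d' ◾)) (Act.symm _ ?_)
  refine Act.act_trans' _ _ (Act.act_trans' _ _ (Act.act_trans' _ _ ?_))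
  refine act_left _ rfl rfl (Act.E.cR (Act.trans _ (act_right _ rfl rfl ?_) (Act.act_single ..)) _)
  refine Act.E.cR (Act.act_nil' _ ?_) _
  exact Act.trans _ (act_left _ rfl rfl (Act.E_cast c' ◾))
    (act_right _ rfl rfl (Act.E.cL (Act.E.cR (Act.symm _ e) _) _))

lemma scaleF_tensor_obj (r : R) (X Y) :
    (scaleF r).obj (X ⊗ Y) = (scaleF r).obj X ⊗ (scaleF r).obj Y := (scale_tensor r X Y).symm

lemma contrAt_tensor (r1 r2 r : R) (h : r = r1 + r2) : ∀ X Y : CCat R, NEq (contrAt r1 r2 r h (X ⊗ Y))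
      ((contrAt r1 r2 r h X ⊗ₘ contrAt r1 r2 r h Y) ≫ tensorμ ..)
  | ⟨[]⟩, Y => by
    have : Nil (contrAt r1 r2 r h (𝟙_ (CCat R))) := ⟨rfl, rfl⟩
    have : Nil (β_ ((scaleF r2).obj (𝟙_ (CCat R))) ((scaleF r1).obj Y)).hom :=
      inferInstanceAs (Nil (β_ (𝟙_ (CCat R)) _).hom)
    have := tensorμ_nil ((scaleF r1).obj (𝟙_ (CCat R))) ((scaleF r2).obj (𝟙_ (CCat R)))
      ((scaleF r1).obj Y) ((scaleF r2).obj Y)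
    refine .symm ((NEq.comp_nil ..).trans ?_)
    exact (NEq.tensor (NEq.nil _) (.refl _)).trans (.trans (.of_eq (id_tensorHom ..)) (.unit_left _))
  | ⟨p :: E⟩, Y => by
    refine (contrAt_cons r1 r2 r h p (CCat.of E ⊗ Y)).trans (.trans (.comp (.tensor (.refl _)
      (contrAt_tensor r1 r2 r h (CCat.of E) Y)) (NEq.tensorμ_congr rfl rfl (scaleF_tensor_obj ..)
        (scaleF_tensor_obj ..))) (.trans (.symm (NEq.of_sq _ _ (tensorμ_tensor_assoc ..))) ?_))
    exact .comp (.tensor (contrAt_cons r1 r2 r h p (CCat.of E)).symm (.refl _)) (.refl _)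

end

section

variable {C : Type u} [Category.{u} C] [MonoidalCategory C] [SymmetricCategory C]

lemma tensorμ_tensorμ (X1 X2 Y1 Y2 : C) : tensorμ X1 X2 Y1 Y2 ≫ tensorμ X1 Y1 X2 Y2 = 𝟙 _ := by
  simp [tensorμ, SymmetricCategory.braiding_swap_eq_inv_braiding Y1 X2]

lemma braiding_tensorμ (X1 X2 Y1 Y2 : C) : (β_ (X1 ⊗ X2) (Y1 ⊗ Y2)).hom ≫ tensorμ Y1 Y2 X1 X2 =
      tensorμ X1 X2 Y1 Y2 ≫ ((β_ X1 Y1).hom ⊗ₘ (β_ X2 Y2).hom) := by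
  have h := tensorμ_braiding X1 Y1 X2 Y2
  calc (β_ (X1 ⊗ X2) (Y1 ⊗ Y2)).hom ≫ tensorμ Y1 Y2 X1 X2 = (tensorμ X1 X2 Y1 Y2 ≫ tensorμ X1 Y1 X2 Y2) ≫
        (β_ (X1 ⊗ X2) (Y1 ⊗ Y2)).hom ≫ tensorμ Y1 Y2 X1 X2 := by
        rw [tensorμ_tensorμ, Category.id_comp]
    _ = tensorμ X1 X2 Y1 Y2 ≫ (tensorμ X1 Y1 X2 Y2 ≫
        (β_ (X1 ⊗ X2) (Y1 ⊗ Y2)).hom) ≫ tensorμ Y1 Y2 X1 X2 := by simp only [Category.assoc]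
    _ = _ := by rw [h, Category.assoc, tensorμ_tensorμ, Category.comp_id]

end

namespace Act.Ob

variable {α : Type u} {L : List α → List α → Type u} {A : Act L} {ex : ∀ a b, L [a, b] [b, a]}
  {S : A.Exch ex}

lemma hom_induction {P : ∀ {X Y : Ob S}, (X ⟶ Y) → Prop} (nil : ∀ {X Y : Ob S} (f : X ⟶ Y) [Nil f], P f)
    (comp : ∀ {X Y Z : Ob S} {f : X ⟶ Y} {g : Y ⟶ Z}, P f → P g → P (f ≫ g))
    (tensor : ∀ {X Y X' Y' : Ob S} {f : X ⟶ Y} {g : X' ⟶ Y'}, P f → P g → P (f ⊗ₘ g))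
    (step : ∀ {X Y : List α} (l : L X Y), P (hom (⟨Y⟩ : Ob S) ⟨X⟩ (.single l)))
    {X Y : Ob S} (f : X ⟶ Y) : P f := by
  obtain ⟨p, rfl⟩ := hom_surj f
  obtain ⟨K⟩ := X
  obtain ⟨N⟩ := Y
  dsimp only at p
  induction p with
  | nil h => exact nil _
  | @snoc M X Y K p E1 E2 l hN hK ih =>
    subst hN; subst hK
    have e : hom (⟨E1 ++ Y ++ E2⟩ : Ob S) ⟨N⟩ (.snoc p E1 E2 l rfl rfl) =
        ((𝟙 (⟨E1⟩ : Ob S) ⊗ₘ hom (⟨Y⟩ : Ob S) ⟨X⟩ (.single l)) ⊗ₘ 𝟙 (⟨E2⟩ : Ob S)) ≫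
          hom (⟨E1 ++ X ++ E2⟩ : Ob S) ⟨N⟩ p := by
      rw [id_tensorHom, tensorHom_id]
      refine hom_sound ⟨fun D1 D2 c => A.trans (act_snoc ..) (A.symm (act_trans' _ _ ?_))⟩
      refine A.trans (act_right _ rfl rfl (A.E_cast _ ◾)) ?_
      refine A.trans (act_left _ rfl rfl (A.E_cast _ ◾)) ?_
      refine A.trans (act_single' _ rfl rfl (A.refl _)) ?_
      exact A.run_congr _ _ _ (E.cL (E.cL (E.cR (A.refl _) _) _) _)
    rw [e]
    exact comp (tensor (tensor (nil _) (step l)) (nil _)) ih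

end Act.Ob

section

variable {R : Type u} [Semiring R] [Preorder R] [MulLeftMono R] [MulRightMono R]

lemma GS.exists_concl : ∀ E : GCtx R, ∃ Z, Nonempty (GS E Z)
  | [] => ⟨_, ⟨.unitR⟩⟩
  | p :: E => (exists_concl E).elim fun _ ⟨κ⟩ => ⟨_, ⟨.tenR (uDer p) κ⟩⟩

lemma weakAt_natural (r : R) (h : r = 0) (f : X ⟶ Y) : (scaleF r).map f ≫ weakAt r h Y = weakAt r h X := by
  obtain ⟨p, rfl⟩ := hom_surj f
  obtain ⟨Z, ⟨κ⟩⟩ := GS.exists_concl Y.list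
  rw [← cutHom_weak1 r h κ, ← Category.assoc,
    scaleF_map_cutHom r p κ (GS.cast (GS.act [] [] p (GS.cast κ ◾)) ◾)
      (.cL (.refl _) _), cutHom_weak1]

/-! ### Naturality of contraction -/

def ContrNat {X Y : CCat R} (f : X ⟶ Y) : Prop := ∀ (r1 r2 r : R) (h : r = r1 + r2),
  NEq ((scaleF r).map f ≫ contrAt r1 r2 r h Y)
    (contrAt r1 r2 r h X ≫ ((scaleF r1).map f ⊗ₘ (scaleF r2).map f))

lemma ContrNat.of_neq {X Y X' Y' : CCat R} {f : X ⟶ Y} {g : X' ⟶ Y'} (h : NEq f g)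
    (hf : ContrNat f) : ContrNat g := by
  obtain ⟨rfl, rfl, ⟨⟩⟩ := h; exact hf

lemma ContrNat.id (X : CCat R) : ContrNat (𝟙 X) := fun r1 r2 r h => by
  simpa using NEq.refl (contrAt r1 r2 r h X)

lemma ContrNat.comp {X Y Z : CCat R} {f : X ⟶ Y} {g : Y ⟶ Z} (hf : ContrNat f)
    (hg : ContrNat g) : ContrNat (f ≫ g) := fun r1 r2 r h => .of_eq <| by
  rw [Functor.map_comp, Functor.map_comp, Functor.map_comp, Category.assoc, (hg ..).eq,
    reassoc_of% (hf ..).eq, tensorHom_comp_tensorHom]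

lemma ContrNat.tensor {X Y X' Y' : CCat R} {f : X ⟶ Y} {g : X' ⟶ Y'} (hf : ContrNat f)
    (hg : ContrNat g) : ContrNat (f ⊗ₘ g) := fun r1 r2 r h => by
  refine .trans (.comp (.map_tensor r f g) (contrAt_tensor ..)) (.trans (.of_eq ?_) (.symm
    (NEq.comp (contrAt_tensor ..) (.tensor (.map_tensor r1 f g) (.map_tensor r2 f g)))))
  rw [tensorHom_comp_tensorHom_assoc, (hf ..).eq, (hg ..).eq, Category.assoc,
    ← tensorμ_natural, tensorHom_comp_tensorHom_assoc]

lemma ContrNat.inv {X Y : CCat R} {f : X ⟶ Y} {g : Y ⟶ X} (h1 : f ≫ g = 𝟙 _) (h2 : g ≫ f = 𝟙 _)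
    (hf : ContrNat f) : ContrNat g := fun r1 r2 r h => .of_eq <| by
  have e : ∀ s, (scaleF s).map f ≫ (scaleF s).map g = 𝟙 _ := fun s => by
    rw [← Functor.map_comp, h1, CategoryTheory.Functor.map_id]
  have e' : (scaleF r).map g ≫ (scaleF r).map f = 𝟙 _ := by
    rw [← Functor.map_comp, h2, CategoryTheory.Functor.map_id]
  calc (scaleF r).map g ≫ contrAt r1 r2 r h X
      = (scaleF r).map g ≫ (contrAt r1 r2 r h X ≫ ((scaleF r1).map f ⊗ₘ (scaleF r2).map f)) ≫
        ((scaleF r1).map g ⊗ₘ (scaleF r2).map g) := by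
        rw [Category.assoc, tensorHom_comp_tensorHom, e, e, id_tensorHom_id, Category.comp_id]
    _ = _ := by rw [← (hf r1 r2 r h).eq, Category.assoc, reassoc_of% e']

lemma ContrNat.sub {P Q : GCtx R} (m : CtxLe P Q) :
    ContrNat (hom (CCat.of Q) (CCat.of P) (.single (.sub m))) := fun r1 r2 r h => by
  have e : (scaleF r1).map (hom (CCat.of Q) (CCat.of P) (.single (.sub m))) ⊗ₘ
      (scaleF r2).map (hom (CCat.of Q) (CCat.of P) (.single (.sub m))) =
      subHom ((m.scale r1).append (m.scale r2)) := subHom_tensor (m.scale r1) (m.scale r2)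
  rw [e]
  exact .of_eq (subHom_natural (fun t => contPath_subNat h h ((m.scale _).scale t)
    ((m.scale _).scale t) ((m.scale _).scale t)) (m.scale r) _).symm

lemma scaleF_cutHom (r u : R) {E : CCat R} (a : GS E.list X) :
    NEq ((scaleF r).map (cutHom u a)) (cutHom (r * u) a) :=
  .of_hsame (congrArg Act.Ob.mk (scale_scale ..)) rfl fun t => ⟨fun D1 D2 Y c c' e =>
    (GS.act_scaled_scaled t r _ rfl rfl (.cR (.refl _) (by simp [mul_assoc]))).trans
      ((act_cutHom (t * r) u a D1 D2 (.refl _)).trans (.trans (.cut (mul_assoc ..) rfl rfl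
        rfl (.refl _) (.cL e _)) (act_cutHom t (r * u) a D1 D2 (.refl _)).symm))⟩

lemma ContrNat.cutHom (u : R) {E : CCat R} (a : GS E.list X) : ContrNat (cutHom u a) := fun r1 r2 r h => by
  refine .trans (.comp (scaleF_cutHom r u a) (contrAt_one r1 r2 r h u X)) (.trans (.of_eq
    (cutHom_cont1 _ _ _ _ a)) (.comp (contrAt_neq _ _ (by simp [scale_scale])
    (by simp [scale_scale]) (by simp [scale_scale])) (.tensor (scaleF_cutHom r1 u a).symm
    (scaleF_cutHom r2 u a).symm)))

/-! ### Laws for one hypothesis -/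

lemma GS.cont_weak (hz : z = 0) (h : r = z + r2) (X : GTy R) {c : GS (D1 ++ [(z, X), (r2, X)] ++ D2) Y}
    {d : GS (D1 ++ [] ++ ([(r2, X)] ++ D2)) Y} (e : EqG c (.left (.weak z X hz) D1 ([(r2, X)] ++ D2) d)) :
    EqG (.left (.cont z r2 r X h) D1 D2 c) d := by
  subst hz
  obtain rfl : r = r2 := by rw [h, zero_add]
  refine .trans ?_ ((EqG.struct (.contr_unitL r X) D1 D2 (d.cast ◾)).trans (.cL (.cast_left ..) _))
  refine .cR (.left _ ◾ rfl (.cR (.cR (e.trans ?_) _) _)) _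
  exact .left _ ◾ rfl (.cR (.cR (.cR (.refl _) _) _) _)

lemma GS.cont_assoc (hu : u = r1 + r2) (hw : w = r2 + r3) (h : v = u + r3) (h' : v = r1 + w) (X : GTy R)
    {c : GS (D1 ++ [(r1, X), (r2, X)] ++ ([(r3, X)] ++ D2)) Y}
    {c' : GS (D1 ++ [(r1, X)] ++ [(r2, X), (r3, X)] ++ D2) Y} (e : EqG c c')
    {d : GS (D1 ++ [(u, X), (r3, X)] ++ D2) Y} {d' : GS (D1 ++ [(r1, X), (w, X)] ++ D2) Y}
    (k : EqG d (.left (.cont r1 r2 u X hu) D1 ([(r3, X)] ++ D2) c))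
    (k' : EqG d' (.left (.cont r2 r3 w X hw) (D1 ++ [(r1, X)]) D2 c')) :
    EqG (.left (.cont u r3 v X h) D1 D2 d) (.left (.cont r1 w v X h') D1 D2 d') := by
  subst hu; subst hw; subst h
  have q := EqG.struct (.contr_assoc r1 r2 r3 X) D1 D2 (c.cast ◾)
  refine .trans (.cR (.left _ ◾ rfl (.cR (.cR (k.trans
    (.left _ ◾ rfl ?_)) _) _)) _) (q.trans (.cL (.left _ ◾ rfl
    (.cL (.cL (.trans (.left _ rfl rfl ?_) k'.symm) _) _)) _))
  · exact .cR (.cR (.cR (.refl _) _) _) _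
  · exact .cL (.cL (.cL e _) _) _

lemma GS.cont_ex (h : r = r1 + r2) (h' : r = r2 + r1) (X : GTy R) {c : GS (D1 ++ [(r2, X), (r1, X)] ++ D2) Y} {d : GS (D1 ++ [(r1, X), (r2, X)] ++ D2) Y}
    (e : EqG d (.left (.ex (r2, X) (r1, X)) D1 D2 c)) :
    EqG (.left (.cont r1 r2 r X h) D1 D2 d) (.left (.cont r2 r1 r X h') D1 D2 c) := by
  subst h'
  have q := EqG.struct (.contr_sym r2 r1 X) D1 D2 c
  refine .trans (.cR (.left _ ◾ rfl (.cR (.cR (e.trans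
    (.left _ ◾ rfl ?_)) _) _)) _) (q.symm.trans (.cL (.left _ ◾ rfl ?_) _))
  · exact .cR (.cR (.refl _) _) _
  · exact .cL (.cL (.refl _) _) _

lemma act_inside_single (t : R) (st : GStep P Q) (E1 E2 : GCtx R) (hM : M = E1 ++ P ++ E2) (hK : K = E1 ++ Q ++ E2)
    (D1 D2 : GCtx R) (h1 : D1 ++ scale t E1 = D1') (h2 : scale t E2 ++ D2 = D2') {c : GS (D1 ++ scale t M ++ D2) Y} {c' : GS (D1' ++ scale t P ++ D2') Y}
    (e : EqG c c') : EqG (GS.act D1 D2 (((Path.single st).inside E1 E2 hM hK).scaled t) c)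
      ((st.scaled t).runG D1' D2' c') := by
  subst h1; subst h2
  exact .trans (Path.act_scaled_inside (A := actG R) t _ E1 E2 hM hK D1 D2 (d := c') e)
    (Act.act_single (A := actG R) ..)

lemma cont1_weak1 (hz : z = 0) (h : r = z + r2) (X : GTy R) :
    NEq (cont1 z r2 r h X ≫ weak1 z hz X ▷ CCat.of [(r2, X)]) (𝟙 (CCat.of [(r2, X)])) := by
  have hr : r = r2 := by rw [h, hz, zero_add]
  refine .of_hsame (by rw [hr]) rfl fun t => ⟨fun D1 D2 Y c c' e => act_scaled_trans t _ _ ?_⟩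
  refine .trans (Act.act_single (A := actG R) _ _ _ _) (.trans (GS.cont_weak _ _ _
    (act_inside_single t _ [] [(r2, X)] _ _ D1 D2 (D1' := D1) ◾ rfl
      (c' := GS.cast c ◾) (.cR (.refl _) _)))
    (.cL (e.trans (.symm (Act.act_nil (A := actG R) ..))) _))

lemma cont1_assoc (hu : u = r1 + r2) (hw : w = r2 + r3) (h : v = u + r3) (h' : v = r1 + w) (X : GTy R) :
    NEq (cont1 u r3 v h X ≫ cont1 r1 r2 u hu X ▷ CCat.of [(r3, X)])
      (cont1 r1 w v h' X ≫ CCat.of [(r1, X)] ◁ cont1 r2 r3 w hw X) := by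
  refine .of_hsame rfl rfl fun t => ⟨fun D1 D2 Y c c' e => act_scaled_trans t _ _ (.symm (act_scaled_trans t _ _ ?_))⟩
  refine .symm (.trans (Act.act_single (A := actG R) ..) (.trans
    (GS.cont_assoc (c := GS.cast c ◾) (c' := GS.cast c' ◾) _ (by rw [hw, mul_add]) _
      (by rw [h', mul_add]) X
      (.cL (.cR e _) _)
      (act_inside_single t _ [] [(r3, X)] _ _ D1 D2 ◾ rfl (.cR (.refl _) _))
      (act_inside_single t _ [(r1, X)] [] _ _ D1 D2 rfl rfl (.cR (.refl _) _)))
    (.symm (Act.act_single (A := actG R) ..))))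

lemma braiding_one (a b : R × GTy R) : (β_ (CCat.of [b]) (CCat.of [a])).hom =
    hom (CCat.of [b] ⊗ CCat.of [a]) (CCat.of [a] ⊗ CCat.of [b]) (.single (.ex a b)) := by
  refine hom_sound (S := actC_exch) ⟨fun {β} D1 D2 c => ?_⟩
  refine Act.trans _ (Act.act_swap_one ..) (Act.act_trans' _ _ ?_)
  refine Act.trans _ (Act.act_inside' _ _ _ rfl rfl (Act.E_cast _ ◾)) (Act.act_nil' _ (Act.E.cL ?_ _))
  exact Act.trans _ (Act.act_inside' _ _ _ rfl rfl (Act.E_cast _ ◾))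
    (Act.act_congr _ ◾ rfl (Act.cast_E ..))

lemma cont1_braiding (h : r = r1 + r2) (h' : r = r2 + r1) (X : GTy R) :
    cont1 r1 r2 r h X ≫ (β_ (CCat.of [(r1, X)]) (CCat.of [(r2, X)])).hom = cont1 r2 r1 r h' X := by
  rw [braiding_one]
  refine hom_eq_of_act fun t D1 D2 Y c => act_scaled_trans t _ _ ?_
  exact .trans (Act.act_single (A := actG R) ..) (.trans (GS.cont_ex _ _ X
    (Act.act_single (A := actG R) ..)) (.symm (Act.act_single (A := actG R) ..)))

/-! ### Left introduction of `J` and of `⊠` is invertible -/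

lemma GS.left_unit_cut (r : R) {c : GS (D1 ++ [(r, .unit)] ++ D2) Y} {d : GS (D1 ++ [] ++ D2) Y}
    (e : EqG d (.cut r D1 D2 .unitR c)) : EqG (.left (.unit r) D1 D2 d) c := by
  refine .symm ((EqG.cut_id_left r D1 D2 c).symm.trans (.trans (.congr_cut r D1 D2
    EqG.eta_unit (.refl c)) ((EqG.cut_left_left r D1 D2 (.unit 1) [] [] GS.unitR c).trans
    (EqG.left_heq rfl (by simp [scale]) ?_ (by simp [scale]) rfl (.cL e.symm _)))))
  show HEq (GLeft.unit (r * 1)) (GLeft.unit r)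
  rw [mul_one]

lemma GS.left_tensor_cut (r : R) (X Z : GTy R)
    {c : GS (D1 ++ [(r, .tensor X Z)] ++ D2) Y} {d : GS (D1 ++ [(r, X), (r, Z)] ++ D2) Y}
    (e : EqG d (.cut r D1 D2 (.tenR (.id X) (.id Z)) c)) :
    EqG (.left (.tensor r X Z) D1 D2 d) c := by
  refine .symm ((EqG.cut_id_left r D1 D2 c).symm.trans (.trans (.congr_cut r D1 D2
    (EqG.eta_tensor X Z) (.refl c)) ((EqG.cut_left_left r D1 D2 (.tensor 1 X Z) [] [] _ c).trans
    (EqG.left_heq (by simp [scale]) (by simp [scale]) ?_ (by simp [scale]) rfl (.cL e.symm _)))))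
  show HEq (GLeft.tensor (r * 1) X Z) (GLeft.tensor r X Z)
  rw [mul_one]

def unitHom (r : R) : CCat.of [] ⟶ CCat.of [(r, .unit)] := cutHom r (E := CCat.of []) .unitR

def pairHom (r : R) (X Y : GTy R) : CCat.of [(r, X), (r, Y)] ⟶ CCat.of [(r, .tensor X Y)] :=
  hom (CCat.of [(r, X), (r, Y)]) (CCat.of [(r, .tensor X Y)])
    (.single (.cut r (.tenR (.id X) (.id Y)) (by simp [scale])))

def unitIso (r : R) : CCat.of [(r, .unit)] ≅ CCat.of [] where
  hom := hom (CCat.of [(r, .unit)]) (CCat.of []) (.single (.left (.unit r)))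
  inv := unitHom r
  hom_inv_id := hom_eq_of_act fun t D1 D2 _ _ => act_scaled_trans t _ _ <|
    EqG.trans (Act.act_single (A := actG R) ..) (.trans (GS.left_unit_cut (t * r)
      (act_cutHom t r .unitR D1 D2 (.refl _))) (.symm (Act.act_nil (A := actG R) ..)))
  inv_hom_id := hom_eq_of_act fun t D1 D2 _ _ => act_scaled_trans t _ _ <|
    (act_cutHom t r .unitR D1 D2 (Act.act_single (A := actG R) ..)).trans
      (.trans (EqG.cut_unit ..) (.symm (Act.act_nil (A := actG R) ..)))

lemma act_pairHom (t r : R) (X Z : GTy R) (D1 D2 : GCtx R)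
    {c c' : GS (D1 ++ [(t * r, .tensor X Z)] ++ D2) Y} (e : EqG c c') :
    EqG (GS.act D1 D2 ((Path.single (GStep.cut (Q := [(r, X), (r, Z)]) r
      (.tenR (.id X) (.id Z)) (by simp [scale]))).scaled t) c)
      (GS.cut (t * r) D1 D2 (.tenR (.id X) (.id Z)) c') := by
  refine .trans (Act.act_single (A := actG R) ..) ?_
  exact .cL (.cut rfl rfl rfl rfl (.refl _) e) _

def pairIso (r : R) (X Y : GTy R) : CCat.of [(r, .tensor X Y)] ≅ CCat.of [(r, X), (r, Y)] where
  hom := hom (CCat.of [(r, .tensor X Y)]) (CCat.of [(r, X), (r, Y)])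
    (.single (.left (.tensor r X Y)))
  inv := pairHom r X Y
  hom_inv_id := hom_eq_of_act fun t D1 D2 Z c => act_scaled_trans t _ _ <|
    EqG.trans (Act.act_single (A := actG R) ..) (.trans (GS.left_tensor_cut (t * r) X Y
      (act_pairHom t r X Y D1 D2 (.refl _))) (.symm (Act.act_nil (A := actG R) ..)))
  inv_hom_id := hom_eq_of_act fun t D1 D2 Z c => act_scaled_trans t _ _ <| by
    refine (act_pairHom t r X Y D1 D2 (Act.act_single (A := actG R) ..)).trans
      ((EqG.cut_tensor ..).trans (.trans ?_
        (.symm (Act.act_nil (A := actG R) ..))))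
    refine .trans (.cut rfl (D1' := D1 ++ [(t * r, X)]) (by simp [scale]) rfl rfl (.refl _)
      (c' := GS.cast c (by simp [scale])) (.cL ?_ _)) ((EqG.cut_id_left ..).trans
      (.cL (.refl _) _))
    exact (EqG.cut_id_left ..).trans (.cast2 ..)

/-! ### Naturality of contraction -/

lemma ContrNat.unit (r : R) : ContrNat (unitIso r).hom :=
  .inv (unitIso r).inv_hom_id (unitIso r).hom_inv_id (.cutHom r _)

lemma ContrNat.pair (r : R) (X Y : GTy R) : ContrNat (pairIso r X Y).hom := by
  refine .inv (pairIso r X Y).inv_hom_id (pairIso r X Y).hom_inv_id (.of_neq ?_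
    (.cutHom r (E := CCat.of [(1, X), (1, Y)]) (.tenR (.id X) (.id Y))))
  exact .of_hsame (congrArg Act.Ob.mk (by simp [scale])) rfl fun t => ⟨fun D1 D2 _ _ _ e =>
    (act_cutHom t r _ D1 D2 e).trans (act_pairHom t r X Y D1 D2 (.refl _)).symm⟩

lemma weak1_neq (h : r = 0) (h' : r' = 0) (X : GTy R) : NEq (weak1 r h X) (weak1 r' h' X) := by
  obtain rfl : r = r' := h.trans h'.symm; exact .refl _

lemma ContrNat.weak (r : R) (h : r = 0) (X : GTy R) : ContrNat (weak1 r h X) := fun r1 r2 t k => by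
  have hz : Nil (contrAt r1 r2 t k (𝟙_ (CCat R))) := ⟨rfl, rfl⟩
  have e : ∀ s : R, NEq ((scaleF s).map (weak1 r h X)) (weak1 (s * r) (by rw [h, mul_zero]) X) := fun s => .of_eq rfl
  refine .trans (NEq.comp_nil ..) (.trans (e t) (.symm (.trans (.comp (contrAt_one r1 r2 t k r X)
    (.tensor (e r1) (e r2))) ?_)))
  rw [MonoidalCategory.tensorHom_def, ← Category.assoc]
  refine .trans (.comp (cont1_weak1 (by rw [h, mul_zero]) _ X) (NEq.unit_left _)) ?_
  exact .trans (.of_eq (Category.id_comp _)) (weak1_neq ..)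

lemma cont1_four (hu : u = p + q) (hv : v = s + t) (hy : y = u + v)
    (k : R) (hk : k = q + s) (hw : w = k + t) (X : GTy R) :
    NEq (cont1 u v y hy X ≫ (cont1 p q u hu X ⊗ₘ cont1 s t v hv X))
      (cont1 p w y (by rw [hy, hw, hu, hk, hv]; simp only [add_assoc]) X ≫
        CCat.of [(p, X)] ◁ (cont1 k t w hw X ≫ cont1 q s k hk X ▷ CCat.of [(t, X)])) := by
  have hw' : w = q + v := by rw [hw, hk, hv, add_assoc]
  rw [MonoidalCategory.tensorHom_def, ← Category.assoc]
  refine .trans (.comp (cont1_assoc hu hw' hy (by rw [hy, hu, hw', add_assoc]) X) (NEq.left_left ..)) ?_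
  rw [Category.assoc, ← whiskerLeft_comp]
  exact .comp (.refl _) (.left rfl (cont1_assoc hk hv hw hw' X).symm)

lemma ContrNat.cont (a b r : R) (h : r = a + b) (X : GTy R) : ContrNat (cont1 a b r h X) := fun r1 r2 t k => by
  have e : ∀ s : R, NEq ((scaleF s).map (cont1 a b r h X))
    (cont1 (s * a) (s * b) (s * r) (by rw [h, mul_add]) X) := fun s => .of_eq rfl
  refine .trans (.comp (e t) (contrAt_cons ..)) (.symm (.trans (.comp
    (contrAt_one ..) (.tensor (e r1) (e r2))) ?_))
  have hm : r1 * b + r2 * a = r2 * a + r1 * b := add_comm ..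
  refine .trans (cont1_four _ _ _ _ rfl (w := r1 * b + r2 * a + r2 * b) rfl X) (.symm ?_)
  refine .trans (.of_eq (Category.assoc ..).symm) ?_
  refine .trans (.comp (.trans (.comp (.refl _) (.tensor (contrAt_one ..)
    (contrAt_one ..))) (cont1_four _ _ _ (r1 * b + r2 * a) hm rfl X))
    (NEq.tensorμ_mid ..)) ?_
  refine .of_eq ((Category.assoc ..).trans (congrArg _ ?_))
  refine (whiskerLeft_comp ..).symm.trans (congrArg _ ?_)
  refine (Category.assoc ..).trans (congrArg _ ?_)
  refine (comp_whiskerRight ..).symm.trans (congrArg (· ▷ _) ?_)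
  exact cont1_braiding _ _ X

lemma Act.Ob.NEq.map_braiding (r : R) (X Y : CCat R) :
    NEq ((scaleF r).map (β_ X Y).hom) (β_ ((scaleF r).obj X) ((scaleF r).obj Y)).hom :=
  .symm (.of_sq (eqToHom (scale_tensor r X Y)) (eqToHom (scale_tensor r Y X))
    (Functor.LaxBraided.braided (F := scaleF r) X Y).symm)

lemma ContrNat.braiding (X Y : CCat R) : ContrNat (β_ X Y).hom := fun r1 r2 r h => by
  refine .trans (.comp (.map_braiding r X Y) (contrAt_tensor ..)) (.symm (.trans
    (.comp (contrAt_tensor ..) (.tensor (.map_braiding r1 X Y) (.map_braiding r2 X Y)))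
    (.of_eq ?_)))
  rw [Category.assoc, ← braiding_tensorμ, BraidedCategory.braiding_naturality_assoc]

lemma contrNat {X Y : CCat R} (f : X ⟶ Y) : ContrNat f := by
  refine hom_induction (P := fun f => ContrNat f) (fun {X Y} f hf => ?_) .comp .tensor (fun {P Q} l => ?_) f
  · exact .of_neq (NEq.nil f).symm (.id X)
  · cases l with
    | left l =>
      cases l with
      | unit r => exact .unit r
      | tensor r X Y => exact .pair r X Y
      | weak r X h => exact .weak r h X
      | cont r1 r2 r X h => exact .cont r1 r2 r h X
      | ex a b =>
        have := ContrNat.braiding (CCat.of [b]) (CCat.of [a])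
        rw [braiding_one] at this
        exact this
    | cut r a hQ => subst hQ; exact .cutHom r a
    | sub h => exact .sub h

/-! ### Laws for contraction and weakening of a context -/

lemma weakAt_one (r : R) (h : r = 0) (a : R) (X) :
    NEq (weakAt r h (CCat.of [(a, X)])) (weak1 (r * a) (by rw [h, zero_mul]) X) :=
  .of_eq rfl

lemma weakAt_cons (r : R) (h : r = 0) (p) (Y) :
    NEq (weakAt r h (CCat.of [p] ⊗ Y)) (weakAt r h (CCat.of [p]) ⊗ₘ weakAt r h Y) := by
  obtain ⟨a, X⟩ := p
  refine .symm (.trans (.tensor (weakAt_one r h a X) (.refl _)) ?_)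
  rw [MonoidalCategory.tensorHom_def]
  refine .trans (.comp (.refl _) (NEq.unit_left _)) (.of_eq ?_)
  refine hom_eq_of_act fun t D1 D2 Z c => act_scaled_trans t _ _ ?_
  refine .trans (act_inside_single t _ [] (scale r Y.list) _ _ D1 D2 (D1' := D1) ◾ rfl
    (c' := GS.cast (GS.act D1 D2 ((weakPath r h Y.list).scaled t) c) ◾)
    (.cR (.refl _) _)) (.symm ?_)
  refine .trans (Act.act_snoc (A := actG R) ..) ?_
  exact .left _ (by simp [scale]) rfl (.cast2 ..)

lemma contrAt_weakAt (hz : z = 0) (h : r = z + r2) : ∀ X : CCat R,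
    NEq (contrAt z r2 r h X ≫ weakAt z hz X ▷ (scaleF r2).obj X) (𝟙 ((scaleF r2).obj X))
  | ⟨[]⟩ => by
    have h1 : Nil (contrAt z r2 r h (𝟙_ (CCat R))) := ⟨rfl, rfl⟩
    have h2 : Nil (weakAt z hz (𝟙_ (CCat R))) := ⟨rfl, rfl⟩
    exact NEq.nil (contrAt z r2 r h (𝟙_ (CCat R)) ≫ weakAt z hz (𝟙_ (CCat R)) ▷ (scaleF r2).obj (𝟙_ (CCat R)))
  | ⟨(a, T) :: E⟩ => by
    let X : CCat R := CCat.of [(a, T)]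
    let Y : CCat R := CCat.of E
    have e : NEq (contrAt z r2 r h X ≫ weakAt z hz X ▷ (scaleF r2).obj X) (𝟙 ((scaleF r2).obj X)) :=
      .trans (.comp (contrAt_one ..) (.right (weakAt_one ..) rfl))
        (cont1_weak1 (by rw [hz, zero_mul]) ..)
    have := tensorμ_nil (𝟙_ (CCat R)) ((scaleF r2).obj X) (𝟙_ (CCat R)) ((scaleF r2).obj Y)
    refine .trans (.comp (contrAt_cons z r2 r h (a, T) Y) (.right (weakAt_cons z hz (a, T) Y) rfl)) ?_
    refine .trans (.of_eq (g := ((contrAt z r2 r h X ≫ weakAt z hz X ▷ (scaleF r2).obj X) ⊗ₘ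
      (contrAt z r2 r h Y ≫ weakAt z hz Y ▷ (scaleF r2).obj Y)) ≫ tensorμ ..) ?_) ?_
    · rw [← tensorHom_comp_tensorHom, Category.assoc, Category.assoc]
      refine congrArg _ ?_
      have k := (tensorμ_natural (weakAt z hz X) (𝟙 ((scaleF r2).obj X)) (weakAt z hz Y) (𝟙 ((scaleF r2).obj Y))).symm
      rw [id_tensorHom_id, tensorHom_id, tensorHom_id, tensorHom_id] at k
      exact k
    · refine .trans (NEq.comp_nil ..) (.trans (.tensor e (contrAt_weakAt hz h Y)) (.of_eq ?_))
      exact id_tensorHom_id ..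

lemma contrAt_braiding (h : r = r1 + r2) (h' : r = r2 + r1) : ∀ X : CCat R,
    contrAt r1 r2 r h X ≫ (β_ ((scaleF r1).obj X) ((scaleF r2).obj X)).hom = contrAt r2 r1 r h' X
  | ⟨[]⟩ => by
    have h1 : Nil (contrAt r1 r2 r h (𝟙_ (CCat R))) := ⟨rfl, rfl⟩
    have h2 : Nil (contrAt r2 r1 r h' (𝟙_ (CCat R))) := ⟨rfl, rfl⟩
    have h3 : Nil (β_ ((scaleF r1).obj (𝟙_ (CCat R))) ((scaleF r2).obj (𝟙_ (CCat R)))).hom :=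
      inferInstanceAs (Nil (β_ (𝟙_ (CCat R)) (𝟙_ (CCat R))).hom)
    exact Nil.eq (contrAt r1 r2 r h (𝟙_ (CCat R)) ≫ (β_ ((scaleF r1).obj (𝟙_ (CCat R)))
      ((scaleF r2).obj (𝟙_ (CCat R)))).hom) (contrAt r2 r1 r h' (𝟙_ (CCat R)))
  | ⟨(a, T) :: E⟩ => by
    let X : CCat R := CCat.of [(a, T)]
    let Y : CCat R := CCat.of E
    have e : contrAt r1 r2 r h X ≫ (β_ ((scaleF r1).obj X) ((scaleF r2).obj X)).hom = contrAt r2 r1 r h' X :=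
      (NEq.trans (.comp (contrAt_one ..) (.refl _)) (.trans (.of_eq
        (cont1_braiding _ (by rw [h', add_mul]) T)) (contrAt_one ..).symm)).eq
    refine NEq.eq (.trans (.comp (contrAt_cons r1 r2 r h (a, T) Y) (.refl (β_ ((scaleF r1).obj X ⊗
      (scaleF r1).obj Y) ((scaleF r2).obj X ⊗ (scaleF r2).obj Y)).hom)) (.trans (.of_eq ?_)
      (contrAt_cons r2 r1 r h' (a, T) Y).symm))
    refine (Category.assoc ..).trans ((congrArg _ (tensorμ_braiding ..)).trans ?_)
    refine (Category.assoc ..).symm.trans (congrArg (· ≫ _) ?_)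
    refine (tensorHom_comp_tensorHom ..).trans ?_
    exact congrArg₂ _ e (contrAt_braiding h h' Y)

lemma contrAt_assoc (hu : u = r1 + r2) (hw : w = r2 + r3) (h : v = u + r3) (h' : v = r1 + w) : ∀ X : CCat R,
    NEq (contrAt u r3 v h X ≫ contrAt r1 r2 u hu X ▷ (scaleF r3).obj X)
      (contrAt r1 w v h' X ≫ (scaleF r1).obj X ◁ contrAt r2 r3 w hw X)
  | ⟨[]⟩ => by
    have h1 : ∀ {a b c : R} (k : c = a + b), Nil (contrAt a b c k (𝟙_ (CCat R))) := fun _ => ⟨rfl, rfl⟩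
    have h2 := h1 hu; have h3 := h1 hw; have h4 := h1 h; have h5 := h1 h'
    exact (NEq.nil (contrAt u r3 v h (𝟙_ (CCat R)) ≫ contrAt r1 r2 u hu (𝟙_ (CCat R)) ▷
      (scaleF r3).obj (𝟙_ (CCat R)))).trans (NEq.nil (contrAt r1 w v h' (𝟙_ (CCat R)) ≫
        (scaleF r1).obj (𝟙_ (CCat R)) ◁ contrAt r2 r3 w hw (𝟙_ (CCat R)))).symm
  | ⟨(a, T) :: E⟩ => by
    let X : CCat R := CCat.of [(a, T)]
    let Y : CCat R := CCat.of E
    have e : NEq (contrAt u r3 v h X ≫ contrAt r1 r2 u hu X ▷ (scaleF r3).obj X)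
        (contrAt r1 w v h' X ≫ (scaleF r1).obj X ◁ contrAt r2 r3 w hw X) :=
      .trans (.comp (contrAt_one ..) (.right (contrAt_one ..) rfl)) (.trans
        (cont1_assoc (by rw [hu, add_mul]) (by rw [hw, add_mul]) _ (by rw [h', add_mul]) T)
        (.symm (.comp (contrAt_one ..) (.left rfl (contrAt_one ..)))))
    refine .trans (.comp (contrAt_cons u r3 v h (a, T) Y) (.right (contrAt_cons r1 r2 u hu (a, T) Y)
      rfl)) (.symm (.trans (.comp (contrAt_cons r1 w v h' (a, T) Y) (.left rfl
      (contrAt_cons r2 r3 w hw (a, T) Y))) (.symm ?_)))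
    have k1 := tensorμ_natural (contrAt r1 r2 u hu X) (𝟙 ((scaleF r3).obj X))
      (contrAt r1 r2 u hu Y) (𝟙 ((scaleF r3).obj Y))
    have k2 := tensorμ_natural (𝟙 ((scaleF r1).obj X)) (contrAt r2 r3 w hw X)
      (𝟙 ((scaleF r1).obj Y)) (contrAt r2 r3 w hw Y)
    rw [id_tensorHom_id, tensorHom_id, tensorHom_id, tensorHom_id] at k1
    rw [id_tensorHom_id, id_tensorHom, id_tensorHom, id_tensorHom] at k2
    refine .trans (.of_eq (g := ((contrAt u r3 v h X ≫ contrAt r1 r2 u hu X ▷ (scaleF r3).obj X) ⊗ₘ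
      (contrAt u r3 v h Y ≫ contrAt r1 r2 u hu Y ▷ (scaleF r3).obj Y)) ≫ tensorμ _ _ _ _ ≫
        tensorμ _ _ _ _ ▷ ((scaleF r3).obj X ⊗ (scaleF r3).obj Y)) ?_) (.trans (.comp
          (.tensor e (contrAt_assoc hu hw h h' Y)) (.of_sq _ _
            ((Category.assoc ..).trans (associator_monoidal ..)))) (.of_eq ?_))
    · rw [← tensorHom_comp_tensorHom, Category.assoc, Category.assoc, reassoc_of% k1]
      refine congrArg _ (congrArg _ ?_)
      exact comp_whiskerRight ..
    · rw [← tensorHom_comp_tensorHom, Category.assoc, reassoc_of% k2]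
      refine Eq.symm ((Category.assoc ..).trans (congrArg _ (congrArg _ ?_)))
      exact whiskerLeft_comp ..

instance {r s : R} (h : r = s) (X : CCat R) : Nil (gcast (actF R) h X) := by
  unfold gcast; infer_instance

lemma Act.Ob.NEq.comp_eqToHom {X Y Z : CCat R} (f : X ⟶ Y) (h : Y = Z) : NEq (f ≫ eqToHom h) f :=
  NEq.comp_nil ..

lemma Act.Ob.NEq.eqToHom_comp {X Y Z : CCat R} (h : X = Y) (f : Y ⟶ Z) : NEq (eqToHom h ≫ f) f :=
  NEq.nil_comp ..

lemma Act.Ob.NEq.gcast_comp (h : r = s) (X : CCat R)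
    (f : (gobj (actF R) s).obj X ⟶ Z) : NEq (gcast (actF R) h X ≫ f) f := .eqToHom_comp _ f

lemma Act.Ob.NEq.comp_pair {X Y Z Y' Z' : CCat R} (f : X ⟶ Y ⊗ Z) (h : Y = Y') (h' : Z = Z') :
    NEq (f ≫ (eqToHom h ⊗ₘ eqToHom h')) f := NEq.comp_nil ..

lemma subHom_neq {X Y X' Y' : CCat R} (hX : X = X') (hY : Y = Y') (h : CtxLe Y.list X.list)
    (h' : CtxLe Y'.list X'.list) : NEq (subHom h) (subHom h') := by
  subst hX; subst hY; exact .refl _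

variable (R) in
def expC : ExpAction R (CCat R) where
  act := actF R
  act_one := scaleF_one
  act_mul := scaleF_mul
  act_mul_natural {r r' s s'} hr hs h X := by
    have e : (scaleF r').map (gle (actF R) hs X) ≫ gle (actF R) hr ((scaleF s).obj X) =
      subHom _ := subHom_comp ((CtxLe.scale_grade hs _).scale r') (CtxLe.scale_grade hr _)
    refine NEq.eq (.trans (NEq.comp_nil ..) (.symm (.trans (NEq.nil_comp ..) (.trans (.of_eq e)
      (subHom_neq ?_ ?_ ..)))))
    · exact congrArg Act.Ob.mk (scale_scale ..)
    · exact congrArg Act.Ob.mk (scale_scale ..)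
  lax r := inferInstanceAs (scaleF r).LaxBraided
  unit_obj r := scale_unit r
  unit_eq _ := rfl
  tensor_obj r X Y := scale_tensor r X Y
  tensor_eq _ _ _ := rfl
  unit_natural {r s} h := by
    have e : gle (actF R) h (𝟙_ (CCat R)) = 𝟙 _ := subHom_eq _ rfl
    rw [e]; exact Category.comp_id _
  tensor_natural {r s} h X Y := by
    refine NEq.eq (.trans (.eqToHom_comp ..) (.symm (.trans (.comp_eqToHom ..) (.trans (.of_eq
      (subHom_tensor (CtxLe.scale_grade h _) (CtxLe.scale_grade h _))) (subHom_neq ?_ ?_ ..)))))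
    · exact scale_tensor s X Y
    · exact scale_tensor r X Y
  weak X := weakAt 0 rfl X
  weak_natural f := weakAt_natural 0 rfl f
  contr r s X := contrAt r s (r + s) rfl X
  contr_natural r s X Y f := (contrNat f r s (r + s) rfl).eq
  contr_natural_grade {r r' s s'} hr hs h X := by
    have e : gle (actF R) hr X ⊗ₘ gle (actF R) hs X = subHom ((CtxLe.scale_grade hr X.list).append
      (CtxLe.scale_grade hs X.list)) := subHom_tensor (CtxLe.scale_grade hr _) (CtxLe.scale_grade hs _)
    rw [e]
    exact (subHom_natural (fun t => contPath_subNat rfl rfl ((CtxLe.scale_grade hr _).scale t)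
      ((CtxLe.scale_grade hs _).scale t) ((CtxLe.scale_grade h _).scale t)) ..).symm
  contr_weak_right r X := by
    refine NEq.eq (.trans (.of_eq (Category.assoc ..).symm) (.trans (NEq.comp_nil ..)
      (.trans ?_ (NEq.nil (eqToHom _)).symm)))
    refine .trans (.of_eq (congrArg (· ≫ _) (contrAt_braiding (r1 := 0) (r2 := r) (r := r + 0)
      (add_comm ..) rfl X).symm)) (.trans (.of_eq (Category.assoc ..)) ?_)
    refine .trans (.of_eq (congrArg (_ ≫ ·) (BraidedCategory.braiding_naturality_left ..).symm))
      (.trans (.of_eq (Category.assoc _ _ _).symm) (.trans (NEq.comp_nil _ _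
      (hg := inferInstanceAs (Nil (β_ (𝟙_ (CCat R)) ((scaleF r).obj X)).hom))) ?_))
    exact (contrAt_weakAt rfl _ X).trans (.id (by rw [add_zero]; rfl))
  contr_weak_left r X := by
    refine NEq.eq (.trans (.of_eq (Category.assoc ..).symm) (.trans (NEq.comp_nil ..)
      (.trans (contrAt_weakAt rfl rfl X) (.trans (.id ?_) (NEq.nil (eqToHom _)).symm))))
    show (scaleF r).obj X = (scaleF (0 + r)).obj X
    rw [zero_add]
  contr_assoc r s t X := by
    refine NEq.eq (.trans (.of_eq (Category.assoc ..).symm) (.trans (NEq.comp_nil ..)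
      (.trans (contrAt_assoc rfl rfl rfl (add_assoc r s t) X) (.symm (.trans (.gcast_comp ..)
        (.comp (contrAt_neq _ _ rfl rfl ?_) (.refl _)))))))
    rw [add_assoc]
  contr_symm r s X := by
    refine NEq.eq (.symm (.trans (.gcast_comp ..) (.trans (.of_eq
      (contrAt_braiding rfl (add_comm s r) X)) (contrAt_neq _ _ rfl rfl ?_))))
    rw [add_comm]
  zero_mul_weak s X := by
    refine NEq.eq (.symm (.trans (.gcast_comp ..) (.trans (.eqToHom_comp ..)
      (weakAt_neq _ _ ?_))))
    show scale 0 (scale s X.list) = scale 0 X.list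
    simp [scale_scale]
  mul_zero_weak s X := by
    refine NEq.eq (.trans (.gcast_comp ..) (.trans (.eqToHom_comp ..) (.trans
      (scaleF_weakAt s 0 rfl X) (.trans (weakAt_neq _ _ ?_) (NEq.comp_eqToHom ..).symm))))
    rw [mul_zero]
  mul_add_contr r s1 s2 X := by
    refine NEq.eq (.trans (.eqToHom_comp ..) (.trans (scaleF_contrAt r s1 s2 _ rfl X) (.symm
      (.trans (.gcast_comp ..) (.trans (.trans (.of_eq (Category.assoc ..).symm) (.trans (.comp_eqToHom ..) (.comp_pair ..))) (contrAt_neq _ _ rfl rfl ?_))))))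
    rw [mul_add]
  add_mul_contr s1 s2 r X := by
    refine NEq.eq (.trans (.eqToHom_comp ..) (.symm (.trans (.gcast_comp ..) (.trans
      (.comp_pair ..) (contrAt_neq _ _ ?_ ?_ ?_)))))
    · exact (scale_scale ..).symm
    · exact (scale_scale ..).symm
    · exact (congrArg (scale · _) (add_mul ..).symm).trans (scale_scale ..).symm

end

section

variable {R : Type u} [Semiring R] [Preorder R]

/-- The steps on linear contexts. -/
inductive LStep : LCtx R → LCtx R → Type u
  | left {P Q : LCtx R} (l : LLeft P Q) : LStep P Q
  | cut {Γ : LCtx R} {A : LTy R} (a : MS [] Γ A) : LStep [A] Γ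

def LStep.run : ∀ {P Q : LCtx R}, LStep P Q → ∀ (D1 D2 : LCtx R) {Δ : GCtx R} {B : LTy R},
    MS Δ (D1 ++ P ++ D2) B → MS Δ (D1 ++ Q ++ D2) B
  | _, _, .left l, D1, D2, _, _, c => .lleft l D1 D2 c
  | _, _, .cut a, D1, D2, _, _, c => (MS.cut D1 D2 a c).cast ◾ rfl

variable (R) in
def actK : Act (LStep (R := R)) where
  β := GCtx R × LTy R
  F b Γ := MS b.1 Γ b.2
  E := EqM
  refl := .refl
  symm := .symm
  trans := .trans
  run l D1 D2 _ c := l.run D1 D2 c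
  run_congr l D1 D2 _ _ _ e := by
    cases l with
    | left l => exact .congr_lleft _ _ _ e
    | cut a => exact .cL (.cR (.congr_cut _ _ (.refl _) e) _ rfl) _ rfl

abbrev MS.actL (D1 D2 : LCtx R) {P Q : LCtx R} (p : Path LStep P Q) {Δ : GCtx R} {B : LTy R}
    (c : MS Δ (D1 ++ P ++ D2) B) : MS Δ (D1 ++ Q ++ D2) B := (actK R).act D1 D2 (b := (Δ, B)) p c

lemma LStep.run_cut (a : MS [] Γ A) (D1 D2 : LCtx R) (c : MS Δ (D1 ++ [A] ++ D2) B) :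
    EqM ((LStep.cut a).run D1 D2 c) (.cut D1 D2 a c) := .cast_left _ _ rfl

lemma MS.exists_cast {Δ Δ' : GCtx R} (a : MS Δ Γ A) (h : Δ = Δ')
    (h' : Γ = Γ') : ∃ b : MS Δ' Γ' A, EqM b a := ⟨_, EqM.cast_left a h h'⟩

lemma LStep.run_cut' {a : MS [] Γ A} {a' : MS [] Γ' A} (e : EqM a a')
    (D1 D2 : LCtx R) (c : MS Δ (D1 ++ [A] ++ D2) B) (h : Γ = Γ' := by simp) :
    EqM ((LStep.cut a).run D1 D2 c) (.cut D1 D2 a' c) :=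
  (run_cut a D1 D2 c).trans (.cut rfl rfl rfl rfl h e (.refl _))

lemma MS.lpath_eq (D1 D2 : LCtx R) (p : Path LLeft P Q)
    (c : MS Δ (D1 ++ P ++ D2) B) : EqM (c.lpath D1 D2 p) (c.actL D1 D2 (p.map LStep.left)) := by
  induction p with
  | nil h => exact .cL (.symm (Act.act_nil (A := actK R) (b := (Δ, B)) _ _ _ _)) rfl _
  | snoc p E1 E2 l hN hK ih =>
    refine .cL (.symm ((Act.act_snoc (A := actK R) (b := (Δ, B)) ..).trans ?_)) rfl _
    exact .congr_lleft _ _ _ (.cR ((Act.cast_E (A := actK R) (b := (Δ, B)) ..).trans ih.symm) rfl _)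

/-- Cuts, as steps. -/
inductive LStep.IsBox : ∀ {P Q : LCtx R}, LStep P Q → Prop
  | mk {P : LCtx R} {Z : LTy R} (κ : MS [] P Z) : IsBox (.cut κ)

abbrev LStep.ex (A B : LTy R) : LStep [A, B] [B, A] := .left (.ex A B)

def tn : LCtx R → LTy R
  | [] => .unit
  | [A] => A
  | A :: B :: Γ => .tensor A (tn (B :: Γ))

def tnR : ∀ Γ : LCtx R, MS [] Γ (tn Γ)
  | [] => .unitR
  | [A] => .id A
  | A :: B :: Γ => .tenR (.id A) (tnR (B :: Γ))

def tnL : ∀ Γ : LCtx R, Path (LStep (R := R)) Γ [tn Γ]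
  | [] => .single (.left .unit)
  | [_] => .nil rfl
  | A :: B :: Γ => .trans (Q := [A, tn (B :: Γ)]) ((tnL (B :: Γ)).inside [A] [] ◾ rfl)
      (.single (.left (.tensor A (tn (B :: Γ)))))

lemma MS.cut_id_snd (Γ₁ Γ₃ : LCtx R) (a : MS E G B) (c : MS Δ (Γ₁ ++ [A, B] ++ Γ₃) C) :
    EqM (.cut Γ₁ Γ₃ (.tenR (.id A) a) (.lleft (.tensor A B) Γ₁ Γ₃ c))
      (.cut (Γ₁ ++ [A]) Γ₃ a (c.cast rfl ◾)) :=
  (EqM.cut_tensor ..).trans (.cut ◾ rfl rfl rfl rfl (.refl _)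
    (.cL (.trans (EqM.cut_id_left ..) (.cL (.cR (.refl _) rfl _) rfl _)) rfl _))

lemma MS.cut_tnR : ∀ (Γ Γ₁ Γ₃) {Δ : GCtx R} {C : LTy R} (c : MS Δ (Γ₁ ++ Γ ++ Γ₃) C),
    EqM (.cut Γ₁ Γ₃ (tnR Γ) (c.actL Γ₁ Γ₃ (tnL Γ))) c
  | [], Γ₁, Γ₃, Δ, C, c => (EqM.congr_cut _ _ (.refl _)
      (Act.act_single (A := actK R) (b := (Δ, C)) ..)).trans (.cut_unit ..)
  | [A], Γ₁, Γ₃, Δ, C, c => (EqM.cut_id_left _ _ _).trans (Act.act_nil (A := actK R) (b := (Δ, C)) _ _ _ _)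
  | A :: B :: Γ, Γ₁, Γ₃, Δ, C, c => by
    refine .trans (.congr_cut _ _ (.refl _) ((Act.act_trans (A := actK R) (b := (Δ, C)) ..).trans
      (Act.act_single (A := actK R) (b := (Δ, C)) ..))) ?_
    refine (MS.cut_id_snd ..).trans ?_
    refine .trans (.cut rfl rfl rfl rfl rfl (.refl _) (.cL
      (Act.act_inside' (A := actK R) (b := (Δ, C)) (tnL (B :: Γ)) _ _ rfl rfl
        (EqM.cR (.refl _) rfl ◾)) rfl _)) ?_
    exact (cut_tnR (B :: Γ) (Γ₁ ++ [A]) Γ₃ _).trans (.cast_left ..)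

lemma MS.eta_left_tensor (Γ₁ Γ₃ : LCtx R) (c : MS Δ (Γ₁ ++ [.tensor A B] ++ Γ₃) C) :
    ∃ c' : MS Δ (Γ₁ ++ [A, B] ++ Γ₃) C, EqM c (.lleft (.tensor A B) Γ₁ Γ₃ c') := by
  refine ⟨(MS.cut Γ₁ Γ₃ (.tenR (.id A) (.id B)) c).cast ◾ ◾, ?_⟩
  refine (EqM.cut_id_left ..).symm.trans ((EqM.congr_cut _ _ (.eta_tensor A B) (.refl _)).trans ?_)
  refine (EqM.cut_lleft_left Γ₁ Γ₃ (.tensor A B) [] [] _ c).trans (EqM.lleft _ ◾ ◾ ◾ ?_)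
  exact .cL (.cR (.cut rfl rfl rfl rfl rfl (.cL (.refl _) rfl rfl) (.refl _)) ..) rfl _

lemma MS.actL_tnL_cut : ∀ (Γ Γ₁ Γ₃) {Δ : GCtx R} {C : LTy R}
    (c : MS Δ (Γ₁ ++ [tn Γ] ++ Γ₃) C) (d : MS Δ (Γ₁ ++ Γ ++ Γ₃) C),
    EqM d (.cut Γ₁ Γ₃ (tnR Γ) c) → EqM (d.actL Γ₁ Γ₃ (tnL Γ)) c
  | [], Γ₁, Γ₃, Δ, C, c, d, hd => by
    refine (Act.act_single (A := actK R) (b := (Δ, C)) ..).trans ?_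
    refine .trans ?_ (EqM.cut_id_left _ _ c)
    refine EqM.trans ?_ (EqM.congr_cut _ _ .eta_unit (.refl _)).symm
    refine .trans ?_ (EqM.cut_lleft_left Γ₁ Γ₃ .unit [] [] _ c).symm
    exact .lleft _ ◾ ◾ ◾ (.cR hd ..)
  | [A], Γ₁, Γ₃, Δ, C, c, d, hd =>
    (Act.act_nil (A := actK R) (b := (Δ, C)) ..).trans (hd.trans (EqM.cut_id_left ..))
  | A :: B :: Γ, Γ₁, Γ₃, Δ, C, c, d, hd => by
    obtain ⟨c', e⟩ := MS.eta_left_tensor Γ₁ Γ₃ c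
    refine .trans ((Act.act_trans (A := actK R) (b := (Δ, C)) ..).trans
      (Act.act_single (A := actK R) (b := (Δ, C)) ..)) (.trans ?_ e.symm)
    refine .congr_lleft _ _ _ ?_
    refine .trans (Act.act_inside' (A := actK R) (b := (Δ, C)) (tnL (B :: Γ)) _ _ rfl rfl
        (EqM.cR (.refl _) rfl ◾)) ?_
    refine (actL_tnL_cut (B :: Γ) (Γ₁ ++ [A]) Γ₃ (c'.cast rfl ◾) _ (.cL ?_ rfl _)).trans (.cast_left ..)
    exact hd.trans ((EqM.congr_cut _ _ (.refl _) e).trans (MS.cut_id_snd ..))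

lemma MS.path_gswap_nil (E : GCtx R) (c : MS (D1 ++ ([] ++ E) ++ D2) Γ B) : EqM (MS.path D1 D2 (gswap [] E) c) c :=
  EqM.cast_left ..

lemma LStep.run_cut_comm_left (a : MS [] E A) (st : LStep P Q) : (actK R).StepComm (.cut a) st := by
  rintro ⟨Δ, B⟩ D1 D2 D3 c1 c2 d1 d2 hc h1 h2
  refine (run_cut a D1 _ d2).trans ?_
  have h1' := h1.trans (run_cut a D1 _ c1)
  cases st with
  | left l =>
    refine .trans (.congr_cut _ _ (.refl _) (.cR h2 rfl _))
      ((EqM.cut_lleft_after l D1 D2 D3 a c2).trans (EqM.lleft _ ◾ rfl rfl ?_))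
    exact EqM.cL ((EqM.congr_cut _ _ (.refl _) (EqM.cL hc.symm rfl _)).trans h1'.symm) rfl _
  | cut b =>
    refine .trans (.congr_cut _ _ (.refl _) (.cR (ρ := (MS.cut (D1 ++ [A] ++ D2) D3 b c2).cast ◾ rfl) (.cR (h2.trans (run_cut b _ _ (Δ := Δ) (B := B) c2)) _ rfl) rfl ◾))
      (.trans ?_ (run_cut b _ _ (Δ := Δ) (B := B) d1).symm)
    refine .trans (.trans (.cut ◾ rfl rfl rfl rfl (.refl _) (.cL (.cL (.cR (.refl _) rfl ◾) _ rfl) rfl _)) (EqM.cut_cut D1 D2 D3 a b c2)) ((MS.path_gswap_nil ..).trans (.cL ?_ _ rfl))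
    refine .cut ◾ rfl rfl rfl rfl (.refl _) (.cL ?_ rfl _)
    exact (EqM.congr_cut _ _ (.refl _) (EqM.cL hc.symm rfl _)).trans h1'.symm

lemma LStep.run_cut_comm_right (a : MS [] E A) (st : LStep P Q) : (actK R).StepComm st (.cut a) := by
  rintro ⟨Δ, B⟩ D1 D2 D3 c1 c2 d1 d2 hc h1 h2
  cases st with
  | left l =>
    refine .symm ((run_cut a _ D3 d1).trans ?_)
    refine .trans (.congr_cut _ _ (.refl _) (.cR h1 rfl _))
      ((EqM.cut_lleft_before l D1 D2 D3 a (c1.cast rfl ◾)).trans (EqM.lleft _ ◾ rfl rfl ?_))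
    refine .cL (.trans (.congr_cut _ _ (.refl _) (.cL (.cL hc rfl _) rfl _)) ?_) rfl _
    exact (h2.trans (run_cut a _ _ (Δ := Δ) (B := B) c2)).symm
  | cut b =>
    exact (LStep.run_cut_comm_left b (.cut a)) D1 D2 D3 c1 c2 d1 d2 hc h1 h2

lemma actK_encaps : (actK R).Encaps LStep.ex LStep.IsBox where
  encap {b} D1 P D2 c := ⟨_, _, MS.actL D1 D2 (tnL P) (Δ := b.1) (B := b.2) c, .mk (tnR P),
    ((LStep.run_cut ..).trans (MS.cut_tnR P D1 D2 (Δ := b.1) (C := b.2) c)).symm⟩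
  push s hs st := by
    cases hs with
    | mk κ =>
      cases st with
      | left l =>
        obtain ⟨κ', e⟩ := MS.exists_cast (MS.lleft l [] [] (κ.cast rfl ◾)) rfl (List.append_nil _)
        refine ⟨_, .mk κ', ?_⟩
        intro ⟨Δ, B⟩ D1 D2 c
        refine (LStep.run_cut' e D1 D2 (Δ := Δ) (B := B) c (List.append_nil _).symm).trans ?_
        refine (EqM.cut_lleft_left D1 D2 l [] [] _ c).trans
          (EqM.lleft _ ◾ ◾ ◾ (.cL ?_ ..))
        exact (LStep.run_cut' (.cR (.refl κ) rfl _) D1 D2 (Δ := Δ) (B := B) c).symm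
      | cut a =>
        obtain ⟨κ', e⟩ := MS.exists_cast (MS.cut [] [] a κ) rfl (List.append_nil _)
        refine ⟨_, .mk κ', ?_⟩
        intro ⟨Δ, B⟩ D1 D2 c
        refine (LStep.run_cut' e D1 D2 (Δ := Δ) (B := B) c (List.append_nil _).symm).trans ?_
        refine (EqM.cut_assoc D1 D2 [] [] a κ c).trans (.trans ?_
          (LStep.run_cut a D1 D2 (Δ := Δ) (B := B) ((LStep.cut κ).run D1 D2 c)).symm)
        exact .cut ◾ rfl ◾ ◾ rfl (.refl _)
          (.cL (LStep.run_cut κ D1 D2 (Δ := Δ) (B := B) c).symm rfl _)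
  comm_left s hs st := by cases hs; exact LStep.run_cut_comm_left _ _
  comm_right s hs st := by cases hs; exact LStep.run_cut_comm_right _ _
  ex_snd {z P} s hs b x D1 D2 c := by
    obtain ⟨Δ, B⟩ := b
    cases hs with
    | mk κ =>
      refine (LStep.run_cut ..).trans ((EqM.cut_ex_snd D1 D2 κ c).trans ((MS.lpath_eq ..).trans ?_))
      rw [lswap, Path.map_swap]
      have e : EqM ((LStep.cut κ).run (D1 ++ [x]) D2 (MS.cast (Δ := Δ) c rfl ◾))
        (.cut (D1 ++ [x]) D2 κ (MS.cast (Δ := Δ) c rfl ◾)) := LStep.run_cut ..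
      have k : ∀ {Δ' : GCtx R} (h : Δ' = Δ) (y : MS Δ' (D1 ++ ([x] ++ P) ++ D2) B)
          (z : MS Δ (D1 ++ ([x] ++ P) ++ D2) B), EqM y z →
          EqM (y.actL D1 D2 (.swap LStep.ex [x] P)) (z.actL D1 D2 (.swap LStep.ex [x] P)) := by
        rintro _ rfl y z h
        exact Act.act_congr (A := actK R) (b := (_, B)) _ rfl rfl h
      refine k ◾ _ _ (.cL (e.symm.trans (.trans ?_ (Act.E_cast (A := actK R) (b := (Δ, B)) ..))) rfl _)
      exact .refl _

lemma actK_exch : (actK R).Exch LStep.ex where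
  stepComm := actK_encaps.stepComm
  ex_ex x y D1 D2 c := .ex_ex x y D1 D2 c
  move_natural x _ _ st _ D1 D2 _ _ _ _ := actK_encaps.move_natural x st D1 D2

variable (R) in
abbrev KCat : Type u := Act.Ob (actK_exch (R := R))

end

lemma Act.act_rel {α : Type u} {L : List α → List α → Type u} {A A' : Act L} {b} {b' : A'.β}
    (Φ : ∀ {M N}, A.F b M → A'.F b' N → Prop)
    (T : List α → List α → List α → List α → Prop)
    (hΦ : ∀ {M M' N N'} {c : A.F b M} {c' : A.F b M'} {d : A'.F b' N} {d' : A'.F b' N'},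
      M = M' → N = N' → A.E c c' → A'.E d d' → Φ c d → Φ c' d')
    (hT : ∀ {D1 D2 D1' D2'} (E1 E2), T D1 D2 D1' D2' → T (D1 ++ E1) (E2 ++ D2) (D1' ++ E1) (E2 ++ D2'))
    (h : ∀ {P Q} (l : L P Q) {D1 D2 D1' D2'} (c : A.F b (D1 ++ P ++ D2))
      (d : A'.F b' (D1' ++ P ++ D2')), T D1 D2 D1' D2' → Φ c d → Φ (A.run l D1 D2 c) (A'.run l D1' D2' d))
    {P Q} (p : Path L P Q) {D1 D2 D1' D2'} (c : A.F b (D1 ++ P ++ D2))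
    (d : A'.F b' (D1' ++ P ++ D2')) (t : T D1 D2 D1' D2') (e : Φ c d) :
    Φ (A.act D1 D2 p c) (A'.act D1' D2' p d) := by
  induction p with
  | nil h =>
    subst h
    exact hΦ rfl rfl (A.symm (act_nil ..)) (A'.symm (act_nil ..)) e
  | snoc p E1 E2 l hN hK ih =>
    subst hN; subst hK
    refine hΦ ◾ ◾ (A.symm (act_snoc ..))
      (A'.symm (act_snoc ..)) (h l _ _ (hT _ _ t) ?_)
    exact hΦ ◾ ◾ (E_cast ..) (E_cast ..) ih

section

variable {R : Type u} [Semiring R] [Preorder R] [MulLeftMono R] [MulRightMono R]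

lemma MS.act_gswap_nil (E : GCtx R)
    (c : MS (D1 ++ (E ++ []) ++ D2) Γ B) : EqM (MS.path D1 D2 (gswap E []) c) c := by
  refine (MS.path_eq ..).trans ?_
  rw [gswap, Path.map_swap]
  have h : EqM (MS.act D1 D2 (.swap GStep.ex [] E) (c.cast ◾ rfl)) c :=
    (Act.act_swap_nil (A := actM R) (b := (Γ, B)) E (.cast_left c _ rfl))
  refine (Act.act_congr (A := actM R) (b := (Γ, B)) _ rfl rfl h.symm).trans ?_
  exact (actM_exch.act_swap_swap (b := (Γ, B)) [] E).trans (.cast_left _ _ rfl)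

lemma MS.cut_actL_left {Δ E} (Γ₁ Γ₃) {A B}
    (c : MS Δ (Γ₁ ++ [A] ++ Γ₃) B) {P Q : LCtx R} (p : Path LStep P Q) {D1 D2 D1' D2' : LCtx R}
    (h1 : D1' = Γ₁ ++ D1) (h2 : D2' = D2 ++ Γ₃) (κ : MS E (D1 ++ P ++ D2) A)
    (y : MS (Δ ++ E) (D1' ++ P ++ D2') B) (e : EqM y (.cut Γ₁ Γ₃ κ c)) :
    EqM (y.actL D1' D2' p) (.cut Γ₁ Γ₃ (κ.actL D1 D2 p) c) := by
  refine Act.act_rel (A := actK R) (A' := actK R) (b := (E, A)) (b' := (Δ ++ E, B))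
    (fun κ y => EqM y (MS.cut Γ₁ Γ₃ κ c))
    (fun D1 D2 D1' D2' => D1' = Γ₁ ++ D1 ∧ D2' = D2 ++ Γ₃) ?_ ?_ ?_ p κ y ⟨h1, h2⟩ e
  · rintro M M' N N' c c' d d' rfl rfl h h' k
    exact (EqM.symm h').trans (k.trans (.congr_cut _ _ h (.refl _)))
  · rintro D1 D2 _ _ E1 E2 ⟨rfl, rfl⟩; simp
  · rintro P Q l D1 D2 _ _ κ y ⟨rfl, rfl⟩ e
    cases l with
    | left l =>
      refine .trans ?_ (EqM.cut_lleft_left Γ₁ Γ₃ l D1 D2 κ c).symm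
      exact .lleft _ rfl rfl rfl (.cR e rfl _)
    | cut a =>
      refine (LStep.run_cut a _ _ (Δ := Δ ++ E) (B := B) y).trans ?_
      refine .trans ?_ (.cut rfl ◾ rfl rfl rfl (LStep.run_cut a D1 D2 (Δ := E) (B := A) κ).symm (.refl c))
      refine .trans ?_ (EqM.cut_assoc Γ₁ Γ₃ D1 D2 a κ c).symm
      exact .congr_cut _ _ (.refl _) (.cR e rfl _)

lemma MS.cut_actL_right {Δ E} {A B} (a : MS E [] A) {P Q}
    (p : Path LStep P Q) {D1 D2 : LCtx R} (c : MS Δ (([A] ++ D1) ++ P ++ D2) B)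
    (y : MS (Δ ++ E) (D1 ++ P ++ D2) B)
    (e : EqM y (.cut [] (D1 ++ P ++ D2) a (c.cast rfl ◾))) :
    EqM (y.actL D1 D2 p) (.cut [] (D1 ++ Q ++ D2) a ((c.actL ([A] ++ D1) D2 p).cast rfl ◾)) := by
  have h := Act.act_rel (A := actK R) (A' := actK R) (b := (Δ, B)) (b' := (Δ ++ E, B))
    (fun {M N} c y => ∀ h : M = [] ++ [A] ++ N, EqM y (MS.cut [] N a (MS.cast (Δ := Δ) c rfl h)))
    (fun D1 D2 D1' D2' => D1 = [A] ++ D1' ∧ D2 = D2') ?_ ?_ ?_ p c y ⟨rfl, rfl⟩ (fun _ => e)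
  · exact h ◾
  · rintro M M' N N' c c' d d' rfl rfl h h' k hM
    exact (EqM.symm h').trans ((k hM).trans (.congr_cut _ _ (.refl _) (.cL (.cR h rfl _) rfl _)))
  · rintro D1 D2 _ _ E1 E2 ⟨rfl, rfl⟩; simp
  · rintro P Q l _ D2 D1 _ c y ⟨rfl, rfl⟩ e hM
    have e := e ◾
    cases l with
    | left l =>
      refine .trans ?_ (.trans (EqM.cut_lleft_after l [] D1 D2 a c).symm (.cut rfl rfl rfl
        rfl rfl (.refl _) (.cL (.cR (.refl _) rfl _) rfl _)))
      exact .lleft _ rfl rfl rfl (.cR (e.trans (.cut rfl rfl rfl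
        ◾ rfl (.refl _) (.cL (.cR (.refl _) rfl _) rfl _))) rfl _)
    | cut b =>
      refine (LStep.run_cut b _ _ (Δ := Δ ++ E) (B := B) y).trans ?_
      have k := (EqM.cut_cut [] D1 D2 a b c).trans (MS.act_gswap_nil ..)
      refine .trans ?_ (.trans k.symm (.cut ◾ rfl rfl rfl rfl (.refl _)
        (.cL (.cR (LStep.run_cut b _ _ (Δ := Δ) (B := B) c).symm rfl _) rfl _)))
      refine .cR (.cut ◾ rfl rfl rfl rfl (.refl _) (.cR ?_ rfl _)) _ rfl
      exact e.trans (.cut rfl rfl rfl ◾ rfl (.refl _) (.cL (.cR (.refl _) rfl _) rfl _))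

lemma MS.cut_act_left {Δ} {G} (Γ₁ Γ₃) {A B}
    (c : MS Δ (Γ₁ ++ [A] ++ Γ₃) B) {P Q : GCtx R} (p : Path GStep P Q) {D1 D2 D1' : GCtx R}
    (h1 : D1' = Δ ++ D1) (κ : MS (D1 ++ P ++ D2) G A)
    (y : MS (D1' ++ P ++ D2) (Γ₁ ++ G ++ Γ₃) B) (e : EqM y (.cut Γ₁ Γ₃ κ c)) :
    EqM (y.act D1' D2 p) (.cut Γ₁ Γ₃ (κ.act D1 D2 p) c) := by
  refine Act.act_rel (A := actM R) (A' := actM R) (b := (G, A)) (b' := (Γ₁ ++ G ++ Γ₃, B))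
    (fun κ y => EqM y (MS.cut Γ₁ Γ₃ κ c))
    (fun D1 D2 D1' D2' => D1' = Δ ++ D1 ∧ D2' = D2) ?_ ?_ ?_ p κ y ⟨h1, rfl⟩ e
  · rintro M M' N N' c c' d d' rfl rfl h h' k
    exact (EqM.symm h').trans (k.trans (.congr_cut _ _ h (.refl _)))
  · rintro D1 D2 _ _ E1 E2 ⟨rfl, rfl⟩; simp
  · rintro P Q l D1 D2 _ _ κ y ⟨rfl, rfl⟩ e
    cases l with
    | left l =>
      refine .trans ?_ (EqM.cut_left_left Γ₁ Γ₃ l D1 _ κ c).symm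
      exact .left _ rfl rfl rfl (.cR e _ rfl)
    | cut r a hQ =>
      subst hQ
      refine .trans ?_ (EqM.gcut_cut_fst r D1 _ Γ₁ Γ₃ a κ c)
      exact .congr_gcut _ _ _ (.refl _) (.cR e _ rfl)
    | sub h =>
      refine .trans (.sub _ ((CtxLe.refl Δ).append (h.inside D1 _)) ◾ ◾ rfl e)
        ((EqM.sub_cut (CtxLe.refl Δ) (h.inside D1 _) _ Γ₁ Γ₃ κ c).trans ?_)
      exact .congr_cut _ _ (.refl _) (EqM.sub_refl ..)

lemma MS.cut_act_right {E} {G} (Γ₁ Γ₃) {A B} (a : MS E G A)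
    {P Q : GCtx R} (p : Path GStep P Q) {D1 D2 D2' : GCtx R} (h2 : D2' = D2 ++ E)
    (c : MS (D1 ++ P ++ D2) (Γ₁ ++ [A] ++ Γ₃) B)
    (y : MS (D1 ++ P ++ D2') (Γ₁ ++ G ++ Γ₃) B) (e : EqM y (.cut Γ₁ Γ₃ a c)) :
    EqM (y.act D1 D2' p) (.cut Γ₁ Γ₃ a (c.act D1 D2 p)) := by
  refine Act.act_rel (A := actM R) (A' := actM R) (b := (Γ₁ ++ [A] ++ Γ₃, B))
    (b' := (Γ₁ ++ G ++ Γ₃, B)) (fun c y => EqM y (MS.cut Γ₁ Γ₃ a c))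
    (fun D1 D2 D1' D2' => D1' = D1 ∧ D2' = D2 ++ E) ?_ ?_ ?_ p c y ⟨rfl, h2⟩ e
  · rintro M M' N N' c c' d d' rfl rfl h h' k
    exact (EqM.symm h').trans (k.trans (.congr_cut _ _ (.refl _) h))
  · rintro D1 D2 _ _ E1 E2 ⟨rfl, rfl⟩; simp
  · rintro P Q l D1 D2 _ _ c y ⟨rfl, rfl⟩ e
    cases l with
    | left l =>
      refine .trans ?_ (EqM.cut_left Γ₁ Γ₃ l _ D2 a c).symm
      exact .left _ rfl rfl rfl (.cR e _ rfl)
    | cut r b hQ =>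
      subst hQ
      refine .trans ?_ (EqM.gcut_cut_snd r _ D2 Γ₁ Γ₃ b a c)
      exact .congr_gcut _ _ _ (.refl _) (.cR e _ rfl)
    | sub h =>
      refine .trans (.sub _ ((h.inside _ D2).append (CtxLe.refl E)) ◾ ◾ rfl e)
        ((EqM.sub_cut (h.inside _ D2) (CtxLe.refl E) _ Γ₁ Γ₃ a c).trans ?_)
      exact .congr_cut _ _ (EqM.sub_refl ..) (.refl _)

/-! ## Graded hypotheses as linear hypotheses -/

def Grd (Δ : GCtx R) : LCtx R := Δ.map fun p => .grd p.1 p.2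

@[simp] lemma Grd_append (Δ Δ' : GCtx R) : Grd (Δ ++ Δ') = Grd Δ ++ Grd Δ' := List.map_append

def MS.grdI (p : R × GTy R) : MS [p] [] (.grd p.1 p.2) :=
  (MS.grdR p.1 (.id p.2)).cast (by simp [scale]) rfl

def MS.dec : ∀ (Δ : GCtx R) {D : GCtx R} {Γ : LCtx R} {B : LTy R}, MS D (Grd Δ ++ Γ) B →
    MS (D ++ Δ) Γ B
  | [], _, _, _, c => c.cast ◾ rfl
  | p :: Δ, D, Γ, B, c => (dec Δ (D := D ++ [p])
      (MS.cut (Δ₁ := D) [] (Grd Δ ++ Γ) (MS.grdI p) c : MS (D ++ [p]) (Grd Δ ++ Γ) B)).cast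
        ◾ rfl

def MS.enc : ∀ (Δ : GCtx R) {D : GCtx R} {Γ : LCtx R} {B : LTy R}, MS (D ++ Δ) Γ B →
    MS D (Grd Δ ++ Γ) B
  | [], _, _, _, m => m.cast ◾ rfl
  | p :: Δ, _, _, _, m => .grdL p.1 p.2 (enc Δ (m.cast ◾ rfl))

lemma EqM.dec (Δ) : ∀ {D D' : GCtx R} {Γ Γ' : LCtx R} {B : LTy R}
    {c : MS D (Grd Δ ++ Γ) B} {c' : MS D' (Grd Δ ++ Γ') B}, D = D' → Γ = Γ' → EqM c c' →
    EqM (c.dec Δ) (c'.dec Δ) := by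
  induction Δ with
  | nil => rintro D _ Γ _ B c c' rfl rfl e; exact .cL (.cR e _ rfl) _ rfl
  | cons p Δ ih =>
    rintro D _ Γ _ B c c' rfl rfl e
    exact .cL (.cR (ih rfl rfl (.congr_cut _ _ (.refl _) e)) _ rfl) _ rfl

lemma EqM.enc (Δ) : ∀ {D D' : GCtx R} {Γ Γ' : LCtx R} {B : LTy R}
    {c : MS (D ++ Δ) Γ B} {c' : MS (D' ++ Δ) Γ' B}, D = D' → Γ = Γ' → EqM c c' →
    EqM (c.enc Δ) (c'.enc Δ) := by
  induction Δ with
  | nil => rintro D _ Γ _ B c c' rfl rfl e; exact .cL (.cR e _ rfl) _ rfl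
  | cons p Δ ih =>
    rintro D _ Γ _ B c c' rfl rfl e
    exact .grdL _ _ rfl rfl (ih rfl rfl (.cL (.cR e _ rfl) _ rfl))

lemma MS.cut_grdI (p : R × GTy R) (c : MS (D ++ [p]) Γ B) : EqM (.cut [] Γ (MS.grdI p) (.grdL p.1 p.2 c)) c := by
  refine .trans (.cut rfl (by simp [scale]) rfl rfl rfl (.cast_left _ _ rfl) (.refl _))
    ((EqM.cut_grd p.1 (.id p.2) c).trans ?_)
  exact (EqM.gcut_id ..).trans (.cast_left _ _ rfl)

lemma MS.grdL_cut (p : R × GTy R)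
    (c : MS D (.grd p.1 p.2 :: Γ) B) : EqM (.grdL p.1 p.2 (.cut [] Γ (MS.grdI p) c)) c := by
  refine .trans ?_ (EqM.cut_id_left [] Γ c)
  refine EqM.trans ?_ (EqM.congr_cut _ _ (.eta_grd p.1 p.2) (.refl _)).symm
  refine .trans ?_ (EqM.cut_grdL_left p.1 p.2 [] Γ _ c).symm
  refine .trans ?_ (MS.lpath_eq ..).symm
  rw [lswap, Path.map_swap]
  refine .trans ?_ (Act.act_swap_one (A := actK R) (b := (_, _)) ..).symm
  refine .trans ?_ (Act.act_nil (A := actK R) (b := (_, _)) ..).symm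
  exact .cR (EqM.grdL _ _ ◾ rfl (.cR (.refl _) _ rfl)) rfl _

lemma MS.dec_enc (Δ) : ∀ {D : GCtx R} {Γ : LCtx R} {B : LTy R} (m : MS (D ++ Δ) Γ B), EqM ((m.enc Δ).dec Δ) m := by
  induction Δ with
  | nil => intro D Γ B m; exact .cL (.cL (.refl _) _ rfl) _ rfl
  | cons p Δ ih =>
    intro D Γ B m
    refine (EqM.cast_left _ _ rfl).trans (EqM.trans (EqM.dec Δ (D' := D ++ [p]) rfl rfl
      (MS.cut_grdI p (MS.enc Δ (m.cast ◾ rfl)))) ((ih _).trans (.cast_left _ _ rfl)))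

lemma MS.enc_dec (Δ) : ∀ {D : GCtx R} {Γ : LCtx R} {B : LTy R} (c : MS D (Grd Δ ++ Γ) B),
    EqM ((c.dec Δ).enc Δ) c := by
  induction Δ with
  | nil => intro D Γ B m; exact .cL (.cL (.refl _) _ rfl) _ rfl
  | cons p Δ ih =>
    intro D Γ B c
    refine .trans (EqM.grdL _ _ rfl rfl ?_) (MS.grdL_cut p c)
    refine .trans (EqM.enc Δ (D' := D ++ [p]) rfl rfl (.cL (.cast_left _ _ rfl) _ rfl)) (ih (D := D ++ [p]) _)

@[simp] lemma Grd_nil : Grd ([] : GCtx R) = [] := rfl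

@[simp] lemma Grd_cons (p : R × GTy R) (Δ : GCtx R) :
    Grd (p :: Δ) = .grd p.1 p.2 :: Grd Δ := rfl

lemma MS.dec_append (Δ Δ') : ∀ {D : GCtx R} {Γ : LCtx R} {B : LTy R}
    {c : MS D (Grd (Δ ++ Δ') ++ Γ) B} {c' : MS D (Grd Δ ++ (Grd Δ' ++ Γ)) B}, EqM c c' →
    EqM (c.dec (Δ ++ Δ')) ((c'.dec Δ).dec Δ') := by
  induction Δ with
  | nil =>
    intro D Γ B c c' e
    exact .dec Δ' ◾ rfl (.cR e _ rfl)
  | cons p Δ ih =>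
    intro D Γ B c c' e
    refine (EqM.cast_left _ _ rfl).trans ((ih (D := D ++ [p]) (EqM.cut rfl rfl rfl
      ◾ rfl (.refl _) e)).trans (EqM.dec Δ' ◾ rfl (.cR (.refl _) _ rfl)))

lemma MS.enc_eq {Δ D : GCtx R} {m : MS (D ++ Δ) Γ B}
    {c : MS D (Grd Δ ++ Γ) B} (e : EqM m (c.dec Δ)) : EqM (m.enc Δ) c :=
  (EqM.enc Δ rfl rfl e).trans (MS.enc_dec Δ c)

lemma MS.dec_eq {Δ D : GCtx R} {m : MS (D ++ Δ) Γ B}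
    {c : MS D (Grd Δ ++ Γ) B} (e : EqM c (m.enc Δ)) : EqM (c.dec Δ) m :=
  (EqM.dec Δ rfl rfl e).trans (MS.dec_enc Δ m)

lemma MS.enc_append (Δ Δ' : GCtx R) {m : MS (D ++ (Δ ++ Δ')) Γ B} {m' : MS (D ++ Δ ++ Δ') Γ B} (e : EqM m m') :
    EqM (m.enc (Δ ++ Δ')) ((m'.enc Δ').enc Δ) := by
  refine (MS.enc_eq (c := ((m'.enc Δ').enc Δ).cast rfl ◾) ?_).trans (.cast_left _ rfl _)
  refine .symm ((MS.dec_append Δ Δ' (.cast_left _ rfl _)).trans ?_)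
  exact ((EqM.dec Δ' rfl rfl (MS.dec_enc Δ _)).trans (MS.dec_enc Δ' _)).trans e.symm

lemma MS.dec_act (Δ : GCtx R) (p : Path GStep P Q) : ∀ {D1 D2 D2' : GCtx R}
    {Γ} {B} (c : MS (D1 ++ P ++ D2) (Grd Δ ++ Γ) B)
    (y : MS (D1 ++ P ++ D2') Γ B), D2' = D2 ++ Δ → EqM y (c.dec Δ) →
    EqM ((c.act D1 D2 p).dec Δ) (y.act D1 D2' p) := by
  induction Δ with
  | nil =>
    intro D1 D2 D2' Γ B c y h e
    exact (EqM.cast_left _ _ rfl).trans (Act.act_congr (A := actM R) (b := (Γ, B)) p rfl (by simp [h])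
      (e.trans (.cast_left _ _ rfl)).symm)
  | cons q Δ ih =>
    rintro D1 D2 _ Γ B c y rfl e
    have h := MS.cut_act_right [] (Grd Δ ++ Γ) (MS.grdI q) p (D1 := D1) (D2 := D2) rfl c
      ((MS.cut [] (Grd Δ ++ Γ) (MS.grdI q) c).cast ◾ rfl) (.cast_left _ _ rfl)
    refine (EqM.cast_left _ _ rfl).trans ((EqM.dec Δ ◾ rfl h.symm).trans (ih _ y ◾ ?_))
    refine (e.trans (EqM.cast_left _ _ rfl)).trans (EqM.dec Δ ◾ rfl (EqM.cR (.refl _) _ rfl))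

lemma MS.actL_congr {D D' : GCtx R} (p : Path LStep P Q)
    (h : D = D') (h1 : G1 = G1') (h2 : G2 = G2') {c : MS D (G1 ++ P ++ G2) B}
    {c' : MS D' (G1' ++ P ++ G2') B} (e : EqM c c') : EqM (c.actL G1 G2 p) (c'.actL G1' G2' p) := by
  subst h
  exact Act.act_congr (A := actK R) (b := (D, B)) p h1 h2 e

lemma MS.dec_actL (Δ : GCtx R) (p : Path LStep P Q) : ∀ {D : GCtx R} {G G1 G2} {B} (c : MS D (G ++ P ++ G2) B)
    (d : MS D (Grd Δ ++ (G1 ++ Q ++ G2)) B) (y : MS (D ++ Δ) (G1 ++ P ++ G2) B),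
    G = Grd Δ ++ G1 → EqM d (c.actL G G2 p) →
    (∀ h, EqM y (MS.dec Δ (c.cast (Γ' := Grd Δ ++ (G1 ++ P ++ G2)) rfl h))) →
    EqM (d.dec Δ) (y.actL G1 G2 p) := by
  induction Δ with
  | nil =>
    intro D G G1 G2 B c d y h hd e
    obtain rfl : G = G1 := h
    have e := (e rfl).trans (.cast_left _ _ rfl)
    refine (EqM.cast_left _ _ rfl).trans (hd.trans ?_)
    exact MS.actL_congr p ◾ rfl rfl (e.trans (EqM.cast_left _ _ rfl)).symm
  | cons q Δ ih =>
    rintro D _ G1 G2 B c d y rfl hd e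
    let x : MS (D ++ [q]) (Grd Δ ++ G1 ++ P ++ G2) B := MS.cut (Δ₁ := D) [] (Grd Δ ++ G1 ++ P ++ G2) (MS.grdI q) c
    let d' : MS (D ++ [q]) (Grd Δ ++ (G1 ++ Q ++ G2)) B :=
      MS.cut (Δ₁ := D) [] (Grd Δ ++ (G1 ++ Q ++ G2)) (MS.grdI q) d
    have h := MS.cut_actL_right (MS.grdI q) p (D1 := Grd Δ ++ G1) (D2 := G2) c x (.refl _)
    have hd' : EqM d' (x.actL (Grd Δ ++ G1) G2 p) := .trans
      (.cut rfl rfl rfl ◾ rfl (.refl _) (.cR hd rfl _)) h.symm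
    have := ih x d' (y.cast (Δ' := D ++ [q] ++ Δ) ◾ rfl) rfl hd' fun hh =>
      EqM.cL ((e ◾).trans ((EqM.cast_left _ _ rfl).trans (EqM.dec Δ rfl rfl
        (.cR (.cut rfl rfl rfl (by simp [Grd]) rfl (.refl _) (.cast_left _ rfl _)) rfl _)))) _ rfl
    exact (EqM.cast_left _ _ rfl).trans (this.trans (MS.actL_congr p ◾ rfl rfl (.cast_left _ _ rfl)))

lemma MS.enc_actL (Δ : GCtx R) (p : Path LStep P Q) (m : MS (D ++ Δ) (G1 ++ P ++ G2) B)
    (c : MS D (Grd Δ ++ G1 ++ P ++ G2) B) (e : EqM c (m.enc Δ)) :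
    EqM (MS.enc Δ (D := D) (m.actL G1 G2 p)) (c.actL (Grd Δ ++ G1) G2 p) := by
  refine (MS.enc_eq (c := (c.actL (Grd Δ ++ G1) G2 p).cast rfl ◾) ?_).trans (.cast_left _ rfl _)
  exact (MS.dec_actL Δ p c _ m rfl (.cast_left _ rfl _) fun h => (MS.dec_eq (.cL e rfl _)).symm).symm

lemma MS.actL_swap_nil {D : GCtx R} (c : MS D (G1 ++ (P ++ []) ++ G2) B) :
    EqM (c.actL G1 G2 (.swap LStep.ex P [])) c := by
  have h : EqM (MS.actL G1 G2 (.swap LStep.ex [] P) (c.cast rfl ◾)) c :=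
    Act.act_swap_nil (A := actK R) (b := (D, B)) P (.cast_left c rfl _)
  refine (MS.actL_congr _ rfl rfl rfl h.symm).trans ?_
  exact (actK_exch.act_swap_swap (b := (D, B)) [] P).trans (.cast_left _ rfl _)

lemma MS.cut_enc (Δ) (Γ₁ Γ₃) (c : MS K (Γ₁ ++ [A] ++ Γ₃) B) : ∀ {E : GCtx R} {G : LCtx R} (a : MS (E ++ Δ) G A)
    (w : MS (K ++ E ++ Δ) (Γ₁ ++ (G ++ Γ₃)) B) 
    (z : MS (K ++ E) ([] ++ (Grd Δ ++ Γ₁) ++ (G ++ Γ₃)) B), EqM w (.cut Γ₁ Γ₃ a c) → EqM z (w.enc Δ) →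
    EqM (.cut Γ₁ Γ₃ (a.enc Δ) c) (z.actL [] (G ++ Γ₃) (.swap LStep.ex (Grd Δ) Γ₁)) := by
  induction Δ with
  | nil =>
    intro E G a w z hw hz
    refine .symm ((Act.act_swap_nil (A := actK R) (b := (_, B)) Γ₁ (D1 := []) (.refl z)).trans ?_)
    refine hz.trans ((EqM.cast_left _ _ rfl).trans (hw.trans ?_))
    exact EqM.cut rfl ◾ rfl rfl rfl (EqM.cR (.refl _) _ rfl) (.refl _)
  | cons p Δ ih =>
    intro E G a w z hw hz
    let z' : MS (K ++ (E ++ [p])) ([] ++ (Grd Δ ++ Γ₁) ++ (G ++ Γ₃)) B :=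
      MS.cast (MS.enc Δ (D := K ++ E ++ [p]) (w.cast ◾ rfl)) ◾ ◾
    have h := ih (E := E ++ [p]) (a.cast ◾ rfl) (w.cast ◾ rfl) z'
      (.cL (hw.trans (.cut rfl ◾ rfl rfl rfl (.cR (.refl _) _ rfl) (.refl _)))
        _ rfl) (.cL (EqM.enc Δ ◾ rfl (.cL (.cR (.refl _) _ rfl) _ rfl)) ..)
    have h2 := EqM.cut_grdL_left p.1 p.2 Γ₁ Γ₃ (MS.enc Δ (D := E ++ [p]) (a.cast ◾ rfl)) c
    refine h2.trans ((MS.lpath_eq ..).trans ?_)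
    rw [lswap, Path.map_swap]
    have hz' : EqM z (MS.grdL (Δ := K ++ E) p.1 p.2 (z'.cast ◾ rfl)) :=
      hz.trans (EqM.grdL _ _ rfl (by simp [Grd]) (.cR (.cR (.refl _) ..) _ rfl))
    refine .symm ((Act.act_swap_cons (A := actK R) (b := (_, B)) (ex := LStep.ex) (.grd p.1 p.2) (Grd Δ) Γ₁
      (D1 := []) (D2 := G ++ Γ₃) (c' := (z.cast rfl (by simp [Grd])))
      (d := MS.cast (MS.actL (Δ := K ++ E) [.grd p.1 p.2] (G ++ Γ₃) (.swap LStep.ex (Grd Δ) Γ₁)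
        (z.cast rfl ◾)) rfl ◾)
      (EqM.cR (.refl _) rfl _) (EqM.cast_left _ rfl _)).trans ?_)
    refine .symm ((Act.act_swap_one (A := actK R) (b := (_, B)) ..).trans ?_)
    refine MS.actL_congr _ ◾ rfl ◾ ?_
    have k := MS.enc_actL [p] (D := K ++ E) (.swap LStep.ex (Grd Δ) Γ₁) (G1 := [])
      (G2 := G ++ Γ₃) (z'.cast ◾ rfl) (z.cast rfl ◾) (.cL (hz'.trans
        (EqM.grdL _ _ rfl ◾ (.cL (.cR (.cR (.cR (.refl z') _ rfl) _ rfl) _ rfl) _ rfl))) rfl _)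
    refine (EqM.cast_left _ rfl _).trans (EqM.symm ((EqM.cast_left _ rfl _).trans (k.symm.trans ?_)))
    refine EqM.grdL _ _ rfl ◾ (EqM.cL (EqM.cL (EqM.cR ?_ _ rfl) _ rfl) _ rfl)
    exact .trans (MS.actL_congr _ ◾ rfl rfl (.cast_left _ _ rfl)) h.symm

def kcut (X : KCat R) {A : LTy R} (a : MS [] X.list A) : X ⟶ ⟨[A]⟩ :=
  hom (S := actK_exch) X ⟨[A]⟩ (.single (.cut a))

lemma MS.actL_cut_single (a : MS [] Γ A) {a' : MS [] Γ' A} (e : EqM a a')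
    (h : Γ = Γ') (D1 D2 : LCtx R) (c : MS Δ (D1 ++ [A] ++ D2) B) :
    EqM (c.actL D1 D2 (.single (.cut a))) (.cut D1 D2 a' c) :=
  (Act.act_single (A := actK R) (b := (Δ, B)) ..).trans (LStep.run_cut' e D1 D2 c h)

lemma kcut_congr {X : KCat R} {a a' : MS [] X.list A} (e : EqM a a') : kcut X a = kcut X a' :=
  hom_sound (S := actK_exch) ⟨fun {b} D1 D2 c =>
    (MS.actL_cut_single (Δ := b.1) (B := b.2) a e rfl D1 D2 c).trans
      (MS.actL_cut_single (Δ := b.1) (B := b.2) a' (.refl _) rfl D1 D2 c).symm⟩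

lemma kcut_neq {X X' : KCat R} (h : X = X') {a : MS [] X.list A} {a' : MS [] X'.list A}
    (e : EqM a a') : NEq (kcut X a) (kcut X' a') := by subst h; exact .of_eq (kcut_congr e)

lemma kcut_inj {X : KCat R} {a a' : MS [] X.list A} (h : kcut X a = kcut X a') : EqM a a' := by
  have e := (hom_exact h).out (b := ([], A)) [] [] (MS.id A)
  have k : ∀ a : MS [] X.list A, EqM ((MS.id A).actL [] [] (.single (.cut a))) a := fun a =>
    (MS.actL_cut_single a (.refl _) rfl [] [] (MS.id A)).trans (EqM.cut_id_right a)
  exact (k a).symm.trans (.trans e (k a'))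

lemma hom_kcut {X Y : KCat R} (p : Path LStep Y.list X.list) (a : MS [] Y.list A)
    (a' : MS [] X.list A) (e : EqM a' ((a.cast rfl ◾).actL [] [] p)) :
    hom X Y p ≫ kcut Y a = kcut X a' := by
  refine hom_sound (S := actK_exch) ⟨fun {b} D1 D2 c => Act.act_trans' _ _ ?_⟩
  refine .trans ?_ (MS.actL_cut_single (Δ := b.1) (B := b.2) a' e ◾ D1 D2 c).symm
  have k := MS.cut_actL_left (E := []) D1 D2 (Δ := b.1) (B := b.2) c p (D1 := []) (D2 := [])
    (List.append_nil D1).symm rfl (a.cast rfl ◾)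
    ((MS.cut D1 D2 a c).cast rfl ◾) (.cL (.cut rfl rfl rfl rfl ◾
      (.cR (.refl _) rfl _) (.refl _)) rfl _)
  refine .trans ?_ k
  exact MS.actL_congr p ◾ ◾ ◾ (.cR
    (MS.actL_cut_single (Δ := b.1) (B := b.2) a (.refl _) rfl D1 D2 c) rfl _)

def tnIso (X : KCat R) : X ≅ ⟨[tn X.list]⟩ where
  hom := kcut X (tnR X.list)
  inv := hom (S := actK_exch) _ X (tnL X.list)
  hom_inv_id := hom_sound (S := actK_exch) ⟨fun {b} D1 D2 c => Act.act_trans' (A := actK R) _ _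
    (.trans ((MS.actL_cut_single (Δ := b.1) (B := b.2) _ (.refl _) rfl D1 D2 _).trans
      (MS.cut_tnR X.list D1 D2 (Δ := b.1) (C := b.2) c)) (Act.act_nil (A := actK R) ..).symm)⟩
  inv_hom_id := hom_sound (S := actK_exch) ⟨fun {b} D1 D2 c => Act.act_trans' (A := actK R) _ _
    (.trans (MS.actL_tnL_cut X.list D1 D2 (Δ := b.1) (C := b.2) c _
      (MS.actL_cut_single (Δ := b.1) (B := b.2) (tnR X.list) (.refl _) rfl D1 D2 c))
      (Act.act_nil (A := actK R) ..).symm)⟩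

lemma kcut_surj {X : KCat R} (f : X ⟶ ⟨[A]⟩) : ∃ a : MS [] X.list A, f = kcut X a := by
  obtain ⟨p, rfl⟩ := hom_surj f
  obtain ⟨a, ha⟩ := MS.exists_cast (MS.actL [] [] p (.id A)) rfl (List.append_nil _)
  refine ⟨a, ?_⟩
  rw [← hom_kcut p (.id A) a ha]
  have : kcut ⟨[A]⟩ (.id A) = 𝟙 (⟨[A]⟩ : KCat R) := (tnIso (R := R) ⟨[A]⟩).hom_inv_id.symm.trans
    (Category.comp_id _) |>.symm
  rw [this, Category.comp_id]

lemma KCat.hom_ext {X Y : KCat R} {p q : Path LStep Y.list X.list} (h : ∀ (B) (b : MS [] ([] ++ Y.list ++ []) B),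
      EqM (b.actL [] [] p) (b.actL [] [] q)) : hom X Y p = hom X Y q := by
  obtain ⟨a, ha⟩ := MS.exists_cast (MS.actL [] [] p ((tnR Y.list).cast rfl ◾)) rfl (List.append_nil _)
  rw [← cancel_mono (tnIso Y).hom]
  exact (hom_kcut p _ a ha).trans (hom_kcut q _ a (ha.trans (h ..))).symm

/-! ## The functor `Mny` -/

def MnyRel {P Q : GCtx R} (p : Path GStep P Q) (q : Path LStep (Grd P) (Grd Q)) : Prop :=
  ∀ {D : GCtx R} {Γ : LCtx R} {B : LTy R} (c : MS D (Grd P ++ Γ) B) (d : MS D (Grd Q ++ Γ) B)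
    (m : MS (D ++ P ++ []) Γ B), EqM m (c.dec P) → EqM d (c.actL [] Γ q) →
    EqM (d.dec Q) (m.act D [] p)

namespace MnyRel

lemma trans {P Q K : GCtx R} {p : Path GStep P Q} {q : Path LStep (Grd P) (Grd Q)}
    {p' : Path GStep Q K} {q' : Path LStep (Grd Q) (Grd K)} (h : MnyRel p q) (h' : MnyRel p' q') :
    MnyRel (p.trans p') (q.trans q') := by
  intro D Γ B c d m hm hd
  refine .trans (h' (c.actL [] Γ q) d (m.act D [] p) (h c _ m hm (.refl _)).symm
    (hd.trans (Act.act_trans (A := actK R) (b := (D, B)) q q' [] Γ c))) ?_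
  exact (Act.act_trans (A := actM R) (b := (Γ, B)) p p' D [] m).symm

lemma nil {P Q : GCtx R} (h : P = Q) (h' : Grd P = Grd Q) : MnyRel (.nil h) (.nil h') := by
  subst h
  intro D Γ B c d m hm hd
  refine .trans ?_ (Act.act_nil (A := actM R) (b := (Γ, B)) ..).symm
  refine .trans (EqM.dec P rfl rfl (hd.trans ?_)) hm.symm
  exact Act.act_nil (A := actK R) (b := (D, B)) ..

lemma inside {p : Path GStep P Q} {q : Path LStep (Grd P) (Grd Q)}
    (h : MnyRel p q) (D1 D2 : GCtx R) (hM : M = D1 ++ P ++ D2)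
    (hK : K = D1 ++ Q ++ D2) (hM' : Grd M = Grd D1 ++ Grd P ++ Grd D2)
    (hK' : Grd K = Grd D1 ++ Grd Q ++ Grd D2) :
    MnyRel (p.inside D1 D2 hM hK) (q.inside (Grd D1) (Grd D2) hM' hK') := by
  subst hM; subst hK
  intro D Γ B c d m hm hd
  let c1 : MS D (Grd D1 ++ Grd P ++ (Grd D2 ++ Γ)) B := c.cast rfl ◾
  let d1 : MS D (Grd D1 ++ ([] ++ Grd Q ++ (Grd D2 ++ Γ))) B := d.cast rfl ◾
  let y1 : MS (D ++ D1) ([] ++ Grd P ++ (Grd D2 ++ Γ)) B := MS.dec D1 (c.cast rfl ◾)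
  let y2 : MS (D ++ D1 ++ P ++ []) (Grd D2 ++ Γ) B := (MS.dec P y1).cast ◾ rfl
  have e1 : EqM (d1.dec D1) (y1.actL [] (Grd D2 ++ Γ) q) := by
    refine MS.dec_actL D1 q c1 d1 y1 ◾ (.cL (hd.trans ?_) rfl _)
      fun h => .dec D1 rfl rfl (.cL (.cR (.cR (.refl _) rfl _) rfl _) rfl _)
    exact Act.act_inside' (A := actK R) (b := (D, B)) q _ _ ◾ rfl (EqM.cR (.refl _) rfl _)
  have e2 := h y1 (d1.dec D1) y2 (.cast_left _ _ rfl) e1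
  let y3 : MS (D ++ D1 ++ P ++ D2) Γ B := MS.cast (MS.dec D2 y2) ◾ rfl
  have e3 := MS.dec_act D2 p y2 y3 ◾ (.cast_left _ _ rfl)
  have e4 : EqM (MS.dec (D1 ++ Q ++ D2) d) (MS.dec D2 (MS.cast (Δ' := D ++ D1 ++ Q ++ [])
      (MS.dec Q (d1.dec D1)) ◾ rfl)) := by
    refine (MS.dec_append (D1 ++ Q) D2 (c' := d.cast rfl ◾) (.cR (.refl _) rfl _)).trans
      (EqM.dec D2 ◾ rfl (.cR ?_ _ rfl))
    exact MS.dec_append D1 Q (.cL (.cR (.refl _) rfl _) rfl _)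
  have e5 : EqM m y3 := by
    refine hm.trans (.cR ?_ _ rfl)
    refine (MS.dec_append (D1 ++ P) D2 (c' := c.cast rfl ◾) (.cR (.refl _) rfl _)).trans
      (EqM.dec D2 ◾ rfl (.cR ?_ _ rfl))
    exact MS.dec_append D1 P (.cL (.cR (.refl _) rfl _) rfl _)
  refine e4.trans ((EqM.dec D2 rfl rfl (.cL e2 _ rfl)).trans (e3.trans ?_))
  exact (Act.act_inside' (A := actM R) (b := (Γ, B)) p _ _ rfl ◾ e5).symm

lemma ex (a b : R × GTy R) :
    MnyRel (.single (GStep.ex a b)) (.single (LStep.ex (.grd a.1 a.2) (.grd b.1 b.2))) := by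
  intro D Γ B c d m hm hd
  let x : MS (D ++ [a]) (.grd b.1 b.2 :: Γ) B := MS.cut [] (.grd b.1 b.2 :: Γ) (MS.grdI a) c
  let x' : MS (D ++ [b]) (.grd a.1 a.2 :: Γ) B := MS.cut [.grd a.1 a.2] Γ (MS.grdI b) c
  have e1 : EqM (MS.cut [] (.grd a.1 a.2 :: Γ) (MS.grdI b) d) x' := by
    refine .trans (.cut rfl rfl rfl rfl rfl (.refl _) (hd.trans
      ((Act.act_single (A := actK R) (b := (D, B)) ..).trans (.cR (.refl _) rfl rfl)))) ?_
    refine (EqM.cut_ex_snd [] Γ (MS.grdI b) c).trans ((MS.lpath_eq ..).trans ?_)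
    rw [lswap, Path.map_swap]
    exact (MS.actL_swap_nil _).trans (.cL (.refl _) rfl _)
  have e2 := EqM.cut_cut [] [] Γ (MS.grdI a) (MS.grdI b) c
  have e3 : EqM (d.dec [b, a]) (MS.cut [] Γ (MS.grdI a) x') := by
    refine .cL (.cL (.cL (.cut rfl rfl rfl rfl rfl (.refl _) e1) _ rfl) _ rfl) _ rfl
  refine e3.trans (.trans (.cut rfl rfl rfl rfl rfl (.refl _) (.cR (.refl _) rfl _))
    (e2.trans ((MS.path_eq ..).trans ?_)))
  rw [gswap, Path.map_swap]
  refine .trans (Act.act_swap_one (A := actM R) (b := (Γ, B)) ..) ?_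
  refine .trans (Act.act_move_cons (A := actM R) (b := (Γ, B)) (ex := GStep.ex) a b []
    (c' := m.cast ◾ rfl) (d := MS.cast (MS.left (.ex a b) D [] (m.cast ◾ rfl)) ◾ rfl)
    (EqM.cL (EqM.cR (EqM.symm (hm.trans ?_)) _ rfl) _ rfl)
    (EqM.cL (EqM.left _ rfl rfl rfl (EqM.cL (EqM.cR (.refl _) _ rfl) _ rfl)) _ rfl)) ?_
  · refine EqM.cL (EqM.cL (EqM.cL ?_ _ rfl) _ rfl) _ rfl
    exact .cut rfl rfl rfl rfl rfl (.refl _) (.cR (.cut rfl rfl rfl rfl rfl (.refl _)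
      (.cR (.refl _) rfl rfl)) rfl rfl)
  · refine EqM.trans (Act.act_nil (A := actM R) (b := (Γ, B)) ..) (EqM.cL ?_ _ rfl)
    exact (EqM.left _ rfl rfl rfl (EqM.cL (.refl _) _ rfl)).trans
      (Act.act_single (A := actM R) (b := (Γ, B)) (GStep.ex a b) D [] m).symm

end MnyRel

lemma MS.enc_cut (Δ : GCtx R) (c : MS K ([] ++ [A] ++ Γ) B) (a : MS ([] ++ Δ) G A) (w : MS (K ++ Δ) (G ++ Γ) B) (hw : EqM w (.cut [] Γ a c)) :
    EqM (w.enc Δ) (.cut [] Γ (a.enc Δ) c) := by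
  let w' : MS (K ++ [] ++ Δ) ([] ++ (G ++ Γ)) B := w.cast ◾ ◾
  let z : MS (K ++ []) ([] ++ (Grd Δ ++ []) ++ (G ++ Γ)) B := (w'.enc Δ).cast rfl ◾
  refine .trans ?_ (MS.cut_enc Δ [] Γ c a w' z (.cL hw ..) (.cL (.refl _) rfl _)).symm
  refine .trans ?_ (MS.actL_swap_nil z).symm
  exact .cR (EqM.enc Δ ◾ rfl (.cR (.refl _) ..)) rfl _

def mnyPath {P Q : GCtx R} (p : Path GStep P Q) : Path LStep (Grd P) (Grd Q) :=
  (tnL (Grd P)).trans (.single (.cut ((MS.enc Q (D := []) (MS.cast (MS.act [] [] p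
    ((MS.dec P ((tnR (Grd P)).cast (Γ' := Grd P ++ []) rfl ◾)).cast ◾ rfl))
      ◾ rfl)).cast rfl (List.append_nil _))))

lemma MnyRel.mnyPath {P Q : GCtx R} (p : Path GStep P Q) : MnyRel p (mnyPath p) := by
  intro D Γ B c d m hm hd
  let t : MS [] (Grd P ++ []) (tn (Grd P)) := (tnR (Grd P)).cast rfl ◾
  let a0 : MS ([] ++ P) [] (tn (Grd P)) := MS.dec P t
  let a : MS ([] ++ Q) [] (tn (Grd P)) := MS.cast (MS.act [] [] p (a0.cast ◾ rfl)) ◾ rfl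
  let c' : MS D ([] ++ [tn (Grd P)] ++ Γ) B := c.actL [] Γ (tnL (Grd P))
  let y : MS (D ++ P ++ []) ([] ++ [] ++ Γ) B := MS.cast (MS.cut [] Γ a0 c') ◾ rfl
  have e1 : EqM d (.cut [] Γ (a.enc Q) c') := by
    refine hd.trans (.trans (Act.act_trans (A := actK R) (b := (D, B)) (tnL (Grd P)) _ [] Γ c) ?_)
    exact MS.actL_cut_single _ (.cL (.refl _) rfl _) ◾ [] Γ c'
  have e2 : EqM (y.act D [] p) (.cut [] Γ a c') :=
    (MS.cut_act_left [] Γ c' p (D1 := []) (D2 := []) (List.append_nil D).symm (a0.cast ◾ rfl) y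
      (.cL (.cut rfl ◾ rfl rfl rfl (.cR (.refl _) _ rfl) (.refl _)) _ rfl)).trans
      (.cut rfl ◾ rfl rfl rfl (.cR (.refl _) _ rfl) (.refl _))
  have e3 : EqM m y := by
    refine hm.trans (.cR (MS.dec_eq (c := c) (m := (MS.cut [] Γ a0 c')) ?_) _ rfl)
    refine .trans ?_ (MS.enc_cut P c' a0 _ (.refl _)).symm
    refine (MS.cut_tnR (Grd P) [] Γ c).symm.trans ?_
    have e4 : EqM (tnR (Grd P)) (MS.enc P (D := []) a0) :=
      EqM.trans (ρ := t) (.cR (.refl _) rfl _) (MS.enc_dec P t).symm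
    exact .cut (h1 := rfl) (h2 := rfl) (k1 := rfl) (k3 := rfl) (k := by simp) (ea := e4) (e := .refl c')
  refine (MS.dec_eq (m := MS.cut [] Γ a c') (e1.trans (MS.enc_cut Q c' a _ (.refl _)).symm)).trans ?_
  exact e2.symm.trans (Act.act_congr (A := actM R) (b := (Γ, B)) p rfl rfl e3.symm)

lemma MnyRel.unique {p p' : Path GStep P Q} {q q' : Path LStep (Grd P) (Grd Q)}
    (h : MnyRel p q) (h' : MnyRel p' q') (e : (actC R).Same p p') :
    hom (S := actK_exch) ⟨Grd Q⟩ ⟨Grd P⟩ q = hom _ _ q' := by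
  refine KCat.hom_ext fun B b => ?_
  let m : MS ([] ++ P ++ []) [] B := (b.dec P).cast ◾ rfl
  have k : ∀ {p : Path GStep P Q} {q}, MnyRel p q →
      EqM (b.actL [] [] q) ((MS.cast (Δ' := [] ++ Q) (m.act [] [] p) ◾ rfl).enc Q) := fun h =>
    (MS.enc_eq (.cL (h b _ m (.cL (.refl _) _ rfl) (.refl _)).symm _ rfl)).symm
  refine (k h).trans (.trans (EqM.enc Q rfl rfl ?_) (k h').symm)
  exact .cL (.cR ((same_actM_of_same e).out (b := ([], B)) ..) _ rfl) _ rfl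

end

lemma Act.Ob.braiding_single {α : Type u} {L : List α → List α → Type u} {A : Act L}
    {ex : ∀ a b, L [a, b] [b, a]} {S : A.Exch ex} (a b : α) : (β_ (⟨[b]⟩ : Ob S) ⟨[a]⟩).hom =
    hom ((⟨[b]⟩) ⊗ ⟨[a]⟩) ((⟨[a]⟩) ⊗ ⟨[b]⟩) (.single (ex a b)) := by
  refine hom_sound (S := S) ⟨fun {β} D1 D2 c => ?_⟩
  refine Act.trans _ (Act.act_swap_one (A := A) ..) (Act.act_trans' (A := A) _ _ ?_)
  refine Act.trans _ (Act.act_inside' (A := A) _ _ _ rfl rfl (Act.E_cast _ ◾))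
    (Act.act_nil' (A := A) _ (Act.E.cL ?_ _))
  exact Act.trans _ (Act.act_inside' (A := A) _ _ _ rfl rfl (Act.E_cast _ ◾))
    (Act.act_congr (A := A) _ ◾ rfl (Act.cast_E ..))

instance {α : Type u} {L : List α → List α → Type u} {A : Act L} {ex : ∀ a b, L [a, b] [b, a]}
    {S : A.Exch ex} {X Y : Act.Ob S} (h : X = Y) : Nil (eqToIso h).hom :=
  inferInstanceAs (Nil (eqToHom h))

namespace Act.Ob.NEq

variable {α : Type u} {L : List α → List α → Type u} {A : Act L} {ex : ∀ a b, L [a, b] [b, a]}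
  {S : A.Exch ex}

lemma nils (h : X = X') (f : X ⟶ Y) (g : X' ⟶ Y') [Nil f] [Nil g] : NEq f g :=
  (NEq.nil f).trans ((NEq.id h).trans (NEq.nil g).symm)

lemma braiding_left (X Y Z : Ob S) : NEq (β_ (X ⊗ Y) Z).hom
    (X ◁ (β_ Y Z).hom ≫ (α_ X Z Y).inv ≫ (β_ X Z).hom ▷ Y) := by
  rw [BraidedCategory.braiding_tensor_left_hom]
  refine (NEq.nil_comp ..).trans (.comp (.refl _) (.comp (.refl _) (NEq.comp_nil ..)))

lemma braiding_right (X Y Z : Ob S) : NEq (β_ X (Y ⊗ Z)).hom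
    ((β_ X Y).hom ▷ Z ≫ (α_ Y X Z).hom ≫ Y ◁ (β_ X Z).hom) := by
  rw [BraidedCategory.braiding_tensor_right_hom]
  refine (NEq.nil_comp ..).trans (.comp (.refl _) (.comp (.refl _) (NEq.comp_nil ..)))

lemma braiding (hX : X = X') (hY : Y = Y') : NEq (β_ X Y).hom (β_ X' Y').hom := by
  subst hX; subst hY; exact .refl _

end Act.Ob.NEq

section

variable {R : Type u} [Semiring R] [Preorder R] [MulLeftMono R] [MulRightMono R]

variable (R) in
def MnyF : CCat R ⥤ KCat R where
  obj X := ⟨Grd X.list⟩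
  map {X Y} f := Quotient.lift (fun p => hom (S := actK_exch) ⟨Grd X.list⟩ ⟨Grd Y.list⟩ (mnyPath p))
    (fun p p' h => MnyRel.unique (MnyRel.mnyPath p) (MnyRel.mnyPath p') h) f
  map_id X := MnyRel.unique (MnyRel.mnyPath _) (MnyRel.nil rfl rfl) ⟨fun _ _ _ => (actC R).refl _⟩
  map_comp {X Y Z} f g := by
    obtain ⟨p, rfl⟩ := hom_surj f
    obtain ⟨q, rfl⟩ := hom_surj g
    exact MnyRel.unique (MnyRel.mnyPath _) (MnyRel.trans (MnyRel.mnyPath q) (MnyRel.mnyPath p))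
      ⟨fun _ _ _ => (actC R).refl _⟩

lemma MnyF_hom {p : Path GStep Y.list X.list} {q : Path LStep (Grd Y.list) (Grd X.list)}
    (h : MnyRel p q) : (MnyF R).map (hom X Y p) = hom ((MnyF R).obj X) ((MnyF R).obj Y) q :=
  MnyRel.unique (MnyRel.mnyPath p) h ⟨fun _ _ _ => (actC R).refl _⟩

instance {X Y : CCat R} (f : X ⟶ Y) [hf : Nil f] : Nil ((MnyF R).map f) := by
  obtain ⟨h, rfl⟩ := hf.out
  exact ⟨congrArg Grd h, MnyF_hom (MnyRel.nil h _)⟩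

lemma MnyF_tensor (X Y) : (MnyF R).obj X ⊗ (MnyF R).obj Y = (MnyF R).obj (X ⊗ Y) :=
  congrArg Act.Ob.mk (Grd_append X.list Y.list).symm

lemma MnyF_right (f : X ⟶ Y) (Z) : NEq ((MnyF R).map (f ▷ Z)) ((MnyF R).map f ▷ (MnyF R).obj Z) := by
  obtain ⟨p, rfl⟩ := hom_surj f
  rw [whiskerRight_hom, MnyF_hom (MnyRel.inside (MnyRel.mnyPath p) [] Z.list rfl rfl ◾ ◾)]
  exact .of_act (MnyF_tensor ..).symm (MnyF_tensor ..).symm fun {b} D1 D2 c c' e =>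
    (Act.act_inside' (A := actK R) _ _ _ (List.append_nil _) rfl (c' := c'.cast rfl
      (List.append_assoc D1 (_ ++ _) _ |>.trans (by simp [MnyF]))) (EqM.cR e rfl _)).trans
    (Act.act_inside' (A := actK R) _ _ _ (List.append_nil _) rfl (EqM.cR (.refl _) rfl _)).symm

lemma MnyF_left (f : X ⟶ Y) (Z) : NEq ((MnyF R).map (Z ◁ f)) ((MnyF R).obj Z ◁ (MnyF R).map f) := by
  obtain ⟨p, rfl⟩ := hom_surj f
  rw [whiskerLeft_hom, MnyF_hom (MnyRel.inside (MnyRel.mnyPath p) Z.list [] (M := (Z ⊗ Y).list)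
    (K := (Z ⊗ X).list) ◾ ◾ ◾ ◾)]
  exact .of_act (MnyF_tensor ..).symm (MnyF_tensor ..).symm fun {b} D1 D2 c c' e =>
    (Act.act_inside' (A := actK R) _ _ _ rfl rfl (c' := c'.cast rfl (by simp [MnyF])) (EqM.cR e rfl _)).trans
    (Act.act_inside' (A := actK R) _ _ _ rfl rfl (EqM.cR (.refl _) rfl _)).symm

lemma Act.Ob.NEq.mny {f : X ⟶ Y} {g : X' ⟶ Y'} (h : NEq f g) : NEq ((MnyF R).map f) ((MnyF R).map g) := by
  obtain ⟨rfl, rfl, ⟨⟩⟩ := h; exact .refl _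

lemma MnyF_unit : 𝟙_ (KCat R) = (MnyF R).obj (𝟙_ (CCat R)) := rfl

def MnyF_core : (MnyF R).CoreMonoidal where
  εIso := eqToIso MnyF_unit
  μIso X Y := eqToIso (MnyF_tensor X Y)
  μIso_hom_natural_left f Z :=
    ((NEq.comp_nil ..).trans ((MnyF_right f Z).symm.trans (NEq.nil_comp ..).symm)).eq
  μIso_hom_natural_right Z f :=
    ((NEq.comp_nil ..).trans ((MnyF_left f Z).symm.trans (NEq.nil_comp ..).symm)).eq
  associativity _ _ _ := Nil.eq ..
  left_unitality _ := Nil.eq ..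
  right_unitality _ := Nil.eq ..

instance : (MnyF R).Monoidal := MnyF_core.toMonoidal

lemma MnyF_associator (X Y Z) : NEq ((MnyF R).map (α_ X Y Z).hom)
    (α_ ((MnyF R).obj X) ((MnyF R).obj Y) ((MnyF R).obj Z)).hom :=
  NEq.nils (by rw [MnyF_tensor, MnyF_tensor]) ..

lemma MnyF_associator_inv (X Y Z) : NEq ((MnyF R).map (α_ X Y Z).inv)
    (α_ ((MnyF R).obj X) ((MnyF R).obj Y) ((MnyF R).obj Z)).inv :=
  NEq.nils (by rw [MnyF_tensor, MnyF_tensor]) ..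

instance : Nil (Functor.LaxMonoidal.ε (MnyF R)) := inferInstanceAs (Nil (𝟙 (𝟙_ (KCat R))))
instance (X Y : CCat R) : Nil (Functor.LaxMonoidal.μ (MnyF R) X Y) :=
  inferInstanceAs (Nil (eqToHom (MnyF_tensor X Y)))
instance : Nil (Functor.OplaxMonoidal.η (MnyF R)) := inferInstanceAs (Nil (𝟙 (𝟙_ (KCat R))))
instance (X Y : CCat R) : Nil (Functor.OplaxMonoidal.δ (MnyF R) X Y) :=
  inferInstanceAs (Nil (eqToHom (MnyF_tensor X Y).symm))

lemma MnyF_braiding_unit_left (X) : NEq ((MnyF R).map (β_ (𝟙_ (CCat R)) X).hom)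
    (β_ (𝟙_ (KCat R)) ((MnyF R).obj X)).hom :=
  NEq.nils (X' := 𝟙_ (KCat R) ⊗ (MnyF R).obj X) (Y' := (MnyF R).obj X ⊗ 𝟙_ (KCat R)) (MnyF_tensor (𝟙_ (CCat R)) X).symm ..

lemma MnyF_braiding_unit_right (X) : NEq ((MnyF R).map (β_ X (𝟙_ (CCat R))).hom)
    (β_ ((MnyF R).obj X) (𝟙_ (KCat R))).hom :=
  NEq.nils (X' := (MnyF R).obj X ⊗ 𝟙_ (KCat R)) (Y' := 𝟙_ (KCat R) ⊗ (MnyF R).obj X) (MnyF_tensor X (𝟙_ (CCat R))).symm ..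

lemma MnyF_braiding_single (a b) : NEq ((MnyF R).map (β_ (CCat.of [a]) (CCat.of [b])).hom)
      (β_ ((MnyF R).obj (CCat.of [a])) ((MnyF R).obj (CCat.of [b]))).hom := by
  have h := braiding_single (S := actC_exch) b a
  have h' := braiding_single (S := actK_exch) (LTy.grd b.1 b.2) (.grd a.1 a.2)
  exact (NEq.of_eq ((congrArg _ h).trans (MnyF_hom (MnyRel.ex b a)))).trans (NEq.of_eq h'.symm)

lemma MnyF_braiding_one (a) : ∀ l : GCtx R, NEq ((MnyF R).map (β_ (CCat.of [a]) (CCat.of l)).hom)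
      (β_ ((MnyF R).obj (CCat.of [a])) ((MnyF R).obj (CCat.of l))).hom
  | [] => MnyF_braiding_unit_right _
  | b :: l => by
    refine (NEq.mny (NEq.braiding_right (CCat.of [a]) (CCat.of [b]) (CCat.of l))).trans ?_
    refine .trans ?_ (NEq.braiding_right ((MnyF R).obj (CCat.of [a])) ((MnyF R).obj (CCat.of [b]))
      ((MnyF R).obj (CCat.of l))).symm
    rw [Functor.map_comp, Functor.map_comp]
    refine .comp ((MnyF_right ..).trans (.right (MnyF_braiding_single a b) rfl)) (.comp
      (MnyF_associator ..) ((MnyF_left ..).trans (.left rfl (MnyF_braiding_one a l))))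

lemma MnyF_braiding : ∀ X Y : CCat R, NEq ((MnyF R).map (β_ X Y).hom) (β_ ((MnyF R).obj X) ((MnyF R).obj Y)).hom
  | ⟨[]⟩, Y => MnyF_braiding_unit_left Y
  | ⟨a :: l⟩, Y => by
    refine (NEq.mny (NEq.braiding_left (CCat.of [a]) (CCat.of l) Y)).trans ?_
    refine .trans ?_ (NEq.braiding_left ((MnyF R).obj (CCat.of [a])) ((MnyF R).obj (CCat.of l)) ((MnyF R).obj Y)).symm
    rw [Functor.map_comp, Functor.map_comp]
    refine .comp ((MnyF_left ..).trans (.left rfl (MnyF_braiding ⟨l⟩ Y))) (.comp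
      (MnyF_associator_inv ..) ((MnyF_right ..).trans (.right (MnyF_braiding_one a Y.list) rfl)))

instance : (MnyF R).Braided where
  braided X Y := ((NEq.nil_comp ..).trans ((MnyF_braiding X Y).trans (NEq.comp_nil ..).symm)).eq

end

section

variable {C D : Type u} [Category.{u} C] [Category.{u} D] (F : C ⥤ D) (G : D → C)
  (ε : ∀ Y, F.obj (G Y) ⟶ Y) (h : ∀ X Y, Function.Bijective fun g : X ⟶ G Y => F.map g ≫ ε Y)

noncomputable def univEquiv (X : C) (Y : D) : (F.obj X ⟶ Y) ≃ (X ⟶ G Y) :=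
  (Equiv.ofBijective _ (h X Y)).symm

lemma univEquiv_symm (X : C) (Y : D) (g : X ⟶ G Y) : (univEquiv F G ε h X Y).symm g = F.map g ≫ ε Y := rfl

lemma univEquiv_comp (X' X : C) (Y : D) (f : X' ⟶ X) (g : F.obj X ⟶ Y) :
    univEquiv F G ε h X' Y (F.map f ≫ g) = f ≫ univEquiv F G ε h X Y g := by
  rw [← Equiv.eq_symm_apply, univEquiv_symm, F.map_comp, Category.assoc, ← univEquiv_symm F G ε h,
    Equiv.symm_apply_apply]

noncomputable def univAdj : F ⊣ Adjunction.rightAdjointOfEquiv (univEquiv F G ε h)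
    (univEquiv_comp F G ε h) := Adjunction.adjunctionOfEquivRight ..

lemma univAdj_counit (Y : D) : (univAdj F G ε h).counit.app Y = ε Y := by
  rw [univAdj, Adjunction.adjunctionOfEquivRight_counit_app]
  exact (congrArg (· ≫ ε Y) (F.map_id _)).trans (Category.id_comp _)

end

section

variable {C D : Type u} [Category.{u} C] [MonoidalCategory C] [SymmetricCategory C]
  [Category.{u} D] [MonoidalCategory D] [SymmetricCategory D] {F : C ⥤ D} {G : D ⥤ C} (adj : F ⊣ G)
  [F.Braided] [G.LaxMonoidal] [adj.IsMonoidal]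

open Functor.LaxMonoidal Functor.OplaxMonoidal

lemma rightAdjoint_braided {F : C ⥤ D} {G : D ⥤ C} (adj : F ⊣ G) [F.Braided] [G.LaxMonoidal]
    [adj.IsMonoidal] (X Y : D) :
    μ G X Y ≫ G.map (β_ X Y).hom = (β_ (G.obj X) (G.obj Y)).hom ≫ μ G Y X := by
  refine (adj.homEquiv ..).symm.injective ?_
  rw [Adjunction.homEquiv_counit, Adjunction.homEquiv_counit, F.map_comp, F.map_comp, Category.assoc,
    Category.assoc, adj.map_μ_comp_counit_app_tensor, adj.counit_naturality,
    ← Category.assoc, adj.map_μ_comp_counit_app_tensor, Category.assoc, Functor.map_braiding,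
    Category.assoc, Category.assoc, Functor.Monoidal.μ_δ_assoc]
  exact congrArg (δ F _ _ ≫ ·) (BraidedCategory.braiding_naturality ..)

lemma map_μ_counit (X Y : C) : F.map (adj.unit.app X ⊗ₘ adj.unit.app Y) ≫
    F.map (μ G (F.obj X) (F.obj Y)) ≫ adj.counit.app (F.obj X ⊗ F.obj Y) = δ F X Y := by
  rw [adj.map_μ_comp_counit_app_tensor, ← Category.assoc]
  refine (congrArg (· ≫ _) (δ_natural F (adj.unit.app X) (adj.unit.app Y)).symm).trans ?_
  refine (Category.assoc ..).trans ?_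
  refine (congrArg (δ F X Y ≫ ·) (tensorHom_comp_tensorHom ..)).trans ?_
  dsimp only [Functor.comp_obj, Functor.id_obj]
  rw [ adj.left_triangle_components, adj.left_triangle_components, id_tensorHom_id, Category.comp_id]

end

section

variable {R : Type u} [Semiring R] [Preorder R] [MulLeftMono R] [MulRightMono R]

/-! ## Derivations as morphisms -/

def cut1 (X : CCat R) {Z : GTy R} (a : GS X.list Z) : X ⟶ CCat.of [(1, Z)] :=
  hom X (CCat.of [(1, Z)]) (.single (.cut 1 a (scale_one _).symm))

lemma cut1_neq (X : CCat R) (a : GS X.list Z) : NEq (cut1 X a) (cutHom 1 a) := by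
  have : ∀ (Y : CCat R) (h : Y.list = scale 1 X.list),
      NEq (hom Y (CCat.of [(1, Z)]) (.single (.cut 1 a h))) (cutHom 1 a) := by
    rintro ⟨l⟩ h
    obtain rfl : l = scale 1 X.list := h
    exact .refl _
  exact this X _

lemma hom_cut1 {X Y : CCat R} (p : Path GStep Y.list X.list) (a : GS Y.list Z)
    (a' : GS X.list Z) (e : EqG a' ((a.cast ◾).act [] [] p)) :
    hom X Y p ≫ cut1 Y a = cut1 X a' := by
  have h : ∀ {F : CCat R ⥤ CCat R} (_ : 𝟭 _ = F), NEq (hom X Y p) (F.map (hom X Y p)) := by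
    rintro _ rfl; exact .refl _
  exact ((NEq.comp (h scaleF_one.symm) (cut1_neq Y a)).trans
    ((NEq.of_eq (scaleF_map_cutHom 1 p a a' e)).trans (cut1_neq X a').symm)).eq

lemma cut1_congr {X : CCat R} {a a' : GS X.list Z} (e : EqG a a') : cut1 X a = cut1 X a' := by
  rw [← hom_cut1 (.nil rfl) a a' (e.symm.trans (Act.act_nil' (A := actG R) _ (EqG.cL (.refl _) _)).symm)]
  exact (Category.id_comp (cut1 X a)).symm

lemma act_cut1 (t : R) (a : GS E X) (h : E = scale 1 E) (D1 D2 : GCtx R) {c : GS (D1 ++ scale t [(1, X)] ++ D2) Y} {c' : GS (D1 ++ [(t, X)] ++ D2) Y}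
    (e : EqG c c') : EqG (GS.act D1 D2 ((Path.single (GStep.cut 1 a h)).scaled t) c) (GS.cut t D1 D2 a c') :=
  EqG.trans (Act.act_single (A := actG R) ..) (.cL (.cut (mul_one t) rfl rfl rfl (.refl _) e) _)

lemma cut1_inj {X : CCat R} {a a' : GS X.list Z} (h : cut1 X a = cut1 X a') : EqG a a' := by
  have k : ∀ a : GS X.list Z, EqG (GS.act [] [] ((Path.single (GStep.cut 1 a (scale_one _).symm)).scaled 1)
      ((GS.id Z).cast ◾)) a := fun a =>
    (act_cut1 1 a _ [] [] (c' := .id Z) (.cL (.refl _) _)).trans (EqG.cut_id_right a)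
  exact (k a).symm.trans (.trans (same_actC_iff.1 (hom_exact h) 1 [] [] Z _) (k a'))

lemma cut1_id (Z : GTy R) : cut1 (CCat.of [(1, Z)]) (.id Z) = 𝟙 _ :=
  hom_eq_of_act fun t D1 D2 Y c => (act_cut1 t (.id Z) _ D1 D2 (c' := c.cast (by simp [scale]))
    (.cR (.refl _) _)).trans ((EqG.cut_id_left ..).trans (.cL
      (.symm (Act.act_nil (A := actG R) ..)) _))

lemma cut1_surj {X : CCat R} (f : X ⟶ CCat.of [(1, Z)]) : ∃ a : GS X.list Z, f = cut1 X a := by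
  obtain ⟨p, rfl⟩ := hom_surj f
  refine ⟨(GS.act [] [] p (.id Z)).cast ◾, ?_⟩
  refine .trans ?_ (hom_cut1 p (.id Z) _ (.cL (.refl _) _))
  rw [cut1_id, Category.comp_id]

def kc (X : CCat R) {Γ : LCtx R} {A : LTy R} (m : MS X.list Γ A) :
    (MnyF R).obj X ⊗ (⟨Γ⟩ : KCat R) ⟶ ⟨[A]⟩ :=
  kcut ((MnyF R).obj X ⊗ (⟨Γ⟩ : KCat R)) (m.enc X.list (D := []))

lemma kc_congr {X : CCat R} {m m' : MS X.list Γ A} (e : EqM m m') :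
    kc X m = kc X m' := kcut_congr (EqM.enc X.list rfl rfl e)

lemma kc_inj {X : CCat R} {m m' : MS X.list Γ A} (h : kc X m = kc X m') : EqM m m' :=
  (MS.dec_enc X.list (D := []) m).symm.trans
    ((EqM.dec X.list rfl rfl (kcut_inj h)).trans (MS.dec_enc X.list (D := []) m'))

lemma kc_surj (f : (MnyF R).obj X ⊗ (⟨Γ⟩ : KCat R) ⟶ ⟨[A]⟩) : ∃ m : MS X.list Γ A, f = kc X m := by
  obtain ⟨a, rfl⟩ := kcut_surj f
  exact ⟨MS.dec X.list (D := []) a, kcut_congr (MS.enc_dec X.list (D := []) a).symm⟩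

lemma MnyF_kc (p : Path GStep Y.list X.list)
    (m : MS Y.list Γ A) (m' : MS X.list Γ A) (e : EqM m' ((m.cast ◾ rfl).act [] [] p)) :
    (MnyF R).map (hom X Y p) ▷ (⟨Γ⟩ : KCat R) ≫ kc Y m = kc X m' := by
  refine hom_kcut _ _ _ ?_
  refine .trans ?_ (Act.act_inside' (A := actK R) (b := ([], A)) (D1 := []) (E1 := []) (E2 := Γ) (D2 := []) (mnyPath p) _ _ rfl (List.append_nil _)
    (c' := MS.enc Y.list (D := []) m) (EqM.cL (.refl _) rfl _)).symm
  refine MS.enc_eq (e.trans ?_)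
  exact (MnyRel.mnyPath p (D := []) (MS.enc Y.list (D := []) m) _ _ (.cL (MS.dec_enc Y.list (D := []) m).symm _ rfl)
    (.refl _)).symm

/-! ## The functor `Lin` -/

variable (R) in
abbrev linObj (Y : KCat R) : CCat R := CCat.of [(1, .lin (tn Y.list))]

def MS.linE (A : LTy R) : MS [(1, .lin A)] [] A := .linL (Δ := []) (.id A)

def linE (Y : KCat R) : (MnyF R).obj (linObj R Y) ⟶ Y :=
  (ρ_ _).inv ≫ kc (linObj R Y) (MS.linE (tn Y.list)) ≫ (tnIso Y).inv

lemma MnyF_cut1 (X : CCat R) (b : GS X.list (.lin A)) (m : MS X.list [] A)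
    (e : EqM m (MS.gcut 1 [] [] b (MS.linE A))) :
    (MnyF R).map (cut1 X b) ▷ _ ≫ kc (CCat.of [(1, .lin A)]) (MS.linE A) = kc X m :=
  MnyF_kc _ _ _ (e.trans (.symm (.trans (Act.act_single (A := actM R) (b := ([], A)) _ [] [] _)
    (.cL (.gcut rfl rfl rfl rfl rfl (.refl _) (.cL (.refl _) rfl rfl)) _ rfl))))

lemma MS.gcut_linE {X : CCat R} (m : MS X.list [] A) : EqM (MS.gcut 1 [] [] (.linR m) (MS.linE A)) m :=
  (EqM.gcut rfl rfl rfl rfl rfl (.refl _) (EqM.cR (.refl _) rfl rfl)).trans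
    ((EqM.gcut_lin (Δ := []) (Γ := []) m (.id A)).trans (EqM.cut_id_right m))

lemma GS.linR_gcut {X : CCat R} (b : GS X.list (.lin A)) : EqG (.linR (MS.gcut 1 [] [] b (MS.linE A))) b :=
  (EqG.cut_linR 1 [] [] b (MS.linE A)).symm.trans
    ((EqG.cut rfl rfl rfl rfl (.refl _) (EqG.eta_lin A).symm).trans (EqG.cut_id_right b))

lemma linE_bijective (X : CCat R) (Y : KCat R) :
    Function.Bijective fun g : X ⟶ linObj R Y => (MnyF R).map g ≫ linE Y := by
  have k : ∀ g : X ⟶ linObj R Y, (MnyF R).map g ≫ linE Y = (ρ_ _).inv ≫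
      ((MnyF R).map g ▷ _ ≫ kc (linObj R Y) (MS.linE (tn Y.list))) ≫ (tnIso Y).inv := fun g => by
    rw [linE, Category.assoc, ← rightUnitor_inv_naturality_assoc]
  constructor
  · intro g g' h
    obtain ⟨b, rfl⟩ := cut1_surj g
    obtain ⟨b', rfl⟩ := cut1_surj g'
    have h := (k _).symm.trans (Eq.trans h (k _))
    rw [cancel_epi, cancel_mono] at h
    obtain ⟨m, e⟩ := MS.exists_cast (MS.gcut 1 [] [] b (MS.linE (tn Y.list))) (show _ = X.list by simp) rfl
    obtain ⟨m', e'⟩ := MS.exists_cast (MS.gcut 1 [] [] b' (MS.linE (tn Y.list))) (show _ = X.list by simp) rfl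
    have h := kc_inj ((MnyF_cut1 X b m e).symm.trans (h.trans (MnyF_cut1 X b' m' e')))
    exact cut1_congr ((GS.linR_gcut b).symm.trans (.trans (.congr_linR
      (e.symm.trans (.trans h e'))) (GS.linR_gcut b')))
  · intro f
    obtain ⟨m, hm⟩ := kc_surj ((ρ_ _).hom ≫ f ≫ (tnIso Y).hom)
    refine ⟨cut1 X (.linR m), (k _).trans ?_⟩
    refine (congrArg (fun z => (ρ_ _).inv ≫ z ≫ (tnIso Y).inv)
      (MnyF_cut1 X (.linR m) m (MS.gcut_linE m).symm)).trans ?_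
    rw [← hm, Category.assoc, Category.assoc, Iso.hom_inv_id, Category.comp_id, Iso.inv_hom_id_assoc]

variable (R) in
noncomputable def LinF : KCat R ⥤ CCat R :=
  Adjunction.rightAdjointOfEquiv _ (univEquiv_comp (MnyF R) (linObj R) linE linE_bijective)

variable (R) in
noncomputable def mnyLin : MnyF R ⊣ LinF R := univAdj (MnyF R) (linObj R) linE linE_bijective

noncomputable instance : (LinF R).LaxMonoidal := (mnyLin R).rightAdjointLaxMonoidal

instance : (mnyLin R).IsMonoidal := inferInstanceAs (letI := (mnyLin R).rightAdjointLaxMonoidal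
  (mnyLin R).IsMonoidal)

noncomputable instance : (LinF R).LaxBraided where
  braided := rightAdjoint_braided (mnyLin R)

lemma mnyLin_counit (Y : KCat R) : (mnyLin R).counit.app Y = linE Y := univAdj_counit _ _ _ _ Y

/-! ## The closed structure -/

def MS.ev (A B : LTy R) : MS [] [.imp A B, A] B := MS.impL [] [] (.id A) (.id B)

abbrev homObj (X Z : KCat R) : KCat R := ⟨[.imp (tn X.list) (tn Z.list)]⟩

def evK (X Z : KCat R) : X ⊗ homObj X Z ⟶ Z :=
  (β_ _ _).hom ≫ _ ◁ (tnIso X).hom ≫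
    kcut (homObj X Z ⊗ (⟨[tn X.list]⟩ : KCat R)) (MS.ev (tn X.list) (tn Z.list)) ≫ (tnIso Z).inv

lemma kcut_ev (b : MS [] Y.list (.imp A B)) (m : MS [] (Y.list ++ [A]) B)
    (e : EqM m (.cut [] [A] b (MS.ev A B))) : kcut Y b ▷ (⟨[A]⟩ : KCat R) ≫
      kcut ((⟨[.imp A B]⟩ : KCat R) ⊗ (⟨[A]⟩ : KCat R)) (MS.ev A B) = kcut (Y ⊗ (⟨[A]⟩ : KCat R)) m := by
  refine hom_kcut _ _ _ (e.trans ?_)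
  refine .symm (.trans (Act.act_inside' (A := actK R) (b := ([], B)) (D1 := []) (D2 := []) (E1 := [])
    (E2 := [A]) (D1' := []) (D2' := [A]) (P := [.imp A B]) _ _ _ rfl rfl (c' := MS.ev A B) (EqM.cL (.refl _) rfl rfl)) ?_)
  exact MS.actL_cut_single b (.refl _) rfl [] [A] _

lemma MS.cut_ev {Γ : LCtx R} (m : MS [] (Γ ++ [A]) B) : EqM (.cut [] [A] (.impR m) (MS.ev A B)) m := by
  refine .trans (.cut rfl rfl rfl rfl rfl (.refl _) (.cR (.refl _) rfl rfl))
    ((EqM.cut_imp [] [] m (.id A) (.id B)).trans ?_)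
  refine (MS.path_gswap_nil ..).trans (.cL ((EqM.cut_id_right _).trans ?_) _ rfl)
  exact (EqM.cut_id_left ..).trans (.cast_left _ rfl _)

lemma MS.impR_cut_ev {Γ : LCtx R} (b : MS [] Γ (.imp A B)) (m : MS [] (Γ ++ [A]) B)
    (e : EqM m (.cut [] [A] b (MS.ev A B))) : EqM (.impR m) b := by
  refine .trans ?_ (EqM.cut_id_right b)
  refine .trans ?_ (.cut rfl rfl rfl rfl rfl (.refl _) (EqM.eta_imp A B).symm)
  refine .trans ?_ (EqM.cut_impR [] [] b _).symm
  exact .impR rfl ◾ (e.trans (.cR (.cut rfl rfl rfl rfl rfl (.refl _)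
    (.cR (.cR (.refl _) rfl rfl) rfl rfl)) rfl _))

lemma evK_bijective (X Y Z : KCat R) :
    Function.Bijective fun g : Y ⟶ homObj X Z => (tensorLeft X).map g ≫ evK X Z := by
  have k : ∀ b : MS [] Y.list (.imp (tn X.list) (tn Z.list)), ∀ m, EqM m (.cut [] [_] b (MS.ev ..)) →
      (tensorLeft X).map (kcut Y b) ≫ evK X Z = (β_ _ _).hom ≫ Y ◁ (tnIso X).hom ≫
        kcut (Y ⊗ (⟨[tn X.list]⟩ : KCat R)) m ≫ (tnIso Z).inv := fun b m e => by
    rw [← kcut_ev b m e, evK]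
    refine Eq.trans (b := X ◁ kcut Y b ≫ _) rfl ?_
    rw [BraidedCategory.braiding_naturality_right_assoc, Category.assoc, ← whisker_exchange_assoc]
  constructor
  · intro g g' h
    obtain ⟨b, rfl⟩ := kcut_surj g
    obtain ⟨b', rfl⟩ := kcut_surj g'
    obtain ⟨m, e⟩ : ∃ m : MS [] (Y.list ++ [_]) _, EqM m (.cut [] [_] b (MS.ev ..)) := ⟨_, .refl _⟩
    obtain ⟨m', e'⟩ : ∃ m : MS [] (Y.list ++ [_]) _, EqM m (.cut [] [_] b' (MS.ev ..)) := ⟨_, .refl _⟩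
    have h := (k b m e).symm.trans (Eq.trans h (k b' m' e'))
    rw [cancel_epi, cancel_epi, cancel_mono] at h
    exact kcut_congr ((MS.impR_cut_ev b m e).symm.trans ((EqM.impR rfl rfl (kcut_inj h)).trans
      (MS.impR_cut_ev b' m' e')))
  · intro f
    obtain ⟨m, hm⟩ := kcut_surj (X := Y ⊗ (⟨[tn X.list]⟩ : KCat R))
      (Y ◁ (tnIso X).inv ≫ (β_ _ _).inv ≫ f ≫ (tnIso Z).hom)
    refine ⟨kcut Y (.impR m), (k _ m (MS.cut_ev m).symm).trans ?_⟩
    rw [← hm]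
    simp

noncomputable instance : MonoidalClosed (KCat R) where
  closed X :=
    { rightAdj := _
      adj := univAdj (tensorLeft X) (homObj X) (evK X) (fun Y Z => evK_bijective X Y Z) }

lemma ev_app (X Z : KCat R) : (ihom.ev X).app Z = evK X Z := univAdj_counit _ _ _ _ Z

end

section

variable {α : Type u} {L : List α → List α → Type u} {A : Act L} {ex : ∀ a b, L [a, b] [b, a]}
  {S : A.Exch ex} {f : α → Act.Ob S} (g : ∀ a, f a ≅ (⟨[a]⟩ : Act.Ob S))

def tensIso : ∀ l : List α, tens f l ≅ (⟨l⟩ : Act.Ob S)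
  | [] => Iso.refl (𝟙_ _)
  | a :: l => (tensorIso (g a) (tensIso l) : f a ⊗ tens f l ≅ (⟨[a]⟩ : Act.Ob S) ⊗ (⟨l⟩ : Act.Ob S))

instance tensAppend_nil {β : Type u} {f : β → Act.Ob S} : ∀ l l' : List β, Nil (tensAppend f l l').hom
  | [], l' => inferInstanceAs (Nil (λ_ (tens f l')).inv)
  | a :: l, l' => by
    have := tensAppend_nil (f := f) l l'
    exact inferInstanceAs (Nil (f a ◁ (tensAppend f l l').hom ≫ (α_ _ _ _).inv))

instance tensAppend_inv_nil {β : Type u} {f : β → Act.Ob S} : ∀ l l' : List β, Nil (tensAppend f l l').inv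
  | [], l' => inferInstanceAs (Nil (λ_ (tens f l')).hom)
  | a :: l, l' => by
    have := tensAppend_inv_nil (f := f) l l'
    exact inferInstanceAs (Nil ((α_ _ _ _).hom ≫ f a ◁ (tensAppend f l l').inv))

instance {β : Type u} {f : β → Act.Ob S} (l1 l l2 : List β) : Nil (tensSplit f l1 l l2).hom :=
  inferInstanceAs (Nil (_ ≫ (tensAppend f l1 l).hom ▷ tens f l2))

instance {β : Type u} {f : β → Act.Ob S} (l1 l l2 : List β) : Nil (tensSplit f l1 l l2).inv :=
  inferInstanceAs (Nil ((tensAppend f l1 l).inv ▷ tens f l2 ≫ _))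

lemma tensIso_append : ∀ l l' : List α, NEq (tensIso g (l ++ l')).hom ((tensIso g l).hom ⊗ₘ (tensIso g l').hom)
  | [], _ => ((NEq.of_eq (id_tensorHom _ _)).trans (NEq.unit_left _)).symm
  | a :: l, l' => (NEq.tensor (.refl (g a).hom) (tensIso_append l l')).trans
      (NEq.tensor_assoc (g a).hom (tensIso g l).hom (tensIso g l').hom).symm

lemma tensIso_append_append (l1 l l2) : NEq (tensIso g (l1 ++ l ++ l2)).hom
    (((tensIso g l1).hom ⊗ₘ (tensIso g l).hom) ⊗ₘ (tensIso g l2).hom) :=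
  (tensIso_append g ..).trans (.tensor (tensIso_append g ..) (.refl _))

lemma tensMid_neq {β : Type u} {f : β → Act.Ob S} (l1 l2 : List β) {P Q : List β} (k : tens f Q ⟶ tens f P) :
    NEq (tensMid f l1 l2 k) ((tens f l1 ◁ k) ▷ tens f l2) :=
  (NEq.nil_comp ..).trans (NEq.comp_nil ..)

lemma inside_neq (D1 D2) (p : Path L P Q) : NEq (((⟨D1⟩) ◁ hom ⟨Q⟩ ⟨P⟩ p) ▷ (⟨D2⟩))
      (hom (S := S) ⟨D1 ++ Q ++ D2⟩ ⟨D1 ++ P ++ D2⟩ (p.inside D1 D2 rfl rfl)) :=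
  .of_act rfl rfl fun E1 E2 c c' e => by
    refine A.trans (Act.act_inside' (p.inside D1 [] ◾ ◾) (E1 := []) (E2 := D2) _ _
      (List.append_nil E1) rfl (c' := A.cast c ◾) (Act.E_cast ..)) ?_
    refine A.trans (Act.act_inside' p (E1 := D1) (E2 := []) _ _ rfl (List.nil_append _)
      (c' := A.cast c ◾) (Act.E.cL (Act.E_cast ..) _)) (A.symm ?_)
    exact Act.act_inside' p _ _ rfl rfl (A.trans (A.symm e) (Act.E_cast ..))

lemma tensMid_tensIso (D1 D2) {k : tens f Q ⟶ tens f P} {p : Path L P Q}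
    (h : k ≫ (tensIso g P).hom = (tensIso g Q).hom ≫ hom ⟨Q⟩ ⟨P⟩ p) :
    tensMid f D1 D2 k ≫ (tensIso g (D1 ++ P ++ D2)).hom =
      (tensIso g (D1 ++ Q ++ D2)).hom ≫ hom ⟨D1 ++ Q ++ D2⟩ ⟨D1 ++ P ++ D2⟩ (p.inside D1 D2 rfl rfl) := by
  refine NEq.eq ((NEq.comp (tensMid_neq D1 D2 k) (tensIso_append_append g D1 P D2)).trans ?_)
  refine .trans ?_ (NEq.comp (tensIso_append_append g D1 Q D2) (inside_neq D1 D2 p).symm).symm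
  refine .of_eq ?_
  rw [whiskerRight_comp_tensorHom, whiskerLeft_comp_tensorHom, h,
    ← tensorHom_comp_whiskerLeft, tensorHom_comp_whiskerRight]

end

section

variable (R : Type u) [Semiring R] [Preorder R] [AddLeftMono R] [MulLeftMono R] [MulRightMono R]

noncomputable def synM : Model R where
  C := CCat R
  M := KCat R
  Mny := MnyF R
  Lin := LinF R
  adj := mnyLin R
  exp := expC R

variable {R}

noncomputable def oG (X : GTy R) : CCat R := (synM R).objG X

noncomputable def oM (A : LTy R) : KCat R := (synM R).objM A

mutual
noncomputable def isoG : ∀ X : GTy R, oG X ≅ CCat.of [(1, X)]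
  | .unit => (unitIso 1).symm
  | .tensor X Y => (tensorIso (isoG X) (isoG Y) : oG X ⊗ oG Y ≅ _) ≪≫ (pairIso 1 X Y).symm
  | .lin A => (LinF R).mapIso (isoM A)
noncomputable def isoM : ∀ A : LTy R, oM A ≅ ⟨[A]⟩
  | .unit => tnIso (𝟙_ (KCat R))
  | .tensor A B => (tensorIso (isoM A) (isoM B) : oM A ⊗ oM B ≅ _) ≪≫ tnIso ⟨[A, B]⟩
  | .imp A B => ((MonoidalClosed.internalHom.mapIso (isoM A).symm.op).app (oM B) ≪≫
      (ihom (⟨[A]⟩ : KCat R)).mapIso (isoM B) : (ihom (oM A)).obj (oM B) ≅ _)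
  | .grd r X => (MnyF R).mapIso ((scaleF r).mapIso (isoG X) ≪≫
      eqToIso (show (scaleF r).obj (CCat.of [(1, X)]) = CCat.of [(r, X)] by simp [scaleF, scale]))
end

noncomputable def hG (p : R × GTy R) : CCat R := (scaleF p.1).obj (oG p.2)

noncomputable abbrev hM (p : R × GTy R) : KCat R := (MnyF R).obj (hG p)

noncomputable def iG {Δ : GCtx R} {X : GTy R} (a : GS Δ X) : tens hG Δ ⟶ oG X := (synM R).interpG a

noncomputable def iM {Δ : GCtx R} {Γ : LCtx R} {A : LTy R} (a : MS Δ Γ A) :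
    tens hM Δ ⊗ tens oM Γ ⟶ oM A := (synM R).interpM a

noncomputable def isoH (p : R × GTy R) : hG p ≅ CCat.of [p] :=
  (scaleF p.1).mapIso (isoG p.2) ≪≫
    eqToIso (show (scaleF p.1).obj (CCat.of [(1, p.2)]) = CCat.of [p] by simp [scaleF, scale])

noncomputable def lG {P Q : GCtx R} (l : GLeft P Q) : tens hG Q ⟶ tens hG P := (synM R).leftG l

noncomputable def lM {P Q : GCtx R} (l : GLeft P Q) : tens hM Q ⟶ tens hM P := (synM R).leftM l

end

variable {R : Type u} [Semiring R] [Preorder R] [AddLeftMono R] [MulLeftMono R] [MulRightMono R]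

noncomputable abbrev thG (Δ : GCtx R) : tens hG Δ ⟶ CCat.of Δ := (tensIso isoH Δ).hom

lemma isoH_neq (p : R × GTy R) : NEq (isoH p).hom ((scaleF p.1).map (isoG p.2).hom) :=
  NEq.comp_nil ..

lemma thG_one (p : R × GTy R) : NEq (thG [p]) (isoH p).hom :=
  (NEq.of_eq (tensorHom_id ..)).trans (NEq.right_unit _)

lemma thG_two (p q : R × GTy R) : NEq (thG [p, q]) ((isoH p).hom ⊗ₘ (isoH q).hom) :=
  .tensor (.refl _) (thG_one q)

lemma cutHom_grade (h : r = s) {E : CCat R} (a : GS E.list X) :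
    NEq (cutHom r a) (cutHom s a) := by subst h; exact .refl _

lemma scaleF_unitIso (r : R) : NEq ((scaleF r).map (unitIso (R := R) 1).inv) (unitIso r).inv :=
  (scaleF_cutHom r 1 _).trans (cutHom_grade (mul_one r) _)

lemma pairHom_neq (r : R) (X Y) :
    NEq (pairHom r X Y) (cutHom (E := CCat.of [(1, X), (1, Y)]) r (.tenR (.id X) (.id Y))) := by
  have : ∀ (Z) (h : Z.list = scale r [(1, X), (1, Y)]),
      NEq (hom Z (CCat.of [(r, .tensor X Y)]) (.single (.cut r (.tenR (.id X) (.id Y)) h)))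
        (cutHom (E := CCat.of [(1, X), (1, Y)]) r (.tenR (.id X) (.id Y))) := by
    rintro ⟨l⟩ h
    obtain rfl : l = scale r [(1, X), (1, Y)] := h
    exact .refl _
  exact this ..

lemma scaleF_pairIso (r : R) (X Y : GTy R) : NEq ((scaleF r).map (pairIso 1 X Y).inv) (pairIso r X Y).inv :=
  (NEq.map_scaleF r (pairHom_neq 1 X Y)).trans ((scaleF_cutHom r 1 _).trans
    ((cutHom_grade (mul_one r) _).trans (pairHom_neq r X Y).symm))

lemma cont1_neq (h1 : r1 = s1) (h2 : r2 = s2) (h : r = r1 + r2)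
    (h' : s = s1 + s2) (X : GTy R) : NEq (cont1 r1 r2 r h X) (cont1 s1 s2 s h' X) := by
  subst h1; subst h2; subst h; subst h'; exact .refl _

lemma of_scale_one (r : R) (X) : (scaleF r).obj (CCat.of [(1, X)]) = CCat.of [(r, X)] := by
  simp [scaleF, scale]

lemma lG_unit (r : R) : Nil (lG (.unit r)) :=
  inferInstanceAs (Nil ((ρ_ (hG (r, .unit))).hom ≫ eqToHom (show hG (r, .unit) = 𝟙_ (CCat R) from (scale_unit r).symm) :
    hG (r, .unit) ⊗ 𝟙_ (CCat R) ⟶ 𝟙_ (CCat R)))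

lemma lG_tensor (r : R) (X Y) : Nil (lG (.tensor r X Y)) :=
  inferInstanceAs (Nil (eqToHom (show hG (r, .tensor X Y) = hG (r, X) ⊗ hG (r, Y) from (scale_tensor r (oG X) (oG Y)).symm) ▷ 𝟙_ (CCat R) ≫
    (α_ (hG (r, X)) (hG (r, Y)) (𝟙_ _)).hom :
      hG (r, .tensor X Y) ⊗ 𝟙_ (CCat R) ⟶ hG (r, X) ⊗ hG (r, Y) ⊗ 𝟙_ (CCat R)))

lemma lG_weak (r : R) (X) (h : r = 0) : NEq (lG (.weak r X h)) (weakAt r h (oG X)) :=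
  show NEq ((ρ_ (hG (r, X))).hom ≫ gcast (actF R) h (oG X) ≫ weakAt 0 rfl (oG X) :
    hG (r, X) ⊗ 𝟙_ (CCat R) ⟶ 𝟙_ (CCat R)) _ from
  .trans (.nil_comp ..) (.trans (.gcast_comp ..) (weakAt_neq rfl h (by rw [h])))

lemma lG_cont (r1 r2 r : R) (X) (h : r = r1 + r2) : NEq (lG (.cont r1 r2 r X h)) (contrAt r1 r2 r h (oG X)) :=
  show NEq ((gcast (actF R) h (oG X) ≫ contrAt r1 r2 (r1 + r2) rfl (oG X) : hG (r, X) ⟶ hG (r1, X) ⊗ hG (r2, X)) ▷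
    𝟙_ (CCat R) ≫ (α_ (hG (r1, X)) (hG (r2, X)) (𝟙_ _)).hom :
        hG (r, X) ⊗ 𝟙_ (CCat R) ⟶ hG (r1, X) ⊗ hG (r2, X) ⊗ 𝟙_ (CCat R)) _ from
  .trans (.comp_nil ..) (.trans (.right_unit _) (.trans (.gcast_comp ..) (contrAt_neq _ _ rfl rfl (by rw [h]))))

lemma lG_ex (a b : R × GTy R) : NEq (lG (.ex a b)) (β_ (hG b) (hG a)).hom :=
  show NEq ((α_ (hG b) (hG a) (𝟙_ _)).inv ≫ (β_ (hG b) (hG a)).hom ▷ 𝟙_ (CCat R) ≫ (α_ (hG a) (hG b) (𝟙_ _)).hom :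
      hG b ⊗ hG a ⊗ 𝟙_ (CCat R) ⟶ hG a ⊗ hG b ⊗ 𝟙_ (CCat R)) _ from
  .trans (.nil_comp ..) (.trans (.comp_nil ..) (.right_unit _))

instance : Nil (thG (R := R) []) := inferInstanceAs (Nil (𝟙 (𝟙_ (CCat R))))

lemma ex_neq (a b : R × GTy R) : NEq (hom (CCat.of [b, a]) (CCat.of [a, b]) (.single (.left (.ex a b))))
    (β_ (CCat.of [b]) (CCat.of [a])).hom := by
  rw [braiding_one]
  exact .of_act rfl rfl fun D1 D2 c c' e => Act.act_congr _ rfl rfl e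

lemma lG_thG : ∀ {P Q : GCtx R} (l : GLeft P Q),
    lG l ≫ thG P = thG Q ≫ hom (CCat.of Q) (CCat.of P) (.single (.left l))
  | _, _, .unit r => by
    have := lG_unit r
    refine NEq.eq (NEq.trans (.nil_comp ..) (.trans (.nils (X := tens hG []) (Y := CCat.of []) (X' := 𝟙_ (CCat R)) (Y' := 𝟙_ (CCat R)) rfl (thG []) (𝟙 _)) (.symm ?_)))
    refine (NEq.comp ((thG_one _).trans ((isoH_neq _).trans (scaleF_unitIso r))) (.refl (unitIso r).hom)).trans ?_
    exact .of_eq (unitIso r).inv_hom_id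
  | _, _, .tensor r X Y => by
    have := lG_tensor r X Y
    refine NEq.eq (NEq.trans (.nil_comp ..) (.symm ?_))
    have e : NEq ((scaleF r).map (isoG (.tensor X Y)).hom)
        (((isoH (r, X)).hom ⊗ₘ (isoH (r, Y)).hom) ≫ (pairIso r X Y).inv) :=
      (NEq.of_eq ((scaleF r).map_comp ((isoG X).hom ⊗ₘ (isoG Y).hom) (pairIso 1 X Y).inv)).trans
        (.comp ((NEq.map_tensor r ..).trans (.tensor (isoH_neq (r, X)).symm (isoH_neq (r, Y)).symm))
          (scaleF_pairIso r X Y))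
    refine (NEq.comp ((thG_one _).trans ((isoH_neq _).trans e)) (.refl (pairIso r X Y).hom)).trans ?_
    refine (NEq.of_eq ((Category.assoc ..).trans ?_)).trans (thG_two ..).symm
    rw [(pairIso r X Y).inv_hom_id]; exact Category.comp_id _
  | _, _, .weak r X h => by
    refine NEq.eq (NEq.trans (.comp_nil ..) ((lG_weak r X h).trans (.symm ?_)))
    refine (NEq.comp ((thG_one _).trans (isoH_neq _)) (((weakAt_one r h 1 X).trans (weak1_neq _ h X)).symm)).trans ?_
    exact .of_eq (weakAt_natural r h (isoG X).hom)
  | _, _, .cont r1 r2 r X h => by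
    refine NEq.eq (NEq.trans (.comp (lG_cont r1 r2 r X h) (thG_two ..)) (.symm ?_))
    refine (NEq.comp ((thG_one _).trans (isoH_neq _)) (((contrAt_one r1 r2 r h 1 X).trans
      (cont1_neq (mul_one _) (mul_one _) _ h X)).symm)).trans ?_
    exact (contrNat (isoG X).hom r1 r2 r h).trans (.comp (.refl _)
      (.tensor (isoH_neq (r1, X)).symm (isoH_neq (r2, X)).symm))
  | _, _, .ex a b => by
    refine NEq.eq (NEq.trans (.comp (lG_ex a b) (thG_two a b)) (.symm ?_))
    refine (NEq.comp (thG_two b a) (ex_neq a b)).trans ?_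
    exact .of_eq (BraidedCategory.braiding_naturality ..)

noncomputable def sG {Δ Δ' : GCtx R} (h : CtxLe Δ Δ') : tens hG Δ' ⟶ tens hG Δ := (synM R).subG Δ Δ' h

lemma sG_cons (r s : R) (X) (h : CtxLe ((r, X) :: Δ) ((s, X) :: Δ')) :
    sG h = (gle (actF R) h.1 (oG X) ≫ 𝟙 _) ⊗ₘ sG h.2.2 := rfl

lemma sG_thG : ∀ {Δ Δ' : GCtx R} (h : CtxLe Δ Δ'),
    sG h ≫ thG Δ = thG Δ' ≫ subHom (X := CCat.of Δ') (Y := CCat.of Δ) h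
  | [], [], h => by
    refine NEq.eq (NEq.trans (.comp_nil (𝟙 _) _) (.symm (.trans (.nil_comp ..) (.of_eq (subHom_eq h rfl)))))
  | (r, X) :: Δ, (s, Y) :: Δ', h => by
    obtain rfl : X = Y := h.2.1
    rw [sG_cons, Category.comp_id]
    have e : gle (actF R) h.1 (oG X) ≫ (isoH (r, X)).hom = (isoH (s, X)).hom ≫
        subHom (X := CCat.of [(s, X)]) (Y := CCat.of [(r, X)]) ⟨h.1, rfl, trivial⟩ := by
      refine NEq.eq ((NEq.comp (.refl _) (isoH_neq (r, X))).trans (.symm ?_))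
      refine (NEq.comp (isoH_neq (s, X)) (subHom_neq (of_scale_one s X).symm (of_scale_one r X).symm _
        (CtxLe.scale_grade h.1 _))).trans ?_
      exact .of_eq (((actF R).map (homOfLE h.1).op).naturality (isoG X).hom)
    refine (tensorHom_comp_tensorHom ..).trans ?_
    refine (congrArg₂ (· ⊗ₘ ·) e (sG_thG h.2.2)).trans ?_
    refine (tensorHom_comp_tensorHom ..).symm.trans (congrArg (_ ≫ ·) ?_)
    exact subHom_tensor ..
  | [], _ :: _, h => h.elim
  | _ :: _, [], h => h.elim

def AgreeG {Δ : GCtx R} {X : GTy R} (a : GS Δ X) : Prop :=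
  iG a ≫ (isoG X).hom = thG Δ ≫ cut1 (CCat.of Δ) a

/-! ### Promotion -/

noncomputable def scM (r : R) (Δ : GCtx R) : tens hG (scale r Δ) ⟶ (scaleF r).obj (tens hG Δ) :=
  (synM R).scaleMap r Δ

lemma hG_mul (r s : R) (X) : hG (r * s, X) = (scaleF r).obj (hG (s, X)) :=
  congrArg Act.Ob.mk (scale_scale ..).symm

instance scM_nil (r : R) : ∀ Δ : GCtx R, Nil (scM r Δ)
  | [] => inferInstanceAs (Nil (eqToHom (scale_unit r).symm))
  | p :: Δ => by
    have := scM_nil r Δ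
    exact inferInstanceAs (Nil ((eqToHom (hG_mul r p.1 p.2) ⊗ₘ scM r Δ) ≫
      eqToHom (scale_tensor r (hG p) (tens hG Δ))))

lemma isoH_mul (r s : R) (X) : NEq (isoH (r * s, X)).hom ((scaleF r).map (isoH (s, X)).hom) :=
  (isoH_neq _).trans ((NEq.map_map r s (isoG X).hom).trans (NEq.map_scaleF r (isoH_neq (s, X)).symm))

lemma thG_scale (r : R) : ∀ Δ : GCtx R, NEq (thG (scale r Δ)) ((scaleF r).map (thG Δ))
  | [] => (NEq.id (scale_unit r)).trans (.of_eq ((scaleF r).map_id (𝟙_ (CCat R))).symm)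
  | p :: Δ => (NEq.tensor (isoH_mul r p.1 p.2) (thG_scale r Δ)).trans (NEq.map_tensor r (isoH p).hom (thG Δ)).symm

lemma scaleF_cut1 (r : R) (a : GS E.list X) : NEq ((scaleF r).map (cut1 E a)) (cutHom r a) :=
  (NEq.map_scaleF r (cut1_neq E a)).trans ((scaleF_cutHom r 1 a).trans (cutHom_grade (mul_one r) a))

lemma AgreeG.scaled (r : R) {a : GS E X} (h : AgreeG a) : (scaleF r).map (iG a) ≫ (scaleF r).map (isoG X).hom =
      (scaleF r).map (thG E) ≫ (scaleF r).map (cut1 (CCat.of E) a) := by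
  rw [← Functor.map_comp, h, Functor.map_comp]

noncomputable def prG (r : R) {E : GCtx R} {X : GTy R} (a : GS E X) :
    tens hG (scale r E) ⟶ tens hG [(r, X)] := (synM R).promoteG r (iG a)

lemma prG_neq (r : R) (a : GS E X) : NEq (prG r a) ((scaleF r).map (iG a)) :=
  show NEq (scM r E ≫ (scaleF r).map (iG a) ≫ (ρ_ (hG (r, X))).inv :
    tens hG (scale r E) ⟶ hG (r, X) ⊗ 𝟙_ (CCat R)) _ from
  .trans (.nil_comp ..) (.comp_nil (Y := hG (r, X)) _ (ρ_ (hG (r, X))).inv)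

lemma prG_thG (r : R) (a : GS E X) (h : AgreeG a) : prG r a ≫ thG [(r, X)] =
      thG (scale r E) ≫ hom (CCat.of (scale r E)) (CCat.of [(r, X)]) (.single (.cut r a rfl)) := by
  refine NEq.eq ((NEq.comp (prG_neq r a) ((thG_one _).trans (isoH_neq _))).trans ?_)
  refine (NEq.of_eq (h.scaled r)).trans (NEq.comp (thG_scale r E).symm ?_)
  exact scaleF_cut1 r (E := CCat.of E) a

/-! ### The rules of the graded system -/

lemma hG_one (X : GTy R) : hG (1, X) = oG X :=
  congrArg (fun F : CCat R ⥤ CCat R => F.obj (oG X)) scaleF_one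

lemma AgreeG.id (X : GTy R) : AgreeG (.id X) := by
  have e : NEq (iG (.id X)) (𝟙 (oG X)) :=
    show NEq ((ρ_ (hG (1, X))).hom ≫ eqToHom (hG_one X) : hG (1, X) ⊗ 𝟙_ (CCat R) ⟶ oG X) _ from
      .trans (.nil_comp (ρ_ (hG (1, X))).hom (eqToHom (hG_one X))) (.trans (.nil (eqToHom (hG_one X))) (.id (hG_one X)))
  have h : ∀ {F : CCat R ⥤ CCat R} (_ : F = 𝟭 _), NEq (F.map (isoG X).hom) (isoG X).hom := by
    rintro _ rfl; exact .refl _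
  refine NEq.eq ((NEq.comp e (.refl _)).trans ((NEq.of_eq (Category.id_comp (isoG X).hom)).trans (.symm ?_)))
  refine (NEq.comp (.refl _) (.of_eq (cut1_id X))).trans ((NEq.of_eq (Category.comp_id (thG [(1, X)]))).trans ?_)
  exact (thG_one _).trans ((isoH_neq _).trans (h scaleF_one))

lemma cut1_tenR {Δ₁ Δ₂ : GCtx R} (a : GS Δ₁ X) (b : GS Δ₂ Y) :
    (cut1 (CCat.of Δ₁) a ⊗ₘ cut1 (CCat.of Δ₂) b) ≫ pairHom 1 X Y = cut1 (CCat.of Δ₁ ⊗ CCat.of Δ₂) (.tenR a b) := by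
  have e : pairHom 1 X Y = cut1 (CCat.of [(1, X)] ⊗ CCat.of [(1, Y)]) (GS.tenR (Δ₁ := [(1, X)]) (Δ₂ := [(1, Y)]) (.id X) (.id Y)) := by
    exact ((pairHom_neq 1 X Y).trans (cut1_neq (CCat.of [(1, X), (1, Y)]) _).symm).eq
  rw [e, MonoidalCategory.tensorHom_def, Category.assoc]
  have e1 : CCat.of [(1, X)] ◁ cut1 (CCat.of Δ₂) b ≫
      cut1 (CCat.of [(1, X)] ⊗ CCat.of [(1, Y)]) (.tenR (.id X) (.id Y)) =
        cut1 (CCat.of [(1, X)] ⊗ CCat.of Δ₂) (GS.tenR (Δ₁ := [(1, X)]) (Δ₂ := Δ₂) (.id X) b) := by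
    refine hom_cut1 _ _ _ ?_
    refine .symm (.trans (Act.act_inside' (A := actG R) (D1 := []) (D2 := []) (E1 := [(1, X)]) (E2 := [])
      (P := [(1, Y)]) (D1' := [(1, X)]) (D2' := []) _ _ _ rfl rfl (c' := GS.tenR (Δ₁ := [(1, X)]) (Δ₂ := [(1, Y)]) (.id X) (.id Y))
      (EqG.cL (.refl _) _)) ?_)
    refine .trans (Act.act_single (A := actG R) ..) (.cL ?_ _)
    refine (EqG.cut rfl (List.append_nil _).symm rfl rfl (.refl _) (EqG.cR (.refl _) ◾)).trans
      ((EqG.cut_tenR_snd 1 [] [] b (.id X) (.id Y)).trans (.tenR rfl ◾ (.refl _) (EqG.cut_id_right b)))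
  have e2 : cut1 (CCat.of Δ₁) a ▷ CCat.of Δ₂ ≫ cut1 (CCat.of [(1, X)] ⊗ CCat.of Δ₂) (GS.tenR (Δ₁ := [(1, X)]) (Δ₂ := Δ₂) (.id X) b) =
      cut1 (CCat.of Δ₁ ⊗ CCat.of Δ₂) (.tenR a b) := by
    refine hom_cut1 _ _ _ ?_
    refine .symm (.trans (Act.act_inside' (A := actG R) (D1 := []) (D2 := []) (E1 := []) (E2 := Δ₂)
      (P := [(1, X)]) (D1' := []) (D2' := Δ₂) _ _ _ rfl ◾ (c' := GS.tenR (Δ₁ := [(1, X)]) (Δ₂ := Δ₂) (.id X) b)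
      (EqG.cL (.refl _) _)) ?_)
    refine .trans (Act.act_single (A := actG R) ..) (.cL ?_ _)
    exact (EqG.cut rfl rfl rfl rfl (.refl _) (EqG.cR (.refl _) ◾)).trans
      ((EqG.cut_tenR_fst 1 [] [] a (.id X) b).trans (.tenR ◾ rfl (EqG.cut_id_right a) (.refl _)))
  rw [e1]; exact e2

lemma AgreeG.tenR {Δ₁ Δ₂ : GCtx R} {a : GS Δ₁ X} {b : GS Δ₂ Y} (ha : AgreeG a)
    (hb : AgreeG b) : AgreeG (.tenR a b) := by
  have e : NEq (iG (.tenR a b)) (iG a ⊗ₘ iG b) := NEq.nil_comp (tensAppend hG Δ₁ Δ₂).hom (iG a ⊗ₘ iG b)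
  refine NEq.eq ((NEq.comp e (.refl _)).trans (.symm ?_))
  refine (NEq.comp (tensIso_append isoH Δ₁ Δ₂) (NEq.of_eq (cut1_tenR a b).symm)).trans (.of_eq ?_)
  refine (Category.assoc ..).symm.trans ((congrArg (· ≫ _) ?_).trans (Category.assoc ..))
  refine (tensorHom_comp_tensorHom ..).trans (.trans ?_
    (tensorHom_comp_tensorHom (iG a) (iG b) (isoG X).hom (isoG Y).hom).symm)
  rw [← ha, ← hb]

lemma AgreeG.unitR : AgreeG (R := R) .unitR :=
  NEq.eq (NEq.comp (.refl (𝟙 (𝟙_ (CCat R)))) (cut1_neq (CCat.of []) .unitR).symm)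

lemma AgreeG.pre {Δ Δ' : GCtx R} {a : GS Δ X} {a' : GS Δ' X} (ha : AgreeG a)
    {k : tens hG Δ' ⟶ tens hG Δ} {p : Path GStep Δ Δ'} (h : k ≫ thG Δ = thG Δ' ≫ hom (CCat.of Δ') (CCat.of Δ) p)
    (e : EqG a' ((a.cast ◾).act [] [] p)) (ha' : iG a' = k ≫ iG a) : AgreeG a' := by
  unfold AgreeG
  rw [ha', Category.assoc, ha, ← Category.assoc, h, Category.assoc]
  exact congrArg _ (hom_cut1 (X := CCat.of Δ') (Y := CCat.of Δ) p a a' e)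

lemma act_inside_step (l : GStep P Q) (D1 D2 : GCtx R) (a : GS (D1 ++ P ++ D2) X) : EqG (l.runG D1 D2 a)
      (GS.act [] [] ((Path.single l).inside D1 D2 rfl rfl) (GS.cast a ◾)) :=
  EqG.symm (.trans (Act.act_inside' (A := actG R) (D1 := []) (D2 := []) (E1 := D1)
    (E2 := D2) (P := P) (D1' := D1) (D2' := D2) _ _ _ rfl (List.append_nil _) (c' := a)
    (EqG.cL (.refl _) _)) (Act.act_single (A := actG R) ..))

lemma AgreeG.left (l : GLeft P Q) (D1 D2 : GCtx R)
    {a : GS (D1 ++ P ++ D2) X} (ha : AgreeG a) : AgreeG (.left l D1 D2 a) :=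
  ha.pre (tensMid_tensIso isoH D1 D2 (lG_thG l)) (act_inside_step (.left l) D1 D2 a) rfl

lemma AgreeG.cut (r : R) (D1 D2) {a : GS E X}
    {c : GS (D1 ++ [(r, X)] ++ D2) Y} (ha : AgreeG a) (hc : AgreeG c) : AgreeG (.cut r D1 D2 a c) :=
  hc.pre (tensMid_tensIso isoH D1 D2 (prG_thG r a ha)) (act_inside_step (.cut r a rfl) D1 D2 c) rfl

lemma AgreeG.sub {Δ Δ' : GCtx R} (h : CtxLe Δ Δ') {a : GS Δ X} (ha : AgreeG a) : AgreeG (.sub h a) :=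
  ha.pre (sG_thG h) (.symm ((Act.act_single (A := actG R) ..).trans
    (.sub _ _ ◾ ◾ (.cL (.refl _) _)))) rfl

noncomputable def mM (Δ : GCtx R) : tens hM Δ ⟶ (MnyF R).obj (tens hG Δ) := (synM R).mMny Δ

instance mM_nil : ∀ Δ : GCtx R, Nil (mM Δ)
  | [] => inferInstanceAs (Nil (Functor.LaxMonoidal.ε (MnyF R)))
  | p :: Δ => by
    have := mM_nil Δ
    exact inferInstanceAs (Nil (hM p ◁ mM Δ ≫ Functor.LaxMonoidal.μ (MnyF R) (hG p) (tens hG Δ) :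
      hM p ⊗ tens hM Δ ⟶ (MnyF R).obj (hG p ⊗ tens hG Δ)))

lemma tens_hM : ∀ Δ : GCtx R, tens hM Δ = (MnyF R).obj (tens hG Δ)
  | [] => MnyF_unit
  | p :: Δ => (congrArg (hM p ⊗ ·) (tens_hM Δ)).trans (MnyF_tensor (hG p) (tens hG Δ))

lemma MnyF_tensorHom (f : X ⟶ Y) (g : X' ⟶ Y') :
    NEq ((MnyF R).map (f ⊗ₘ g)) ((MnyF R).map f ⊗ₘ (MnyF R).map g) := by
  rw [MonoidalCategory.tensorHom_def, MonoidalCategory.tensorHom_def, CategoryTheory.Functor.map_comp]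
  exact .comp (MnyF_right f X') (MnyF_left g Y)

lemma tensMid_mny (D1 D2) {k : tens hM Q ⟶ tens hM P} {k' : tens hG Q ⟶ tens hG P} (h : NEq k ((MnyF R).map k')) :
    NEq (tensMid hM D1 D2 k) ((MnyF R).map (tensMid hG D1 D2 k')) :=
  (tensMid_neq (S := actK_exch) D1 D2 k).trans (.trans (.right (.left (tens_hM D1) h) (tens_hM D2))
    (((NEq.mny (tensMid_neq (S := actC_exch) D1 D2 k')).trans ((MnyF_right ..).trans
      (.right (MnyF_left ..) rfl))).symm))

lemma nUnit_nil : Nil ((MnyF R).map (Functor.LaxMonoidal.ε (LinF R)) ≫ (mnyLin R).counit.app (𝟙_ (KCat R))) := by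
  rw [Adjunction.map_ε_comp_counit_app_unit]; infer_instance

lemma nTensor_nil (X Y) : Nil ((MnyF R).map ((mnyLin R).unit.app X ⊗ₘ (mnyLin R).unit.app Y) ≫
    (MnyF R).map (Functor.LaxMonoidal.μ (LinF R) ((MnyF R).obj X) ((MnyF R).obj Y)) ≫
      (mnyLin R).counit.app ((MnyF R).obj X ⊗ (MnyF R).obj Y)) := by
  rw [map_μ_counit]; infer_instance

noncomputable def nU : (MnyF R).obj (𝟙_ (CCat R)) ⟶ 𝟙_ (KCat R) := (synM R).nUnit

instance : Nil (nU (R := R)) := nUnit_nil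

noncomputable def nT (X Y : CCat R) : (MnyF R).obj (X ⊗ Y) ⟶ (MnyF R).obj X ⊗ (MnyF R).obj Y :=
  (synM R).nTensor X Y

instance (X Y : CCat R) : Nil (nT X Y) := nTensor_nil X Y

lemma lM_one {k : hG p ⟶ 𝟙_ (CCat R)} :
    NEq ((ρ_ (hM p)).hom ≫ (MnyF R).map k ≫ nU : hM p ⊗ 𝟙_ (KCat R) ⟶ 𝟙_ (KCat R)) ((MnyF R).map k) :=
  .trans (.nil_comp ..) (.comp_nil ..)

lemma lM_two {k : hG p ⟶ hG q ⊗ hG q'} :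
    NEq (((MnyF R).map k ≫ nT (hG q) (hG q') : hM p ⟶ hM q ⊗ hM q') ▷ 𝟙_ (KCat R) ≫
      (α_ (hM q) (hM q') (𝟙_ (KCat R))).hom : hM p ⊗ 𝟙_ (KCat R) ⟶ hM q ⊗ hM q' ⊗ 𝟙_ (KCat R))
      ((MnyF R).map k) :=
  .trans (.comp_nil ..) (.trans (.right_unit _) (.comp_nil ..))

lemma lM_lG : ∀ {P Q} (l : GLeft P Q), NEq (lM l) ((MnyF R).map (lG l))
  | _, _, .unit r => lM_one.trans (.mny (f := eqToHom (show hG (r, .unit) = 𝟙_ (CCat R) from (scale_unit r).symm))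
      (NEq.nil_comp (X := hG (r, .unit) ⊗ 𝟙_ (CCat R)) (ρ_ (hG (r, .unit))).hom _).symm)
  | _, _, .tensor r X Y => lM_two.trans (.mny
      (f := eqToHom (show hG (r, .tensor X Y) = hG (r, X) ⊗ hG (r, Y) from (scale_tensor r (oG X) (oG Y)).symm))
      (NEq.symm ((NEq.comp_nil (X := hG (r, .tensor X Y) ⊗ 𝟙_ (CCat R)) _
        (α_ (hG (r, X)) (hG (r, Y)) (𝟙_ _)).hom).trans (.right_unit _))))
  | _, _, .weak r X h => (lM_one (p := (r, X)) (k := gcast (actF R) h (oG X) ≫ weakAt 0 rfl (oG X))).trans (.mny (f := gcast (actF R) h (oG X) ≫ weakAt 0 rfl (oG X))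
      (NEq.nil_comp (X := hG (r, X) ⊗ 𝟙_ (CCat R)) (ρ_ (hG (r, X))).hom _).symm)
  | _, _, .cont r1 r2 r X h => lM_two.trans (.mny
      (f := (gcast (actF R) h (oG X) ≫ contrAt r1 r2 (r1 + r2) rfl (oG X) : hG (r, X) ⟶ hG (r1, X) ⊗ hG (r2, X)))
      (NEq.symm ((NEq.comp_nil (X := hG (r, X) ⊗ 𝟙_ (CCat R)) _
        (α_ (hG (r1, X)) (hG (r2, X)) (𝟙_ _)).hom).trans (.right_unit _))))
  | _, _, .ex a b => by
    refine .trans ?_ (.trans (MnyF_braiding (hG b) (hG a)).symm (.mny (lG_ex a b).symm))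
    exact show NEq ((α_ (hM b) (hM a) (𝟙_ _)).inv ≫
      (β_ (hM b) (hM a)).hom ▷ 𝟙_ (KCat R) ≫ (α_ (hM a) (hM b) (𝟙_ _)).hom :
        hM b ⊗ hM a ⊗ 𝟙_ (KCat R) ⟶ hM a ⊗ hM b ⊗ 𝟙_ (KCat R)) _ from
      .trans (.nil_comp ..) (.trans (.comp_nil ..) (.right_unit _))

noncomputable def sM {Δ Δ' : GCtx R} (h : CtxLe Δ Δ') : tens hM Δ' ⟶ tens hM Δ := (synM R).subM Δ Δ' h

lemma sM_sG : ∀ {Δ Δ'} (h : CtxLe Δ Δ'), NEq (sM h) ((MnyF R).map (sG h))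
  | [], [], h => (NEq.id MnyF_unit).trans (.of_eq ((MnyF R).map_id (𝟙_ (CCat R))).symm)
  | (r, X) :: Δ, (s, Y) :: Δ', h => by
    obtain rfl : X = Y := h.2.1
    exact (NEq.tensor (.refl ((MnyF R).map (gle (actF R) h.1 (oG X) ≫ 𝟙 _))) (sM_sG h.2.2)).trans
      (MnyF_tensorHom (gle (actF R) h.1 (oG X) ≫ 𝟙 _) (sG h.2.2)).symm
  | [], _ :: _, h => h.elim
  | _ :: _, [], h => h.elim

noncomputable def prM (r : R) {E : GCtx R} {X : GTy R} (a : GS E X) : tens hM (scale r E) ⟶ hM (r, X) :=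
  (synM R).promoteM r (iG a)

lemma prM_prG (r : R) (a : GS E X) : NEq (prM r a) ((MnyF R).map (prG r a)) :=
  show NEq (mM (scale r E) ≫ (MnyF R).map (scM r E) ≫ (MnyF R).map ((scaleF r).map (iG a))) _ from
  .trans (.nil_comp ..) (.trans (.nil_comp ..) (.mny (prG_neq r a).symm))

noncomputable def thM (Δ : GCtx R) : tens hM Δ ⟶ (MnyF R).obj (CCat.of Δ) :=
  mM Δ ≫ (MnyF R).map (thG Δ)

lemma thM_neq (Δ) : NEq (thM Δ) ((MnyF R).map (thG Δ)) := .nil_comp ..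

noncomputable abbrev thL (Γ : LCtx R) : tens oM Γ ⟶ (⟨Γ⟩ : KCat R) := (tensIso isoM Γ).hom

def AgreeM {Δ : GCtx R} {Γ : LCtx R} {A : LTy R} (a : MS Δ Γ A) : Prop :=
  iM a ≫ (isoM A).hom = (thM Δ ⊗ₘ thL Γ) ≫ kc (CCat.of Δ) a

lemma AgreeM.pre {a : MS Δ Γ A} {a' : MS Δ' Γ A} (ha : AgreeM a)
    {k : tens hM Δ' ⟶ tens hM Δ} {k' : tens hG Δ' ⟶ tens hG Δ} (hk : NEq k ((MnyF R).map k'))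
    {p : Path GStep Δ Δ'} (h : k' ≫ thG Δ = thG Δ' ≫ hom (CCat.of Δ') (CCat.of Δ) p)
    (e : EqM a' ((a.cast ◾ rfl).act [] [] p)) (ha' : iM a' = k ▷ _ ≫ iM a) : AgreeM a' := by
  have q : k ≫ thM Δ = thM Δ' ≫ (MnyF R).map (hom (CCat.of Δ') (CCat.of Δ) p) := by
    refine NEq.eq ((NEq.comp hk (thM_neq Δ)).trans (.trans ?_ (NEq.comp (thM_neq Δ') (.refl _)).symm))
    refine .of_eq ?_
    rw [← Functor.map_comp, h, Functor.map_comp]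
  unfold AgreeM
  rw [ha', Category.assoc, ha, ← Category.assoc, whiskerRight_comp_tensorHom, q,
    ← tensorHom_comp_whiskerRight, Category.assoc]
  exact congrArg _ (MnyF_kc (X := CCat.of Δ') (Y := CCat.of Δ) p a a' e)

lemma act_inside_stepM (l : GStep P Q) (D1 D2 : GCtx R) (a : MS (D1 ++ P ++ D2) Γ A) : EqM (l.runM D1 D2 a)
      (MS.act [] [] ((Path.single l).inside D1 D2 rfl rfl) (MS.cast a ◾ rfl)) :=
  EqM.symm (.trans (Act.act_inside' (A := actM R) (b := (Γ, A)) (D1 := []) (D2 := []) (E1 := D1)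
    (E2 := D2) (P := P) (D1' := D1) (D2' := D2) _ _ _ rfl (List.append_nil _) (c' := a)
    (EqM.cL (.refl _) _ rfl)) (Act.act_single (A := actM R) (b := (Γ, A)) ..))

lemma AgreeM.left (l : GLeft P Q) (D1 D2 : GCtx R)
    {a : MS (D1 ++ P ++ D2) Γ A} (ha : AgreeM a) : AgreeM (.left l D1 D2 a) :=
  ha.pre (tensMid_mny D1 D2 (lM_lG l)) (tensMid_tensIso isoH D1 D2 (lG_thG l))
    (act_inside_stepM (.left l) D1 D2 a) rfl

lemma AgreeM.gcut (r : R) (D1 D2) {a : GS E X}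
    {c : MS (D1 ++ [(r, X)] ++ D2) Γ A} (ha : AgreeG a) (hc : AgreeM c) : AgreeM (.gcut r D1 D2 a c) :=
  hc.pre (tensMid_mny D1 D2 (P := [(r, X)]) (k := prM r a ≫ (ρ_ (hM (r, X))).inv)
    ((NEq.comp_nil (Y := hM (r, X)) _ (ρ_ (hM (r, X))).inv).trans (prM_prG r a)))
    (tensMid_tensIso isoH D1 D2 (prG_thG r a ha)) (act_inside_stepM (.cut r a rfl) D1 D2 c) rfl

lemma AgreeM.sub {Δ Δ' : GCtx R} (h : CtxLe Δ Δ') {a : MS Δ Γ A} (ha : AgreeM a) : AgreeM (.sub h a) :=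
  ha.pre (sM_sG h) (sG_thG h) (.symm ((Act.act_single (A := actM R) (b := (Γ, A)) ..).trans
    (.sub _ _ ◾ ◾ rfl (.cL (.refl _) _ rfl)))) rfl

section

variable {C D : Type u} [Category.{u} C] [MonoidalCategory C] [SymmetricCategory C]
  [Category.{u} D] [MonoidalCategory D] [SymmetricCategory D] {F : C ⥤ D} {G : D ⥤ C} (adj : F ⊣ G)
  [F.Braided] [G.LaxMonoidal] [adj.IsMonoidal]

open Functor.LaxMonoidal Functor.OplaxMonoidal

lemma map_tensor_μ_counit {X Y : C} {U V : D} (f : X ⟶ G.obj U) (g : Y ⟶ G.obj V) :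
    F.map ((f ⊗ₘ g) ≫ μ G U V) ≫ adj.counit.app (U ⊗ V) =
      δ F X Y ≫ ((F.map f ≫ adj.counit.app U) ⊗ₘ (F.map g ≫ adj.counit.app V)) := by
  rw [F.map_comp, Category.assoc, adj.map_μ_comp_counit_app_tensor, ← Category.assoc, ← δ_natural, Category.assoc]
  exact congrArg (δ F X Y ≫ ·) (tensorHom_comp_tensorHom ..)

end

noncomputable def eL (Δ : GCtx R) : tens hG Δ ⟶ (LinF R).obj (tens hM Δ) := (synM R).etaLin Δ

lemma eL_counit : ∀ Δ : GCtx R, Nil ((MnyF R).map (eL Δ) ≫ (mnyLin R).counit.app (tens hM Δ))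
  | [] => nUnit_nil
  | p :: Δ => by
    have ih := eL_counit Δ
    have e := map_tensor_μ_counit (mnyLin R) ((mnyLin R).unit.app (hG p)) (eL Δ) |>.trans (congrArg
      (fun f => Functor.OplaxMonoidal.δ (MnyF R) (hG p) (tens hG Δ) ≫ (f ⊗ₘ _))
        ((mnyLin R).left_triangle_components (hG p)))
    have k : Nil (Functor.OplaxMonoidal.δ (MnyF R) (hG p) (tens hG Δ) ≫
      (𝟙 (hM p) ⊗ₘ ((MnyF R).map (eL Δ) ≫ (mnyLin R).counit.app (tens hM Δ)))) := inferInstance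
    exact (congrArg (fun f => Nil f) e).mpr k

lemma MnyF_cut1_linE (X) (b : GS X.list (.lin A)) (m : MS X.list [] A) (e : EqM m (MS.gcut 1 [] [] b (MS.linE A))) :
    (MnyF R).map (cut1 X b) ≫ linE ⟨[A]⟩ = (ρ_ _).inv ≫ kc X m := by
  have l : linE (⟨[A]⟩) = (ρ_ _).inv ≫ kc (CCat.of [(1, .lin A)]) (MS.linE A) :=
    congrArg ((ρ_ _).inv ≫ ·) (Category.comp_id _)
  refine (congrArg ((MnyF R).map (cut1 X b) ≫ ·) l).trans ((Category.assoc ..).symm.trans ?_)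
  refine (congrArg (· ≫ _) (rightUnitor_inv_naturality ((MnyF R).map (cut1 X b)))).trans ?_
  exact (Category.assoc ..).trans (congrArg _ (MnyF_cut1 X b m e))

lemma MnyF_linE (f : X ⟶ (LinF R).obj U) (g : U ⟶ V) :
    (MnyF R).map (f ≫ (LinF R).map g) ≫ linE V = ((MnyF R).map f ≫ (mnyLin R).counit.app U) ≫ g := by
  rw [← mnyLin_counit, Functor.map_comp, Category.assoc, Category.assoc]
  exact congrArg _ ((mnyLin R).counit_naturality _)

lemma AgreeG.linR {Δ : GCtx R} {a : MS Δ [] A} (ha : AgreeM a) : AgreeG (.linR a) := by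
  refine (linE_bijective (tens hG Δ) (⟨[A]⟩)).injective ?_
  let u : tens hM Δ ⟶ oM A := (ρ_ (tens hM Δ)).inv ≫ iM a
  have q : iG (.linR a) ≫ (isoG (.lin A)).hom = eL Δ ≫ (LinF R).map (u ≫ (isoM A).hom) :=
    (Category.assoc (eL Δ) ((LinF R).map u) ((LinF R).map (isoM A).hom)).trans
      (congrArg (eL Δ ≫ ·) ((LinF R).map_comp ..).symm)
  have h1 : u ≫ (isoM A).hom = (ρ_ (tens hM Δ)).inv ≫ (thM Δ ⊗ₘ (𝟙 (𝟙_ (KCat R)) :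
      𝟙_ (KCat R) ⟶ (⟨[]⟩))) ≫ kc (CCat.of Δ) a :=
    (Category.assoc ..).trans (congrArg ((ρ_ (tens hM Δ)).inv ≫ ·) ha)
  have h2 : (MnyF R).map (thG Δ ≫ cut1 (CCat.of Δ) (.linR a)) ≫ linE ⟨[A]⟩ =
      (MnyF R).map (thG Δ) ≫ (ρ_ _).inv ≫ kc (CCat.of Δ) a :=
    ((congrArg (· ≫ linE _) ((MnyF R).map_comp ..)).trans (Category.assoc ..)).trans
      (congrArg _ (MnyF_cut1_linE (CCat.of Δ) (.linR a) a (MS.gcut_linE (X := CCat.of Δ) a).symm))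
  refine ((congrArg (fun f => (MnyF R).map f ≫ linE _) q).trans (MnyF_linE (eL Δ) _)).trans (.trans ?_ h2.symm)
  have := eL_counit Δ
  refine NEq.eq (.trans (.nil_comp ..) (.trans (.of_eq h1) (.trans
    (.nil_comp (Y := tens hM Δ ⊗ 𝟙_ (KCat R)) (ρ_ (tens hM Δ)).inv _) ?_)))
  refine .trans ?_ (NEq.of_eq (Category.assoc ..))
  refine NEq.comp ?_ (.refl _)
  refine .trans (.trans ?_ (.right_unit _)) (.symm (.comp_nil ..))
  exact (NEq.of_eq (tensorHom_id ..)).trans (.right (thM_neq Δ) rfl)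

/-! ### Structural rules of the mixed system -/

lemma kcut_id (A : LTy R) : kcut ⟨[A]⟩ (.id A) = 𝟙 (⟨[A]⟩ : KCat R) :=
  (Category.comp_id _).symm.trans (tnIso (R := R) ⟨[A]⟩).hom_inv_id

lemma thM_nil {X Y : KCat R} (f : X ⟶ Y) : NEq (thM [] ⊗ₘ f) f := by
  refine (NEq.tensor (.trans (thM_neq []) (.trans (.of_eq ((MnyF R).map_id (𝟙_ (CCat R))))
    (.id MnyF_unit.symm))) (.refl f)).trans ?_
  exact (NEq.of_eq (id_tensorHom ..)).trans (.unit_left f)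

lemma thL_one (A : LTy R) : NEq (thL [A]) (isoM A).hom :=
  (NEq.of_eq (tensorHom_id ..)).trans (.right_unit _)

lemma thL_two (A B : LTy R) : NEq (thL [A, B]) ((isoM A).hom ⊗ₘ (isoM B).hom) :=
  .tensor (.refl _) (thL_one B)

lemma kc_nil {Γ : LCtx R} (m : MS [] Γ A) : NEq (kc (CCat.of []) m) (kcut ⟨Γ⟩ m) :=
  kcut_neq rfl (.cast_left m _ rfl)

lemma AgreeM.id (A : LTy R) : AgreeM (.id A) := by
  have e : NEq (iM (.id A)) (𝟙 (oM A)) :=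
    show NEq ((λ_ (oM A ⊗ 𝟙_ (KCat R))).hom ≫ (ρ_ (oM A)).hom : 𝟙_ (KCat R) ⊗ (oM A ⊗ 𝟙_ (KCat R)) ⟶ oM A) _ from
      .trans (.nil_comp ..) (.trans (.nil _) (.id (congrArg Act.Ob.mk (List.append_nil _))))
  refine NEq.eq ((NEq.comp e (.refl (isoM A).hom)).trans ((NEq.of_eq (Category.id_comp (isoM A).hom)).trans (.symm ?_)))
  refine (NEq.comp ((thM_nil _).trans (thL_one A)) ((kc_nil _).trans (.of_eq (kcut_id A)))).trans ?_
  exact .of_eq (Category.comp_id _)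

lemma AgreeM.unitR : AgreeM (R := R) .unitR := by
  refine NEq.eq (NEq.trans (.nil_comp (λ_ (𝟙_ (KCat R))).hom _) (.symm ?_))
  refine (NEq.comp (thM_nil _) (kc_nil _)).trans ?_
  exact .of_eq (Category.id_comp (kcut (𝟙_ (KCat R)) .unitR))

lemma kc_actL (X) (p : Path LStep Γ Γ') (m : MS X.list Γ A)
    (m' : MS X.list Γ' A) (e : EqM m' ((m.cast rfl ◾).actL [] [] p)) :
    (MnyF R).obj X ◁ hom (⟨Γ'⟩) ⟨Γ⟩ p ≫ kc X m = kc X m' := by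
  refine hom_kcut _ _ _ ?_
  refine .trans ?_ (Act.act_inside' (A := actK R) (b := ([], A)) (D1 := []) (E1 := Grd X.list) (E2 := []) (D2 := [])
    (P := Γ) (D1' := Grd X.list) (D2' := []) p _ _ rfl rfl
    (c' := (MS.enc X.list (D := []) m).cast rfl ◾) (EqM.cL (.cR (.refl _) rfl _) rfl _)).symm
  refine (EqM.enc X.list rfl ◾ e).trans ((MS.enc_actL X.list p (D := []) (G1 := []) (G2 := [])
    (m.cast rfl ◾) ((MS.enc X.list (D := []) m).cast rfl ◾)
    (.cL (EqM.enc X.list rfl ◾ (.cR (.refl _) rfl _)) rfl _)).trans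
    (MS.actL_congr p rfl ◾ rfl (.cL (.cR (.refl _) rfl _) rfl _)))

noncomputable def lL {P Q : LCtx R} (l : LLeft P Q) : tens oM Q ⟶ tens oM P := (synM R).leftL l

lemma ex_neqL (A B : LTy R) : NEq (hom (⟨[B, A]⟩ : KCat R) ⟨[A, B]⟩ (.single (.left (.ex A B))))
    (β_ (⟨[B]⟩) ⟨[A]⟩).hom := by
  rw [braiding_single (S := actK_exch)]
  exact .of_act rfl rfl fun {b} D1 D2 c c' e => Act.act_congr (b := b) _ rfl rfl e

lemma lL_thL : ∀ {P Q} (l : LLeft P Q), lL l ≫ thL P = thL Q ≫ hom (⟨Q⟩ : KCat R) ⟨P⟩ (.single (.left l))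
  | _, _, .unit => by
    refine NEq.eq (NEq.trans (.nil_comp (ρ_ (𝟙_ (KCat R))).hom (𝟙 _)) (.symm ?_))
    exact (NEq.comp (thL_one _) (.refl (tnIso (𝟙_ (KCat R))).inv)).trans (.of_eq (tnIso _).hom_inv_id)
  | _, _, .tensor A B => by
    refine NEq.eq (NEq.trans (.nil_comp (α_ (oM A) (oM B) (𝟙_ (KCat R))).hom (thL [A, B])) (.trans (thL_two A B)
      (.symm ?_)))
    have e : hom (⟨[.tensor A B]⟩) ⟨[A, B]⟩ (.single (.left (.tensor A B))) = (tnIso ⟨[A, B]⟩).inv :=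
      hom_sound (S := actK_exch) ⟨fun {b} D1 D2 c => .symm (Act.act_trans' (b := b) _ _
        (Act.act_congr (b := b) _ rfl rfl (Act.act_nil' (b := b) _ (.refl c))))⟩
    rw [e]
    refine (NEq.comp (thL_one _) (.refl (tnIso (⟨[A, B]⟩)).inv)).trans (.of_eq ?_)
    refine (Category.assoc ((isoM A).hom ⊗ₘ (isoM B).hom) (tnIso (⟨[A, B]⟩)).hom _).trans ?_
    rw [Iso.hom_inv_id]; exact Category.comp_id _
  | _, _, .ex A B => by
    have e : NEq (lL (.ex A B)) (β_ (oM B) (oM A)).hom :=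
      show NEq ((α_ (oM B) (oM A) (𝟙_ _)).inv ≫ (β_ (oM B) (oM A)).hom ▷ 𝟙_ (KCat R) ≫ (α_ (oM A) (oM B) (𝟙_ _)).hom :
          oM B ⊗ oM A ⊗ 𝟙_ (KCat R) ⟶ oM A ⊗ oM B ⊗ 𝟙_ (KCat R)) _ from
      .trans (.nil_comp ..) (.trans (.comp_nil ..) (.right_unit _))
    refine NEq.eq (NEq.trans (.comp e (thL_two A B)) (.symm ?_))
    refine (NEq.comp (thL_two B A) (ex_neqL A B)).trans ?_
    exact .of_eq (BraidedCategory.braiding_naturality ..)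

lemma AgreeM.lleft (l : LLeft P Q) (Γ₁ Γ₂ : LCtx R)
    {a : MS Δ (Γ₁ ++ P ++ Γ₂) A} (ha : AgreeM a) : AgreeM (.lleft l Γ₁ Γ₂ a) := by
  have q := tensMid_tensIso (S := actK_exch) isoM Γ₁ Γ₂ (lL_thL l)
  have e : iM (.lleft l Γ₁ Γ₂ a) = tens hM Δ ◁ tensMid oM Γ₁ Γ₂ (lL l) ≫ iM a := rfl
  unfold AgreeM
  rw [e, Category.assoc, ha, ← Category.assoc, whiskerLeft_comp_tensorHom, q,
    ← tensorHom_comp_whiskerLeft, Category.assoc]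
  refine congrArg _ (kc_actL (CCat.of Δ) _ a _ (.symm (.trans (Act.act_inside' (A := actK R) (b := (Δ, A))
    (D1 := []) (D2 := []) (E1 := Γ₁) (E2 := Γ₂) (P := P) (D1' := Γ₁) (D2' := Γ₂) _ _ _ rfl (List.append_nil _)
    (c' := a) (EqM.cL (.refl _) rfl _)) (Act.act_single (A := actK R) (b := (Δ, A)) ..))))

lemma thM_append (Δ Δ' : GCtx R) : NEq (thM (Δ ++ Δ')) (thM Δ ⊗ₘ thM Δ') :=
  (thM_neq _).trans ((NEq.mny (tensIso_append isoH Δ Δ')).trans ((MnyF_tensorHom ..).trans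
    (.tensor (thM_neq Δ).symm (thM_neq Δ').symm)))

lemma thM_one (p) : NEq (thM [p]) ((MnyF R).map (isoH p).hom) :=
  (thM_neq _).trans (NEq.mny (thG_one p))

lemma AgreeM.grdL (r : R) (X : GTy R) {a : MS (Δ ++ [(r, X)]) Γ A} (ha : AgreeM a) : AgreeM (.grdL r X a) := by
  let t : tens hM Δ ⊗ (hM (r, X) ⊗ 𝟙_ (KCat R)) ⟶ tens hM (Δ ++ [(r, X)]) := (tensAppend hM Δ [(r, X)]).inv
  have : Nil t := tensAppend_inv_nil (f := hM) Δ [(r, X)]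
  have e : NEq (iM (.grdL r X a)) (iM a) :=
    show NEq ((α_ (tens hM Δ) (hM (r, X)) (tens oM Γ)).inv ≫
      (tens hM Δ ◁ (ρ_ (hM (r, X))).inv ≫ t) ▷ tens oM Γ ≫ iM a) _ from
    .trans (.nil_comp ..) (.nil_comp ..)
  have k : NEq (kc (CCat.of Δ) (.grdL r X a)) (kc (CCat.of (Δ ++ [(r, X)])) a) :=
    kcut_neq (congrArg Act.Ob.mk (by simp [MnyF, Grd])) (.trans (EqM.enc Δ (D := []) (D' := []) rfl rfl
      (EqM.grdL r X rfl rfl (.cR (.cR (.refl _) _ rfl) _ rfl)))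
        (MS.enc_append Δ [(r, X)] (D := []) (m' := a) (.refl a)).symm)
  refine NEq.eq ((NEq.comp e (.refl _)).trans ((NEq.of_eq ha).trans (.comp ?_ k.symm)))
  refine (NEq.tensor ((thM_append Δ [(r, X)]).trans (.tensor (.refl _) (thM_one _))) (.refl _)).trans ?_
  exact NEq.tensor_assoc (thM Δ) ((MnyF R).map (isoH (r, X)).hom) (thL Γ)

lemma kc_grdI (r : R) (X) : NEq (kc (CCat.of [(r, X)]) (MS.grdI (r, X))) (𝟙 (⟨[.grd r X]⟩)) := by
  rw [← kcut_id]
  exact kcut_neq rfl (.trans (EqM.grdL r X (Δ := []) rfl rfl (.cL (.cL (.cL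
    (.cR (.refl _) _ rfl) _ rfl) _ rfl) _ rfl)) (EqM.eta_grd r X).symm)

lemma EqM.grdR {r : R} {a : GS E X} {a' : GS E' X} (h : E = E')
    (e : EqG a a') : EqM (.grdR r a) (.grdR r a') := by subst h; exact .congr_grdR r e

lemma AgreeM.grdR (r : R) {a : GS E X} (ha : AgreeG a) : AgreeM (.grdR r a) := by
  have e : NEq (iM (.grdR r a)) (prM r a) := NEq.nil_comp (ρ_ (tens hM (scale r E))).hom (prM r a)
  have h : (MnyF R).map (hom (CCat.of (scale r E)) (CCat.of [(r, X)]) (.single (.cut r a rfl))) ▷ (⟨[]⟩) ≫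
      kc (CCat.of [(r, X)]) (MS.grdI (r, X)) = kc (CCat.of (scale r E)) (.grdR r a) := by
    refine MnyF_kc _ _ _ (.symm (.trans (Act.act_single (A := actM R) (b := ([], .grd r X)) _ [] [] _) ?_))
    refine EqM.cL ((EqM.gcut (mul_one r).symm rfl rfl rfl rfl (.refl _) (EqM.cL (EqM.cL (EqM.cR (.refl _)
      _ rfl) _ rfl) _ rfl)).trans ((EqM.gcut_grdR 1 r [] [] a (.id X)).trans ?_))
      (by simp [scale]) rfl
    exact .grdR ◾ (EqG.cut_id_right a)
  have k : (MnyF R).map (prG r a) ≫ (MnyF R).map (thG [(r, X)]) = (MnyF R).map (thG (scale r E)) ≫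
      (MnyF R).map (hom (CCat.of (scale r E)) (CCat.of [(r, X)]) (.single (.cut r a rfl))) := by
    rw [← Functor.map_comp, prG_thG r a ha, Functor.map_comp]
  refine NEq.eq ((NEq.comp (e.trans (prM_prG r a)) (NEq.mny (thG_one (r, X)).symm)).trans
    ((NEq.of_eq k).trans (.symm ?_)))
  refine (NEq.comp (g' := (MnyF R).map (hom (CCat.of (scale r E)) (CCat.of [(r, X)]) (.single (.cut r a rfl))))
    ?_ ?_).trans (.refl _)
  · exact (NEq.of_eq (tensorHom_id _ (𝟙_ (KCat R)))).trans ((NEq.right_unit _).trans (thM_neq _))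
  · refine (NEq.of_eq h.symm).trans ((NEq.comp (.right_unit _) (kc_grdI r X)).trans (.of_eq ?_))
    exact Category.comp_id _

section

variable {α : Type u} {L : List α → List α → Type u} {A : Act L} {ex : ∀ a b, L [a, b] [b, a]}
  {S : A.Exch ex}

lemma insertMid_neq (D E U G V : Act.Ob S) : NEq (insertMid D E U G V) (D ◁ ((β_ E U).hom ▷ G ▷ V)) :=
  (NEq.nil_comp ..).trans (.left rfl (.trans (.nil_comp ..) (.right (.trans (.nil_comp ..) (.comp_nil ..)) rfl)))

lemma insertMid_natural {D E U G V D' E' U' G' V' : Act.Ob S} (d : D ⟶ D') (e : E ⟶ E') (u : U ⟶ U')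
    (g : G ⟶ G') (v : V ⟶ V') : insertMid D E U G V ≫ (d ⊗ₘ ((u ⊗ₘ (e ⊗ₘ g)) ⊗ₘ v)) =
      ((d ⊗ₘ e) ⊗ₘ ((u ⊗ₘ g) ⊗ₘ v)) ≫ insertMid D' E' U' G' V' := by
  refine NEq.eq ((NEq.comp (insertMid_neq D E U G V) (.tensor (.refl d) (.tensor (NEq.tensor_assoc u e g).symm
    (.refl v)))).trans ?_)
  refine .trans (.of_eq ?_) (NEq.comp (f := d ⊗ₘ (((e ⊗ₘ u) ⊗ₘ g) ⊗ₘ v)) ?_ (insertMid_neq D' E' U' G' V').symm)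
  · rw [whiskerLeft_comp_tensorHom, whiskerRight_comp_tensorHom,
      whiskerRight_comp_tensorHom, tensorHom_comp_whiskerLeft,
      tensorHom_comp_whiskerRight, tensorHom_comp_whiskerRight,
      BraidedCategory.braiding_naturality]
  · refine .trans ?_ (NEq.tensor_assoc d e _).symm
    refine .tensor (.refl d) (.trans ?_ (NEq.tensor (.refl e) (NEq.tensor_assoc u g v).symm |>.symm.symm))
    exact (NEq.tensor_assoc _ g v).trans ((NEq.tensor_assoc e u _).trans (.refl _))

end

lemma kc_neq {X X' : CCat R} (hX : X = X') (hΓ : Γ = Γ') {m : MS X.list Γ A}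
    {m' : MS X'.list Γ' A} (e : EqM m m') : NEq (kc X m) (kc X' m') := by
  subst hX; subst hΓ; exact .of_eq (kc_congr e)

lemma kc_enc (D E : CCat R) (w : MS (D ⊗ E).list Γ A) : NEq (kc D (w.enc E.list)) (kc (D ⊗ E) w) :=
  kcut_neq (congrArg Act.Ob.mk (by simp [MnyF, Grd])) (MS.enc_append D.list E.list (D := []) (m' := w) (.refl w)).symm

lemma kc_cut (D E : CCat R) (Γ₁ Γ₃ : LCtx R) (a : MS E.list G A) (c : MS D.list (Γ₁ ++ [A] ++ Γ₃) C) :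
    NEq (insertMid ((MnyF R).obj D) ((MnyF R).obj E) ⟨Γ₁⟩ ⟨G⟩ ⟨Γ₃⟩ ≫
      (MnyF R).obj D ◁ (((⟨Γ₁⟩ : KCat R) ◁ kc E a) ▷ (⟨Γ₃⟩ : KCat R)) ≫ kc D c)
      (kc (D ⊗ E) (MS.cut Γ₁ Γ₃ a c)) := by
  let w : MS (D.list ++ E.list) (Γ₁ ++ G ++ Γ₃) C := .cut Γ₁ Γ₃ a c
  let e := MS.enc E.list (D := []) a
  obtain ⟨m, hm⟩ := MS.exists_cast (MS.cut Γ₁ Γ₃ e c) (List.append_nil D.list) rfl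
  obtain ⟨z, hz⟩ := MS.exists_cast (w.enc E.list) rfl
    (show Grd E.list ++ (Γ₁ ++ G ++ Γ₃) = [] ++ (Grd E.list ++ Γ₁) ++ (G ++ Γ₃) by simp)
  have h1 := kc_actL D ((Path.single (LStep.cut e)).inside Γ₁ Γ₃ rfl rfl) c m (hm.trans (.symm
    ((Act.act_inside' (A := actK R) (b := (D.list, C)) (D1 := []) (D2 := []) (E1 := Γ₁) (E2 := Γ₃)
      (P := [A]) (D1' := Γ₁) (D2' := Γ₃) _ _ _ rfl (List.append_nil _) (c' := c) (EqM.cL (.refl _) rfl _)).trans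
    (MS.actL_cut_single e (.refl _) rfl Γ₁ Γ₃ c))))
  obtain ⟨m', hm'⟩ := MS.exists_cast m rfl
    (show Γ₁ ++ (Grd E.list ++ G) ++ Γ₃ = [] ++ (Γ₁ ++ Grd E.list) ++ (G ++ Γ₃) by simp)
  have k : EqM m' (z.actL [] (G ++ Γ₃) (.swap LStep.ex (Grd E.list) Γ₁)) := by
    refine hm'.trans (hm.trans ?_)
    obtain ⟨w', hw'⟩ := MS.exists_cast w (show _ = D.list ++ [] ++ E.list by simp) (show _ = Γ₁ ++ (G ++ Γ₃) by simp)
    obtain ⟨z', hz'⟩ := MS.exists_cast z (List.append_nil D.list).symm rfl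
    exact (MS.cut_enc E.list (E := []) Γ₁ Γ₃ c a w' z' hw' (hz'.trans (hz.trans
      (EqM.enc E.list ◾ ◾ hw'.symm)))).trans
      (MS.actL_congr _ (List.append_nil _) rfl rfl hz')
  have h2 := kc_actL D ((Path.swap LStep.ex Γ₁ (Grd E.list)).inside [] (G ++ Γ₃) rfl rfl) m' z (.symm
    ((Act.act_inside' (A := actK R) (b := (D.list, C)) (D1 := []) (D2 := []) (E1 := []) (E2 := G ++ Γ₃)
      (P := Γ₁ ++ Grd E.list) (D1' := []) (D2' := G ++ Γ₃) _ _ _ rfl (List.append_nil _)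
      (c' := z.actL [] (G ++ Γ₃) (.swap LStep.ex (Grd E.list) Γ₁)) (EqM.cL k rfl _)).trans
    (actK_exch.act_swap_swap (b := (D.list, C)) (Grd E.list) Γ₁)))
  have q := (NEq.right (NEq.unit_left (β_ ((MnyF R).obj E) (⟨Γ₁⟩ : KCat R)).hom) (rfl : (⟨G⟩ : KCat R) ⊗ ⟨Γ₃⟩ = _)).trans
    (NEq.right_right _ ⟨G⟩ ⟨Γ₃⟩)
  refine (NEq.comp ((insertMid_neq ..).trans (.left rfl (q.symm.trans (inside_neq [] (G ++ Γ₃) _))))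
    ((NEq.comp (.left rfl (inside_neq Γ₁ Γ₃ _)) (.refl _)).trans ((NEq.of_eq h1).trans (kc_neq (X' := D) rfl
      (show Γ₁ ++ (Grd E.list ++ G) ++ Γ₃ = [] ++ (Γ₁ ++ Grd E.list) ++ (G ++ Γ₃) by simp) hm'.symm)))).trans ?_
  exact (NEq.of_eq h2).trans ((kc_neq (X' := D) rfl
    (show [] ++ (Grd E.list ++ Γ₁) ++ (G ++ Γ₃) = Grd E.list ++ (Γ₁ ++ G ++ Γ₃) by simp) hz).trans (kc_enc D E w))

noncomputable def spl (D E : GCtx R) (Γ₁ G Γ₃ : LCtx R) {A : LTy R} (g : tens hM E ⊗ tens oM G ⟶ oM A) :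
    tens hM (D ++ E) ⊗ tens oM (Γ₁ ++ G ++ Γ₃) ⟶ tens hM D ⊗ tens oM (Γ₁ ++ [A] ++ Γ₃) :=
  (synM R).splice D E Γ₁ G Γ₃ g

lemma spl_neq (D E : GCtx R) (Γ₁ G Γ₃ : LCtx R) (g : tens hM E ⊗ tens oM G ⟶ oM A) :
    NEq (spl D E Γ₁ G Γ₃ g) (insertMid (tens hM D) (tens hM E) (tens oM Γ₁) (tens oM G) (tens oM Γ₃) ≫
      tens hM D ◁ ((tens oM Γ₁ ◁ g) ▷ tens oM Γ₃)) := by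
  let t : (tens oM Γ₁ ⊗ (oM A ⊗ 𝟙_ (KCat R))) ⊗ tens oM Γ₃ ⟶ tens oM (Γ₁ ++ [A] ++ Γ₃) := (tensSplit oM Γ₁ [A] Γ₃).inv
  have : Nil t := inferInstanceAs (Nil (tensSplit oM Γ₁ [A] Γ₃).inv)
  exact show NEq (((tensAppend hM D E).hom ⊗ₘ (tensSplit oM Γ₁ G Γ₃).hom) ≫
    insertMid (tens hM D) (tens hM E) (tens oM Γ₁) (tens oM G) (tens oM Γ₃) ≫
      (tens hM D ◁ (((tens oM Γ₁ ◁ (g ≫ (ρ_ (oM A)).inv)) ▷ tens oM Γ₃) ≫ t))) _ from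
    .trans (.nil_comp ..) (.comp (.refl _) (.left rfl (.trans (.comp_nil ..)
      (.right (.left rfl (.comp_nil ..)) rfl))))

lemma spl_th (D E) (Γ₁ G Γ₃) {g : tens hM E ⊗ tens oM G ⟶ oM A}
    {g' : (MnyF R).obj (CCat.of E) ⊗ (⟨G⟩) ⟶ ⟨[A]⟩} (h : g ≫ (isoM A).hom = (thM E ⊗ₘ thL G) ≫ g') :
    NEq (spl D E Γ₁ G Γ₃ g ≫ (thM D ⊗ₘ thL (Γ₁ ++ [A] ++ Γ₃)))
      (((thM D ⊗ₘ thM E) ⊗ₘ ((thL Γ₁ ⊗ₘ thL G) ⊗ₘ thL Γ₃)) ≫ insertMid _ _ _ _ _ ≫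
        (MnyF R).obj (CCat.of D) ◁ (((⟨Γ₁⟩ : KCat R) ◁ g') ▷ (⟨Γ₃⟩ : KCat R))) := by
  refine (NEq.comp (spl_neq D E Γ₁ G Γ₃ g) (.tensor (.refl (thM D)) ((tensIso_append_append isoM Γ₁ [A] Γ₃).trans
    (.tensor (.tensor (.refl _) (thL_one A)) (.refl _))))).trans (.of_eq ?_)
  rw [Category.assoc, whiskerLeft_comp_tensorHom, whiskerRight_comp_tensorHom,
    whiskerLeft_comp_tensorHom, h, ← tensorHom_comp_whiskerLeft,
    ← tensorHom_comp_whiskerRight, ← tensorHom_comp_whiskerLeft,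
    ← Category.assoc, insertMid_natural, Category.assoc]

lemma AgreeM.of_spl (D E : GCtx R) (Γ₁ G Γ₃ : LCtx R) {g : tens hM E ⊗ tens oM G ⟶ oM A}
    {a : MS E G A} (h : g ≫ (isoM A).hom = (thM E ⊗ₘ thL G) ≫ kc (CCat.of E) a)
    {c : MS D (Γ₁ ++ [A] ++ Γ₃) C} (hc : AgreeM c) :
    (spl D E Γ₁ G Γ₃ g ≫ iM c) ≫ (isoM C).hom = (thM (D ++ E) ⊗ₘ thL (Γ₁ ++ G ++ Γ₃)) ≫
      kc (CCat.of (D ++ E)) (.cut Γ₁ Γ₃ a c) := by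
  rw [Category.assoc, hc, ← Category.assoc]
  refine NEq.eq ((NEq.comp (spl_th D E Γ₁ G Γ₃ h) (.refl _)).trans ?_)
  refine (NEq.of_eq ((Category.assoc ..).trans (congrArg _ (Category.assoc ..)))).trans ?_
  exact .comp (.tensor (thM_append D E).symm (tensIso_append_append isoM Γ₁ G Γ₃).symm)
    (kc_cut (CCat.of D) (CCat.of E) Γ₁ Γ₃ a c)

lemma AgreeM.cut (Γ₁ Γ₃ : LCtx R) {a : MS E G A}
    {c : MS D (Γ₁ ++ [A] ++ Γ₃) C} (ha : AgreeM a) (hc : AgreeM c) : AgreeM (.cut Γ₁ Γ₃ a c) :=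
  AgreeM.of_spl D E Γ₁ G Γ₃ ha hc

lemma AgreeM.of_neq {Δ Δ' : GCtx R} {m : MS Δ Γ A} {m' : MS Δ' Γ' A}
    (hm : AgreeM m') (hΔ : Δ = Δ') (hΓ : Γ = Γ') (e : EqM m m') (k : NEq (iM m) (iM m')) : AgreeM m := by
  subst hΔ; subst hΓ
  exact (congrArg (· ≫ (isoM A).hom) k.eq).trans (hm.trans (congrArg _ (kc_congr e.symm)))

lemma iM_cast {Δ Δ' : GCtx R} (m : MS Δ Γ A) (hΔ : Δ = Δ') (hΓ : Γ = Γ') : NEq (iM (m.cast hΔ hΓ)) (iM m) := by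
  subst hΔ; subst hΓ; exact .refl _

lemma spl_left (Δ E : GCtx R) (Γ : LCtx R) (g : tens hM E ⊗ tens oM [] ⟶ oM A) :
    NEq (spl Δ E [] [] Γ g) (tens hM Δ ◁ (g ▷ tens oM Γ)) :=
  (spl_neq Δ E [] [] Γ g).trans (show NEq (insertMid (tens hM Δ) (tens hM E) (𝟙_ (KCat R)) (𝟙_ (KCat R)) (tens oM Γ) ≫
    tens hM Δ ◁ ((𝟙_ (KCat R) ◁ (show tens hM E ⊗ 𝟙_ (KCat R) ⟶ oM A from g)) ▷ tens oM Γ)) _ from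
  have : Nil (insertMid (tens hM Δ) (tens hM E) (𝟙_ (KCat R)) (𝟙_ (KCat R)) (tens oM Γ)) := by
    unfold insertMid; infer_instance
  .trans (.nil_comp ..) (.left rfl (.right (.unit_left _) rfl)))

lemma AgreeM.linL {Δ : GCtx R} {a : MS Δ (A :: Γ) B} (ha : AgreeM a) : AgreeM (.linL a) := by
  have ho : hG (1, .lin A) = oG (.lin A) := congrArg (fun F : CCat R ⥤ CCat R => F.obj (oG (.lin A))) scaleF_one
  let o : hM (1, .lin A) ⟶ (MnyF R).obj (oG (.lin A)) := (MnyF R).map (eqToHom ho)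
  have : Nil o := inferInstanceAs (Nil ((MnyF R).map (eqToHom ho)))
  let k : (MnyF R).obj (oG (.lin A)) ⟶ oM A := (mnyLin R).counit.app (oM A)
  let g0 : hM (1, .lin A) ⊗ 𝟙_ (KCat R) ⟶ oM A := (ρ_ (hM (1, .lin A))).hom ≫ o ≫ k
  let g : tens hM [(1, .lin A)] ⊗ tens oM [] ⟶ oM A := (ρ_ (hM (1, .lin A) ⊗ 𝟙_ (KCat R))).hom ≫ g0
  have eg : NEq g g0 := show NEq ((ρ_ (hM (1, .lin A) ⊗ 𝟙_ (KCat R))).hom ≫ g0) _ from .nil_comp ..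
  have eg0 : NEq g0 k := .trans (.nil_comp ..) (.nil_comp ..)
  have el : NEq (linE (⟨[A]⟩)) (kc (CCat.of [(1, .lin A)]) (MS.linE A)) :=
    .trans (.of_eq (congrArg ((ρ_ _).inv ≫ ·) (Category.comp_id _)))
      (.nil_comp (Y := (MnyF R).obj (CCat.of [(1, .lin A)]) ⊗ 𝟙_ (KCat R)) (ρ_ _).inv _)
  have h : g ≫ (isoM A).hom = (thM [(1, .lin A)] ⊗ₘ thL []) ≫ kc (CCat.of [(1, .lin A)]) (MS.linE A) := by
    refine NEq.eq ((NEq.comp (eg.trans eg0) (.refl (isoM A).hom)).trans ((NEq.of_eq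
      ((mnyLin R).counit_naturality (isoM A).hom).symm).trans ?_))
    refine NEq.comp ?_ ((NEq.of_eq (mnyLin_counit _)).trans el)
    refine .symm ((NEq.of_eq (tensorHom_id _ (𝟙_ (KCat R)))).trans ((NEq.right_unit _).trans
      ((thM_one _).trans (NEq.mny ((isoH_neq _).trans ?_)))))
    have k : ∀ {F G : CCat R ⥤ CCat R} (_ : F = G), NEq (F.map (isoG (.lin A)).hom) (G.map (isoG (.lin A)).hom) := by
      rintro F _ rfl; exact .refl _
    exact k scaleF_one
  refine .trans ?_ ((AgreeM.of_spl Δ [(1, .lin A)] [] [] Γ h ha).trans (congrArg _ (kc_congr ?_)))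
  · refine congrArg (· ≫ (isoM B).hom) (NEq.eq ?_)
    let t : tens hM (Δ ++ [(1, .lin A)]) ⟶ tens hM Δ ⊗ (hM (1, .lin A) ⊗ 𝟙_ (KCat R)) :=
      (tensAppend hM Δ [(1, .lin A)]).hom
    have : Nil t := tensAppend_nil (f := hM) Δ [(1, .lin A)]
    exact show NEq ((t ≫ (tens hM Δ ◁ g0)) ▷ tens oM Γ ≫ (α_ (tens hM Δ) (oM A) (tens oM Γ)).hom ≫ iM a) _ from
      NEq.trans (.of_eq (Category.assoc ..).symm) (.comp (.trans (.comp_nil ..) (.trans (.right (.nil_comp ..) rfl)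
        (.trans (.left_right ..) ((spl_left Δ _ Γ g).trans (.left rfl (.right eg rfl))).symm))) (.refl (iM a)))
  · refine (EqM.cut_linL_left [] Γ (.id A) a).trans (EqM.linL ◾ rfl (.cL ?_ rfl _))
    exact (EqM.cast_left ..).trans (EqM.cL (EqM.cut_id_left [] Γ a) rfl _)

instance iM_id_nil (A : LTy R) : Nil (iM (.id A)) :=
  inferInstanceAs (Nil ((λ_ (oM A ⊗ 𝟙_ (KCat R))).hom ≫ (ρ_ (oM A)).hom : 𝟙_ (KCat R) ⊗ (oM A ⊗ 𝟙_ (KCat R)) ⟶ oM A))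

lemma iM_tenR_id (A B : LTy R) : NEq (iM (.tenR (.id A) (.id B))) (𝟙 (oM A ⊗ oM B)) := by
  have := tensorμ_nil (𝟙_ (KCat R)) (𝟙_ (KCat R)) (oM A ⊗ 𝟙_ (KCat R)) (oM B ⊗ 𝟙_ (KCat R))
  let s : 𝟙_ (KCat R) ⟶ 𝟙_ (KCat R) ⊗ 𝟙_ (KCat R) := (tensAppend hM [] []).hom
  have : Nil s := tensAppend_nil (f := hM) [] []
  let t : oM A ⊗ oM B ⊗ 𝟙_ (KCat R) ⟶ (oM A ⊗ 𝟙_ (KCat R)) ⊗ (oM B ⊗ 𝟙_ (KCat R)) := (tensAppend oM [A] [B]).hom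
  have : Nil t := tensAppend_nil (f := oM) [A] [B]
  let i : 𝟙_ (KCat R) ⊗ (oM A ⊗ 𝟙_ (KCat R)) ⟶ oM A := iM (.id A)
  let j : 𝟙_ (KCat R) ⊗ (oM B ⊗ 𝟙_ (KCat R)) ⟶ oM B := iM (.id B)
  have : Nil i := iM_id_nil A
  have : Nil j := iM_id_nil B
  exact show NEq ((s ⊗ₘ t) ≫ tensorμ _ _ _ _ ≫ (i ⊗ₘ j)) _ from .trans (.nil _) (.id (congrArg Act.Ob.mk ◾))

lemma AgreeM.tenR_id (A B : LTy R) : AgreeM (.tenR (.id A) (.id B)) := by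
  refine NEq.eq ((NEq.comp (iM_tenR_id A B) (.refl (isoM (.tensor A B)).hom)).trans ((NEq.of_eq (Category.id_comp _)).trans (.symm ?_)))
  exact NEq.comp ((thM_nil _).trans (thL_two A B)) (kc_nil _)

lemma spl_right (E : GCtx R) (G Γ : LCtx R) (g : tens hM E ⊗ tens oM G ⟶ oM A) :
    NEq (spl [] E [] G Γ g) (g ▷ tens oM Γ) :=
  (spl_neq [] E [] G Γ g).trans (show NEq (insertMid (𝟙_ (KCat R)) (tens hM E) (𝟙_ (KCat R)) (tens oM G) (tens oM Γ) ≫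
    𝟙_ (KCat R) ◁ ((𝟙_ (KCat R) ◁ g) ▷ tens oM Γ)) _ from
  have : Nil (insertMid (𝟙_ (KCat R)) (tens hM E) (𝟙_ (KCat R)) (tens oM G) (tens oM Γ)) := by
    unfold insertMid; infer_instance
  .trans (.nil_comp ..) (.trans (.unit_left _) (.right (.unit_left _) rfl)))

lemma spl_last (D E : GCtx R) (Γ G : LCtx R) (g : tens hM E ⊗ tens oM G ⟶ oM A) :
    NEq (spl D E Γ G [] g) (tensorμ (tens hM D) (tens hM E) (tens oM Γ) (tens oM G) ≫ (tens hM D ⊗ tens oM Γ) ◁ g) :=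
  (spl_neq D E Γ G [] g).trans (.comp ((insertMid_neq ..).trans (.trans
    (.left rfl (show NEq (((β_ (tens hM E) (tens oM Γ)).hom ▷ tens oM G) ▷ 𝟙_ (KCat R)) _ from .right_unit _))
      (NEq.tensorμ_mid ..).symm)) (.trans (.left rfl (show NEq ((tens oM Γ ◁ g) ▷ 𝟙_ (KCat R)) _ from .right_unit _))
      (NEq.left_left ..).symm))

lemma AgreeM.tenR {Δ₁ Δ₂ : GCtx R} {a : MS Δ₁ Γ₁ A} {b : MS Δ₂ Γ₂ B}
    (ha : AgreeM a) (hb : AgreeM b) : AgreeM (.tenR a b) := by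
  let T : MS (R := R) [] ([] ++ [A] ++ [B]) (.tensor A B) := .tenR (.id A) (.id B)
  let c : MS Δ₁ (Γ₁ ++ [B]) (.tensor A B) := .cut [] [B] a T
  have hc : AgreeM c := ha.cut [] [B] (AgreeM.tenR_id A B)
  let c' : MS Δ₁ (Γ₁ ++ [B] ++ []) (.tensor A B) := c.cast rfl (by first | rfl | simp)
  have hc' : AgreeM c' := hc.of_neq rfl (by first | rfl | simp) (.cast_left ..) (iM_cast ..)
  have e1 : EqM c (.tenR a (.id B)) := (EqM.cut rfl rfl rfl rfl rfl (.refl a) (EqM.cR (.refl _) ..)).trans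
      ((EqM.cut_tenR_fst [] [] a (.id A) (.id B)).trans
        ((MS.act_gswap_nil ..).trans (.cL (EqM.tenR rfl rfl (by first | rfl | simp) rfl (EqM.cut_id_right a) (.refl _)) ..)))
  have e2 : EqM (.tenR a b) (.cut Γ₁ [] b c') := .symm <|
    (EqM.cut (List.append_nil Δ₁).symm rfl (List.append_nil Γ₁).symm rfl rfl (.refl b) (EqM.cL (EqM.cR e1 ..) ..)).trans
      ((EqM.cut_tenR_snd [] [] b a (.id B)).trans
        (EqM.tenR rfl (by first | rfl | simp) rfl (by first | rfl | simp) (.refl a) (EqM.cut_id_right b)))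
  refine (hb.cut Γ₁ [] hc').of_neq rfl (by first | rfl | simp) e2 ?_
  have k : NEq (iM c') (iM a ▷ oM B) := by
    refine (iM_cast ..).trans ?_
    refine .trans (show NEq (spl [] Δ₁ [] Γ₁ [B] (iM a) ≫ iM T) _ from NEq.comp (f' := iM a ▷ (oM B ⊗ 𝟙_ (KCat R)))
      (spl_right Δ₁ Γ₁ [B] (iM a)) (g' := oM A ◁ (ρ_ (oM B)).hom) ?_) ?_
    · exact (iM_tenR_id A B).trans ((NEq.id (congrArg Act.Ob.mk (by first | rfl | simp))).trans (NEq.nil _).symm)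
    · exact (NEq.comp_nil ..).trans ((NEq.right_right ..).trans (.right_unit _))
  refine .trans ?_ (NEq.comp (spl_last Δ₁ Δ₂ Γ₁ Γ₂ (iM b)) k).symm
  refine .trans (show NEq (((tensAppend hM Δ₁ Δ₂).hom ⊗ₘ (tensAppend oM Γ₁ Γ₂).hom) ≫
    tensorμ (tens hM Δ₁) (tens hM Δ₂) (tens oM Γ₁) (tens oM Γ₂) ≫ (iM a ⊗ₘ iM b)) _ from .nil_comp ..) ?_
  rw [tensorHom_def']
  exact .of_eq (Category.assoc ..).symm

section

variable {C : Type u} [Category.{u} C] [MonoidalCategory C] [MonoidalClosed C]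

lemma ihom_ev_iso {A A' B B' : C} (f : A ≅ A') (g : B ⟶ B') :
    (f.hom ⊗ₘ ((MonoidalClosed.pre f.inv).app B ≫ (ihom A').map g)) ≫ (ihom.ev A').app B' =
      (ihom.ev A).app B ≫ g := by
  rw [MonoidalCategory.tensorHom_def, MonoidalCategory.whiskerLeft_comp, Category.assoc, Category.assoc,
    ihom.ev_naturality, MonoidalClosed.id_tensor_pre_app_comp_ev_assoc, ← comp_whiskerRight_assoc, f.hom_inv_id,
    id_whiskerRight, Category.id_comp]

end

lemma evK_single (A B : LTy R) : evK (⟨[A]⟩ : KCat R) ⟨[B]⟩ =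
    (β_ (⟨[A]⟩ : KCat R) ⟨[.imp A B]⟩).hom ≫ kcut ((⟨[.imp A B]⟩ : KCat R) ⊗ (⟨[A]⟩ : KCat R)) (MS.ev A B) := by
  have h1 : (tnIso (⟨[A]⟩ : KCat R)).hom = 𝟙 (⟨[A]⟩ : KCat R) := kcut_id A
  refine congrArg ((β_ (⟨[A]⟩ : KCat R) ⟨[.imp A B]⟩).hom ≫ ·) ?_
  refine (congrArg (fun f => (⟨[.imp A B]⟩ : KCat R) ◁ f ≫ _) h1).trans ?_
  refine (congrArg (· ≫ _) (whiskerLeft_id ..)).trans ((Category.id_comp _).trans ?_)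
  exact Category.comp_id _

lemma ev_isoM (A B : LTy R) : ((β_ (oM (.imp A B)) (oM A)).hom ≫ (ihom.ev (oM A)).app (oM B)) ≫ (isoM B).hom =
      ((isoM (.imp A B)).hom ⊗ₘ (isoM A).hom) ≫ kcut ((⟨[.imp A B]⟩ : KCat R) ⊗ (⟨[A]⟩ : KCat R)) (MS.ev A B) := by
  have h := congrArg ((β_ (⟨[.imp A B]⟩ : KCat R) ⟨[A]⟩).hom ≫ ·) ((ev_app ..).trans (evK_single A B))
  have h' : (β_ (⟨[.imp A B]⟩ : KCat R) ⟨[A]⟩).hom ≫ (ihom.ev (⟨[A]⟩ : KCat R)).app ⟨[B]⟩ =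
      kcut ((⟨[.imp A B]⟩ : KCat R) ⊗ (⟨[A]⟩ : KCat R)) (MS.ev A B) :=
    h.trans (SymmetricCategory.symmetry_assoc ..)
  have k : (isoM (.imp A B)).hom = (MonoidalClosed.pre (isoM A).inv).app (oM B) ≫
    (ihom (⟨[A]⟩ : KCat R)).map (isoM B).hom := rfl
  rw [← h']
  refine .trans ?_ (Category.assoc ..)
  refine .trans ?_ (congrArg (· ≫ (ihom.ev (⟨[A]⟩ : KCat R)).app ⟨[B]⟩)
    (BraidedCategory.braiding_naturality (isoM (.imp A B)).hom (isoM A).hom).symm)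
  rw [k]
  exact (Category.assoc ..).trans ((congrArg _ (ihom_ev_iso (isoM A) (isoM B).hom).symm).trans
    (Category.assoc ..).symm)

lemma MS.cut_impR_ev {Δ : GCtx R} (m : MS Δ (Γ ++ [A]) B) : EqM (.cut [] [A] (.impR m) (MS.ev A B)) m := by
  refine .trans (.cut rfl rfl rfl rfl rfl (.refl _) (.cR (.refl _) rfl rfl))
    ((EqM.cut_imp [] [] m (.id A) (.id B)).trans ?_)
  refine (MS.act_gswap_nil ..).trans (.cL ((EqM.cut_id_right _).trans ?_) _ rfl)
  exact (EqM.cut_id_left ..).trans (.cast_left _ rfl _)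

lemma kc_impR_ev (X) (a : MS X.list (Γ ++ [A]) B) : NEq (kc X (.impR a) ▷ (⟨[A]⟩) ≫
      kcut ((⟨[.imp A B]⟩ : KCat R) ⊗ (⟨[A]⟩ : KCat R)) (MS.ev A B)) (kc X a) := by
  refine (NEq.of_eq (kcut_ev (Y := (MnyF R).obj X ⊗ (⟨Γ⟩)) (MS.enc X.list (D := []) (.impR a))
    _ (.refl _))).trans (kcut_neq (X' := (MnyF R).obj X ⊗ (⟨Γ ++ [A]⟩))
      (congrArg Act.Ob.mk (List.append_assoc ..)) ?_)
  exact (MS.enc_cut X.list (K := []) (MS.ev A B) (.impR a) a (MS.cut_impR_ev a).symm).symm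

lemma AgreeM.impR {Δ : GCtx R} {a : MS Δ (Γ ++ [A]) B} (ha : AgreeM a) : AgreeM (.impR a) := by
  refine (evK_bijective (⟨[A]⟩ : KCat R) (tens hM Δ ⊗ tens oM Γ) ⟨[B]⟩).injective ?_
  let t : tens oM Γ ⊗ (oM A ⊗ 𝟙_ (KCat R)) ⟶ tens oM (Γ ++ [A]) := (tensAppend oM Γ [A]).inv
  have : Nil t := tensAppend_inv_nil (f := oM) Γ [A]
  let F : (tens hM Δ ⊗ tens oM Γ) ⊗ oM A ⟶ oM B := (α_ (tens hM Δ) (tens oM Γ) (oM A)).hom ≫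
    (tens hM Δ ◁ ((tens oM Γ ◁ (ρ_ (oM A)).inv) ≫ t)) ≫ iM a
  have hF : NEq F (iM a) := .trans (.nil_comp ..) (.nil_comp ..)
  have hi : iM (.impR a) = MonoidalClosed.curry ((β_ (oM A) (tens hM Δ ⊗ tens oM Γ)).hom ≫ F) := rfl
  have key : ∀ g g' : tens hM Δ ⊗ tens oM Γ ⟶ (⟨[.imp A B]⟩ : KCat R),
      (g ⊗ₘ (isoM A).hom) ≫ kcut ((⟨[.imp A B]⟩ : KCat R) ⊗ (⟨[A]⟩ : KCat R)) (MS.ev A B) =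
      (g' ⊗ₘ (isoM A).hom) ≫ kcut ((⟨[.imp A B]⟩ : KCat R) ⊗ (⟨[A]⟩ : KCat R)) (MS.ev A B) →
      (tensorLeft (⟨[A]⟩ : KCat R)).map g ≫ evK (⟨[A]⟩ : KCat R) ⟨[B]⟩ =
        (tensorLeft (⟨[A]⟩ : KCat R)).map g' ≫ evK (⟨[A]⟩ : KCat R) ⟨[B]⟩ := by
    intro g g' h
    rw [tensorHom_def', tensorHom_def', Category.assoc, Category.assoc, cancel_epi] at h
    rw [evK_single]
    have n : ∀ g : tens hM Δ ⊗ tens oM Γ ⟶ (⟨[.imp A B]⟩ : KCat R), (tensorLeft (⟨[A]⟩ : KCat R)).map g ≫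
        (β_ (⟨[A]⟩ : KCat R) ⟨[.imp A B]⟩).hom ≫ kcut ((⟨[.imp A B]⟩ : KCat R) ⊗ (⟨[A]⟩ : KCat R)) (MS.ev A B) =
      (β_ (⟨[A]⟩ : KCat R) (tens hM Δ ⊗ tens oM Γ)).hom ≫ g ▷ (⟨[A]⟩ : KCat R) ≫
        kcut ((⟨[.imp A B]⟩ : KCat R) ⊗ (⟨[A]⟩ : KCat R)) (MS.ev A B) := fun g =>
      BraidedCategory.braiding_naturality_right_assoc ..
    exact (n g).trans ((congrArg _ h).trans (n g').symm)
  refine key _ _ ?_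
  have l : ((iM (.impR a) ≫ (isoM (.imp A B)).hom) ⊗ₘ (isoM A).hom) ≫
      kcut ((⟨[.imp A B]⟩ : KCat R) ⊗ (⟨[A]⟩ : KCat R)) (MS.ev A B) = F ≫ (isoM B).hom := by
    refine (congrArg (· ≫ _) (whiskerRight_comp_tensorHom ..).symm).trans ?_
    refine (Category.assoc ..).trans ((congrArg _ (ev_isoM A B).symm).trans ?_)
    refine (Category.assoc ..).symm.trans (congrArg (· ≫ (isoM B).hom) ?_)
    refine (BraidedCategory.braiding_naturality_left_assoc (iM (.impR a)) (oM A) _).trans ?_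
    refine (congrArg (_ ≫ ·) ((congrArg (fun f => oM A ◁ f ≫ (ihom.ev (oM A)).app (oM B)) hi).trans
      (show oM A ◁ MonoidalClosed.curry _ ≫ (ihom.ev (oM A)).app (oM B) = _ from
        MonoidalClosed.uncurry_curry ((β_ (oM A) (tens hM Δ ⊗ tens oM Γ)).hom ≫ F)))).trans ?_
    exact SymmetricCategory.symmetry_assoc ..
  refine l.trans (NEq.eq ((NEq.comp hF (.refl _)).trans ((NEq.of_eq ha).trans (.symm ?_))))
  refine (NEq.of_eq ((congrArg (· ≫ _) (tensorHom_comp_whiskerRight (thM Δ ⊗ₘ thL Γ)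
    (kc (CCat.of Δ) (.impR a)) (isoM A).hom).symm).trans (Category.assoc ..))).trans ?_
  refine NEq.comp ?_ (kc_impR_ev (CCat.of Δ) a)
  exact (NEq.tensor_assoc (thM Δ) (thL Γ) (isoM A).hom).trans (.tensor (.refl _) (.symm ((tensIso_append isoM Γ [A]).trans
    (.tensor (.refl _) (thL_one A)))))

lemma iM_ev (A B : LTy R) :
    NEq (iM (MS.ev A B)) ((β_ (oM (.imp A B)) (oM A)).hom ≫ (ihom.ev (oM A)).app (oM B)) := by
  let i : 𝟙_ (KCat R) ⊗ (oM A ⊗ 𝟙_ (KCat R)) ⟶ oM A := iM (.id A)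
  have : Nil i := iM_id_nil A
  let J0 : 𝟙_ (KCat R) ⊗ (oM (.imp A B) ⊗ (oM A ⊗ 𝟙_ (KCat R))) ⟶ oM B :=
    (α_ (𝟙_ (KCat R)) (oM (.imp A B)) (oM A ⊗ 𝟙_ (KCat R))).inv ≫
      ((β_ (𝟙_ (KCat R)) (oM (.imp A B))).hom ▷ (oM A ⊗ 𝟙_ (KCat R))) ≫
      (α_ (oM (.imp A B)) (𝟙_ (KCat R)) (oM A ⊗ 𝟙_ (KCat R))).hom ≫ (oM (.imp A B) ◁ i) ≫
      (β_ (oM (.imp A B)) (oM A)).hom ≫ (ihom.ev (oM A)).app (oM B)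
  let J : tens hM [] ⊗ tens oM [.imp A B, A] ⟶ oM B := J0
  have e : NEq J0 ((β_ (oM (.imp A B)) (oM A)).hom ≫ (ihom.ev (oM A)).app (oM B)) :=
    .trans (.nil_comp ..) (.trans (.nil_comp ..) (.trans (.nil_comp ..) (.nil_comp ..)))
  refine .trans (show NEq (spl [] [] [] [.imp A B, A] [] J ≫ iM (.id B)) _ from NEq.comp_nil _ (iM (.id B))) ?_
  exact (spl_right [] [.imp A B, A] [] J).trans ((show NEq (J ▷ 𝟙_ (KCat R)) _ from .right_unit _).trans e)

lemma AgreeM.ev (A B : LTy R) : AgreeM (MS.ev A B) :=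
  NEq.eq ((NEq.comp (iM_ev A B) (.refl (isoM B).hom)).trans ((NEq.of_eq (ev_isoM A B)).trans
    (NEq.comp ((thM_nil _).trans (thL_two (.imp A B) A)) (kc_nil _)).symm))

lemma AgreeM.impL (Γ₁ Γ₃ : LCtx R) {a : MS Δ₂ Γ₂ A}
    {c : MS Δ₁ (Γ₁ ++ [B] ++ Γ₃) C} (ha : AgreeM a) (hc : AgreeM c) : AgreeM (.impL Γ₁ Γ₃ a c) := by
  let J0 : tens hM Δ₂ ⊗ (oM (.imp A B) ⊗ tens oM Γ₂) ⟶ oM B := (α_ (tens hM Δ₂) (oM (.imp A B)) (tens oM Γ₂)).inv ≫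
      ((β_ (tens hM Δ₂) (oM (.imp A B))).hom ▷ tens oM Γ₂) ≫
      (α_ (oM (.imp A B)) (tens hM Δ₂) (tens oM Γ₂)).hom ≫ (oM (.imp A B) ◁ iM a) ≫
      (β_ (oM (.imp A B)) (oM A)).hom ≫ (ihom.ev (oM A)).app (oM B)
  let J : tens hM Δ₂ ⊗ tens oM (.imp A B :: Γ₂) ⟶ oM B := J0
  let m : MS Δ₂ ([.imp A B] ++ Γ₂ ++ []) B := .cut [.imp A B] [] a (MS.ev A B)
  let n : MS Δ₂ (.imp A B :: Γ₂) B := m.cast rfl (List.append_nil _)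
  have hm : AgreeM m := ha.cut [.imp A B] [] (AgreeM.ev A B)
  have hn : AgreeM n := hm.of_neq rfl (List.append_nil _).symm (.cast_left ..) (iM_cast ..)
  have eJ : NEq J (iM n) := by
    refine .trans ?_ ((NEq.comp (spl_last [] Δ₂ [.imp A B] Γ₂ (iM a)) (iM_ev A B)).symm.trans (iM_cast m ..).symm)
    have hI : oM (.imp A B) = 𝟙_ (KCat R) ⊗ (oM (.imp A B) ⊗ 𝟙_ (KCat R)) :=
      congrArg Act.Ob.mk (List.append_nil _).symm
    refine show NEq J0 _ from .trans (.nil_comp ..) (.trans (.of_eq (Category.assoc ..).symm)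
      (.trans (.of_eq (Category.assoc ..).symm) (.comp (.comp (.trans (.comp_nil ..) ?_) (.left hI (.refl _)))
        (.refl _))))
    refine .trans ?_ (NEq.tensorμ_mid ..).symm
    exact .trans (.right (.braiding rfl (congrArg Act.Ob.mk (List.append_nil _).symm)) rfl) (NEq.unit_left _).symm
  have h : J ≫ (isoM B).hom = (thM Δ₂ ⊗ₘ thL (.imp A B :: Γ₂)) ≫ kc (CCat.of Δ₂) n := by rw [eJ.eq]; exact hn
  have e : EqM (.impL [] [] a (.id B)) n := by
    refine .symm (.cL ?_ ..)
    refine (EqM.cut rfl rfl rfl rfl rfl (.refl a) (EqM.cR (.refl _) ..)).trans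
      ((EqM.cut_impL_arg [] [] [] [] a (.id A) (.id B)).trans ?_)
    exact EqM.impL rfl rfl rfl rfl (show [] ++ Γ₂ ++ [] = Γ₂ by simp) (EqM.cut_id_right a) (.refl _)
  refine (AgreeM.of_spl Δ₁ Δ₂ Γ₁ (.imp A B :: Γ₂) Γ₃ h hc).trans (congrArg _ (kc_congr ?_))
  refine (EqM.cut rfl rfl rfl rfl (show .imp A B :: Γ₂ = [] ++ .imp A B :: Γ₂ ++ [] by simp) e.symm (.refl c)).trans ((EqM.cut_impL_left Γ₁ Γ₃ [] [] a (.id B) c).trans ?_)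
  exact EqM.impL (List.append_nil Δ₁) rfl (List.append_nil Γ₁) (show [] ++ Γ₃ = Γ₃ from rfl) rfl (.refl a) (EqM.cL (EqM.cut_id_left Γ₁ Γ₃ c) ..)

mutual
lemma agreeG : ∀ {Δ : GCtx R} {X : GTy R} (a : GS Δ X), AgreeG a
  | _, _, .id X => .id X
  | _, _, .unitR => .unitR
  | _, _, .tenR a b => .tenR (agreeG a) (agreeG b)
  | _, _, .linR a => .linR (agreeM a)
  | _, _, .left l D1 D2 a => .left l D1 D2 (agreeG a)
  | _, _, .cut r D1 D2 a c => .cut r D1 D2 (agreeG a) (agreeG c)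
  | _, _, .sub h a => .sub h (agreeG a)
lemma agreeM : ∀ {Δ : GCtx R} {Γ : LCtx R} {A : LTy R} (a : MS Δ Γ A), AgreeM a
  | _, _, _, .id A => .id A
  | _, _, _, .unitR => .unitR
  | _, _, _, .tenR a b => .tenR (agreeM a) (agreeM b)
  | _, _, _, .impR a => .impR (agreeM a)
  | _, _, _, .impL Γ₁ Γ₃ a c => .impL Γ₁ Γ₃ (agreeM a) (agreeM c)
  | _, _, _, .grdR r a => .grdR r (agreeG a)
  | _, _, _, .grdL r X a => .grdL r X (agreeM a)
  | _, _, _, .linL a => .linL (agreeM a)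
  | _, _, _, .left l D1 D2 a => .left l D1 D2 (agreeM a)
  | _, _, _, .lleft l Γ₁ Γ₂ a => .lleft l Γ₁ Γ₂ (agreeM a)
  | _, _, _, .cut Γ₁ Γ₃ a c => .cut Γ₁ Γ₃ (agreeM a) (agreeM c)
  | _, _, _, .gcut r D1 D2 a c => .gcut r D1 D2 (agreeG a) (agreeM c)
  | _, _, _, .sub h a => .sub h (agreeM a)
end

lemma eqG_of_iG {Δ : GCtx R} {a b : GS Δ X} (h : iG a = iG b) : EqG a b := by
  have e := (agreeG a).symm.trans ((congrArg (· ≫ (isoG X).hom) h).trans (agreeG b))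
  exact cut1_inj (X := CCat.of Δ) ((cancel_epi (thG Δ)).1 e)

lemma nil_isIso {X Y : KCat R} (f : X ⟶ Y) [hf : Nil f] : IsIso f := by
  obtain ⟨h, rfl⟩ := hf.out
  cases X; cases Y; cases h; exact inferInstanceAs (IsIso (𝟙 _))

lemma eqM_of_iM {Δ : GCtx R} {a b : MS Δ Γ A} (h : iM a = iM b) : EqM a b := by
  have e := (agreeM a).symm.trans ((congrArg (· ≫ (isoM A).hom) h).trans (agreeM b))
  have : IsIso (mM Δ) := nil_isIso _
  have : IsIso (thM Δ) := inferInstanceAs (IsIso (mM Δ ≫ (MnyF R).map (thG Δ)))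
  exact kc_inj (X := CCat.of Δ) ((cancel_epi (thM Δ ⊗ₘ thL Γ)).1 e)

end MGL

theorem mainTheorem3 {R : Type u} [Semiring R] [Preorder R] [AddLeftMono R] [MulLeftMono R]
    [MulRightMono R] :
    (∀ (Δ : MGL.GCtx R) (X : MGL.GTy R) (π₁ π₂ : MGL.GS Δ X),
      (∀ 𝓜 : MGL.Model R, 𝓜.interpG π₁ = 𝓜.interpG π₂) → MGL.EqG π₁ π₂) ∧
    (∀ (Δ : MGL.GCtx R) (Γ : MGL.LCtx R) (A : MGL.LTy R) (π₁ π₂ : MGL.MS Δ Γ A),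
      (∀ 𝓜 : MGL.Model R, 𝓜.interpM π₁ = 𝓜.interpM π₂) → MGL.EqM π₁ π₂) :=
  ⟨fun _ _ _ _ h => MGL.eqG_of_iG (h (MGL.synM R)), fun _ _ _ _ _ h => MGL.eqM_of_iM (h (MGL.synM R))⟩
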